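/- Let $d\ge 1$ be an integer, $\mu\in\{1,-1\}$, and let $\nu>1$ be a real number which is an odd integer or satisfies $\nu\ge k+1$ for some integer $k>d/2$. Put $\gamma_c=\frac d2-\frac1{\nu-1}$ and let $\Lambda=\sqrt{-\Delta}$ be the Fourier multiplier with symbol $|\xi|$. Consider the nonlinear half-wave equation $$ i\partial_t u+\Lambda u=-\mu|u|^{\nu-1}u \quad\text{on } \mathbb R^d,\qquad u(0)=u_0. \tag{NLHW} $$ A solution on $[0,T]$ is a function $u\in C([0,T],H^s(\mathbb R^d))$, for some $s>d/2$, with $u(t)=e^{it\Lambda}u_0+i\mu\int_0^t e^{i(t-\tau)\Lambda}(|u|^{\nu-1}u)(\tau)\,d\tau$ for $0\le t\le T$; it is unique. Write $\mathcal S$ for the space of Schwartz functions $\mathbb R^d\to\mathbb C$. (1) Let $\gamma\in(-\infty,-d/2]\cup(0,\gamma_c)$ if $\gamma_c>0$, and $\gamma\in(-\infty,-d/2]\cap(-\infty,\gamma_c)$ if $\gamma_c\le 0$. Then for every $t>0$ the solution map $\mathcal S\ni u(0)\mapsto u(t)$ fails to be continuous at $0$ in the $H^\gamma$ topology; that is,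 it is not true that for every $\varepsilon>0$ there is $\delta>0$ such that every $u_0\in\mathcal S$ with $\|u_0\|_{H^\gamma}<\delta$ has a solution $u$ on $[0,t]$ with $\|u(t)\|_{H^\gamma}<\varepsilon$. More precisely, this failure goes along with norm inflation: for every $\varepsilon>0$ there are $t\in(0,\varepsilon)$ and a solution $u$ on $[0,t]$ with $u(0)\in\mathcal S$, $\|u(0)\|_{H^\gamma}<\varepsilon$ and $\|u(t)\|_{H^\gamma}>\varepsilon^{-1}$. (2) If $\gamma_c>0$, then for every $t>0$ the solution map $\mathcal S\ni u(0)\mapsto u(t)$ fails to be uniformly continuous in the $L^2$ topology; that is, it is not true that for every $\varepsilon>0$ there is $\delta>0$ such that all $f,g\in\mathcal S$ with $\|f-g\|_{L^2}<\delta$ are the data of solutions $u,v$ on $[0,t]$ with $\|u(t)-v(t)\|_{L^2}<\varepsilon$. Moreover, for every $R>0$ there is $\eta>0$ such that for every $\sigma>0$ there are $t\in(0,\sigma)$ and solutions $u,v$ on $[0,t]$ with $u(0),v(0)\in\mathcal S$, $\|u(0)\|_{L^2}<R$, $\|v(0)\|_{L^2}<R$, $\|u(0)-v(0)\|_{L^2}<\sigma$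 and $\|u(t)-v(t)\|_{L^2}\ge\eta$. -/

import Mathlib

open MeasureTheory SchwartzMap FourierTransform Filter Topology Set
open scoped ENNReal

/-- `ℝ^d` with its Euclidean norm. -/
abbrev Space (d : ℕ) : Type := EuclideanSpace ℝ (Fin d)

/-- The complex space `L²(ℝ^d)`. -/
abbrev L2 (d : ℕ) : Type := Lp ℂ 2 (volume : Measure (Space d))

/-- A Schwartz function, as an element of `L²`. -/
noncomputable abbrev schwartzL2 {d : ℕ} (f : 𝓢(Space d, ℂ)) : L2 d := f.toLp 2 volume

/-- The `H^γ` norm of an `L²` function, with value `∞` if the function is not in `H^γ`: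
`‖f‖_{H^γ} = ‖(1 + |2πξ|²)^{γ/2} 𝓕 f‖_{L²}`. The factor `2π` appears since Mathlib's Fourier
transform is `𝓕 f (ξ) = ∫ e^{-2πi⟨x, ξ⟩} f(x) dx`, so that `-Δ` has the symbol `|2πξ|²`. -/
noncomputable def sobolevNorm {d : ℕ} (γ : ℝ) (f : L2 d) : ℝ≥0∞ :=
  (∫⁻ ξ : Space d, ENNReal.ofReal ((1 + (2 * Real.pi * ‖ξ‖) ^ 2) ^ γ) *
    ‖(𝓕 f : L2 d) ξ‖ₑ ^ 2) ^ (1 / 2 : ℝ)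

/-- Multiplication by the unimodular symbol of `e^{itΛ}` preserves `L²`. -/
theorem memLp_halfWave_symbol {d : ℕ} (t : ℝ) (g : L2 d) :
    MemLp (fun ξ : Space d =>
      Complex.exp (Complex.I * ((t * (2 * Real.pi * ‖ξ‖) : ℝ) : ℂ)) * g ξ) 2 volume := by
  have hm : Continuous (fun ξ : Space d =>
      Complex.exp (Complex.I * ((t * (2 * Real.pi * ‖ξ‖) : ℝ) : ℂ))) := by fun_prop
  refine (Lp.memLp g).of_le (hm.aestronglyMeasurable.mul (Lp.aestronglyMeasurable g)) ?_
  refine Eventually.of_forall fun ξ => ?_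
  rw [norm_mul, mul_comm Complex.I, Complex.norm_exp_ofReal_mul_I, one_mul]

/-- The free half-wave evolution `e^{itΛ}` on `L²`, where `Λ = √(-Δ)` is the Fourier multiplier
whose symbol is the length of the frequency. -/
noncomputable def halfWave {d : ℕ} (t : ℝ) (f : L2 d) : L2 d :=
  𝓕⁻ ((memLp_halfWave_symbol t (𝓕 f : L2 d)).toLp _ : L2 d)

open Classical in
/-- The power nonlinearity `|f|^{ν-1} f`, as an element of `L²`. The value `0` in the case where
`|f|^{ν-1} f` is not in `L²` is never used for solutions in the sense below: these take values in
`H^s` with `s > d/2`, hence in `L² ∩ L^∞`. -/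
noncomputable def powerNonlinearity {d : ℕ} (ν : ℝ) (f : L2 d) : L2 d :=
  if h : MemLp (fun x : Space d => ((‖f x‖ ^ (ν - 1) : ℝ) : ℂ) * f x) 2 volume
  then h.toLp _ else 0

/-- `u ∈ C([0,T], H^s)`. -/
def ContinuousSobolevOn {d : ℕ} (s T : ℝ) (u : ℝ → L2 d) : Prop :=
  ∀ t ∈ Icc (0 : ℝ) T, sobolevNorm s (u t) < ∞ ∧
    Tendsto (fun t' => sobolevNorm s (u t' - u t)) (𝓝[Icc 0 T] t) (𝓝 0)

/-- `u` is a solution on `[0,T]` of the nonlinear half-wave equation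
`i ∂ₜ u + Λ u = -μ |u|^{ν-1} u`, `u(0) = u₀`: for some `s > d/2` it lies in `C([0,T], H^s)`, and it
satisfies Duhamel's formula
`u(t) = e^{itΛ} u₀ + i μ ∫₀ᵗ e^{i(t-τ)Λ} (|u|^{ν-1} u)(τ) dτ` (an integral in `L²`) on `[0,T]`.
There is at most one such `u` on `[0,T]`, whatever the exponents `s`. -/
def IsNLHWSolution {d : ℕ} (μ ν T : ℝ) (u₀ : L2 d) (u : ℝ → L2 d) : Prop :=
  (∃ s : ℝ, (d : ℝ) / 2 < s ∧ ContinuousSobolevOn s T u) ∧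
  ∀ t ∈ Icc (0 : ℝ) T,
    u t = halfWave t u₀ +
      (Complex.I * (μ : ℂ)) • ∫ τ in (0 : ℝ)..t, halfWave (t - τ) (powerNonlinearity ν (u τ))

/-- The critical regularity exponent `γ_c = d/2 - 1/(ν-1)`. -/
noncomputable def criticalExponent (d : ℕ) (ν : ℝ) : ℝ := (d : ℝ) / 2 - 1 / (ν - 1)

/-- The solution map `𝒮 ∋ u(0) ↦ u(t)` is continuous at `0` in the `H^γ` topology: Schwartz data
that are small in `H^γ` have solutions up to time `t`, and `u(t)` is small in `H^γ`. -/
def SolutionMapContinuousAtZero (d : ℕ) (μ ν γ t : ℝ) : Prop :=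
  ∀ ε : ℝ, 0 < ε → ∃ δ : ℝ, 0 < δ ∧ ∀ f : 𝓢(Space d, ℂ),
    sobolevNorm γ (schwartzL2 f) < ENNReal.ofReal δ →
      ∃ u : ℝ → L2 d, IsNLHWSolution μ ν t (schwartzL2 f) u ∧
        sobolevNorm γ (u t) < ENNReal.ofReal ε

/-- Norm inflation at arbitrarily small times: some Schwartz data which are arbitrarily small in
`H^γ` have solutions that become arbitrarily large in `H^γ` in an arbitrarily short time. -/
def NormInflation (d : ℕ) (μ ν γ : ℝ) : Prop :=
  ∀ ε : ℝ, 0 < ε → ∃ f : 𝓢(Space d, ℂ), ∃ t : ℝ, ∃ u : ℝ → L2 d,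
    0 < t ∧ t < ε ∧ IsNLHWSolution μ ν t (schwartzL2 f) u ∧
      sobolevNorm γ (schwartzL2 f) < ENNReal.ofReal ε ∧
      ENNReal.ofReal ε⁻¹ < sobolevNorm γ (u t)

/-- The solution map `𝒮 ∋ u(0) ↦ u(t)` is uniformly continuous in the `L²` topology. -/
def SolutionMapUniformlyContinuousL2 (d : ℕ) (μ ν t : ℝ) : Prop :=
  ∀ ε : ℝ, 0 < ε → ∃ δ : ℝ, 0 < δ ∧ ∀ f g : 𝓢(Space d, ℂ),
    ‖schwartzL2 f - schwartzL2 g‖ < δ →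
      ∃ u v : ℝ → L2 d, IsNLHWSolution μ ν t (schwartzL2 f) u ∧
        IsNLHWSolution μ ν t (schwartzL2 g) v ∧ ‖u t - v t‖ < ε

/-- Decoherence at arbitrarily small times: in every ball around `0` of `L²` there are pairs of
Schwartz data, arbitrarily close in `L²`, whose solutions are separated in `L²` by a fixed amount
at some arbitrarily small time. -/
def DecoherenceL2 (d : ℕ) (μ ν : ℝ) : Prop :=
  ∀ R : ℝ, 0 < R → ∃ η : ℝ, 0 < η ∧ ∀ σ : ℝ, 0 < σ →
    ∃ f g : 𝓢(Space d, ℂ), ∃ t : ℝ, ∃ u v : ℝ → L2 d,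
      0 < t ∧ t < σ ∧
      IsNLHWSolution μ ν t (schwartzL2 f) u ∧ IsNLHWSolution μ ν t (schwartzL2 g) v ∧
      ‖schwartzL2 f‖ < R ∧ ‖schwartzL2 g‖ < R ∧
      ‖schwartzL2 f - schwartzL2 g‖ < σ ∧ η ≤ ‖u t - v t‖

open scoped NNReal BoundedContinuousFunction ComplexConjugate

/-! ## Fourier multipliers on `L²` -/

/-! Call the equation with `e^{iδtΛ}` in place of `e^{itΛ}` the δ-equation. If `v` solves it, then
`u(t, x) = A v(t/l, x/ℓ)` solves the original equation as soon as `A^{ν-1} l = 1` and `δ = l/ℓ`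
(`Params.scale`). The `H^γ` norm of such a function is `A ℓ^{d/2-γ}` times the square root of an
energy of `v` that depends on `ℓ` only through a regularised weight (`sobolevNorm_scaled_sq`). For
`γ < γ_c` the prefactor can be held at any value `B` while `δ`, `l` and `ℓ` all tend to `0`
(`eventually_exists_scaling_params`). So growth of `v` over a fixed time `T`, for all small `δ`,
becomes growth of `u` over the arbitrarily short time `lT`. What remains is to find growth in the
δ-equation.

For `0 < γ < γ_c` and for decoherence, the model is `δ = 0`: an ordinary differential equation at
each point, solved by `φ e^{iμt|φ|^{ν-1}}`. Its phase gradient grows with `t`, so its homogeneous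
Sobolev norm of order `γ` is unbounded (`exists_energy_gt`). Two amplitudes `1` and `1 + κ` drift
apart in `L²` by a fixed amount after a time of order `1/κ` (`norm_oscL2_add_sub`). Solutions of the
δ-equation converge to this model as `δ → 0` (`IsLift.exists_small_dispersion`).

For `γ ≤ -d/2`, the data have no low frequencies, but their nonlinearity has nonzero integral.
Duhamel's formula then fills a neighbourhood of frequency zero within a short time, uniformly in `δ
≤ 1` (`Params.exists_low_frequency_growth`). The weight `(ℓ² + |2πη|²)^γ` has an integral near zero
that tends to infinity as `ℓ → 0`, because `γ ≤ -d/2`, while the energy of the data stays bounded.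

Failure at a fixed time `t` follows from the short-time results by time reversal. If the solution
map were continuous at time `t`, scaling would give continuity, with uniform constants, at all times
in `[t, 2t]`. Inflating data with inflation time `r ≤ t` would then have a solution up to time `t +
r` that is small there. Conjugated and run backwards over time `t`, it arrives at the conjugate of
the large function `u(r)`, which contradicts continuity at time `t`
(`Params.not_continuous_of_normInflation`); pairs of solutions give the uniform version
(`Params.not_uniformly_continuous`).

The Cauchy theory lives in `H^k` with `k = idx d`, the least integer above `d/2`. The Bessel
potential transports it to `L²`, where the nonlinearity becomes a map that is Lipschitz on balls
(`Params.exists_isLift`), and the existence and perturbation results come from the single lemma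
`exists_mild_near`. Since a solution may have any regularity `s > d/2`, uniqueness across exponents
and persistence of `H^k` regularity are needed too (`Params.unique`, `Params.persistence`); the
latter rests on the tame estimate `sobolevNorm_compL2_sub_le`. -/

theorem memLp_bounded_mul {d : ℕ} (m : Space d →ᵇ ℂ) (g : L2 d) :
    MemLp (fun ξ : Space d => m ξ * g ξ) 2 volume := by
  refine ((Lp.memLp g).const_mul (‖m‖ : ℂ)).of_le
    (m.continuous.aestronglyMeasurable.mul (Lp.aestronglyMeasurable g)) ?_
  refine Eventually.of_forall fun ξ => ?_
  rw [norm_mul, norm_mul, Complex.norm_real, norm_norm]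
  gcongr
  exact m.norm_coe_le_norm ξ

/-- Multiplication by a bounded continuous function on `L²`. -/
noncomputable def mulOp {d : ℕ} (m : Space d →ᵇ ℂ) : L2 d →L[ℂ] L2 d :=
  LinearMap.mkContinuous
    { toFun := fun g => (memLp_bounded_mul m g).toLp _
      map_add' := fun f g => by
        rw [← MemLp.toLp_add]
        refine MemLp.toLp_congr _ _ ?_
        filter_upwards [Lp.coeFn_add f g] with ξ h
        rw [h, Pi.add_apply, Pi.add_apply, mul_add]
      map_smul' := fun c f => by
        rw [RingHom.id_apply, ← MemLp.toLp_const_smul]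
        refine MemLp.toLp_congr _ _ ?_
        filter_upwards [Lp.coeFn_smul c f] with ξ h
        simp [h, mul_left_comm] }
    ‖m‖ (fun g => by
      refine Lp.norm_le_mul_norm_of_ae_le_mul ?_
      filter_upwards [(memLp_bounded_mul m g).coeFn_toLp] with ξ h
      simp only [LinearMap.coe_mk, AddHom.coe_mk]
      rw [h, norm_mul]
      gcongr
      exact m.norm_coe_le_norm ξ)

theorem coeFn_mulOp {d : ℕ} (m : Space d →ᵇ ℂ) (g : L2 d) :
    mulOp m g =ᵐ[volume] fun ξ => m ξ * g ξ :=
  (memLp_bounded_mul m g).coeFn_toLp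

/-- The Fourier multiplier with a bounded continuous symbol. -/
noncomputable def fourierMul {d : ℕ} (m : Space d →ᵇ ℂ) : L2 d →L[ℂ] L2 d :=
  ((Lp.fourierTransformₗᵢ (Space d) ℂ).symm.toContinuousLinearEquiv : L2 d →L[ℂ] L2 d) ∘L
    mulOp m ∘L ((Lp.fourierTransformₗᵢ (Space d) ℂ).toContinuousLinearEquiv : L2 d →L[ℂ] L2 d)

theorem fourierMul_apply {d : ℕ} (m : Space d →ᵇ ℂ) (f : L2 d) :
    fourierMul m f = 𝓕⁻ (mulOp m (𝓕 f : L2 d)) := rfl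

theorem fourier_fourierMul {d : ℕ} (m : Space d →ᵇ ℂ) (f : L2 d) :
    (𝓕 (fourierMul m f) : L2 d) =ᵐ[volume] fun ξ => m ξ * (𝓕 f : L2 d) ξ := by
  rw [fourierMul_apply, fourier_fourierInv_eq]
  exact coeFn_mulOp m _

theorem fourier_injective {d : ℕ} {f g : L2 d} (h : (𝓕 f : L2 d) =ᵐ[volume] (𝓕 g : L2 d)) :
    f = g :=
  (Lp.fourierTransformₗᵢ (Space d) ℂ).injective (Lp.ext h)

theorem fourier_add_ae {d : ℕ} (f g : L2 d) :
    (𝓕 (f + g) : L2 d) =ᵐ[volume] fun ξ => (𝓕 f : L2 d) ξ + (𝓕 g : L2 d) ξ := by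
  rw [FourierTransform.fourier_add]
  exact Lp.coeFn_add _ _

theorem fourier_sub_ae {d : ℕ} (f g : L2 d) :
    (𝓕 (f - g) : L2 d) =ᵐ[volume] fun ξ => (𝓕 f : L2 d) ξ - (𝓕 g : L2 d) ξ := by
  have : (𝓕 (f - g) : L2 d) = 𝓕 f - 𝓕 g := (Lp.fourierTransformₗᵢ (Space d) ℂ).map_sub f g
  rw [this]
  exact Lp.coeFn_sub _ _

theorem fourier_smul_ae {d : ℕ} (c : ℂ) (f : L2 d) :
    (𝓕 (c • f) : L2 d) =ᵐ[volume] fun ξ => c * (𝓕 f : L2 d) ξ := by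
  rw [FourierTransform.fourier_smul]
  exact Lp.coeFn_smul _ _

theorem fourierMul_comm {d : ℕ} (m n : Space d →ᵇ ℂ) (f : L2 d) :
    fourierMul m (fourierMul n f) = fourierMul n (fourierMul m f) := by
  refine fourier_injective ?_
  filter_upwards [fourier_fourierMul m (fourierMul n f), fourier_fourierMul n f,
    fourier_fourierMul n (fourierMul m f), fourier_fourierMul m f] with ξ h1 h2 h3 h4
  rw [h1, h2, h3, h4]; ring

/-! ## The weight and the Bessel potentials -/

/-- The weight `1 + |2πξ|²`. -/
noncomputable def weight {d : ℕ} (ξ : Space d) : ℝ := 1 + (2 * Real.pi * ‖ξ‖) ^ 2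

theorem one_le_weight {d : ℕ} (ξ : Space d) : 1 ≤ weight ξ := by
  unfold weight; nlinarith [sq_nonneg (2 * Real.pi * ‖ξ‖)]

theorem weight_pos {d : ℕ} (ξ : Space d) : 0 < weight ξ :=
  zero_lt_one.trans_le (one_le_weight ξ)

theorem continuous_weight {d : ℕ} : Continuous (weight : Space d → ℝ) := by
  unfold weight; fun_prop

theorem continuous_weight_rpow {d : ℕ} (s : ℝ) : Continuous fun ξ : Space d => weight ξ ^ s :=
  continuous_weight.rpow_const fun ξ => Or.inl (weight_pos ξ).ne'

theorem continuous_weight_rpow_ofReal {d : ℕ} (s : ℝ) :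
    Continuous fun ξ : Space d => ((weight ξ ^ s : ℝ) : ℂ) :=
  Complex.continuous_ofReal.comp (continuous_weight_rpow s)

theorem norm_weight_rpow {d : ℕ} (s : ℝ) (ξ : Space d) :
    ‖((weight ξ ^ s : ℝ) : ℂ)‖ = weight ξ ^ s := by
  rw [Complex.norm_real, Real.norm_of_nonneg (Real.rpow_nonneg (weight_pos ξ).le _)]

theorem sobolevNorm_eq {d : ℕ} (γ : ℝ) (f : L2 d) :
    sobolevNorm γ f =
      (∫⁻ ξ : Space d, ENNReal.ofReal (weight ξ ^ γ) * ‖(𝓕 f : L2 d) ξ‖ₑ ^ 2) ^ (1 / 2 : ℝ) := rfl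

theorem eLpNorm_two_eq {d : ℕ} (f : Space d → ℂ) :
    eLpNorm f 2 volume = (∫⁻ ξ, ‖f ξ‖ₑ ^ 2) ^ (1 / 2 : ℝ) := by
  have := eLpNorm_nnreal_eq_lintegral (μ := (volume : Measure (Space d))) (f := f) (p := 2)
    two_ne_zero
  simpa using this

theorem sobolevNorm_eq_eLpNorm {d : ℕ} (γ : ℝ) (f : L2 d) :
    sobolevNorm γ f =
      eLpNorm (fun ξ : Space d => ((weight ξ ^ (γ / 2) : ℝ) : ℂ) * (𝓕 f : L2 d) ξ) 2 volume := by
  rw [sobolevNorm_eq, eLpNorm_two_eq]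
  congr 2
  funext ξ
  rw [enorm_mul, mul_pow, ← ofReal_norm ((weight ξ ^ (γ / 2) : ℝ) : ℂ), norm_weight_rpow,
    ← ENNReal.ofReal_pow (Real.rpow_nonneg (weight_pos ξ).le _), ← Real.rpow_natCast,
    ← Real.rpow_mul (weight_pos ξ).le]
  congr 3
  push_cast; ring

theorem aestronglyMeasurable_weight_mul {d : ℕ} (γ : ℝ) (f : L2 d) :
    AEStronglyMeasurable
      (fun ξ : Space d => ((weight ξ ^ γ : ℝ) : ℂ) * (𝓕 f : L2 d) ξ) volume :=
  (continuous_weight_rpow_ofReal γ).aestronglyMeasurable.mul (Lp.aestronglyMeasurable _)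

theorem sobolevNorm_zero_left {d : ℕ} (f : L2 d) : sobolevNorm 0 f = ‖f‖ₑ := by
  rw [sobolevNorm_eq_eLpNorm]
  simp only [zero_div, Real.rpow_zero, Complex.ofReal_one, one_mul]
  rw [← Lp.enorm_def, ← ofReal_norm, Lp.norm_fourier_eq, ofReal_norm]

theorem sobolevNorm_mono {d : ℕ} {s r : ℝ} (h : s ≤ r) (f : L2 d) :
    sobolevNorm s f ≤ sobolevNorm r f := by
  rw [sobolevNorm_eq, sobolevNorm_eq]
  gcongr
  exact one_le_weight _

theorem enorm_le_sobolevNorm {d : ℕ} {s : ℝ} (hs : 0 ≤ s) (f : L2 d) : ‖f‖ₑ ≤ sobolevNorm s f := by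
  rw [← sobolevNorm_zero_left]; exact sobolevNorm_mono hs f

theorem sobolevNorm_congr {d : ℕ} {s : ℝ} {f g : L2 d}
    (h : ∀ᵐ ξ : Space d, ‖(𝓕 f : L2 d) ξ‖ = ‖(𝓕 g : L2 d) ξ‖) :
    sobolevNorm s f = sobolevNorm s g := by
  rw [sobolevNorm_eq, sobolevNorm_eq]
  congr 1
  refine lintegral_congr_ae ?_
  filter_upwards [h] with ξ h
  rw [← ofReal_norm, h, ofReal_norm]

theorem sobolevNorm_add_le {d : ℕ} (s : ℝ) (f g : L2 d) :
    sobolevNorm s (f + g) ≤ sobolevNorm s f + sobolevNorm s g := by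
  simp only [sobolevNorm_eq_eLpNorm]
  refine le_trans (le_of_eq (eLpNorm_congr_ae ?_))
    (eLpNorm_add_le (aestronglyMeasurable_weight_mul _ f) (aestronglyMeasurable_weight_mul _ g)
      (by norm_num))
  filter_upwards [fourier_add_ae f g] with ξ h
  rw [h, Pi.add_apply, mul_add]

theorem sobolevNorm_smul {d : ℕ} (s : ℝ) (c : ℂ) (f : L2 d) :
    sobolevNorm s (c • f) = ‖c‖ₑ * sobolevNorm s f := by
  simp only [sobolevNorm_eq_eLpNorm]
  rw [← eLpNorm_const_smul]
  refine eLpNorm_congr_ae ?_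
  filter_upwards [fourier_smul_ae c f] with ξ h
  rw [h, Pi.smul_apply, smul_eq_mul, mul_left_comm]

theorem sobolevNorm_neg {d : ℕ} (s : ℝ) (f : L2 d) : sobolevNorm s (-f) = sobolevNorm s f := by
  have := sobolevNorm_smul s (-1) f
  simpa using this

theorem sobolevNorm_sub_le {d : ℕ} (s : ℝ) (f g : L2 d) :
    sobolevNorm s (f - g) ≤ sobolevNorm s f + sobolevNorm s g := by
  rw [sub_eq_add_neg, ← sobolevNorm_neg s g]
  exact sobolevNorm_add_le s f (-g)

theorem sobolevNorm_zero {d : ℕ} (s : ℝ) : sobolevNorm s (0 : L2 d) = 0 := by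
  have := sobolevNorm_smul s 0 (0 : L2 d)
  simpa using this

/-- The symbol `(1 + |2πξ|²)^{-|s|/2}`. -/
noncomputable def besselSymbol {d : ℕ} (s : ℝ) : Space d →ᵇ ℂ :=
  BoundedContinuousFunction.ofNormedAddCommGroup
    -- The absolute value bounds the symbol by `1` for every real `s`, so no sign hypothesis enters
    -- the definition.
    (fun ξ => ((weight ξ ^ (-|s| / 2) : ℝ) : ℂ)) (continuous_weight_rpow_ofReal _) 1 (fun ξ => by
      rw [norm_weight_rpow]
      exact Real.rpow_le_one_of_one_le_of_nonpos (one_le_weight ξ)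
        (by have := abs_nonneg s; linarith))

/-- The Bessel potential of order `s ≥ 0`: an isomorphism from `L²` onto `H^s`. -/
noncomputable def bessel {d : ℕ} (s : ℝ) : L2 d →L[ℂ] L2 d := fourierMul (besselSymbol s)

theorem fourier_bessel {d : ℕ} {s : ℝ} (hs : 0 ≤ s) (f : L2 d) :
    (𝓕 (bessel s f) : L2 d) =ᵐ[volume]
      fun ξ => ((weight ξ ^ (-s / 2) : ℝ) : ℂ) * (𝓕 f : L2 d) ξ := by
  unfold bessel
  filter_upwards [fourier_fourierMul (besselSymbol s) f] with ξ h
  rw [h, besselSymbol, BoundedContinuousFunction.coe_ofNormedAddCommGroup, abs_of_nonneg hs]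

theorem weight_rpow_mul_cancel {d : ℕ} (s : ℝ) (ξ : Space d) (z : ℂ) :
    ((weight ξ ^ (s / 2) : ℝ) : ℂ) * (((weight ξ ^ (-s / 2) : ℝ) : ℂ) * z) = z := by
  rw [← mul_assoc, ← Complex.ofReal_mul, ← Real.rpow_add (weight_pos ξ)]
  have : s / 2 + -s / 2 = 0 := by ring
  simp [this]

theorem sobolevNorm_bessel {d : ℕ} {s : ℝ} (hs : 0 ≤ s) (f : L2 d) :
    sobolevNorm s (bessel s f) = ‖f‖ₑ := by
  rw [sobolevNorm_eq_eLpNorm, ← sobolevNorm_zero_left f, sobolevNorm_eq_eLpNorm]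
  refine eLpNorm_congr_ae ?_
  filter_upwards [fourier_bessel hs f] with ξ h
  rw [h, weight_rpow_mul_cancel]
  simp

/-- Divide `𝓕 f` by the symbol. With `sobolevNorm_bessel` this makes `bessel s` an isometry of `L²`
onto `H^s`, so curves and nonlinear maps in `H^s` can be pulled back to the Banach space `L²`, where
Picard–Lindelöf and Gronwall apply. -/
theorem exists_bessel_eq {d : ℕ} {s : ℝ} (hs : 0 ≤ s) {f : L2 d} (hf : sobolevNorm s f < ∞) :
    ∃ g : L2 d, bessel s g = f := by
  have hm : MemLp (fun ξ : Space d => ((weight ξ ^ (s / 2) : ℝ) : ℂ) * (𝓕 f : L2 d) ξ) 2 volume :=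
    ⟨aestronglyMeasurable_weight_mul _ f, by rwa [← sobolevNorm_eq_eLpNorm]⟩
  refine ⟨𝓕⁻ (hm.toLp : L2 d), fourier_injective ?_⟩
  have h2 := fourier_bessel hs (𝓕⁻ (hm.toLp : L2 d))
  rw [fourier_fourierInv_eq] at h2
  filter_upwards [h2, hm.coeFn_toLp] with ξ h2 h3
  rw [h2, h3, mul_left_comm, weight_rpow_mul_cancel]

theorem bessel_injective {d : ℕ} {s : ℝ} (hs : 0 ≤ s) :
    Function.Injective (bessel s : L2 d →L[ℂ] L2 d) := by
  intro f g h
  have := sobolevNorm_bessel hs (f - g)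
  rw [map_sub, h, sub_self, sobolevNorm_zero] at this
  rw [← sub_eq_zero, ← enorm_eq_zero, this]

theorem sobolevNorm_bessel_lt_top {d : ℕ} {s : ℝ} (hs : 0 ≤ s) (f : L2 d) :
    sobolevNorm s (bessel s f) < ∞ := by
  rw [sobolevNorm_bessel hs]; exact enorm_lt_top

/-! ## The half-wave group -/

/-- The symbol of `e^{itΛ}`. -/
noncomputable def phaseSymbol {d : ℕ} (t : ℝ) : Space d →ᵇ ℂ :=
  BoundedContinuousFunction.ofNormedAddCommGroup
    (fun ξ => Complex.exp (Complex.I * ((t * (2 * Real.pi * ‖ξ‖) : ℝ) : ℂ)))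
    (by fun_prop) 1 (fun ξ => by rw [mul_comm Complex.I, Complex.norm_exp_ofReal_mul_I])

/-- The half-wave evolution as a bounded operator. -/
noncomputable def halfWaveL {d : ℕ} (t : ℝ) : L2 d →L[ℂ] L2 d := fourierMul (phaseSymbol t)

theorem halfWaveL_apply {d : ℕ} (t : ℝ) (f : L2 d) : halfWaveL t f = halfWave t f := rfl

theorem fourier_halfWave {d : ℕ} (t : ℝ) (f : L2 d) :
    (𝓕 (halfWave t f) : L2 d) =ᵐ[volume]
      fun ξ => Complex.exp (Complex.I * ((t * (2 * Real.pi * ‖ξ‖) : ℝ) : ℂ)) * (𝓕 f : L2 d) ξ :=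
  fourier_fourierMul (phaseSymbol t) f

theorem norm_phase {d : ℕ} (t : ℝ) (ξ : Space d) :
    ‖Complex.exp (Complex.I * ((t * (2 * Real.pi * ‖ξ‖) : ℝ) : ℂ))‖ = 1 := by
  rw [mul_comm Complex.I, Complex.norm_exp_ofReal_mul_I]

theorem sobolevNorm_halfWave {d : ℕ} (s t : ℝ) (f : L2 d) :
    sobolevNorm s (halfWave t f) = sobolevNorm s f := by
  refine sobolevNorm_congr ?_
  filter_upwards [fourier_halfWave t f] with ξ h
  rw [h, norm_mul, norm_phase, one_mul]

theorem norm_halfWave {d : ℕ} (t : ℝ) (f : L2 d) : ‖halfWave t f‖ = ‖f‖ := by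
  have := sobolevNorm_halfWave 0 t f
  rw [sobolevNorm_zero_left, sobolevNorm_zero_left] at this
  rw [← toReal_enorm, this, toReal_enorm]

theorem halfWave_zero {d : ℕ} (f : L2 d) : halfWave 0 f = f := by
  refine fourier_injective ?_
  filter_upwards [fourier_halfWave 0 f] with ξ h
  simp [h]

theorem halfWave_add {d : ℕ} (s t : ℝ) (f : L2 d) :
    halfWave (s + t) f = halfWave s (halfWave t f) := by
  refine fourier_injective ?_
  filter_upwards [fourier_halfWave (s + t) f, fourier_halfWave s (halfWave t f),
    fourier_halfWave t f] with ξ h1 h2 h3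
  rw [h1, h2, h3, ← mul_assoc (Complex.exp _), ← Complex.exp_add]
  congr 2
  push_cast; ring

theorem halfWave_bessel {d : ℕ} (t s : ℝ) (f : L2 d) :
    halfWave t (bessel s f) = bessel s (halfWave t f) :=
  fourierMul_comm (phaseSymbol t) (besselSymbol s) f

/-! ## Schwartz functions in `L²` -/

theorem denseRange_schwartzL2 {d : ℕ} : DenseRange (schwartzL2 : 𝓢(Space d, ℂ) → L2 d) :=
  SchwartzMap.denseRange_toLpCLM (F := ℂ) (E := Space d) (p := 2) ENNReal.ofNat_ne_top

theorem fourier_schwartzL2 {d : ℕ} (f : 𝓢(Space d, ℂ)) :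
    (𝓕 (schwartzL2 f) : L2 d) = schwartzL2 (𝓕 f) := SchwartzMap.toLp_fourier_eq f

theorem fourierInv_schwartzL2 {d : ℕ} (f : 𝓢(Space d, ℂ)) :
    (𝓕⁻ (schwartzL2 f) : L2 d) = schwartzL2 (𝓕⁻ f) := SchwartzMap.toLp_fourierInv_eq f

theorem coeFn_schwartzL2 {d : ℕ} (f : 𝓢(Space d, ℂ)) : schwartzL2 f =ᵐ[volume] f :=
  f.coeFn_toLp 2

theorem fourierMul_schwartzL2 {d : ℕ} (m : Space d →ᵇ ℂ)
    (hm : Function.HasTemperateGrowth m) (f : 𝓢(Space d, ℂ)) :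
    fourierMul m (schwartzL2 f) = schwartzL2 (SchwartzMap.fourierMultiplierCLM ℂ m f) := by
  rw [fourierMul_apply, fourier_schwartzL2, SchwartzMap.fourierMultiplierCLM_apply,
    ← fourierInv_schwartzL2]
  congr 1
  refine Lp.ext ?_
  filter_upwards [coeFn_mulOp m (schwartzL2 (𝓕 f)), coeFn_schwartzL2 (𝓕 f),
    coeFn_schwartzL2 (smulLeftCLM ℂ m (𝓕 f))] with ξ h1 h2 h3
  rw [h1, h2, h3, SchwartzMap.smulLeftCLM_apply_apply hm, smul_eq_mul]

theorem hasTemperateGrowth_weight_rpow {d : ℕ} (s : ℝ) :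
    Function.HasTemperateGrowth fun ξ : Space d => weight ξ ^ s := by
  have h1 := Function.hasTemperateGrowth_one_add_norm_sq_rpow (Space d) s
  have h2 : Function.HasTemperateGrowth fun ξ : Space d => (2 * Real.pi) • ξ :=
    ((2 * Real.pi) • ContinuousLinearMap.id ℝ (Space d)).hasTemperateGrowth
  have h3 := h1.comp h2
  have h4 : (fun ξ : Space d => weight ξ ^ s) =
      (fun x : Space d => (1 + ‖x‖ ^ 2) ^ s) ∘ fun ξ => (2 * Real.pi) • ξ := by
    funext ξ
    simp only [Function.comp, weight, norm_smul, Real.norm_eq_abs, mul_pow, sq_abs, abs_mul]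
  rw [h4]; exact h3

theorem hasTemperateGrowth_besselSymbol {d : ℕ} (s : ℝ) :
    Function.HasTemperateGrowth (besselSymbol s : Space d →ᵇ ℂ) :=
  Function.Complex.hasTemperateGrowth_ofReal.comp (hasTemperateGrowth_weight_rpow _)

theorem exists_schwartzL2_eq_bessel {d : ℕ} (s : ℝ) (f : 𝓢(Space d, ℂ)) :
    ∃ g : 𝓢(Space d, ℂ), schwartzL2 g = bessel s (schwartzL2 f) :=
  ⟨_, (fourierMul_schwartzL2 _ (hasTemperateGrowth_besselSymbol s) f).symm⟩

theorem exists_schwartz_sobolevNorm_sub_lt {d : ℕ} {s : ℝ} (hs : 0 ≤ s) {f : L2 d}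
    (hf : sobolevNorm s f < ∞) {ε : ℝ≥0∞} (hε : 0 < ε) :
    ∃ φ : 𝓢(Space d, ℂ), sobolevNorm s (schwartzL2 φ - f) < ε := by
  obtain ⟨g, rfl⟩ := exists_bessel_eq hs hf
  have ho : IsOpen {h : L2 d | edist h g < ε} :=
    isOpen_lt (continuous_id.edist continuous_const) continuous_const
  obtain ⟨φ, hφ⟩ := denseRange_schwartzL2.exists_mem_open ho ⟨g, by simpa using hε⟩
  obtain ⟨ψ, hψ⟩ := exists_schwartzL2_eq_bessel s φ
  refine ⟨ψ, ?_⟩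
  rw [hψ, ← map_sub, sobolevNorm_bessel hs, ← edist_eq_enorm_sub]
  exact hφ

theorem exists_schwartz_seq {d : ℕ} {s : ℝ} (hs : 0 ≤ s) {f : L2 d} (hf : sobolevNorm s f < ∞) :
    ∃ φ : ℕ → 𝓢(Space d, ℂ),
      Tendsto (fun n => sobolevNorm s (schwartzL2 (φ n) - f)) atTop (𝓝 0) := by
  have h : ∀ n : ℕ, ∃ φ : 𝓢(Space d, ℂ),
      sobolevNorm s (schwartzL2 φ - f) < ((n : ℝ≥0∞) + 1)⁻¹ := fun n =>
    exists_schwartz_sobolevNorm_sub_lt hs hf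
      (ENNReal.inv_pos.2 (ENNReal.add_ne_top.2 ⟨ENNReal.natCast_ne_top n, ENNReal.one_ne_top⟩))
  choose φ hφ using h
  refine ⟨φ, tendsto_of_tendsto_of_tendsto_of_le_of_le tendsto_const_nhds ?_
    (fun n => zero_le) (fun n => (hφ n).le)⟩
  have := (tendsto_add_atTop_iff_nat 1).2 ENNReal.tendsto_inv_nat_nhds_zero
  simpa using this

theorem sobolevNorm_schwartzL2_lt_top {d : ℕ} (s : ℝ) (φ : 𝓢(Space d, ℂ)) :
    sobolevNorm s (schwartzL2 φ) < ∞ := by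
  have hw : Function.HasTemperateGrowth fun ξ : Space d => ((weight ξ ^ (s / 2) : ℝ) : ℂ) :=
    Function.Complex.hasTemperateGrowth_ofReal.comp (hasTemperateGrowth_weight_rpow _)
  set ψ : 𝓢(Space d, ℂ) :=
    smulLeftCLM ℂ (fun ξ : Space d => ((weight ξ ^ (s / 2) : ℝ) : ℂ)) (𝓕 φ) with hψ
  have hm : MemLp ψ 2 (volume : Measure (Space d)) := ψ.memLp 2 volume
  have he : (fun ξ : Space d => ((weight ξ ^ (s / 2) : ℝ) : ℂ) * (𝓕 (schwartzL2 φ) : L2 d) ξ)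
      =ᵐ[volume] ψ := by
    rw [fourier_schwartzL2]
    filter_upwards [coeFn_schwartzL2 (𝓕 φ)] with ξ h
    rw [h, hψ, SchwartzMap.smulLeftCLM_apply_apply hw, smul_eq_mul]
  rw [sobolevNorm_eq_eLpNorm, eLpNorm_congr_ae he]
  exact hm.eLpNorm_lt_top

/-! ## Reflection, conjugation, and integrable functions -/

/-- The reflection `x ↦ -x` on `L²`. -/
noncomputable def reflL2 {d : ℕ} : L2 d →+ L2 d :=
  Lp.compMeasurePreserving (fun x : Space d => -x) (Measure.measurePreserving_neg volume)

theorem coeFn_reflL2 {d : ℕ} (f : L2 d) : reflL2 f =ᵐ[volume] fun x => f (-x) :=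
  Lp.coeFn_compMeasurePreserving f (Measure.measurePreserving_neg volume)

theorem continuous_reflL2 {d : ℕ} : Continuous (reflL2 : L2 d → L2 d) :=
  (Lp.isometry_compMeasurePreserving (Measure.measurePreserving_neg volume)).continuous

theorem ae_comp_neg {d : ℕ} {p : Space d → Prop} (h : ∀ᵐ x, p x) : ∀ᵐ x, p (-x) :=
  (Measure.measurePreserving_neg (volume : Measure (Space d))).quasiMeasurePreserving.ae h

/-- Both sides are continuous and agree on the dense Schwartz functions. This turns bounds for `𝓕`
into bounds for its inverse, as in `norm_le_integral_fourier`. -/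
theorem fourierInv_eq_reflL2 {d : ℕ} (f : L2 d) : (𝓕⁻ f : L2 d) = reflL2 (𝓕 f) := by
  have h1 : Continuous fun f : L2 d => (𝓕⁻ f : L2 d) :=
    (Lp.fourierTransformₗᵢ (Space d) ℂ).symm.continuous
  have h2 : Continuous fun f : L2 d => reflL2 (𝓕 f : L2 d) :=
    continuous_reflL2.comp (Lp.fourierTransformₗᵢ (Space d) ℂ).continuous
  refine congrFun (denseRange_schwartzL2.equalizer h1 h2 ?_) f
  funext φ
  simp only [Function.comp]
  rw [fourierInv_schwartzL2, fourier_schwartzL2]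
  refine Lp.ext ?_
  filter_upwards [coeFn_schwartzL2 (𝓕⁻ φ), coeFn_reflL2 (schwartzL2 (𝓕 φ)),
    ae_comp_neg (coeFn_schwartzL2 (𝓕 φ))] with x h1 h2 h3
  rw [h1, h2, h3, SchwartzMap.fourierInv_coe, SchwartzMap.fourier_coe,
    Real.fourierInv_eq_fourier_neg]

/-- On `L¹ ∩ L²` the two Fourier transforms coincide. -/
theorem fourier_toLp_ae {d : ℕ} {f : Space d → ℂ} (h1 : Integrable f) (h2 : MemLp f 2 volume) :
    (𝓕 (h2.toLp f : L2 d) : L2 d) =ᵐ[volume] 𝓕 f := by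
  have hc : Continuous (𝓕 f) := VectorFourier.fourierIntegral_continuous
    Real.continuous_fourierChar (L := innerₗ (Space d)) continuous_inner h1
  refine ae_eq_of_integral_contDiff_smul_eq
    ((Lp.memLp _).locallyIntegrable (by norm_num)) hc.locallyIntegrable ?_
  intro g hg hgs
  have hs : HasCompactSupport fun x => ((g x : ℝ) : ℂ) := hgs.comp_left Complex.ofReal_zero
  have hsm : ContDiff ℝ (⊤ : ℕ∞) fun x => ((g x : ℝ) : ℂ) := Complex.ofRealCLM.contDiff.comp hg
  set ψ : 𝓢(Space d, ℂ) := hs.toSchwartzMap hsm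
  -- The `L²` transform is the distributional one, tested here against `ψ`; the `L¹` transform obeys
  -- the same duality formula (`e3`).
  have e1 := congrArg (fun T : 𝓢'(Space d, ℂ) => T ψ)
    (Lp.fourier_toTemperedDistribution_eq (h2.toLp f : L2 d))
  simp only [TemperedDistribution.fourier_apply, Lp.toTemperedDistribution_apply] at e1
  have e2 : ∫ x, (𝓕 ψ : 𝓢(Space d, ℂ)) x • (h2.toLp f : L2 d) x = ∫ x, 𝓕 ψ x • f x := by
    refine integral_congr_ae ?_
    filter_upwards [h2.coeFn_toLp] with x hx
    rw [hx]
  have e3 : ∫ x, 𝓕 (ψ : Space d → ℂ) x • f x = ∫ x, ψ x • 𝓕 f x := by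
    have := VectorFourier.integral_fourierIntegral_smul_eq_flip (μ := (volume : Measure (Space d)))
      (ν := (volume : Measure (Space d))) (L := innerₗ (Space d)) Real.continuous_fourierChar
      continuous_inner ψ.integrable h1
    rw [flip_innerₗ] at this
    exact this
  have e4 := (e2.symm.trans e1).symm
  rw [SchwartzMap.fourier_coe] at e4
  rw [e3] at e4
  exact e4

theorem norm_fourier_le_of_integrable {d : ℕ} {f : L2 d} (h1 : Integrable f) :
    ∀ᵐ ξ, ‖(𝓕 f : L2 d) ξ‖ ≤ ∫ x, ‖f x‖ := by
  have := fourier_toLp_ae h1 (Lp.memLp f)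
  rw [Lp.toLp_coeFn] at this
  filter_upwards [this] with ξ h
  rw [h]
  exact VectorFourier.norm_fourierIntegral_le_integral_norm _ _ _ _ _

theorem norm_le_integral_fourier {d : ℕ} {f : L2 d} (h1 : Integrable (𝓕 f : L2 d)) :
    ∀ᵐ x, ‖f x‖ ≤ ∫ ξ, ‖(𝓕 f : L2 d) ξ‖ := by
  have h2 := coeFn_reflL2 (𝓕 (𝓕 f : L2 d) : L2 d)
  rw [← fourierInv_eq_reflL2, fourierInv_fourier_eq] at h2
  filter_upwards [h2, ae_comp_neg (norm_fourier_le_of_integrable h1)] with x h h'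
  rw [h]; exact h'

/-- Complex conjugation on `L²`. -/
noncomputable def conjL2 {d : ℕ} : L2 d →L[ℝ] L2 d :=
  (Complex.conjCLE : ℂ →L[ℝ] ℂ).compLpL 2 volume

theorem coeFn_conjL2 {d : ℕ} (f : L2 d) : conjL2 f =ᵐ[volume] fun x => conj (f x) :=
  (Complex.conjCLE : ℂ →L[ℝ] ℂ).coeFn_compLpL f

theorem fourier_conjL2 {d : ℕ} (f : L2 d) :
    (𝓕 (conjL2 f) : L2 d) = reflL2 (conjL2 (𝓕 f : L2 d)) := by
  have hF : Continuous fun f : L2 d => (𝓕 f : L2 d) :=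
    (Lp.fourierTransformₗᵢ (Space d) ℂ).continuous
  have h1 : Continuous fun f : L2 d => (𝓕 (conjL2 f) : L2 d) := hF.comp conjL2.continuous
  have h2 : Continuous fun f : L2 d => reflL2 (conjL2 (𝓕 f : L2 d)) :=
    continuous_reflL2.comp (conjL2.continuous.comp hF)
  refine congrFun (denseRange_schwartzL2.equalizer h1 h2 ?_) f
  funext φ
  simp only [Function.comp]
  have hc : conjL2 (schwartzL2 φ) =
      schwartzL2 (SchwartzMap.postcompCLM (𝕜 := ℝ) (Complex.conjCLE : ℂ →L[ℝ] ℂ) φ) := by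
    refine Lp.ext ?_
    filter_upwards [coeFn_conjL2 (schwartzL2 φ), coeFn_schwartzL2 φ, coeFn_schwartzL2
      (SchwartzMap.postcompCLM (𝕜 := ℝ) (Complex.conjCLE : ℂ →L[ℝ] ℂ) φ)] with x h1 h2 h3
    rw [h1, h2, h3, SchwartzMap.postcompCLM_apply]
    rfl
  rw [hc, fourier_schwartzL2, fourier_schwartzL2]
  refine Lp.ext ?_
  filter_upwards [coeFn_schwartzL2
      (𝓕 (SchwartzMap.postcompCLM (𝕜 := ℝ) (Complex.conjCLE : ℂ →L[ℝ] ℂ) φ)),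
    coeFn_reflL2 (conjL2 (schwartzL2 (𝓕 φ))), ae_comp_neg (coeFn_conjL2 (schwartzL2 (𝓕 φ))),
    ae_comp_neg (coeFn_schwartzL2 (𝓕 φ))] with x h1 h2 h3 h4
  rw [h1, h2, h3, h4, SchwartzMap.fourier_coe, SchwartzMap.fourier_coe, Real.fourier_eq',
    Real.fourier_eq', ← integral_conj]
  refine integral_congr_ae (Eventually.of_forall fun v => ?_)
  simp only [SchwartzMap.postcompCLM_apply, smul_eq_mul, map_mul, ← Complex.exp_conj,
    Complex.conj_ofReal, Complex.conj_I, inner_neg_right]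
  have : ((Complex.conjCLE : ℂ →L[ℝ] ℂ)) (φ v) = conj (φ v) := rfl
  rw [this]
  congr 2
  push_cast; ring

theorem fourier_conjL2_ae {d : ℕ} (f : L2 d) :
    (𝓕 (conjL2 f) : L2 d) =ᵐ[volume] fun ξ => conj ((𝓕 f : L2 d) (-ξ)) := by
  rw [fourier_conjL2]
  filter_upwards [coeFn_reflL2 (conjL2 (𝓕 f : L2 d)), ae_comp_neg (coeFn_conjL2 (𝓕 f : L2 d))]
    with ξ h1 h2
  rw [h1, h2]

theorem weight_neg {d : ℕ} (ξ : Space d) : weight (-ξ) = weight ξ := by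
  simp [weight]

theorem sobolevNorm_conjL2 {d : ℕ} (s : ℝ) (f : L2 d) :
    sobolevNorm s (conjL2 f) = sobolevNorm s f := by
  rw [sobolevNorm_eq, sobolevNorm_eq]
  congr 1
  rw [← (Measure.measurePreserving_neg (volume : Measure (Space d))).lintegral_comp_emb
    (MeasurableEquiv.neg (Space d)).measurableEmbedding
    (fun ξ => ENNReal.ofReal (weight ξ ^ s) * ‖(𝓕 f : L2 d) ξ‖ₑ ^ 2)]
  refine lintegral_congr_ae ?_
  filter_upwards [fourier_conjL2_ae f] with ξ h
  rw [h, weight_neg, ← ofReal_norm, RCLike.norm_conj, ofReal_norm]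

theorem norm_conjL2 {d : ℕ} (f : L2 d) : ‖conjL2 f‖ = ‖f‖ := by
  have := sobolevNorm_conjL2 0 f
  rw [sobolevNorm_zero_left, sobolevNorm_zero_left] at this
  rw [← toReal_enorm, this, toReal_enorm]

/-- The symbol is even in `ξ`, so conjugation, which reflects frequencies, only reverses the time.
This is what makes the equation time reversible. -/
theorem halfWave_conjL2 {d : ℕ} (t : ℝ) (f : L2 d) :
    halfWave t (conjL2 f) = conjL2 (halfWave (-t) f) := by
  refine fourier_injective ?_
  filter_upwards [fourier_halfWave t (conjL2 f), fourier_conjL2_ae f,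
    fourier_conjL2_ae (halfWave (-t) f), ae_comp_neg (fourier_halfWave (-t) f)] with ξ h1 h2 h3 h4
  rw [h1, h2, h3, h4, map_mul, ← Complex.exp_conj, map_mul, Complex.conj_ofReal, Complex.conj_I,
    norm_neg]
  congr 2
  push_cast; ring

/-! ## Sobolev embedding -/

theorem lintegral_weight_lt_top {d : ℕ} {s : ℝ} (hs : (d : ℝ) / 2 < s) :
    ∫⁻ ξ : Space d, ENNReal.ofReal (weight ξ ^ (-s)) < ∞ := by
  have h1 : Integrable (fun ξ : Space d => (1 + ‖ξ‖ ^ 2) ^ (-(2 * s) / 2)) volume :=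
    integrable_rpow_neg_one_add_norm_sq (by simpa using by linarith)
  have hs0 : 0 ≤ s := le_trans (by positivity) hs.le
  refine lt_of_le_of_lt (lintegral_mono fun ξ => ?_) h1.lintegral_lt_top
  refine ENNReal.ofReal_le_ofReal ?_
  have : -(2 * s) / 2 = -s := by ring
  rw [this, Real.rpow_neg (weight_pos ξ).le, Real.rpow_neg (by positivity)]
  gcongr
  unfold weight
  have h3 := Real.pi_gt_three
  have h4 : 1 ≤ (2 * Real.pi) ^ 2 := by nlinarith
  nlinarith [sq_nonneg ‖ξ‖, mul_pow (2 * Real.pi) ‖ξ‖ 2]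

/-- The `L²` norm of `(1 + |2πξ|²)^{-s/2}`. -/
noncomputable def embConst (d : ℕ) (s : ℝ) : ℝ≥0∞ :=
  (∫⁻ ξ : Space d, ENNReal.ofReal (weight ξ ^ (-s))) ^ (1 / 2 : ℝ)

theorem embConst_lt_top {d : ℕ} {s : ℝ} (hs : (d : ℝ) / 2 < s) : embConst d s < ∞ :=
  ENNReal.rpow_lt_top_of_nonneg (by norm_num) (lintegral_weight_lt_top hs).ne

theorem lintegral_mul_le_two {d : ℕ} {f g : Space d → ℝ≥0∞} (hf : AEMeasurable f)
    (hg : AEMeasurable g) :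
    ∫⁻ x, f x * g x ≤ (∫⁻ x, f x ^ 2) ^ (1 / 2 : ℝ) * (∫⁻ x, g x ^ 2) ^ (1 / 2 : ℝ) := by
  have := ENNReal.lintegral_mul_le_Lp_mul_Lq volume Real.HolderConjugate.two_two hf hg
  simpa using this

theorem ofReal_weight_rpow_half_sq {d : ℕ} (s : ℝ) (ξ : Space d) :
    ENNReal.ofReal (weight ξ ^ (s / 2)) ^ 2 = ENNReal.ofReal (weight ξ ^ s) := by
  rw [← ENNReal.ofReal_pow (Real.rpow_nonneg (weight_pos ξ).le _), ← Real.rpow_natCast,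
    ← Real.rpow_mul (weight_pos ξ).le]
  congr 2; push_cast; ring

theorem measurable_ofReal_weight {d : ℕ} (s : ℝ) :
    Measurable fun ξ : Space d => ENNReal.ofReal (weight ξ ^ s) :=
  (continuous_weight_rpow s).measurable.ennreal_ofReal

theorem lintegral_weight_mul_le {d : ℕ} (s : ℝ) {A : Space d → ℝ≥0∞} (hA : AEMeasurable A) :
    ∫⁻ ξ, ENNReal.ofReal (weight ξ ^ (-s / 2)) * A ξ ≤
      embConst d s * (∫⁻ ξ, A ξ ^ 2) ^ (1 / 2 : ℝ) := by
  refine (lintegral_mul_le_two (measurable_ofReal_weight _).aemeasurable hA).trans_eq ?_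
  simp only [ofReal_weight_rpow_half_sq, embConst]

theorem ofReal_weight_cancel {d : ℕ} (s : ℝ) (ξ : Space d) :
    ENNReal.ofReal (weight ξ ^ (-s / 2)) * ENNReal.ofReal (weight ξ ^ (s / 2)) = 1 := by
  rw [← ENNReal.ofReal_mul (Real.rpow_nonneg (weight_pos ξ).le _), ← Real.rpow_add (weight_pos ξ)]
  have : -s / 2 + s / 2 = 0 := by ring
  simp [this]

theorem sobolevNorm_eq_half {d : ℕ} (s : ℝ) (f : L2 d) :
    sobolevNorm s f =
      (∫⁻ ξ, (ENNReal.ofReal (weight ξ ^ (s / 2)) * ‖(𝓕 f : L2 d) ξ‖ₑ) ^ 2) ^ (1 / 2 : ℝ) := by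
  simp only [mul_pow, ofReal_weight_rpow_half_sq, sobolevNorm_eq]

theorem lintegral_fourier_le {d : ℕ} (s : ℝ) (f : L2 d) :
    ∫⁻ ξ, ‖(𝓕 f : L2 d) ξ‖ₑ ≤ embConst d s * sobolevNorm s f := by
  rw [sobolevNorm_eq_half]
  refine le_trans (le_of_eq (lintegral_congr fun ξ => ?_)) (lintegral_weight_mul_le s
    ((measurable_ofReal_weight (s / 2)).aemeasurable.mul
      (Lp.aestronglyMeasurable (𝓕 f : L2 d)).enorm))
  rw [← mul_assoc, ofReal_weight_cancel, one_mul]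

theorem integrable_fourier {d : ℕ} {s : ℝ} (hs : (d : ℝ) / 2 < s) {f : L2 d}
    (hf : sobolevNorm s f < ∞) : Integrable (𝓕 f : L2 d) :=
  ⟨Lp.aestronglyMeasurable _, lt_of_le_of_lt (lintegral_fourier_le s f)
    (ENNReal.mul_lt_top (embConst_lt_top hs) hf)⟩

/-- The embedding `H^s ⊂ L^∞` for `s > d/2`. -/
theorem enorm_le_of_sobolev {d : ℕ} {s : ℝ} (hs : (d : ℝ) / 2 < s) {f : L2 d}
    (hf : sobolevNorm s f < ∞) : ∀ᵐ x, ‖f x‖ₑ ≤ embConst d s * sobolevNorm s f := by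
  filter_upwards [norm_le_integral_fourier (integrable_fourier hs hf)] with x h
  refine le_trans ?_ (lintegral_fourier_le s f)
  rw [← ofReal_norm, ← ofReal_integral_norm_eq_lintegral_enorm (integrable_fourier hs hf)]
  exact ENNReal.ofReal_le_ofReal h

/-! ## The product law -/

theorem weight_add_le {d : ℕ} (η ζ : Space d) :
    weight (η + ζ) ≤ 4 * max (weight η) (weight ζ) := by
  have h1 : ‖η + ζ‖ ≤ ‖η‖ + ‖ζ‖ := norm_add_le _ _
  have h2 : ‖η + ζ‖ ^ 2 ≤ 2 * ‖η‖ ^ 2 + 2 * ‖ζ‖ ^ 2 := by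
    nlinarith [norm_nonneg (η + ζ), sq_nonneg (‖η‖ - ‖ζ‖)]
  have h3 : weight (η + ζ) ≤ 2 * weight η + 2 * weight ζ := by
    unfold weight
    nlinarith [sq_nonneg (2 * Real.pi), mul_le_mul_of_nonneg_left h2 (sq_nonneg (2 * Real.pi))]
  linarith [le_max_left (weight η) (weight ζ), le_max_right (weight η) (weight ζ)]

/-- Here `Y` and `Z` stand for the smaller and the larger of two weights. The `c` output derivatives
are charged to `Z`; its surplus `b - c` is traded for powers of `Y`, which then has `a + b - c ≥ σ`
derivatives to spend and yields the factor `Y^{-σ/2}`. -/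
theorem rpow_le_of_le_of_le {Y Z a b c σ : ℝ} (hY : 1 ≤ Y) (hYZ : Y ≤ Z) (hbc : c ≤ b)
    (habc : σ ≤ a + b - c) :
    Z ^ (c / 2) ≤ Y ^ (-σ / 2) * (Y ^ (a / 2) * Z ^ (b / 2)) := by
  have hY0 : 0 < Y := by linarith
  have hZ0 : 0 < Z := by linarith
  have h1 : 1 ≤ Y ^ ((a + b - c - σ) / 2) := Real.one_le_rpow hY (by linarith)
  have h2 : Y ^ ((b - c) / 2) ≤ Z ^ ((b - c) / 2) := Real.rpow_le_rpow hY0.le hYZ (by linarith)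
  calc Z ^ (c / 2) = Z ^ (b / 2) * Z ^ (-((b - c) / 2)) := by
        rw [← Real.rpow_add hZ0]; congr 1; ring
    _ ≤ Z ^ (b / 2) * Y ^ (-((b - c) / 2)) := by
        refine mul_le_mul_of_nonneg_left ?_ (by positivity)
        rw [Real.rpow_neg hZ0.le, Real.rpow_neg hY0.le]
        gcongr
    _ ≤ Z ^ (b / 2) * (Y ^ (-((b - c) / 2)) * Y ^ ((a + b - c - σ) / 2)) := by
        gcongr
        exact le_mul_of_one_le_right (by positivity) h1
    _ = Y ^ (-σ / 2) * (Y ^ (a / 2) * Z ^ (b / 2)) := by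
        rw [← Real.rpow_add hY0, ← mul_assoc, ← Real.rpow_add hY0, mul_comm]
        congr 2; ring

/-- Each summand covers one of the cases in which `η` or `ζ` is the smaller frequency; their sum is
valid for all frequencies and can be integrated. -/
theorem weight_rpow_add_le {d : ℕ} {a b c σ : ℝ} (hc : 0 ≤ c) (hca : c ≤ a) (hcb : c ≤ b)
    (habc : σ ≤ a + b - c) (η ζ : Space d) :
    weight (η + ζ) ^ (c / 2) ≤ 4 ^ (c / 2) *
      (weight η ^ (-σ / 2) * (weight η ^ (a / 2) * weight ζ ^ (b / 2)) +
        weight ζ ^ (-σ / 2) * (weight η ^ (a / 2) * weight ζ ^ (b / 2))) := by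
  have hη := weight_pos η
  have hζ := weight_pos ζ
  have h1 : weight (η + ζ) ^ (c / 2) ≤ 4 ^ (c / 2) * max (weight η) (weight ζ) ^ (c / 2) := by
    rw [← Real.mul_rpow (by norm_num) (by positivity)]
    exact Real.rpow_le_rpow (weight_pos _).le (weight_add_le η ζ) (by linarith)
  refine h1.trans ?_
  gcongr
  rcases le_total (weight η) (weight ζ) with h | h
  · rw [max_eq_right h]
    refine (rpow_le_of_le_of_le (one_le_weight η) h hcb habc).trans ?_
    exact le_add_of_nonneg_right (by positivity)
  · rw [max_eq_left h]
    refine (rpow_le_of_le_of_le (a := b) (b := a) (σ := σ) (one_le_weight ζ) h hca (by linarith)).trans ?_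
    rw [mul_comm (weight ζ ^ (b / 2))]
    exact le_add_of_nonneg_left (by positivity)

/-- Young's inequality `L¹ * L² ⊂ L²`. -/
theorem lintegral_conv_sq_le {d : ℕ} {p B : Space d → ℝ≥0∞} (hp : Measurable p)
    (hB : Measurable B) :
    (∫⁻ ξ, (∫⁻ η, p η * B (ξ - η)) ^ 2) ^ (1 / 2 : ℝ) ≤
      (∫⁻ η, p η) * (∫⁻ η, B η ^ 2) ^ (1 / 2 : ℝ) := by
  -- Cauchy–Schwarz for the measure `p(η) dη`, by the splitting `p = p^{1/2} · p^{1/2}`.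
  have key : ∀ ξ, (∫⁻ η, p η * B (ξ - η)) ^ 2 ≤ (∫⁻ η, p η) * ∫⁻ η, p η * B (ξ - η) ^ 2 := by
    intro ξ
    have hB' : Measurable fun η => B (ξ - η) := hB.comp (measurable_const.sub measurable_id)
    have hq : Measurable fun η => p η ^ (1 / 2 : ℝ) := hp.pow_const _
    have h := lintegral_mul_le_two (d := d) hq.aemeasurable (hq.mul hB').aemeasurable
    have e1 : ∀ x : ℝ≥0∞, x ^ (1 / 2 : ℝ) * x ^ (1 / 2 : ℝ) = x := fun x => by
      rw [← ENNReal.rpow_add_of_nonneg _ _ (by norm_num) (by norm_num)]; norm_num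
    have e2 : ∀ x : ℝ≥0∞, (x ^ (1 / 2 : ℝ)) ^ 2 = x := fun x => by rw [sq, e1]
    simp only [Pi.mul_apply, ← mul_assoc, e1, mul_pow, e2] at h
    calc (∫⁻ η, p η * B (ξ - η)) ^ 2 ≤ _ := pow_le_pow_left₀ zero_le h 2
      _ = _ := by rw [mul_pow, e2, e2]
  have h2 : ∫⁻ ξ, (∫⁻ η, p η * B (ξ - η)) ^ 2 ≤ (∫⁻ η, p η) ^ 2 * ∫⁻ η, B η ^ 2 := by
    calc ∫⁻ ξ, (∫⁻ η, p η * B (ξ - η)) ^ 2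
        ≤ ∫⁻ ξ, (∫⁻ η, p η) * ∫⁻ η, p η * B (ξ - η) ^ 2 := lintegral_mono key
      _ = (∫⁻ η, p η) * ∫⁻ ξ, ∫⁻ η, p η * B (ξ - η) ^ 2 := by
          refine lintegral_const_mul _ (Measurable.lintegral_prod_right' (f := fun z : Space d × Space d => p z.2 * B (z.1 - z.2) ^ 2) ?_)
          exact (hp.comp measurable_snd).mul
            ((hB.comp (measurable_fst.sub measurable_snd)).pow_const 2)
      _ = (∫⁻ η, p η) * ∫⁻ η, ∫⁻ ξ, p η * B (ξ - η) ^ 2 := by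
          rw [lintegral_lintegral_swap]
          exact ((hp.comp measurable_snd).mul
            ((hB.comp (measurable_fst.sub measurable_snd)).pow_const 2)).aemeasurable
      _ = (∫⁻ η, p η) * ∫⁻ η, p η * ∫⁻ ξ, B ξ ^ 2 := by
          congr 1
          refine lintegral_congr fun η => ?_
          have hB'' : Measurable fun ξ => B (ξ - η) ^ 2 :=
            (hB.comp (measurable_id.sub measurable_const)).pow_const 2
          rw [lintegral_const_mul _ hB'', lintegral_sub_right_eq_self (fun ξ => B ξ ^ 2) η]
      _ = (∫⁻ η, p η) ^ 2 * ∫⁻ η, B η ^ 2 := by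
          rw [lintegral_mul_const _ hp, sq, mul_assoc]
  calc _ ≤ ((∫⁻ η, p η) ^ 2 * ∫⁻ η, B η ^ 2) ^ (1 / 2 : ℝ) :=
        ENNReal.rpow_le_rpow h2 (by norm_num)
    _ = _ := by
        rw [ENNReal.mul_rpow_of_nonneg _ _ (by norm_num), ← ENNReal.rpow_natCast,
          ← ENNReal.rpow_mul]
        norm_num

/-- The pointwise product of Schwartz functions. -/
noncomputable def schwartzMul {d : ℕ} (f g : 𝓢(Space d, ℂ)) : 𝓢(Space d, ℂ) :=
  SchwartzMap.pairing (ContinuousLinearMap.mul ℂ ℂ) f g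

theorem schwartzMul_apply {d : ℕ} (f g : 𝓢(Space d, ℂ)) (x : Space d) :
    schwartzMul f g x = f x * g x := rfl

theorem fourier_fourier_apply {d : ℕ} (f : 𝓢(Space d, ℂ)) (x : Space d) :
    (𝓕 (𝓕 f)) x = f (-x) := by
  have h : (𝓕⁻ (𝓕 f)) (-x) = f (-x) := by rw [fourierInv_fourier_eq]
  rw [← h, SchwartzMap.fourierInv_coe, Real.fourierInv_eq_fourier_neg, neg_neg,
    SchwartzMap.fourier_coe (𝓕 f)]

/-- Read off from the transform of a convolution: `𝓕 ∘ 𝓕` is the reflection, so the product's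
transform and the convolution have the same transform. -/
theorem fourier_schwartzMul {d : ℕ} (f g : 𝓢(Space d, ℂ)) (ξ : Space d) :
    (𝓕 (schwartzMul f g)) ξ = ∫ η, (𝓕 f) η * (𝓕 g) (ξ - η) := by
  have h : 𝓕 (schwartzMul f g) =
      SchwartzMap.convolution (ContinuousLinearMap.mul ℂ ℂ) (𝓕 f) (𝓕 g) := by
    have inj : ∀ {p q : 𝓢(Space d, ℂ)}, 𝓕 p = 𝓕 q → p = q := fun {p q} h => by
      rw [← fourierInv_fourier_eq (F := 𝓢(Space d, ℂ)) p, h, fourierInv_fourier_eq]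
    refine inj ?_
    ext x
    rw [fourier_fourier_apply, SchwartzMap.fourier_convolution, SchwartzMap.pairing_apply_apply,
      fourier_fourier_apply, fourier_fourier_apply]
    rfl
  rw [h, SchwartzMap.convolution_apply]
  rfl

theorem measurable_weight_mul_enorm {d : ℕ} (s : ℝ) (f : 𝓢(Space d, ℂ)) :
    Measurable fun ξ : Space d => ENNReal.ofReal (weight ξ ^ s) * ‖f ξ‖ₑ :=
  (measurable_ofReal_weight s).mul f.continuous.measurable.enorm

theorem sobolevNorm_schwartzL2 {d : ℕ} (s : ℝ) (f : 𝓢(Space d, ℂ)) :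
    sobolevNorm s (schwartzL2 f) =
      (∫⁻ ξ, (ENNReal.ofReal (weight ξ ^ (s / 2)) * ‖(𝓕 f) ξ‖ₑ) ^ 2) ^ (1 / 2 : ℝ) := by
  rw [sobolevNorm_eq_half, fourier_schwartzL2]
  congr 1
  refine lintegral_congr_ae ?_
  filter_upwards [coeFn_schwartzL2 (𝓕 f)] with ξ h
  rw [h]

/-- The constant in the product law. -/
noncomputable def prodConst (d : ℕ) (c σ : ℝ) : ℝ≥0∞ :=
  ENNReal.ofReal (4 ^ (c / 2)) * (2 * embConst d σ)

theorem prodConst_lt_top {d : ℕ} {c σ : ℝ} (hσ : (d : ℝ) / 2 < σ) : prodConst d c σ < ∞ :=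
  ENNReal.mul_lt_top ENNReal.ofReal_lt_top (ENNReal.mul_lt_top (by simp) (embConst_lt_top hσ))

/-- The transform of the product is a convolution, and `weight_rpow_add_le` moves the output weight
onto the factors. The factor that carries `weight^{-σ/2}` is integrable by Cauchy–Schwarz, and
Young's inequality finishes. -/
theorem sobolevNorm_schwartzMul_le {d : ℕ} {a b c σ : ℝ} (hc : 0 ≤ c) (hca : c ≤ a) (hcb : c ≤ b)
    (habc : σ ≤ a + b - c) (f g : 𝓢(Space d, ℂ)) :
    sobolevNorm c (schwartzL2 (schwartzMul f g)) ≤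
      prodConst d c σ * sobolevNorm a (schwartzL2 f) * sobolevNorm b (schwartzL2 g) := by
  set A : Space d → ℝ≥0∞ := fun ξ => ENNReal.ofReal (weight ξ ^ (a / 2)) * ‖(𝓕 f) ξ‖ₑ with hA
  set B : Space d → ℝ≥0∞ := fun ξ => ENNReal.ofReal (weight ξ ^ (b / 2)) * ‖(𝓕 g) ξ‖ₑ with hB
  set W : Space d → ℝ≥0∞ := fun ξ => ENNReal.ofReal (weight ξ ^ (-σ / 2)) with hW
  have mA : Measurable A := measurable_weight_mul_enorm _ _
  have mB : Measurable B := measurable_weight_mul_enorm _ _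
  have mW : Measurable W := measurable_ofReal_weight _
  set X : Space d → ℝ≥0∞ := fun ξ => ∫⁻ η, (W η * A η) * B (ξ - η)
  set Y : Space d → ℝ≥0∞ := fun ξ => ∫⁻ η, (W η * B η) * A (ξ - η)
  have mX : Measurable X := Measurable.lintegral_prod_right'
    (f := fun z : Space d × Space d => (W z.2 * A z.2) * B (z.1 - z.2))
    (((mW.comp measurable_snd).mul (mA.comp measurable_snd)).mul
      (mB.comp (measurable_fst.sub measurable_snd)))
  have mY : Measurable Y := Measurable.lintegral_prod_right'
    (f := fun z : Space d × Space d => (W z.2 * B z.2) * A (z.1 - z.2))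
    (((mW.comp measurable_snd).mul (mB.comp measurable_snd)).mul
      (mA.comp (measurable_fst.sub measurable_snd)))
  have pw : ∀ ξ, ENNReal.ofReal (weight ξ ^ (c / 2)) * ‖(𝓕 (schwartzMul f g)) ξ‖ₑ ≤
      ENNReal.ofReal (4 ^ (c / 2)) * (X ξ + Y ξ) := by
    intro ξ
    -- The substitution `η ↦ ξ - η` lets `X` and `Y` be added under one integral, with `f` at `η`
    -- and `g` at `ξ - η` in both.
    have hY : Y ξ = ∫⁻ η, (W (ξ - η) * B (ξ - η)) * A η := by
      have := lintegral_sub_left_eq_self (μ := (volume : Measure (Space d)))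
        (fun η => (W η * B η) * A (ξ - η)) ξ
      refine this.symm.trans (lintegral_congr fun η => ?_)
      rw [sub_sub_cancel]
    have hX : Measurable fun η => W η * A η * B (ξ - η) :=
      (mW.mul mA).mul (mB.comp (measurable_const.sub measurable_id))
    rw [hY, ← lintegral_add_left hX, ← lintegral_const_mul' _ _ ENNReal.ofReal_ne_top, fourier_schwartzMul]
    calc _ ≤ ENNReal.ofReal (weight ξ ^ (c / 2)) * ∫⁻ η, ‖(𝓕 f) η * (𝓕 g) (ξ - η)‖ₑ := by
          gcongr
          exact enorm_integral_le_lintegral_enorm _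
      _ = ∫⁻ η, ENNReal.ofReal (weight ξ ^ (c / 2)) * ‖(𝓕 f) η * (𝓕 g) (ξ - η)‖ₑ :=
          (lintegral_const_mul' _ _ ENNReal.ofReal_ne_top).symm
      _ ≤ _ := by
          refine lintegral_mono fun η => ?_
          have h := weight_rpow_add_le hc hca hcb habc η (ξ - η)
          rw [add_sub_cancel] at h
          have h' := ENNReal.ofReal_le_ofReal h
          have p1 := fun (r : ℝ) (ζ : Space d) => Real.rpow_nonneg (weight_pos ζ).le r
          rw [ENNReal.ofReal_mul (by positivity),
            ENNReal.ofReal_add (mul_nonneg (p1 _ _) (mul_nonneg (p1 _ _) (p1 _ _)))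
              (mul_nonneg (p1 _ _) (mul_nonneg (p1 _ _) (p1 _ _))),
            ENNReal.ofReal_mul (p1 _ _), ENNReal.ofReal_mul (p1 _ _),
            ENNReal.ofReal_mul (p1 _ _), ENNReal.ofReal_mul (p1 _ _)] at h'
          rw [enorm_mul]
          refine (mul_le_mul_left h' _).trans_eq ?_
          simp only [hA, hB, hW]
          ring
  rw [sobolevNorm_schwartzL2 c]
  have mk : ∀ {P Q : Space d → ℝ≥0∞}, Measurable P → Measurable Q →
      (∫⁻ ξ, (∫⁻ η, (W η * P η) * Q (ξ - η)) ^ 2) ^ (1 / 2 : ℝ) ≤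
        embConst d σ * (∫⁻ η, P η ^ 2) ^ (1 / 2 : ℝ) * (∫⁻ η, Q η ^ 2) ^ (1 / 2 : ℝ) := by
    intro P Q hP hQ
    refine (lintegral_conv_sq_le (mW.mul hP) hQ).trans ?_
    gcongr
    exact lintegral_weight_mul_le σ hP.aemeasurable
  have mink := ENNReal.lintegral_Lp_add_le (p := 2) (μ := (volume : Measure (Space d)))
    mX.aemeasurable mY.aemeasurable (by norm_num)
  simp only [Pi.add_apply, ENNReal.rpow_ofNat] at mink
  calc (∫⁻ ξ, (ENNReal.ofReal (weight ξ ^ (c / 2)) * ‖(𝓕 (schwartzMul f g)) ξ‖ₑ) ^ 2) ^ (1 / 2 : ℝ)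
      ≤ (∫⁻ ξ, (ENNReal.ofReal (4 ^ (c / 2)) * (X ξ + Y ξ)) ^ 2) ^ (1 / 2 : ℝ) := by
        exact ENNReal.rpow_le_rpow
          (lintegral_mono fun ξ => pow_le_pow_left₀ zero_le (pw ξ) 2) (by norm_num)
    _ = ENNReal.ofReal (4 ^ (c / 2)) * (∫⁻ ξ, (X ξ + Y ξ) ^ 2) ^ (1 / 2 : ℝ) := by
        simp only [mul_pow]
        rw [lintegral_const_mul' _ _ (ENNReal.pow_ne_top ENNReal.ofReal_ne_top),
          ENNReal.mul_rpow_of_nonneg _ _ (by norm_num), ← ENNReal.rpow_natCast, ← ENNReal.rpow_mul]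
        norm_num
    _ ≤ ENNReal.ofReal (4 ^ (c / 2)) *
        (embConst d σ * (∫⁻ η, A η ^ 2) ^ (1 / 2 : ℝ) * (∫⁻ η, B η ^ 2) ^ (1 / 2 : ℝ) +
          embConst d σ * (∫⁻ η, B η ^ 2) ^ (1 / 2 : ℝ) * (∫⁻ η, A η ^ 2) ^ (1 / 2 : ℝ)) := by
        gcongr
        exact mink.trans (add_le_add (mk mA mB) (mk mB mA))
    _ = _ := by
        rw [sobolevNorm_schwartzL2 a, sobolevNorm_schwartzL2 b, prodConst]
        ring

/-! ### Limits in `L²` and lower semicontinuity of Sobolev norms -/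

theorem exists_subseq_ae {d : ℕ} {f : ℕ → L2 d} {g : L2 d} (h : Tendsto f atTop (𝓝 g)) :
    ∃ ns : ℕ → ℕ, StrictMono ns ∧ ∀ᵐ x, Tendsto (fun i => f (ns i) x) atTop (𝓝 (g x)) :=
  (tendstoInMeasure_of_tendsto_Lp h).exists_seq_tendsto_ae

theorem tendsto_fourier {d : ℕ} {f : ℕ → L2 d} {g : L2 d} (h : Tendsto f atTop (𝓝 g)) :
    Tendsto (fun n => (𝓕 (f n) : L2 d)) atTop (𝓝 (𝓕 g)) :=
  ((Lp.fourierTransformₗᵢ (Space d) ℂ).continuous.tendsto g).comp h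

/-- The Sobolev norms are lower semicontinuous on `L²`. -/
theorem sobolevNorm_le_of_tendsto {d : ℕ} {s : ℝ} {f : ℕ → L2 d} {g : L2 d}
    (h : Tendsto f atTop (𝓝 g)) {K : ℕ → ℝ≥0∞} {L : ℝ≥0∞} (hK : ∀ n, sobolevNorm s (f n) ≤ K n)
    (hL : Tendsto K atTop (𝓝 L)) : sobolevNorm s g ≤ L := by
  obtain ⟨ns, hns, hae⟩ := exists_subseq_ae (tendsto_fourier h)
  have h1 : ∫⁻ ξ, ENNReal.ofReal (weight ξ ^ s) * ‖(𝓕 g : L2 d) ξ‖ₑ ^ 2 ≤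
      liminf (fun i => ∫⁻ ξ, ENNReal.ofReal (weight ξ ^ s) * ‖(𝓕 (f (ns i)) : L2 d) ξ‖ₑ ^ 2)
        atTop := by
    refine le_trans (le_of_eq (lintegral_congr_ae ?_)) (lintegral_liminf_le' fun i =>
      (measurable_ofReal_weight s).aemeasurable.mul
        ((Lp.aestronglyMeasurable (𝓕 (f (ns i)) : L2 d)).enorm.pow_const 2))
    filter_upwards [hae] with ξ hξ
    refine (Tendsto.liminf_eq ?_).symm
    exact ENNReal.Tendsto.const_mul (ENNReal.Tendsto.pow hξ.enorm) (Or.inr ENNReal.ofReal_ne_top)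
  have h2 : ∀ i, ∫⁻ ξ, ENNReal.ofReal (weight ξ ^ s) * ‖(𝓕 (f (ns i)) : L2 d) ξ‖ₑ ^ 2 ≤
      K (ns i) ^ 2 := by
    intro i
    have := pow_le_pow_left₀ zero_le (hK (ns i)) 2
    rwa [sobolevNorm_eq, ← ENNReal.rpow_natCast, ← ENNReal.rpow_mul, Nat.cast_ofNat,
      one_div, inv_mul_cancel₀ two_ne_zero, ENNReal.rpow_one] at this
  have h3 : Tendsto (fun i => K (ns i) ^ 2) atTop (𝓝 (L ^ 2)) :=
    ENNReal.Tendsto.pow (hL.comp hns.tendsto_atTop)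
  have h4 := h1.trans ((liminf_le_liminf (Eventually.of_forall h2)).trans_eq h3.liminf_eq)
  rw [sobolevNorm_eq]
  calc _ ≤ (L ^ 2) ^ (1 / 2 : ℝ) := ENNReal.rpow_le_rpow h4 (by norm_num)
    _ = L := by rw [← ENNReal.rpow_natCast, ← ENNReal.rpow_mul]; norm_num

theorem tendsto_of_sobolevNorm {d : ℕ} {s : ℝ} (hs : 0 ≤ s) {f : ℕ → L2 d} {g : L2 d}
    (h : Tendsto (fun n => sobolevNorm s (f n - g)) atTop (𝓝 0)) : Tendsto f atTop (𝓝 g) := by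
  rw [tendsto_iff_edist_tendsto_0]
  refine tendsto_of_tendsto_of_tendsto_of_le_of_le tendsto_const_nhds h (fun n => zero_le)
    (fun n => ?_)
  rw [edist_eq_enorm_sub]
  exact enorm_le_sobolevNorm hs _

theorem tendsto_sobolevNorm {d : ℕ} {s : ℝ} {f : ℕ → L2 d} {g : L2 d}
    (h : Tendsto (fun n => sobolevNorm s (f n - g)) atTop (𝓝 0)) (hg : sobolevNorm s g < ∞) :
    Tendsto (fun n => sobolevNorm s (f n)) atTop (𝓝 (sobolevNorm s g)) := by
  have h1 : Tendsto (fun n => sobolevNorm s (f n - g) + sobolevNorm s g) atTop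
      (𝓝 (sobolevNorm s g)) := by simpa using h.add_const (sobolevNorm s g)
  have h2 : Tendsto (fun n => sobolevNorm s g - sobolevNorm s (f n - g)) atTop
      (𝓝 (sobolevNorm s g)) := by
    simpa using ENNReal.Tendsto.sub tendsto_const_nhds h (Or.inl hg.ne)
  refine tendsto_of_tendsto_of_tendsto_of_le_of_le h2 h1 (fun n => ?_) (fun n => ?_)
  · refine tsub_le_iff_right.2 ?_
    calc sobolevNorm s g = sobolevNorm s (f n - (f n - g)) := by rw [sub_sub_cancel]
      _ ≤ _ := sobolevNorm_sub_le _ _ _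
  · calc sobolevNorm s (f n) = sobolevNorm s ((f n - g) + g) := by rw [sub_add_cancel]
      _ ≤ _ := sobolevNorm_add_le _ _ _

/-- Multiplication by a Schwartz function on `L²`. -/
noncomputable def schwartzSymbol {d : ℕ} (φ : 𝓢(Space d, ℂ)) : Space d →ᵇ ℂ :=
  φ.toBoundedContinuousFunction

theorem mulOp_schwartzL2 {d : ℕ} (φ ψ : 𝓢(Space d, ℂ)) :
    mulOp (schwartzSymbol φ) (schwartzL2 ψ) = schwartzL2 (schwartzMul φ ψ) := by
  refine Lp.ext ?_
  filter_upwards [coeFn_mulOp (schwartzSymbol φ) (schwartzL2 ψ), coeFn_schwartzL2 ψ,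
    coeFn_schwartzL2 (schwartzMul φ ψ)] with x h1 h2 h3
  rw [h1, h2, h3]; rfl

theorem sobolevNorm_mulOp_schwartz_le {d : ℕ} {a b c σ : ℝ} (hc : 0 ≤ c) (hca : c ≤ a)
    (hcb : c ≤ b) (habc : σ ≤ a + b - c) (hσ : (d : ℝ) / 2 < σ) (φ : 𝓢(Space d, ℂ)) {g : L2 d}
    (hg : sobolevNorm b g < ∞) :
    sobolevNorm c (mulOp (schwartzSymbol φ) g) ≤
      prodConst d c σ * sobolevNorm a (schwartzL2 φ) * sobolevNorm b g := by
  obtain ⟨ψ, hψ⟩ := exists_schwartz_seq (hc.trans hcb) hg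
  have hlim := tendsto_of_sobolevNorm (hc.trans hcb) hψ
  refine sobolevNorm_le_of_tendsto
    (((mulOp (schwartzSymbol φ)).continuous.tendsto g).comp hlim)
    (K := fun n => prodConst d c σ * sobolevNorm a (schwartzL2 φ) *
      sobolevNorm b (schwartzL2 (ψ n))) (fun n => ?_)
    (ENNReal.Tendsto.const_mul (tendsto_sobolevNorm hψ hg) (Or.inr ?_))
  · simp only [Function.comp, mulOp_schwartzL2]
    exact sobolevNorm_schwartzMul_le hc hca hcb habc _ _
  · exact (ENNReal.mul_lt_top (prodConst_lt_top hσ) (sobolevNorm_schwartzL2_lt_top a φ)).ne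

/-- The product law `H^a · H^b ⊂ H^c` for `0 ≤ c ≤ a, b` and `a + b - c > d/2`. -/
theorem exists_mul_sobolev {d : ℕ} {a b c σ : ℝ} (hc : 0 ≤ c) (hca : c ≤ a)
    (hcb : c ≤ b) (habc : σ ≤ a + b - c) (hσ : (d : ℝ) / 2 < σ) {f g : L2 d}
    (hf : sobolevNorm a f < ∞) (hg : sobolevNorm b g < ∞) :
    ∃ h : L2 d, h =ᵐ[volume] (fun x => f x * g x) ∧
      sobolevNorm c h ≤ prodConst d c σ * sobolevNorm a f * sobolevNorm b g := by
  obtain ⟨φ, hφ⟩ := exists_schwartz_seq (hc.trans hca) hf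
  have hlim := tendsto_of_sobolevNorm (hc.trans hca) hφ
  set u : ℕ → L2 d := fun n => mulOp (schwartzSymbol (φ n)) g
  set C : ℝ≥0∞ := prodConst d c σ * sobolevNorm b g
  have hC : C ≠ ∞ := (ENNReal.mul_lt_top (prodConst_lt_top hσ) hg).ne
  -- Multiplying `g` by Schwartz approximations of `f` gives a Cauchy sequence, because the
  -- difference of two such products is again a product with a Schwartz function.
  have hdiff : ∀ n m, sobolevNorm c (u n - u m) ≤
      C * (sobolevNorm a (schwartzL2 (φ n) - f) + sobolevNorm a (schwartzL2 (φ m) - f)) := by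
    intro n m
    have e1 : u n - u m = mulOp (schwartzSymbol (φ n - φ m)) g := by
      refine Lp.ext ?_
      filter_upwards [Lp.coeFn_sub (u n) (u m), coeFn_mulOp (schwartzSymbol (φ n)) g,
        coeFn_mulOp (schwartzSymbol (φ m)) g, coeFn_mulOp (schwartzSymbol (φ n - φ m)) g]
        with x h1 h2 h3 h4
      rw [h1, Pi.sub_apply, h2, h3, h4, ← sub_mul]; rfl
    have e2 : schwartzL2 (φ n - φ m) = (schwartzL2 (φ n) - f) - (schwartzL2 (φ m) - f) := by
      rw [sub_sub_sub_cancel_right]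
      exact (SchwartzMap.toLpCLM ℂ ℂ 2 (volume : Measure (Space d))).map_sub (φ n) (φ m)
    rw [e1]
    refine (sobolevNorm_mulOp_schwartz_le hc hca hcb habc hσ _ hg).trans ?_
    rw [mul_right_comm]
    gcongr
    rw [e2]
    exact sobolevNorm_sub_le _ _ _
  have hz : Tendsto (fun p : ℕ × ℕ => C * (sobolevNorm a (schwartzL2 (φ p.1) - f) +
      sobolevNorm a (schwartzL2 (φ p.2) - f))) atTop (𝓝 0) := by
    have h1 := (hφ.comp tendsto_fst).add (hφ.comp tendsto_snd)
    have h2 := ENNReal.Tendsto.const_mul h1 (Or.inr hC)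
    rw [← prod_atTop_atTop_eq]
    simpa using h2
  have hcau : CauchySeq u := by
    rw [EMetric.cauchySeq_iff]
    intro ε hε
    obtain ⟨⟨N, M⟩, hN⟩ := eventually_atTop.1 (hz.eventually (gt_mem_nhds hε))
    refine ⟨max N M, fun m hm n hn => ?_⟩
    rw [edist_eq_enorm_sub]
    exact ((enorm_le_sobolevNorm hc _).trans (hdiff m n)).trans_lt
      (hN (m, n) ⟨(le_max_left _ _).trans hm, (le_max_right _ _).trans hn⟩)
  obtain ⟨h, hh⟩ := cauchySeq_tendsto_of_complete hcau
  refine ⟨h, ?_, ?_⟩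
  · obtain ⟨ns, hns, hae⟩ := exists_subseq_ae hh
    obtain ⟨ms, hms, hae'⟩ := exists_subseq_ae (hlim.comp hns.tendsto_atTop)
    have hco := ae_all_iff.2 fun n => coeFn_schwartzL2 (φ n)
    have hcu := ae_all_iff.2 fun n => coeFn_mulOp (schwartzSymbol (φ n)) g
    filter_upwards [hae, hae', hco, hcu] with x h1 h2 h3 h4
    refine tendsto_nhds_unique (h1.comp hms.tendsto_atTop) ?_
    refine (h2.mul_const (g x)).congr fun i => ?_
    simp only [Function.comp, u]
    rw [h3, h4]; rfl
  · refine sobolevNorm_le_of_tendsto hh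
      (fun n => sobolevNorm_mulOp_schwartz_le hc hca hcb habc hσ (φ n) hg) ?_
    refine ENNReal.Tendsto.mul_const (ENNReal.Tendsto.const_mul (tendsto_sobolevNorm hφ hf)
      (Or.inr (prodConst_lt_top hσ).ne)) (Or.inr hg.ne)

/-! ## Pointwise products in `L²` -/

open Classical in
/-- The pointwise product of a function with an `L²` function, with value `0` if it is not in
`L²`. -/
noncomputable def pmul {d : ℕ} (m : Space d → ℂ) (f : L2 d) : L2 d :=
  if h : MemLp (fun x => m x * f x) 2 volume then h.toLp _ else 0

theorem coeFn_pmul {d : ℕ} {m : Space d → ℂ} {f : L2 d}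
    (h : MemLp (fun x => m x * f x) 2 volume) : pmul m f =ᵐ[volume] fun x => m x * f x := by
  rw [pmul, dif_pos h]; exact h.coeFn_toLp

theorem memLp_mul_of_bound {d : ℕ} {m : Space d → ℂ} (hm : AEStronglyMeasurable m volume) {C : ℝ}
    (hC : ∀ᵐ x, ‖m x‖ ≤ C) (f : L2 d) : MemLp (fun x => m x * f x) 2 volume := by
  refine ((Lp.memLp f).const_mul (C : ℂ)).of_le (hm.mul (Lp.aestronglyMeasurable f)) ?_
  filter_upwards [hC] with x hx
  rw [norm_mul, norm_mul, Complex.norm_real]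
  gcongr
  exact hx.trans (le_abs_self C)

theorem norm_pmul_le {d : ℕ} {m : Space d → ℂ} (hm : AEStronglyMeasurable m volume) {C : ℝ}
    (hC : ∀ᵐ x, ‖m x‖ ≤ C) (f : L2 d) : ‖pmul m f‖ ≤ C * ‖f‖ := by
  refine Lp.norm_le_mul_norm_of_ae_le_mul ?_
  filter_upwards [coeFn_pmul (memLp_mul_of_bound hm hC f), hC] with x h hx
  rw [h, norm_mul]
  gcongr

theorem pmul_eq_of_ae {d : ℕ} {m : Space d → ℂ} {f h : L2 d}
    (hh : h =ᵐ[volume] fun x => m x * f x) : pmul m f = h := by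
  have hm : MemLp (fun x => m x * f x) 2 volume := (memLp_congr_ae hh).1 (Lp.memLp h)
  exact Lp.ext ((coeFn_pmul hm).trans hh.symm)

theorem memLp_mul_sobolev {d : ℕ} {a b c σ : ℝ} (hc : 0 ≤ c) (hca : c ≤ a)
    (hcb : c ≤ b) (habc : σ ≤ a + b - c) (hσ : (d : ℝ) / 2 < σ) {f g : L2 d}
    (hf : sobolevNorm a f < ∞) (hg : sobolevNorm b g < ∞) :
    MemLp (fun x => f x * g x) 2 volume := by
  obtain ⟨h, hh, -⟩ := exists_mul_sobolev hc hca hcb habc hσ hf hg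
  exact (memLp_congr_ae hh).1 (Lp.memLp h)

theorem sobolevNorm_pmul_le {d : ℕ} {a b c σ : ℝ} (hc : 0 ≤ c) (hca : c ≤ a)
    (hcb : c ≤ b) (habc : σ ≤ a + b - c) (hσ : (d : ℝ) / 2 < σ) {f g : L2 d}
    (hf : sobolevNorm a f < ∞) (hg : sobolevNorm b g < ∞) :
    sobolevNorm c (pmul f g) ≤ prodConst d c σ * sobolevNorm a f * sobolevNorm b g := by
  obtain ⟨h, hh, hb⟩ := exists_mul_sobolev hc hca hcb habc hσ hf hg
  rwa [pmul_eq_of_ae hh]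

theorem tendsto_pmul {d : ℕ} {m : ℕ → Space d → ℂ} {m₀ : Space d → ℂ}
    (hm : ∀ n, AEStronglyMeasurable (m n) volume) (hm₀ : AEStronglyMeasurable m₀ volume) {C : ℝ}
    (hC : ∀ n, ∀ᵐ x, ‖m n x‖ ≤ C) (hC₀ : ∀ᵐ x, ‖m₀ x‖ ≤ C) {ε : ℕ → ℝ}
    (hε : Tendsto ε atTop (𝓝 0)) (hmε : ∀ n, ∀ᵐ x, ‖m n x - m₀ x‖ ≤ ε n)
    {f : ℕ → L2 d} {g : L2 d} (hf : Tendsto f atTop (𝓝 g)) :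
    Tendsto (fun n => pmul (m n) (f n)) atTop (𝓝 (pmul m₀ g)) := by
  have e : ∀ n, pmul (m n) (f n) - pmul m₀ g =
      pmul (m n) (f n - g) + pmul (fun x => m n x - m₀ x) g := by
    intro n
    refine Lp.ext ?_
    filter_upwards [Lp.coeFn_sub (pmul (m n) (f n)) (pmul m₀ g),
      Lp.coeFn_add (pmul (m n) (f n - g)) (pmul (fun x => m n x - m₀ x) g),
      coeFn_pmul (memLp_mul_of_bound (hm n) (hC n) (f n)),
      coeFn_pmul (memLp_mul_of_bound hm₀ hC₀ g),
      coeFn_pmul (memLp_mul_of_bound (hm n) (hC n) (f n - g)),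
      coeFn_pmul (m := fun x => m n x - m₀ x) (memLp_mul_of_bound ((hm n).sub hm₀) (hmε n) g), Lp.coeFn_sub (f n) g]
      with x h1 h2 h3 h4 h5 h6 h7
    rw [h1, h2, Pi.sub_apply, Pi.add_apply, h3, h4, h5, h6, h7, Pi.sub_apply]
    ring
  rw [tendsto_iff_norm_sub_tendsto_zero] at hf ⊢
  refine squeeze_zero (fun n => norm_nonneg _) (fun n => ?_)
    (by simpa using (hf.const_mul C).add (hε.mul_const ‖g‖) :
      Tendsto (fun n => C * ‖f n - g‖ + ε n * ‖g‖) atTop (𝓝 0))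
  rw [e]
  exact (norm_add_le _ _).trans (add_le_add (norm_pmul_le (hm n) (hC n) _)
    (norm_pmul_le ((hm n).sub hm₀) (hmε n) g))

/-! ## Weak derivatives -/

/-- The symbol `2πi ξ_j (1 + |2πξ|²)^{-1/2}`. -/
noncomputable def rieszSymbol {d : ℕ} (i : Fin d) : Space d →ᵇ ℂ :=
  BoundedContinuousFunction.ofNormedAddCommGroup
    (fun ξ => (2 * Real.pi * Complex.I * ξ i) * ((weight ξ ^ (-1 / 2 : ℝ) : ℝ) : ℂ))
    ((by fun_prop : Continuous fun ξ : Space d => (2 * Real.pi * Complex.I * ξ i : ℂ)).mul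
      (continuous_weight_rpow_ofReal _)) 1 (fun ξ => by
      rw [norm_mul, norm_weight_rpow]
      have hw := weight_pos ξ
      have h1 : ‖(2 * Real.pi * Complex.I * ξ i : ℂ)‖ ≤ weight ξ ^ (1 / 2 : ℝ) := by
        have h2 : ‖ξ i‖ ≤ ‖ξ‖ := PiLp.norm_apply_le ξ i
        rw [← Real.sqrt_eq_rpow]
        refine Real.le_sqrt_of_sq_le ?_
        simp only [norm_mul, Complex.norm_real, Complex.norm_I, mul_one, Complex.norm_ofNat,
          Real.norm_of_nonneg Real.pi_pos.le]
        unfold weight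
        have h3 : (2 * Real.pi * ‖ξ i‖) ^ 2 ≤ (2 * Real.pi * ‖ξ‖) ^ 2 := by
          gcongr
        linarith
      calc _ ≤ weight ξ ^ (1 / 2 : ℝ) * weight ξ ^ (-1 / 2 : ℝ) := by gcongr
        _ = 1 := by rw [← Real.rpow_add hw]; norm_num)

/-- `g` is the weak derivative of `f` in the direction of the `i`-th coordinate. -/
def HasD {d : ℕ} (i : Fin d) (f g : L2 d) : Prop := bessel 1 g = fourierMul (rieszSymbol i) f

/-- The order-one Bessel potential on both sides of the definition makes it a relation between
bounded operators, which passes to `L²` limits at once (`HasD.of_tendsto`). On the Fourier side the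
nonvanishing factor cancels. -/
theorem hasD_iff {d : ℕ} {i : Fin d} {f g : L2 d} :
    HasD i f g ↔ (𝓕 g : L2 d) =ᵐ[volume]
      fun ξ => (2 * Real.pi * Complex.I * ξ i) * (𝓕 f : L2 d) ξ := by
  have h1 := fourier_bessel (d := d) zero_le_one g
  have h2 := fourier_fourierMul (rieszSymbol i) f
  have key : ∀ ξ : Space d, ((weight ξ ^ (-1 / 2 : ℝ) : ℝ) : ℂ) ≠ 0 := fun ξ =>
    Complex.ofReal_ne_zero.2 (Real.rpow_pos_of_pos (weight_pos ξ) _).ne'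
  have hr : ∀ ξ : Space d, rieszSymbol i ξ =
    (2 * Real.pi * Complex.I * ξ i) * ((weight ξ ^ (-1 / 2 : ℝ) : ℝ) : ℂ) := fun ξ => rfl
  constructor
  · intro h
    rw [HasD] at h
    rw [h] at h1
    filter_upwards [h1, h2] with ξ h1 h2
    rw [h2, hr] at h1
    refine mul_left_cancel₀ (key ξ) ?_
    rw [← h1]; ring
  · intro h
    refine fourier_injective ?_
    filter_upwards [h1, h2, h] with ξ h1 h2 h
    rw [h1, h2, h, hr]; ring

theorem HasD.sub {d : ℕ} {i : Fin d} {f g f' g' : L2 d} (h : HasD i f f') (h' : HasD i g g') :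
    HasD i (f - g) (f' - g') := by
  unfold HasD at *; rw [map_sub, map_sub, h, h']

theorem HasD.of_tendsto {d : ℕ} {i : Fin d} {f g : ℕ → L2 d} {f₀ g₀ : L2 d}
    (h : ∀ n, HasD i (f n) (g n)) (hf : Tendsto f atTop (𝓝 f₀)) (hg : Tendsto g atTop (𝓝 g₀)) :
    HasD i f₀ g₀ := by
  refine tendsto_nhds_unique (((bessel 1).continuous.tendsto g₀).comp hg) ?_
  refine (((fourierMul (rieszSymbol i)).continuous.tendsto f₀).comp hf).congr fun n => ?_
  exact (h n).symm

theorem HasD.enorm_fourier {d : ℕ} {i : Fin d} {f g : L2 d} (h : HasD i f g) :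
    ∀ᵐ ξ, ‖(𝓕 g : L2 d) ξ‖ₑ ^ 2 =
      ENNReal.ofReal ((2 * Real.pi * ξ i) ^ 2) * ‖(𝓕 f : L2 d) ξ‖ₑ ^ 2 := by
  filter_upwards [hasD_iff.1 h] with ξ hξ
  rw [hξ, enorm_mul, mul_pow]
  congr 1
  rw [← ofReal_norm, ← ENNReal.ofReal_pow (norm_nonneg _)]
  congr 1
  simp only [norm_mul, Complex.norm_real, Complex.norm_I, mul_one, Complex.norm_ofNat,
    Real.norm_of_nonneg Real.pi_pos.le, mul_pow, Real.norm_eq_abs, sq_abs]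

theorem sobolevNorm_sq {d : ℕ} (s : ℝ) (f : L2 d) :
    sobolevNorm s f ^ 2 = ∫⁻ ξ, ENNReal.ofReal (weight ξ ^ s) * ‖(𝓕 f : L2 d) ξ‖ₑ ^ 2 := by
  rw [sobolevNorm_eq, ← ENNReal.rpow_natCast, ← ENNReal.rpow_mul]
  norm_num

theorem aemeasurable_weight_enorm_sq {d : ℕ} (s : ℝ) (f : L2 d) :
    AEMeasurable (fun ξ => ENNReal.ofReal (weight ξ ^ s) * ‖(𝓕 f : L2 d) ξ‖ₑ ^ 2) :=
  (measurable_ofReal_weight s).aemeasurable.mul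
    ((Lp.aestronglyMeasurable (𝓕 f : L2 d)).enorm.pow_const 2)

/-- Since `weight = 1 + ∑ᵢ (2πξᵢ)²`, one more order of regularity is exactly one weak derivative in
each direction. The inductions on the Sobolev order rest on this identity. -/
theorem sobolevNorm_succ_sq {d : ℕ} (s : ℝ) {f : L2 d} {g : Fin d → L2 d}
    (h : ∀ i, HasD i f (g i)) :
    sobolevNorm (s + 1) f ^ 2 = sobolevNorm s f ^ 2 + ∑ i, sobolevNorm s (g i) ^ 2 := by
  simp only [sobolevNorm_sq]
  rw [← lintegral_finsetSum' _ fun i _ => aemeasurable_weight_enorm_sq s (g i),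
    ← lintegral_add_left' (aemeasurable_weight_enorm_sq s f)]
  refine lintegral_congr_ae ?_
  filter_upwards [ae_all_iff.2 fun i => (h i).enorm_fourier] with ξ hξ
  simp only [hξ]
  have hw := weight_pos ξ
  have e1 : weight ξ ^ (s + 1) = weight ξ ^ s + ∑ i, weight ξ ^ s * (2 * Real.pi * ξ i) ^ 2 := by
    rw [Real.rpow_add_one hw.ne', ← Finset.mul_sum, ← mul_one_add]
    congr 1
    simp only [mul_pow, ← Finset.mul_sum, weight, EuclideanSpace.real_norm_sq_eq]
  have p1 : 0 ≤ weight ξ ^ s := Real.rpow_nonneg hw.le _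
  rw [e1, ENNReal.ofReal_add p1 (Finset.sum_nonneg fun i _ => by positivity),
    ENNReal.ofReal_sum_of_nonneg fun i _ => by positivity, add_mul, Finset.sum_mul]
  congr 1
  refine Finset.sum_congr rfl fun i _ => ?_
  rw [ENNReal.ofReal_mul p1, mul_assoc]

theorem ennreal_le_of_sq_le {a b : ℝ≥0∞} (h : a ^ 2 ≤ b ^ 2) : a ≤ b :=
  (ENNReal.pow_le_pow_left_iff two_ne_zero).1 h

theorem sobolevNorm_succ_le {d : ℕ} (s : ℝ) {f : L2 d} {g : Fin d → L2 d}
    (h : ∀ i, HasD i f (g i)) :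
    sobolevNorm (s + 1) f ≤ sobolevNorm s f + ∑ i, sobolevNorm s (g i) := by
  refine ennreal_le_of_sq_le ?_
  rw [sobolevNorm_succ_sq s h]
  have : ∑ i, sobolevNorm s (g i) ^ 2 ≤ (∑ i, sobolevNorm s (g i)) ^ 2 := by
    rw [sq (∑ i, sobolevNorm s (g i)), Finset.sum_mul]
    refine Finset.sum_le_sum fun i _ => ?_
    rw [sq]
    gcongr
    exact Finset.single_le_sum (f := fun i => sobolevNorm s (g i)) (fun _ _ => zero_le)
      (Finset.mem_univ i)
  calc _ ≤ sobolevNorm s f ^ 2 + (∑ i, sobolevNorm s (g i)) ^ 2 := by gcongr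
    _ ≤ sobolevNorm s f ^ 2 + (∑ i, sobolevNorm s (g i)) ^ 2 +
        2 * sobolevNorm s f * ∑ i, sobolevNorm s (g i) := le_self_add
    _ = _ := by ring

theorem exists_hasD {d : ℕ} (i : Fin d) {f : L2 d} (hf : sobolevNorm 1 f < ∞) :
    ∃ g : L2 d, HasD i f g := by
  obtain ⟨k, rfl⟩ := exists_bessel_eq zero_le_one hf
  refine ⟨fourierMul (rieszSymbol i) k, ?_⟩
  rw [HasD, bessel, fourierMul_comm]

theorem HasD.sobolevNorm_le {d : ℕ} {i : Fin d} {f g : L2 d} (h : HasD i f g) (s : ℝ) :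
    sobolevNorm s g ≤ sobolevNorm (s + 1) f := by
  refine ennreal_le_of_sq_le ?_
  rw [sobolevNorm_sq, sobolevNorm_sq]
  refine lintegral_mono_ae ?_
  filter_upwards [h.enorm_fourier] with ξ hξ
  rw [hξ, ← mul_assoc, ← ENNReal.ofReal_mul (Real.rpow_nonneg (weight_pos ξ).le _)]
  gcongr
  rw [Real.rpow_add_one (weight_pos ξ).ne']
  have : 0 ≤ weight ξ ^ s := Real.rpow_nonneg (weight_pos ξ).le _
  gcongr
  have h2 : ‖ξ i‖ ≤ ‖ξ‖ := PiLp.norm_apply_le ξ i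
  have h3 : (2 * Real.pi * ‖ξ i‖) ^ 2 ≤ (2 * Real.pi * ‖ξ‖) ^ 2 := by gcongr
  rw [mul_pow _ ‖ξ i‖, Real.norm_eq_abs, sq_abs, ← mul_pow] at h3
  unfold weight; linarith

theorem HasD.sobolevNorm_le_pred {d : ℕ} {i : Fin d} {f g : L2 d} (h : HasD i f g) (s : ℝ) :
    sobolevNorm (s - 1) g ≤ sobolevNorm s f := by
  simpa using h.sobolevNorm_le (s - 1)

/-! ## Functions of limited smoothness and the chain rule -/

/-- The real-linear map `w ↦ a w + b w̄`. -/
noncomputable def wirtinger (a b : ℂ) : ℂ →L[ℝ] ℂ :=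
  a • (ContinuousLinearMap.id ℝ ℂ) + b • (Complex.conjCLE : ℂ →L[ℝ] ℂ)

theorem wirtinger_apply (a b w : ℂ) : wirtinger a b w = a * w + b * conj w := rfl

/-- `G` has `j` derivatives with respect to `z` and `z̄`, and the derivatives of order up to `j` are
locally Lipschitz. -/
def IsC : ℕ → (ℂ → ℂ) → Prop
  | 0, G => ∀ R : ℝ, ∃ K : ℝ≥0, LipschitzOnWith K G (Metric.closedBall 0 R)
  | j + 1, G => ∃ G₁ G₂ : ℂ → ℂ, IsC j G₁ ∧ IsC j G₂ ∧
      ∀ z, HasFDerivAt G (wirtinger (G₁ z) (G₂ z)) z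

theorem IsC.exists_bound {G : ℂ → ℂ} (hG : IsC 0 G) (R : ℝ) :
    ∃ M : ℝ, 0 ≤ M ∧ ∀ z, ‖z‖ ≤ R → ‖G z‖ ≤ M := by
  obtain ⟨K, hK⟩ := hG (max R 0)
  refine ⟨‖G 0‖ + K * max R 0, by positivity, fun z hz => ?_⟩
  have h1 : ‖z‖ ≤ max R 0 := hz.trans (le_max_left _ _)
  have h2 := hK.norm_sub_le (x := z) (y := 0) (by simpa using h1) (by simp)
  rw [sub_zero] at h2
  have h3 : ‖G z‖ ≤ ‖G 0‖ + ‖G z - G 0‖ := by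
    calc ‖G z‖ = ‖G 0 + (G z - G 0)‖ := by rw [add_sub_cancel]
      _ ≤ _ := norm_add_le _ _
  have h4 : (K : ℝ) * ‖z‖ ≤ K * max R 0 := by gcongr
  linarith

theorem norm_wirtinger_le (a b : ℂ) : ‖wirtinger a b‖ ≤ ‖a‖ + ‖b‖ := by
  refine ContinuousLinearMap.opNorm_le_bound _ (by positivity) fun w => ?_
  rw [wirtinger_apply, add_mul]
  refine (norm_add_le _ _).trans ?_
  rw [norm_mul, norm_mul, RCLike.norm_conj]

theorem isC_zero_of_hasFDerivAt {G G₁ G₂ : ℂ → ℂ} (h₁ : IsC 0 G₁) (h₂ : IsC 0 G₂)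
    (h : ∀ z, HasFDerivAt G (wirtinger (G₁ z) (G₂ z)) z) : IsC 0 G := by
  intro R
  obtain ⟨M₁, hM₁, h₁⟩ := h₁.exists_bound R
  obtain ⟨M₂, hM₂, h₂⟩ := h₂.exists_bound R
  refine ⟨(M₁ + M₂).toNNReal, ?_⟩
  refine (convex_closedBall (0 : ℂ) R).lipschitzOnWith_of_nnnorm_hasFDerivWithin_le
    (fun z _ => (h z).hasFDerivWithinAt) fun z hz => ?_
  have hz' : ‖z‖ ≤ R := by simpa using hz
  rw [← NNReal.coe_le_coe, coe_nnnorm, Real.coe_toNNReal _ (by positivity)]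
  exact (norm_wirtinger_le _ _).trans (add_le_add (h₁ z hz') (h₂ z hz'))

theorem IsC.of_succ : ∀ {j : ℕ} {G : ℂ → ℂ}, IsC (j + 1) G → IsC j G
  | 0, _, ⟨_, _, h₁, h₂, h⟩ => isC_zero_of_hasFDerivAt h₁ h₂ h
  | _ + 1, _, ⟨G₁, G₂, h₁, h₂, h⟩ => ⟨G₁, G₂, h₁.of_succ, h₂.of_succ, h⟩

theorem IsC.zero : ∀ {j : ℕ} {G : ℂ → ℂ}, IsC j G → IsC 0 G
  | 0, _, h => h
  | _ + 1, _, h => h.of_succ.zero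

theorem IsC.continuous {j : ℕ} {G : ℂ → ℂ} (h : IsC j G) : Continuous G := by
  refine continuous_iff_continuousAt.2 fun z => ?_
  obtain ⟨K, hK⟩ := h.zero (‖z‖ + 1)
  refine hK.continuousOn.continuousAt ?_
  refine Filter.mem_of_superset (Metric.ball_mem_nhds z one_pos) fun w hw => ?_
  rw [mem_closedBall_zero_iff]
  have h1 : ‖w - z‖ < 1 := by simpa [dist_eq_norm] using hw
  calc ‖w‖ = ‖z + (w - z)‖ := by rw [add_sub_cancel]
    _ ≤ ‖z‖ + ‖w - z‖ := norm_add_le _ _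
    _ ≤ ‖z‖ + 1 := by gcongr

theorem aestronglyMeasurable_comp {d : ℕ} {G : ℂ → ℂ} (hG : Continuous G) (u : L2 d) :
    AEStronglyMeasurable (fun x => G (u x)) volume :=
  hG.comp_aestronglyMeasurable (Lp.aestronglyMeasurable u)

/-- The `i`-th partial derivative of a Schwartz function. -/
noncomputable def schwartzD {d : ℕ} (i : Fin d) (φ : 𝓢(Space d, ℂ)) : 𝓢(Space d, ℂ) :=
  SchwartzMap.evalCLM ℝ (Space d) ℂ (EuclideanSpace.single i (1 : ℝ))
    (SchwartzMap.fderivCLM ℝ (Space d) ℂ φ)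

theorem schwartzD_apply {d : ℕ} (i : Fin d) (φ : 𝓢(Space d, ℂ)) (x : Space d) :
    schwartzD i φ x = fderiv ℝ φ x (EuclideanSpace.single i (1 : ℝ)) := rfl

/-- Links classical and weak derivatives: for an integrable function with integrable derivative, the
`L¹` transform turns `∂ᵢ` into multiplication by `2πi ξᵢ`, and it agrees with the `L²` transform. -/
theorem hasD_of_differentiable {d : ℕ} {i : Fin d} {f : Space d → ℂ} {F H : L2 d}
    (hf : Integrable f) (hd : Differentiable ℝ f) (hdf : Integrable (fderiv ℝ f))
    (hF : F =ᵐ[volume] f)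
    (hH : H =ᵐ[volume] fun x => fderiv ℝ f x (EuclideanSpace.single i (1 : ℝ))) :
    HasD i F H := by
  set e : Space d := EuclideanSpace.single i (1 : ℝ)
  have h1 := Real.fourier_fderiv hf hd hdf
  have hFi : Integrable F := hf.congr hF.symm
  have hde : Integrable fun x => fderiv ℝ f x e :=
    (ContinuousLinearMap.apply ℝ ℂ e).integrable_comp hdf
  have hHi : Integrable H := hde.congr hH.symm
  have hF' : 𝓕 (F : Space d → ℂ) = 𝓕 f := by
    funext ξ; rw [Real.fourier_eq', Real.fourier_eq']
    exact integral_congr_ae (by filter_upwards [hF] with x h; rw [h])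
  have hH' : 𝓕 (H : Space d → ℂ) = 𝓕 fun x => fderiv ℝ f x e := by
    funext ξ; rw [Real.fourier_eq', Real.fourier_eq']
    exact integral_congr_ae (by filter_upwards [hH] with x h; rw [h])
  have a1 := fourier_toLp_ae hFi (Lp.memLp F)
  have a2 := fourier_toLp_ae hHi (Lp.memLp H)
  rw [Lp.toLp_coeFn] at a1 a2
  rw [hasD_iff]
  filter_upwards [a1, a2] with ξ h2 h3
  rw [h2, h3, hF', hH']
  have h4 : 𝓕 (fun x => fderiv ℝ f x e) ξ = 𝓕 (fderiv ℝ f) ξ e :=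
    (Real.fourier_continuousLinearMap_apply hdf).symm
  rw [h4, h1]
  simp only [VectorFourier.fourierSMulRight_apply]
  have h5 : innerSL ℝ ξ e = ξ i := by
    change inner ℝ ξ e = _
    simp [e, EuclideanSpace.inner_single_right]
  simp [h5]
  ring

theorem hasD_schwartz {d : ℕ} (i : Fin d) (φ : 𝓢(Space d, ℂ)) :
    HasD i (schwartzL2 φ) (schwartzL2 (schwartzD i φ)) :=
  hasD_of_differentiable φ.integrable φ.differentiable
    (SchwartzMap.fderivCLM ℝ (Space d) ℂ φ).integrable (coeFn_schwartzL2 φ)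
    (coeFn_schwartzL2 (schwartzD i φ))

theorem hasD_comp_mul_schwartz {d : ℕ} {i : Fin d} {G G₁ G₂ : ℂ → ℂ} (hG : Continuous G)
    (hG₁ : Continuous G₁) (hG₂ : Continuous G₂)
    (h : ∀ z, HasFDerivAt G (wirtinger (G₁ z) (G₂ z)) z) (φ ψ : 𝓢(Space d, ℂ)) {F H : L2 d}
    (hF : F =ᵐ[volume] fun x => G (φ x) * ψ x)
    (hH : H =ᵐ[volume] fun x => G (φ x) * schwartzD i ψ x +
      (G₁ (φ x) * schwartzD i φ x + G₂ (φ x) * conj (schwartzD i φ x)) * ψ x) :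
    HasD i F H := by
  obtain ⟨R, hR⟩ : ∃ R : ℝ, ∀ x, ‖φ x‖ ≤ R :=
    ⟨_, fun x => SchwartzMap.norm_le_seminorm ℝ φ x⟩
  have bd : ∀ {P : ℂ → ℂ}, Continuous P → ∃ M : ℝ, 0 ≤ M ∧ ∀ x, ‖P (φ x)‖ ≤ M := by
    intro P hP
    obtain ⟨M, hM⟩ := (isCompact_closedBall (0 : ℂ) R).exists_bound_of_continuousOn hP.continuousOn
    exact ⟨M, (norm_nonneg _).trans (hM (φ 0) (by simpa using hR 0)),
      fun x => hM (φ x) (by simpa using hR x)⟩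
  obtain ⟨M, hM0, hM⟩ := bd hG
  obtain ⟨M₁, hM0₁, hM₁⟩ := bd hG₁
  obtain ⟨M₂, hM0₂, hM₂⟩ := bd hG₂
  obtain ⟨L, hL⟩ : ∃ L : ℝ, ∀ x, ‖fderiv ℝ φ x‖ ≤ L :=
    ⟨_, fun x => SchwartzMap.norm_le_seminorm ℝ (SchwartzMap.fderivCLM ℝ (Space d) ℂ φ) x⟩
  have hd : ∀ x, HasFDerivAt (fun x => G (φ x) * ψ x) (G (φ x) • fderiv ℝ ψ x +
      ψ x • (wirtinger (G₁ (φ x)) (G₂ (φ x))).comp (fderiv ℝ φ x)) x := fun x =>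
    ((h (φ x)).comp x (φ.differentiableAt.hasFDerivAt)).mul ψ.differentiableAt.hasFDerivAt
  have hfd : fderiv ℝ (fun x => G (φ x) * ψ x) = fun x => G (φ x) • fderiv ℝ ψ x +
      ψ x • (wirtinger (G₁ (φ x)) (G₂ (φ x))).comp (fderiv ℝ φ x) :=
    funext fun x => (hd x).fderiv
  have cφ : Continuous (fderiv ℝ φ) := (SchwartzMap.fderivCLM ℝ (Space d) ℂ φ).continuous
  have cψ : Continuous (fderiv ℝ ψ) := (SchwartzMap.fderivCLM ℝ (Space d) ℂ ψ).continuous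
  have cw : Continuous fun x => wirtinger (G₁ (φ x)) (G₂ (φ x)) :=
    ((hG₁.comp φ.continuous).smul continuous_const).add
      ((hG₂.comp φ.continuous).smul continuous_const)
  have cfd : Continuous (fderiv ℝ (fun x => G (φ x) * ψ x)) := by
    rw [hfd]
    exact ((hG.comp φ.continuous).smul cψ).add (ψ.continuous.smul (cw.clm_comp cφ))
  refine hasD_of_differentiable (f := fun x => G (φ x) * ψ x) ?_
    (fun x => (hd x).differentiableAt) ?_ hF ?_
  · exact ψ.integrable.bdd_mul (hG.comp φ.continuous).aestronglyMeasurable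
      (Eventually.of_forall hM)
  · have i1 : Integrable fun x => M * ‖fderiv ℝ ψ x‖ + ‖ψ x‖ * ((M₁ + M₂) * L) :=
      ((SchwartzMap.fderivCLM ℝ (Space d) ℂ ψ).integrable.norm.const_mul M).add
        (ψ.integrable.norm.mul_const _)
    refine i1.mono' cfd.aestronglyMeasurable (Eventually.of_forall fun x => ?_)
    rw [hfd]
    refine (norm_add_le _ _).trans (add_le_add ?_ ?_)
    · rw [norm_smul]; gcongr; exact hM x
    · rw [norm_smul]
      gcongr
      refine (ContinuousLinearMap.opNorm_comp_le _ _).trans ?_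
      have := (norm_wirtinger_le (G₁ (φ x)) (G₂ (φ x))).trans (add_le_add (hM₁ x) (hM₂ x))
      gcongr
      exact hL x
  · filter_upwards [hH] with x hx
    rw [hx, hfd]
    simp only [schwartzD_apply, _root_.add_apply, _root_.smul_apply,
      ContinuousLinearMap.comp_apply, wirtinger_apply, smul_eq_mul]
    ring

theorem ae_norm_le_of_sobolev {d : ℕ} {s : ℝ} (hs : (d : ℝ) / 2 < s) {f : L2 d} {R : ℝ≥0∞}
    (hR : R < ∞) (hf : sobolevNorm s f ≤ R) : ∀ᵐ x, ‖f x‖ ≤ (embConst d s * R).toReal := by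
  filter_upwards [enorm_le_of_sobolev hs (hf.trans_lt hR)] with x hx
  rw [← toReal_enorm]
  refine ENNReal.toReal_mono (ENNReal.mul_lt_top (embConst_lt_top hs) hR).ne (hx.trans ?_)
  gcongr

theorem pmul_sub_pmul {d : ℕ} {f f' g g' : L2 d} (h1 : MemLp (fun x => f x * g x) 2 volume)
    (h2 : MemLp (fun x => f' x * g' x) 2 volume)
    (h3 : MemLp (fun x => (f - f') x * g x) 2 volume)
    (h4 : MemLp (fun x => f' x * (g - g') x) 2 volume) :
    pmul f g - pmul f' g' = pmul (f - f' : L2 d) g + pmul f' (g - g') := by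
  refine Lp.ext ?_
  filter_upwards [Lp.coeFn_sub (pmul f g) (pmul f' g'),
    Lp.coeFn_add (pmul (f - f' : L2 d) g) (pmul f' (g - g')), coeFn_pmul h1, coeFn_pmul h2,
    coeFn_pmul h3, coeFn_pmul h4, Lp.coeFn_sub f f', Lp.coeFn_sub g g']
    with x e1 e2 e3 e4 e5 e6 e7 e8
  rw [e1, e2, Pi.sub_apply, Pi.add_apply, e3, e4, e5, e6, e7, e8, Pi.sub_apply, Pi.sub_apply]
  ring

theorem tendsto_pmul_sobolev {d : ℕ} {a b : ℝ} (ha : 0 ≤ a) (hb : 0 ≤ b)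
    (hab : (d : ℝ) / 2 < a + b) {f g : ℕ → L2 d} {f₀ g₀ : L2 d}
    (hf : Tendsto (fun n => sobolevNorm a (f n - f₀)) atTop (𝓝 0)) (hf₀ : sobolevNorm a f₀ < ∞)
    (hfn : ∀ n, sobolevNorm a (f n) < ∞)
    (hg : Tendsto (fun n => sobolevNorm b (g n - g₀)) atTop (𝓝 0)) (hg₀ : sobolevNorm b g₀ < ∞)
    (hgn : ∀ n, sobolevNorm b (g n) < ∞) :
    Tendsto (fun n => pmul (f n) (g n)) atTop (𝓝 (pmul f₀ g₀)) := by
  have hσ : (d : ℝ) / 2 < a + b - 0 := by simpa using hab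
  have mem := fun {f g : L2 d} (h1 : sobolevNorm a f < ∞) (h2 : sobolevNorm b g < ∞) =>
    memLp_mul_sobolev le_rfl ha hb le_rfl hσ h1 h2
  have bound := fun {f g : L2 d} (h1 : sobolevNorm a f < ∞) (h2 : sobolevNorm b g < ∞) =>
    sobolevNorm_pmul_le le_rfl ha hb le_rfl hσ h1 h2
  have hsub : ∀ n, sobolevNorm a (f n - f₀) < ∞ := fun n =>
    (sobolevNorm_sub_le _ _ _).trans_lt (ENNReal.add_lt_top.2 ⟨hfn n, hf₀⟩)
  have hsub' : ∀ n, sobolevNorm b (g n - g₀) < ∞ := fun n =>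
    (sobolevNorm_sub_le _ _ _).trans_lt (ENNReal.add_lt_top.2 ⟨hgn n, hg₀⟩)
  have hP : prodConst d 0 (a + b - 0) ≠ ∞ := (prodConst_lt_top hσ).ne
  refine tendsto_of_sobolevNorm (s := 0) le_rfl ?_
  have l1 := ENNReal.Tendsto.mul (ENNReal.Tendsto.const_mul hf (Or.inr hP)) (Or.inr hg₀.ne)
    (tendsto_sobolevNorm hg hg₀) (Or.inr (by simp))
  have l2 := ENNReal.Tendsto.const_mul (a := prodConst d 0 (a + b - 0) * sobolevNorm a f₀) hg
    (Or.inr (ENNReal.mul_ne_top hP hf₀.ne))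
  have l3 := l1.add l2
  simp only [mul_zero, zero_mul, add_zero] at l3
  refine tendsto_of_tendsto_of_tendsto_of_le_of_le tendsto_const_nhds l3 (fun n => zero_le)
    fun n => ?_
  simp only
  rw [pmul_sub_pmul (mem (hfn n) (hgn n)) (mem hf₀ hg₀) (mem (hsub n) (hgn n))
    (mem hf₀ (hsub' n))]
  exact (sobolevNorm_add_le _ _ _).trans (add_le_add (bound (hsub n) (hgn n))
    (bound hf₀ (hsub' n)))

/-! ## The chain rule in Sobolev spaces -/

theorem exists_schwartz_seq_bounded {d : ℕ} {s : ℝ} (hs : 0 ≤ s) {f : L2 d}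
    (hf : sobolevNorm s f < ∞) :
    ∃ φ : ℕ → 𝓢(Space d, ℂ),
      Tendsto (fun n => sobolevNorm s (schwartzL2 (φ n) - f)) atTop (𝓝 0) ∧
      ∀ n, sobolevNorm s (schwartzL2 (φ n)) ≤ sobolevNorm s f + 1 := by
  obtain ⟨φ, hφ⟩ := exists_schwartz_seq hs hf
  obtain ⟨N, hN⟩ := eventually_atTop.1 (hφ.eventually (gt_mem_nhds one_pos))
  refine ⟨fun n => φ (n + N), hφ.comp (tendsto_add_atTop_nat N), fun n => ?_⟩
  have h := sobolevNorm_add_le s (schwartzL2 (φ (n + N)) - f) f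
  rw [sub_add_cancel] at h
  refine h.trans ?_
  rw [add_comm (sobolevNorm s f)]
  gcongr
  exact (hN (n + N) (by omega)).le

theorem lipschitz_ball_norm_le {G : ℂ → ℂ} {K : ℝ≥0} {B : ℝ}
    (hK : LipschitzOnWith K G (Metric.closedBall 0 B)) {z w : ℂ} (hz : ‖z‖ ≤ B) (hw : ‖w‖ ≤ B) :
    ‖G z - G w‖ ≤ K * ‖z - w‖ :=
  hK.norm_sub_le (by simpa using hz) (by simpa using hw)

/-- Convergence in `H^s` with `s > d/2` is uniform, and all values stay in one ball on which `G` is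
Lipschitz; hence the multipliers `G (φ n)` converge uniformly. -/
theorem tendsto_pmul_comp {d : ℕ} {s : ℝ} (hs : (d : ℝ) / 2 < s) {G : ℂ → ℂ} (hG : IsC 0 G)
    {φ : ℕ → L2 d} {u : L2 d} {R : ℝ≥0∞} (hR : R < ∞) (hφR : ∀ n, sobolevNorm s (φ n) ≤ R)
    (hu : sobolevNorm s u ≤ R) (hφ : Tendsto (fun n => sobolevNorm s (φ n - u)) atTop (𝓝 0))
    {f : ℕ → L2 d} {g : L2 d} (hf : Tendsto f atTop (𝓝 g)) :
    Tendsto (fun n => pmul (fun x => G (φ n x)) (f n)) atTop (𝓝 (pmul (fun x => G (u x)) g)) := by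
  obtain ⟨K, hK⟩ := hG (embConst d s * R).toReal
  obtain ⟨M, -, hM⟩ := hG.exists_bound (embConst d s * R).toReal
  have hsub : ∀ n, sobolevNorm s (φ n - u) < ∞ := fun n =>
    (sobolevNorm_sub_le _ _ _).trans_lt
      (ENNReal.add_lt_top.2 ⟨(hφR n).trans_lt hR, hu.trans_lt hR⟩)
  have hε : Tendsto (fun n => (K : ℝ) * (embConst d s * sobolevNorm s (φ n - u)).toReal) atTop
      (𝓝 0) := by
    have h1 := ENNReal.Tendsto.const_mul hφ (Or.inr (embConst_lt_top hs).ne)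
    rw [mul_zero] at h1
    have h2 := ((ENNReal.tendsto_toReal ENNReal.zero_ne_top).comp h1).const_mul (K : ℝ)
    simpa using h2
  refine tendsto_pmul (fun n => aestronglyMeasurable_comp hG.continuous _)
    (aestronglyMeasurable_comp hG.continuous _) (fun n => ?_) ?_ hε (fun n => ?_) hf (C := M)
  · filter_upwards [ae_norm_le_of_sobolev hs hR (hφR n)] with x hx using hM _ hx
  · filter_upwards [ae_norm_le_of_sobolev hs hR hu] with x hx using hM _ hx
  · filter_upwards [ae_norm_le_of_sobolev hs hR (hφR n), ae_norm_le_of_sobolev hs hR hu,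
      ae_norm_le_of_sobolev hs (hsub n) le_rfl, Lp.coeFn_sub (φ n) u] with x h1 h2 h3 h4
    rw [h4, Pi.sub_apply] at h3
    exact (lipschitz_ball_norm_le hK h1 h2).trans (by gcongr)

theorem memLp_schwartz_mul {d : ℕ} (φ : 𝓢(Space d, ℂ)) (f : L2 d) :
    MemLp (fun x => schwartzL2 φ x * f x) 2 volume := by
  refine memLp_mul_of_bound (Lp.aestronglyMeasurable _) (C := SchwartzMap.seminorm ℝ 0 0 φ) ?_ f
  filter_upwards [coeFn_schwartzL2 φ] with x hx
  rw [hx]; exact SchwartzMap.norm_le_seminorm ℝ φ x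

theorem memLp_conj_schwartz_mul {d : ℕ} (φ : 𝓢(Space d, ℂ)) (f : L2 d) :
    MemLp (fun x => conjL2 (schwartzL2 φ) x * f x) 2 volume := by
  refine memLp_mul_of_bound (Lp.aestronglyMeasurable _) (C := SchwartzMap.seminorm ℝ 0 0 φ) ?_ f
  filter_upwards [coeFn_schwartzL2 φ, coeFn_conjL2 (schwartzL2 φ)] with x hx h
  rw [h, hx, RCLike.norm_conj]; exact SchwartzMap.norm_le_seminorm ℝ φ x

theorem memLp_comp_mul {d : ℕ} {s : ℝ} (hs : (d : ℝ) / 2 < s) {G : ℂ → ℂ} (hG : IsC 0 G)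
    {u : L2 d} (hu : sobolevNorm s u < ∞) (f : L2 d) :
    MemLp (fun x => G (u x) * f x) 2 volume := by
  obtain ⟨M, -, hM⟩ := hG.exists_bound (embConst d s * sobolevNorm s u).toReal
  refine memLp_mul_of_bound (aestronglyMeasurable_comp hG.continuous _) (C := M) ?_ f
  filter_upwards [ae_norm_le_of_sobolev hs hu le_rfl] with x hx using hM _ hx

/-- For Schwartz functions this is the classical product and chain rule; the general case is a
limit. The delicate terms contain `u' v` and its analogue with the conjugate of `u'`, products of
`H^{s-1}` and `H¹` functions, which converge in `L²` because `(s - 1) + 1 > d/2`. -/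
theorem hasD_comp_mul {d : ℕ} {i : Fin d} {s : ℝ} (hs : (d : ℝ) / 2 < s) (hs1 : 1 ≤ s)
    {G G₁ G₂ : ℂ → ℂ} (hG : IsC 0 G) (hG₁ : IsC 0 G₁) (hG₂ : IsC 0 G₂)
    (h : ∀ z, HasFDerivAt G (wirtinger (G₁ z) (G₂ z)) z) {u u' v v' : L2 d}
    (hu : sobolevNorm s u < ∞) (hu' : HasD i u u') (hv : sobolevNorm 1 v < ∞)
    (hv' : HasD i v v') :
    HasD i (pmul (fun x => G (u x)) v) (pmul (fun x => G (u x)) v' +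
      (pmul (fun x => G₁ (u x)) (pmul u' v) + pmul (fun x => G₂ (u x)) (pmul (conjL2 u') v))) := by
  have hs0 : 0 ≤ s := zero_le_one.trans hs1
  obtain ⟨φ, hφ, hφR⟩ := exists_schwartz_seq_bounded hs0 hu
  obtain ⟨ψ, hψ, -⟩ := exists_schwartz_seq_bounded zero_le_one hv
  have hR : sobolevNorm s u + 1 < ∞ := ENNReal.add_lt_top.2 ⟨hu, ENNReal.one_lt_top⟩
  have hle : sobolevNorm s u ≤ sobolevNorm s u + 1 := le_self_add
  have hψ0 := tendsto_of_sobolevNorm zero_le_one hψ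
  have hψ' : Tendsto (fun n => schwartzL2 (schwartzD i (ψ n))) atTop (𝓝 v') := by
    refine tendsto_of_sobolevNorm (s := 0) le_rfl ?_
    refine tendsto_of_tendsto_of_tendsto_of_le_of_le tendsto_const_nhds hψ (fun n => zero_le)
      fun n => ?_
    simpa using ((hasD_schwartz i (ψ n)).sub hv').sobolevNorm_le 0
  have hφ' : Tendsto (fun n => sobolevNorm (s - 1) (schwartzL2 (schwartzD i (φ n)) - u')) atTop
      (𝓝 0) :=
    tendsto_of_tendsto_of_tendsto_of_le_of_le tendsto_const_nhds hφ (fun n => zero_le)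
      fun n => ((hasD_schwartz i (φ n)).sub hu').sobolevNorm_le_pred s
  have hφc : Tendsto (fun n => sobolevNorm (s - 1)
      (conjL2 (schwartzL2 (schwartzD i (φ n))) - conjL2 u')) atTop (𝓝 0) := by
    simpa only [← map_sub, sobolevNorm_conjL2] using hφ'
  have f1 : sobolevNorm (s - 1) u' < ∞ := (hu'.sobolevNorm_le_pred s).trans_lt hu
  have f2 : ∀ n, sobolevNorm (s - 1) (schwartzL2 (schwartzD i (φ n))) < ∞ := fun n =>
    sobolevNorm_schwartzL2_lt_top _ _
  have p1 := tendsto_pmul_sobolev (by linarith : 0 ≤ s - 1) zero_le_one (by linarith) hφ' f1 f2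
    hψ hv (fun n => sobolevNorm_schwartzL2_lt_top _ _)
  have p2 := tendsto_pmul_sobolev (by linarith : 0 ≤ s - 1) zero_le_one (by linarith) hφc
    (by rwa [sobolevNorm_conjL2]) (fun n => by rw [sobolevNorm_conjL2]; exact f2 n)
    hψ hv (fun n => sobolevNorm_schwartzL2_lt_top _ _)
  refine HasD.of_tendsto (fun n => ?_) (tendsto_pmul_comp hs hG hR hφR hle hφ hψ0)
    ((tendsto_pmul_comp hs hG hR hφR hle hφ hψ').add
      ((tendsto_pmul_comp hs hG₁ hR hφR hle hφ p1).add
        (tendsto_pmul_comp hs hG₂ hR hφR hle hφ p2)))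
  have fs := sobolevNorm_schwartzL2_lt_top (d := d) s (φ n)
  refine hasD_comp_mul_schwartz hG.continuous hG₁.continuous hG₂.continuous h (φ n) (ψ n) ?_ ?_
  · filter_upwards [coeFn_pmul (memLp_comp_mul hs hG fs (schwartzL2 (ψ n))),
      coeFn_schwartzL2 (φ n), coeFn_schwartzL2 (ψ n)] with x h1 h2 h3
    rw [h1, h2, h3]
  · set a := pmul (fun x => G (schwartzL2 (φ n) x)) (schwartzL2 (schwartzD i (ψ n)))
    set b := pmul (fun x => G₁ (schwartzL2 (φ n) x))
      (pmul (schwartzL2 (schwartzD i (φ n))) (schwartzL2 (ψ n)))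
    set c := pmul (fun x => G₂ (schwartzL2 (φ n) x))
      (pmul (conjL2 (schwartzL2 (schwartzD i (φ n)))) (schwartzL2 (ψ n)))
    filter_upwards [Lp.coeFn_add a (b + c), Lp.coeFn_add b c,
      coeFn_pmul (memLp_comp_mul hs hG fs (schwartzL2 (schwartzD i (ψ n)))),
      coeFn_pmul (memLp_comp_mul hs hG₁ fs
        (pmul (schwartzL2 (schwartzD i (φ n))) (schwartzL2 (ψ n)))),
      coeFn_pmul (memLp_comp_mul hs hG₂ fs
        (pmul (conjL2 (schwartzL2 (schwartzD i (φ n)))) (schwartzL2 (ψ n)))),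
      coeFn_pmul (memLp_schwartz_mul (schwartzD i (φ n)) (schwartzL2 (ψ n))),
      coeFn_pmul (memLp_conj_schwartz_mul (schwartzD i (φ n)) (schwartzL2 (ψ n))),
      coeFn_conjL2 (schwartzL2 (schwartzD i (φ n))),
      coeFn_schwartzL2 (φ n), coeFn_schwartzL2 (ψ n), coeFn_schwartzL2 (schwartzD i (φ n)),
      coeFn_schwartzL2 (schwartzD i (ψ n))] with x e1 e2 e3 e4 e5 e6 e7 e8 e9 e10 e11 e12
    rw [e1, Pi.add_apply, e2, Pi.add_apply, e3, e4, e5, e6, e7, e8, e9, e10, e11, e12]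
    ring

open Classical in
/-- The composition `F ∘ u`, with value `0` if it is not in `L²`. -/
noncomputable def compL2 {d : ℕ} (F : ℂ → ℂ) (u : L2 d) : L2 d :=
  if h : MemLp (fun x => F (u x)) 2 volume then h.toLp _ else 0

theorem memLp_comp {d : ℕ} {s : ℝ} (hs : (d : ℝ) / 2 < s) {F : ℂ → ℂ} (hF : IsC 0 F)
    (h0 : F 0 = 0) {u : L2 d} (hu : sobolevNorm s u < ∞) :
    MemLp (fun x => F (u x)) 2 volume := by
  obtain ⟨K, hK⟩ := hF (embConst d s * sobolevNorm s u).toReal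
  refine ((Lp.memLp u).const_mul ((K : ℝ) : ℂ)).of_le
    (aestronglyMeasurable_comp hF.continuous u) ?_
  filter_upwards [ae_norm_le_of_sobolev hs hu le_rfl] with x hx
  have := lipschitz_ball_norm_le hK hx (w := 0) (by rw [norm_zero]; exact ENNReal.toReal_nonneg)
  rw [h0, sub_zero, sub_zero] at this
  rw [norm_mul]
  simpa using this

theorem coeFn_compL2 {d : ℕ} {s : ℝ} (hs : (d : ℝ) / 2 < s) {F : ℂ → ℂ} (hF : IsC 0 F)
    (h0 : F 0 = 0) {u : L2 d} (hu : sobolevNorm s u < ∞) :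
    compL2 F u =ᵐ[volume] fun x => F (u x) := by
  rw [compL2, dif_pos (memLp_comp hs hF h0 hu)]
  exact MemLp.coeFn_toLp _

theorem norm_compL2_sub_le {d : ℕ} {s : ℝ} (hs : (d : ℝ) / 2 < s) {F : ℂ → ℂ} (hF : IsC 0 F)
    (h0 : F 0 = 0) {R : ℝ≥0∞} (hR : R < ∞) :
    ∃ K : ℝ≥0, ∀ u v : L2 d, sobolevNorm s u ≤ R → sobolevNorm s v ≤ R →
      ‖compL2 F u - compL2 F v‖ ≤ K * ‖u - v‖ := by
  obtain ⟨K, hK⟩ := hF (embConst d s * R).toReal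
  refine ⟨K, fun u v hu hv => Lp.norm_le_mul_norm_of_ae_le_mul ?_⟩
  filter_upwards [ae_norm_le_of_sobolev hs hR hu, ae_norm_le_of_sobolev hs hR hv,
    coeFn_compL2 hs hF h0 (hu.trans_lt hR), coeFn_compL2 hs hF h0 (hv.trans_lt hR),
    Lp.coeFn_sub u v, Lp.coeFn_sub (compL2 F u) (compL2 F v)] with x h1 h2 h3 h4 h5 h6
  rw [h5, h6, Pi.sub_apply, Pi.sub_apply, h3, h4]
  exact lipschitz_ball_norm_le hK h1 h2

theorem hasD_comp_schwartz {d : ℕ} {i : Fin d} {F F₁ F₂ : ℂ → ℂ} (hF : IsC 0 F) (h0 : F 0 = 0)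
    (hF₁ : Continuous F₁) (hF₂ : Continuous F₂)
    (h : ∀ z, HasFDerivAt F (wirtinger (F₁ z) (F₂ z)) z) (φ : 𝓢(Space d, ℂ)) {P Q : L2 d}
    (hP : P =ᵐ[volume] fun x => F (φ x))
    (hQ : Q =ᵐ[volume] fun x => F₁ (φ x) * schwartzD i φ x + F₂ (φ x) * conj (schwartzD i φ x)) :
    HasD i P Q := by
  obtain ⟨R, hR⟩ : ∃ R : ℝ, ∀ x, ‖φ x‖ ≤ R :=
    ⟨_, fun x => SchwartzMap.norm_le_seminorm ℝ φ x⟩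
  have bd : ∀ {P : ℂ → ℂ}, Continuous P → ∃ M : ℝ, 0 ≤ M ∧ ∀ x, ‖P (φ x)‖ ≤ M := by
    intro P hP
    obtain ⟨M, hM⟩ := (isCompact_closedBall (0 : ℂ) R).exists_bound_of_continuousOn hP.continuousOn
    exact ⟨M, (norm_nonneg _).trans (hM (φ 0) (by simpa using hR 0)),
      fun x => hM (φ x) (by simpa using hR x)⟩
  obtain ⟨K, hK⟩ := hF R
  obtain ⟨M₁, hM0₁, hM₁⟩ := bd hF₁
  obtain ⟨M₂, hM0₂, hM₂⟩ := bd hF₂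
  have hd : ∀ x, HasFDerivAt (fun x => F (φ x))
      ((wirtinger (F₁ (φ x)) (F₂ (φ x))).comp (fderiv ℝ φ x)) x := fun x =>
    (h (φ x)).comp x (φ.differentiableAt.hasFDerivAt)
  have hfd : fderiv ℝ (fun x => F (φ x)) =
      fun x => (wirtinger (F₁ (φ x)) (F₂ (φ x))).comp (fderiv ℝ φ x) :=
    funext fun x => (hd x).fderiv
  have cφ : Continuous (fderiv ℝ φ) := (SchwartzMap.fderivCLM ℝ (Space d) ℂ φ).continuous
  have cw : Continuous fun x => wirtinger (F₁ (φ x)) (F₂ (φ x)) :=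
    ((hF₁.comp φ.continuous).smul continuous_const).add
      ((hF₂.comp φ.continuous).smul continuous_const)
  have cfd : Continuous (fderiv ℝ (fun x => F (φ x))) := by
    rw [hfd]
    exact cw.clm_comp cφ
  refine hasD_of_differentiable (f := fun x => F (φ x)) ?_
    (fun x => (hd x).differentiableAt) ?_ hP ?_
  · refine (φ.integrable.norm.const_mul (K : ℝ)).mono'
      (hF.continuous.comp φ.continuous).aestronglyMeasurable (Eventually.of_forall fun x => ?_)
    have := lipschitz_ball_norm_le hK (hR x) (w := 0) (by simpa using (norm_nonneg _).trans (hR x))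
    rwa [h0, sub_zero, sub_zero] at this
  · refine ((SchwartzMap.fderivCLM ℝ (Space d) ℂ φ).integrable.norm.const_mul (M₁ + M₂)).mono'
      cfd.aestronglyMeasurable (Eventually.of_forall fun x => ?_)
    rw [hfd]
    refine (ContinuousLinearMap.opNorm_comp_le _ _).trans ?_
    have := (norm_wirtinger_le (F₁ (φ x)) (F₂ (φ x))).trans (add_le_add (hM₁ x) (hM₂ x))
    gcongr
    exact le_rfl
  · filter_upwards [hQ] with x hx
    rw [hx, hfd]
    rfl

theorem hasD_comp {d : ℕ} {i : Fin d} {s : ℝ} (hs : (d : ℝ) / 2 < s) (hs1 : 1 ≤ s)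
    {F F₁ F₂ : ℂ → ℂ} (hF : IsC 0 F) (h0 : F 0 = 0) (hF₁ : IsC 0 F₁) (hF₂ : IsC 0 F₂)
    (h : ∀ z, HasFDerivAt F (wirtinger (F₁ z) (F₂ z)) z) {u u' : L2 d}
    (hu : sobolevNorm s u < ∞) (hu' : HasD i u u') :
    HasD i (compL2 F u) (pmul (fun x => F₁ (u x)) u' + pmul (fun x => F₂ (u x)) (conjL2 u')) := by
  have hs0 : 0 ≤ s := zero_le_one.trans hs1
  obtain ⟨φ, hφ, hφR⟩ := exists_schwartz_seq_bounded hs0 hu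
  have hR : sobolevNorm s u + 1 < ∞ := ENNReal.add_lt_top.2 ⟨hu, ENNReal.one_lt_top⟩
  have hle : sobolevNorm s u ≤ sobolevNorm s u + 1 := le_self_add
  have hφ0 := tendsto_of_sobolevNorm hs0 hφ
  have hφ' : Tendsto (fun n => schwartzL2 (schwartzD i (φ n))) atTop (𝓝 u') := by
    refine tendsto_of_sobolevNorm (s := s - 1) (by linarith) ?_
    exact tendsto_of_tendsto_of_tendsto_of_le_of_le tendsto_const_nhds hφ (fun n => zero_le)
      fun n => ((hasD_schwartz i (φ n)).sub hu').sobolevNorm_le_pred s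
  have hφc := (conjL2.continuous.tendsto u').comp hφ'
  have hP : Tendsto (fun n => compL2 F (schwartzL2 (φ n))) atTop (𝓝 (compL2 F u)) := by
    obtain ⟨K, hK⟩ := norm_compL2_sub_le hs hF h0 hR
    rw [tendsto_iff_norm_sub_tendsto_zero] at hφ0 ⊢
    exact squeeze_zero (fun n => norm_nonneg _) (fun n => hK _ _ (hφR n) hle)
      (by simpa using hφ0.const_mul (K : ℝ))
  refine HasD.of_tendsto (fun n => ?_) hP ((tendsto_pmul_comp hs hF₁ hR hφR hle hφ hφ').add
    (tendsto_pmul_comp hs hF₂ hR hφR hle hφ hφc))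
  have fs := sobolevNorm_schwartzL2_lt_top (d := d) s (φ n)
  refine hasD_comp_schwartz hF h0 hF₁.continuous hF₂.continuous h (φ n) ?_ ?_
  · filter_upwards [coeFn_compL2 hs hF h0 fs, coeFn_schwartzL2 (φ n)] with x h1 h2
    rw [h1, h2]
  · filter_upwards [Lp.coeFn_add
        (pmul (fun x => F₁ (schwartzL2 (φ n) x)) (schwartzL2 (schwartzD i (φ n))))
        (pmul (fun x => F₂ (schwartzL2 (φ n) x)) (conjL2 (schwartzL2 (schwartzD i (φ n))))),
      coeFn_pmul (memLp_comp_mul hs hF₁ fs (schwartzL2 (schwartzD i (φ n)))),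
      coeFn_pmul (memLp_comp_mul hs hF₂ fs (conjL2 (schwartzL2 (schwartzD i (φ n))))),
      coeFn_conjL2 (schwartzL2 (schwartzD i (φ n))),
      coeFn_schwartzL2 (φ n), coeFn_schwartzL2 (schwartzD i (φ n))] with x e1 e2 e3 e4 e5 e6
    rw [Function.comp_apply, e1, Pi.add_apply, e2, e3, e4, e5, e6]

/-! ## Nonlinear estimates in Sobolev spaces -/

theorem pmul_sub_left {d : ℕ} {m m' : Space d → ℂ} {f : L2 d}
    (h : MemLp (fun x => m x * f x) 2 volume) (h' : MemLp (fun x => m' x * f x) 2 volume) :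
    pmul (fun x => m x - m' x) f = pmul m f - pmul m' f := by
  refine pmul_eq_of_ae ?_
  filter_upwards [Lp.coeFn_sub (pmul m f) (pmul m' f), coeFn_pmul h, coeFn_pmul h']
    with x h1 h2 h3
  rw [h1, Pi.sub_apply, h2, h3]; ring

theorem pmul_sub_right {d : ℕ} {m : Space d → ℂ} {f g : L2 d}
    (h : MemLp (fun x => m x * f x) 2 volume) (h' : MemLp (fun x => m x * g x) 2 volume) :
    pmul m (f - g) = pmul m f - pmul m g := by
  refine pmul_eq_of_ae ?_
  filter_upwards [Lp.coeFn_sub (pmul m f) (pmul m g), Lp.coeFn_sub f g, coeFn_pmul h,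
    coeFn_pmul h'] with x h1 h2 h3 h4
  rw [h1, h2, Pi.sub_apply, Pi.sub_apply, h3, h4]; ring

theorem pmul_const {d : ℕ} (c : ℂ) (f : L2 d) : pmul (fun _ => c) f = c • f := by
  refine pmul_eq_of_ae ?_
  filter_upwards [Lp.coeFn_smul c f] with x h
  rw [h, Pi.smul_apply, smul_eq_mul]

/-- Local Lipschitz continuity of `u ↦ G(u) v` from `H^s` to the bounded operators on `H^j`. -/
def LipComp (d : ℕ) (s : ℝ) (j : ℝ) (G : ℂ → ℂ) : Prop :=
  ∀ R : ℝ≥0∞, R < ∞ → ∃ C : ℝ≥0∞, C < ∞ ∧ ∀ u₁ u₂ v : L2 d, sobolevNorm s u₁ ≤ R →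
    sobolevNorm s u₂ ≤ R → sobolevNorm j v < ∞ →
    sobolevNorm j (pmul (fun x => G (u₁ x) - G (u₂ x)) v) ≤
      C * sobolevNorm s (u₁ - u₂) * sobolevNorm j v

theorem lipComp_zero {d : ℕ} {s : ℝ} (hs : (d : ℝ) / 2 < s) {G : ℂ → ℂ} (hG : IsC 0 G) :
    LipComp d s 0 G := by
  intro R hR
  obtain ⟨K, hK⟩ := hG (embConst d s * R).toReal
  refine ⟨K * embConst d s, ENNReal.mul_lt_top ENNReal.coe_lt_top (embConst_lt_top hs),
    fun u₁ u₂ v h1 h2 _ => ?_⟩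
  rw [sobolevNorm_zero_left, sobolevNorm_zero_left]
  have hD : sobolevNorm s (u₁ - u₂) < ∞ := (sobolevNorm_sub_le _ _ _).trans_lt
    (ENNReal.add_lt_top.2 ⟨h1.trans_lt hR, h2.trans_lt hR⟩)
  have hb : ∀ᵐ x, ‖G (u₁ x) - G (u₂ x)‖ ≤
      K * (embConst d s * sobolevNorm s (u₁ - u₂)).toReal := by
    filter_upwards [ae_norm_le_of_sobolev hs hR h1, ae_norm_le_of_sobolev hs hR h2,
      ae_norm_le_of_sobolev hs hD le_rfl, Lp.coeFn_sub u₁ u₂] with x h1 h2 h3 h4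
    rw [h4, Pi.sub_apply] at h3
    exact (lipschitz_ball_norm_le hK h1 h2).trans (by gcongr)
  have := norm_pmul_le ((aestronglyMeasurable_comp hG.continuous u₁).sub
    (aestronglyMeasurable_comp hG.continuous u₂)) hb v
  have h3 := ENNReal.ofReal_le_ofReal this
  rw [ofReal_norm, ENNReal.ofReal_mul (by positivity), ofReal_norm,
    ENNReal.ofReal_mul (by positivity), ENNReal.ofReal_coe_nnreal,
    ENNReal.ofReal_toReal (ENNReal.mul_lt_top (embConst_lt_top hs) hD).ne] at h3
  rwa [mul_assoc (K : ℝ≥0∞)]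

theorem LipComp.exists_bound {d : ℕ} {s j : ℝ} (hs : (d : ℝ) / 2 < s) {G : ℂ → ℂ}
    (hG : IsC 0 G) (h : LipComp d s j G) {R : ℝ≥0∞} (hR : R < ∞) :
    ∃ C : ℝ≥0∞, C < ∞ ∧ ∀ u v : L2 d, sobolevNorm s u ≤ R → sobolevNorm j v < ∞ →
      sobolevNorm j (pmul (fun x => G (u x)) v) ≤ C * sobolevNorm j v := by
  obtain ⟨C, hC, h⟩ := h R hR
  refine ⟨C * R + ‖G 0‖ₑ, ENNReal.add_lt_top.2 ⟨ENNReal.mul_lt_top hC hR, enorm_lt_top⟩,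
    fun u v hu hv => ?_⟩
  have h1 := h u 0 v hu (by simp [sobolevNorm_zero]) hv
  have e : pmul (fun x => G (u x)) v =
      pmul (fun x => G (u x) - G ((0 : L2 d) x)) v + G 0 • v := by
    rw [pmul_sub_left (memLp_comp_mul hs hG (hu.trans_lt hR) v)
      (memLp_comp_mul hs hG (by simp [sobolevNorm_zero]) v),
      show pmul (fun x => G ((0 : L2 d) x)) v = G 0 • v from ?_, sub_add_cancel]
    rw [← pmul_const]
    refine pmul_eq_of_ae ?_
    filter_upwards [coeFn_pmul (m := fun _ => G 0) (f := v) ((Lp.memLp v).const_mul _),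
      Lp.coeFn_zero ℂ 2 (volume : Measure (Space d))] with x h1 h2
    rw [h1, h2]; rfl
  rw [e, add_mul]
  refine (sobolevNorm_add_le _ _ _).trans ?_
  rw [sobolevNorm_smul]
  rw [sub_zero] at h1
  gcongr
  exact h1.trans (by gcongr)

/-- Controls the terms `G(u) u' v` of the Leibniz rule, with `p` in the role of `u'` or its
conjugate. A product of `p ∈ H^{s-1}` and `v ∈ H^{j+1}` lies in `H^j` because `(s - 1) + (j + 1) - j
= s > d/2`. -/
theorem LipComp.bracket {d j : ℕ} {s : ℝ} (hs : (d : ℝ) / 2 < s) (hj : (j : ℝ) + 1 ≤ s)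
    {G : ℂ → ℂ} (hG : IsC 0 G) (h : LipComp d s j G) {R : ℝ≥0∞} (hR : R < ∞) :
    ∃ C : ℝ≥0∞, C < ∞ ∧ ∀ u₁ u₂ p₁ p₂ v : L2 d, sobolevNorm s u₁ ≤ R → sobolevNorm s u₂ ≤ R →
      sobolevNorm (s - 1) p₁ ≤ R → sobolevNorm (s - 1) p₂ ≤ R →
      sobolevNorm (s - 1) (p₁ - p₂) ≤ sobolevNorm s (u₁ - u₂) →
      sobolevNorm ((j : ℝ) + 1) v < ∞ →
      sobolevNorm j (pmul (fun x => G (u₁ x)) (pmul p₁ v) - pmul (fun x => G (u₂ x)) (pmul p₂ v)) ≤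
        C * sobolevNorm s (u₁ - u₂) * sobolevNorm ((j : ℝ) + 1) v := by
  obtain ⟨C₁, hC₁, b₁⟩ := h R hR
  obtain ⟨C₂, hC₂, b₂⟩ := h.exists_bound hs hG hR
  have hj0 : (0 : ℝ) ≤ j := Nat.cast_nonneg j
  have hP : prodConst d j s < ∞ := prodConst_lt_top hs
  refine ⟨C₁ * (prodConst d j s * R) + C₂ * prodConst d j s, ENNReal.add_lt_top.2
    ⟨ENNReal.mul_lt_top hC₁ (ENNReal.mul_lt_top hP hR), ENNReal.mul_lt_top hC₂ hP⟩,
    fun u₁ u₂ p₁ p₂ v hu₁ hu₂ hp₁ hp₂ hp hv => ?_⟩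
  have prod := fun {p : L2 d} (hp : sobolevNorm (s - 1) p < ∞) =>
    sobolevNorm_pmul_le hj0 (by linarith : (j : ℝ) ≤ s - 1) (by linarith : (j : ℝ) ≤ j + 1)
      (by linarith : s ≤ s - 1 + (j + 1) - j) hs hp hv
  have mem := fun {p : L2 d} (hp : sobolevNorm (s - 1) p < ∞) =>
    memLp_mul_sobolev hj0 (by linarith : (j : ℝ) ≤ s - 1) (by linarith : (j : ℝ) ≤ j + 1)
      (by linarith : s ≤ s - 1 + (j + 1) - j) hs hp hv
  have f1 := hp₁.trans_lt hR
  have f2 := hp₂.trans_lt hR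
  have f3 : sobolevNorm (s - 1) (p₁ - p₂) < ∞ :=
    (sobolevNorm_sub_le _ _ _).trans_lt (ENNReal.add_lt_top.2 ⟨f1, f2⟩)
  have fin : ∀ {p : L2 d}, sobolevNorm (s - 1) p < ∞ → sobolevNorm (j : ℝ) (pmul p v) < ∞ :=
    fun hp => (prod hp).trans_lt (ENNReal.mul_lt_top (ENNReal.mul_lt_top hP hp) hv)
  have e1 : pmul (p₁ - p₂ : L2 d) v = pmul p₁ v - pmul p₂ v := by
    rw [← pmul_sub_left (mem f1) (mem f2)]
    refine pmul_eq_of_ae ?_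
    filter_upwards [coeFn_pmul (m := fun x => p₁ x - p₂ x) (f := v)
      (((mem f1).sub (mem f2)).ae_eq (Eventually.of_forall fun x => (sub_mul _ _ _).symm)), Lp.coeFn_sub p₁ p₂] with x h1 h2
    rw [h1, h2]; rfl
  have e : pmul (fun x => G (u₁ x)) (pmul p₁ v) - pmul (fun x => G (u₂ x)) (pmul p₂ v) =
      pmul (fun x => G (u₁ x) - G (u₂ x)) (pmul p₁ v) +
        pmul (fun x => G (u₂ x)) (pmul (p₁ - p₂ : L2 d) v) := by
    have m1 := memLp_comp_mul hs hG (hu₁.trans_lt hR)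
    have m2 := memLp_comp_mul hs hG (hu₂.trans_lt hR)
    rw [pmul_sub_left (m1 _) (m2 _), e1, pmul_sub_right (m2 _) (m2 _)]
    abel
  rw [e]
  refine (sobolevNorm_add_le _ _ _).trans ?_
  have q1 := b₁ u₁ u₂ (pmul p₁ v) hu₁ hu₂ (fin f1)
  have q2 := b₂ u₂ (pmul (p₁ - p₂ : L2 d) v) hu₂ (fin f3)
  have q3 : sobolevNorm (j : ℝ) (pmul p₁ v) ≤
      prodConst d j s * R * sobolevNorm ((j : ℝ) + 1) v := (prod f1).trans (by gcongr)
  have q4 : sobolevNorm (j : ℝ) (pmul (p₁ - p₂ : L2 d) v) ≤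
      prodConst d j s * sobolevNorm s (u₁ - u₂) * sobolevNorm ((j : ℝ) + 1) v :=
    (prod f3).trans (by gcongr)
  calc _ ≤ C₁ * sobolevNorm s (u₁ - u₂) * (prodConst d j s * R * sobolevNorm ((j : ℝ) + 1) v) +
        C₂ * (prodConst d j s * sobolevNorm s (u₁ - u₂) * sobolevNorm ((j : ℝ) + 1) v) :=
        add_le_add (q1.trans (by gcongr)) (q2.trans (by gcongr))
    _ = _ := by ring

/-- Induction on `j`. Differentiating `(G(u₁) - G(u₂)) v` puts the derivative either on `v`, where
the case `j` for `G` applies, or on `u₁` and `u₂`, where `LipComp.bracket` applies to the Wirtinger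
derivatives of `G`. -/
theorem lipComp_of_isC {d : ℕ} {s : ℝ} (hs : (d : ℝ) / 2 < s) :
    ∀ {j : ℕ}, (j : ℝ) ≤ s → ∀ {G : ℂ → ℂ}, IsC j G → LipComp d s j G := by
  intro j
  induction j with
  | zero => intro _ G hG; simpa using lipComp_zero hs hG
  | succ j ih =>
    intro hj G hG R hR
    obtain ⟨G₁, G₂, h₁, h₂, hd⟩ := id hG
    have hj' : (j : ℝ) + 1 ≤ s := by exact_mod_cast hj
    have hjs : (j : ℝ) ≤ s := by linarith
    have hj0 : (0 : ℝ) ≤ j := Nat.cast_nonneg j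
    have hs1 : 1 ≤ s := by linarith
    obtain ⟨C₀, hC₀, b₀⟩ := ih hjs hG.of_succ R hR
    obtain ⟨C₁, hC₁, b₁⟩ := (ih hjs h₁).bracket hs hj' h₁.zero hR
    obtain ⟨C₂, hC₂, b₂⟩ := (ih hjs h₂).bracket hs hj' h₂.zero hR
    refine ⟨C₀ + d * (C₀ + (C₁ + C₂)), ?_, fun u₁ u₂ v hu₁ hu₂ hv => ?_⟩
    · exact ENNReal.add_lt_top.2 ⟨hC₀, ENNReal.mul_lt_top (ENNReal.natCast_lt_top d)
        (ENNReal.add_lt_top.2 ⟨hC₀, ENNReal.add_lt_top.2 ⟨hC₁, hC₂⟩⟩)⟩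
    push_cast at hv ⊢
    have fu₁ := hu₁.trans_lt hR
    have fu₂ := hu₂.trans_lt hR
    have hvj : sobolevNorm j v < ∞ := (sobolevNorm_mono (by linarith) v).trans_lt hv
    have hv1 : sobolevNorm 1 v < ∞ := (sobolevNorm_mono (by linarith) v).trans_lt hv
    choose p₁ hp₁ using fun i : Fin d =>
      exists_hasD i ((sobolevNorm_mono hs1 u₁).trans_lt fu₁)
    choose p₂ hp₂ using fun i : Fin d =>
      exists_hasD i ((sobolevNorm_mono hs1 u₂).trans_lt fu₂)
    choose q hq using fun i : Fin d => exists_hasD i hv1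
    have mG := fun {u : L2 d} (hu : sobolevNorm s u < ∞) (f : L2 d) =>
      memLp_comp_mul hs hG.zero hu f
    have D := fun i => (hasD_comp_mul hs hs1 hG.zero h₁.zero h₂.zero hd fu₁ (hp₁ i) hv1 (hq i)).sub
      (hasD_comp_mul hs hs1 hG.zero h₁.zero h₂.zero hd fu₂ (hp₂ i) hv1 (hq i))
    rw [← pmul_sub_left (mG fu₁ v) (mG fu₂ v)] at D
    refine (sobolevNorm_succ_le j D).trans ?_
    have T : ∀ i : Fin d, sobolevNorm j
        (pmul (fun x => G (u₁ x)) (q i) + (pmul (fun x => G₁ (u₁ x)) (pmul (p₁ i) v) +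
            pmul (fun x => G₂ (u₁ x)) (pmul (conjL2 (p₁ i)) v)) -
          (pmul (fun x => G (u₂ x)) (q i) + (pmul (fun x => G₁ (u₂ x)) (pmul (p₂ i) v) +
            pmul (fun x => G₂ (u₂ x)) (pmul (conjL2 (p₂ i)) v)))) ≤
        (C₀ + (C₁ + C₂)) * sobolevNorm s (u₁ - u₂) * sobolevNorm (j + 1) v := by
      intro i
      have hq' : sobolevNorm j (q i) ≤ sobolevNorm (j + 1) v := (hq i).sobolevNorm_le j
      have t0 := b₀ u₁ u₂ (q i) hu₁ hu₂ (hq'.trans_lt hv)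
      have P₁ := (hp₁ i).sobolevNorm_le_pred s
      have P₂ := (hp₂ i).sobolevNorm_le_pred s
      have P₃ := ((hp₁ i).sub (hp₂ i)).sobolevNorm_le_pred s
      have t1 := b₁ u₁ u₂ (p₁ i) (p₂ i) v hu₁ hu₂ (P₁.trans hu₁) (P₂.trans hu₂) P₃ hv
      have t2 := b₂ u₁ u₂ (conjL2 (p₁ i)) (conjL2 (p₂ i)) v hu₁ hu₂
        (by rw [sobolevNorm_conjL2]; exact P₁.trans hu₁)
        (by rw [sobolevNorm_conjL2]; exact P₂.trans hu₂)
        (by rw [← map_sub, sobolevNorm_conjL2]; exact P₃) hv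
      rw [pmul_sub_left (mG fu₁ (q i)) (mG fu₂ (q i))] at t0
      rw [add_sub_add_comm, add_sub_add_comm, add_mul, add_mul, add_mul, add_mul]
      refine (sobolevNorm_add_le _ _ _).trans (add_le_add (t0.trans (by gcongr)) ?_)
      exact (sobolevNorm_add_le _ _ _).trans (add_le_add t1 t2)
    rw [add_mul, add_mul]
    refine add_le_add ((b₀ u₁ u₂ v hu₁ hu₂ hvj).trans ?_) ?_
    · gcongr
      exact sobolevNorm_mono (by linarith) v
    · refine (Finset.sum_le_sum fun i _ => T i).trans ?_
      rw [Finset.sum_const, Finset.card_univ, Fintype.card_fin, nsmul_eq_mul, mul_assoc,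
        mul_assoc, mul_assoc]

theorem compL2_zero {d : ℕ} {F : ℂ → ℂ} (h0 : F 0 = 0) : compL2 F (0 : L2 d) = 0 := by
  have h : (fun x => F ((0 : L2 d) x)) =ᵐ[volume] ((0 : L2 d) : Space d → ℂ) := by
    filter_upwards [Lp.coeFn_zero ℂ 2 (volume : Measure (Space d))] with x h2
    rw [h2]; exact h0
  have hm : MemLp (fun x => F ((0 : L2 d) x)) 2 volume := (memLp_congr_ae h).2 (Lp.memLp _)
  rw [compL2, dif_pos hm]
  exact Lp.ext (hm.coeFn_toLp.trans h)

/-- A tame estimate: `C` depends on the `H^s` bound alone, and the `H^j` norms enter linearly. One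
derivative is taken by the chain rule, after which `lipComp_of_isC` serves up to order `s`. This is
why `j` may reach `s + 1`, so that `j = idx d` is allowed for every `s > d/2`. -/
theorem sobolevNorm_compL2_sub_le {d : ℕ} {s : ℝ} (hs : (d : ℝ) / 2 < s) {F : ℂ → ℂ}
    (h0 : F 0 = 0) :
    ∀ {j : ℕ}, (j : ℝ) ≤ s + 1 → IsC j F → ∀ {R : ℝ≥0∞}, R < ∞ → ∃ C : ℝ≥0∞, C < ∞ ∧
      ∀ u₁ u₂ : L2 d, sobolevNorm s u₁ ≤ R → sobolevNorm s u₂ ≤ R → sobolevNorm j u₁ < ∞ →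
        sobolevNorm j u₂ < ∞ → sobolevNorm j (compL2 F u₁ - compL2 F u₂) ≤
          C * (sobolevNorm s (u₁ - u₂) * sobolevNorm j u₁ + sobolevNorm j (u₁ - u₂)) := by
  intro j
  induction j with
  | zero =>
    intro _ hF R hR
    obtain ⟨K, hK⟩ := norm_compL2_sub_le hs hF h0 hR
    refine ⟨K, ENNReal.coe_lt_top, fun u₁ u₂ h1 h2 _ _ => ?_⟩
    have := ENNReal.ofReal_le_ofReal (hK u₁ u₂ h1 h2)
    rw [ofReal_norm, ENNReal.ofReal_mul (by positivity), ofReal_norm,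
      ENNReal.ofReal_coe_nnreal] at this
    simp only [Nat.cast_zero, sobolevNorm_zero_left]
    exact this.trans (by gcongr; exact le_add_self)
  | succ j ih =>
    intro hj hF R hR
    obtain ⟨F₁, F₂, h₁, h₂, hd⟩ := id hF
    have hj' : (j : ℝ) ≤ s := by push_cast at hj; linarith
    obtain ⟨C₀, hC₀, b₀⟩ := ih (by linarith) hF.of_succ hR
    obtain ⟨C₁, hC₁, b₁⟩ := lipComp_of_isC hs hj' h₁ R hR
    obtain ⟨C₂, hC₂, b₂⟩ := lipComp_of_isC hs hj' h₂ R hR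
    obtain ⟨B₁, hB₁, c₁⟩ := (lipComp_of_isC hs hj' h₁).exists_bound hs h₁.zero hR
    obtain ⟨B₂, hB₂, c₂⟩ := (lipComp_of_isC hs hj' h₂).exists_bound hs h₂.zero hR
    refine ⟨C₀ + d * ((C₁ + B₁) + (C₂ + B₂)), ?_, fun u₁ u₂ hu₁ hu₂ hv₁ hv₂ => ?_⟩
    · exact ENNReal.add_lt_top.2 ⟨hC₀, ENNReal.mul_lt_top (ENNReal.natCast_lt_top d)
        (ENNReal.add_lt_top.2 ⟨ENNReal.add_lt_top.2 ⟨hC₁, hB₁⟩, ENNReal.add_lt_top.2 ⟨hC₂, hB₂⟩⟩)⟩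
    push_cast at hv₁ hv₂ ⊢
    have hj0 : (0 : ℝ) ≤ j := Nat.cast_nonneg j
    have fu₁ := hu₁.trans_lt hR
    have fu₂ := hu₂.trans_lt hR
    -- `hasD_comp` needs an exponent that is at least `1`; passing to `max s 1` costs nothing, as
    -- both functions lie in `H^{j+1} ⊂ H¹`.
    have hst : (d : ℝ) / 2 < max s 1 := hs.trans_le (le_max_left _ _)
    have hmax : ∀ {u : L2 d}, sobolevNorm s u < ∞ → sobolevNorm (j + 1) u < ∞ →
        sobolevNorm (max s 1) u < ∞ := by
      intro u h h'
      rcases max_choice s 1 with e | e <;> rw [e]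
      · exact h
      · exact (sobolevNorm_mono (by linarith) u).trans_lt h'
    have one : ∀ {u : L2 d}, sobolevNorm (j + 1) u < ∞ → sobolevNorm 1 u < ∞ := fun {u} h =>
      (sobolevNorm_mono (by linarith) u).trans_lt h
    have lej : ∀ u : L2 d, sobolevNorm j u ≤ sobolevNorm (j + 1) u := fun u =>
      sobolevNorm_mono (by linarith) u
    choose p₁ hp₁ using fun i : Fin d => exists_hasD i (one hv₁)
    choose p₂ hp₂ using fun i : Fin d => exists_hasD i (one hv₂)
    have D := fun i => (hasD_comp hst (le_max_right _ _) hF.zero h0 h₁.zero h₂.zero hd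
      (hmax fu₁ hv₁) (hp₁ i)).sub (hasD_comp hst (le_max_right _ _) hF.zero h0 h₁.zero h₂.zero hd
      (hmax fu₂ hv₂) (hp₂ i))
    refine (sobolevNorm_succ_le j D).trans ?_
    have split : ∀ {G : ℂ → ℂ}, IsC 0 G → ∀ a b : L2 d,
        pmul (fun x => G (u₁ x)) a - pmul (fun x => G (u₂ x)) b =
          pmul (fun x => G (u₁ x) - G (u₂ x)) a + pmul (fun x => G (u₂ x)) (a - b) := by
      intro G hG a b
      have m1 := memLp_comp_mul hs hG fu₁
      have m2 := memLp_comp_mul hs hG fu₂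
      rw [pmul_sub_left (m1 _) (m2 _), pmul_sub_right (m2 _) (m2 _)]
      abel
    set E := sobolevNorm s (u₁ - u₂) * sobolevNorm (j + 1) u₁ + sobolevNorm (j + 1) (u₁ - u₂)
    have est : ∀ {G : ℂ → ℂ} {C B : ℝ≥0∞}, IsC 0 G →
        (∀ u₁ u₂ v : L2 d, sobolevNorm s u₁ ≤ R → sobolevNorm s u₂ ≤ R → sobolevNorm j v < ∞ →
          sobolevNorm j (pmul (fun x => G (u₁ x) - G (u₂ x)) v) ≤
            C * sobolevNorm s (u₁ - u₂) * sobolevNorm j v) →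
        (∀ u v : L2 d, sobolevNorm s u ≤ R → sobolevNorm j v < ∞ →
          sobolevNorm j (pmul (fun x => G (u x)) v) ≤ B * sobolevNorm j v) → ∀ a b : L2 d,
        sobolevNorm j a ≤ sobolevNorm (j + 1) u₁ →
        sobolevNorm j (a - b) ≤ sobolevNorm (j + 1) (u₁ - u₂) →
        sobolevNorm j (pmul (fun x => G (u₁ x)) a - pmul (fun x => G (u₂ x)) b) ≤
          (C + B) * E := by
      intro G C B hG hb hc a b ha hab
      rw [split hG, add_mul]
      have hab' : sobolevNorm (j + 1) (u₁ - u₂) < ∞ :=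
        (sobolevNorm_sub_le _ _ _).trans_lt (ENNReal.add_lt_top.2 ⟨hv₁, hv₂⟩)
      refine (sobolevNorm_add_le _ _ _).trans (add_le_add ?_ ?_)
      · refine (hb u₁ u₂ a hu₁ hu₂ (ha.trans_lt hv₁)).trans ?_
        rw [mul_assoc]
        gcongr
        refine le_trans ?_ le_self_add
        gcongr
      · refine (hc u₂ (a - b) hu₂ (hab.trans_lt hab')).trans ?_
        gcongr
        exact hab.trans le_add_self
    rw [add_mul]
    refine add_le_add ((b₀ u₁ u₂ hu₁ hu₂ ((lej _).trans_lt hv₁) ((lej _).trans_lt hv₂)).trans ?_) ?_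
    · gcongr
      exact add_le_add (by gcongr; exact lej _) (lej _)
    · refine (Finset.sum_le_sum (g := fun _ => ((C₁ + B₁) + (C₂ + B₂)) * E) fun i _ => ?_).trans ?_
      · have P₁ := (hp₁ i).sobolevNorm_le j
        have P₂ := ((hp₁ i).sub (hp₂ i)).sobolevNorm_le j
        rw [add_sub_add_comm, add_mul (C₁ + B₁)]
        refine (sobolevNorm_add_le _ _ _).trans (add_le_add ?_ ?_)
        · exact est h₁.zero b₁ c₁ _ _ P₁ P₂
        · exact est h₂.zero b₂ c₂ _ _ (by rw [sobolevNorm_conjL2]; exact P₁)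
            (by rw [← map_sub, sobolevNorm_conjL2]; exact P₂)
      · rw [Finset.sum_const, Finset.card_univ, Fintype.card_fin, nsmul_eq_mul, mul_assoc]

section

open scoped ContDiff

/-! ## Smoothness of the power nonlinearity -/

theorem wirtinger_of_linear (L : ℂ →L[ℝ] ℂ) :
    L = wirtinger ((L 1 - Complex.I * L Complex.I) / 2) ((L 1 + Complex.I * L Complex.I) / 2) := by
  ext w
  have h : L w = w.re * L 1 + w.im * L Complex.I := by
    conv_lhs => rw [← Complex.re_add_im w]
    rw [map_add, show (w.re : ℂ) = w.re • (1 : ℂ) by simp,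
      show (w.im : ℂ) * Complex.I = w.im • Complex.I by simp, map_smul, map_smul]
    simp
  have hw : (w.re : ℂ) = (w + conj w) / 2 := by rw [Complex.re_eq_add_conj]
  have hi : (w.im : ℂ) = (w - conj w) / (2 * Complex.I) := by rw [Complex.im_eq_sub_conj]
  rw [h, wirtinger_apply, hw, hi]
  have := Complex.I_ne_zero
  field_simp
  ring_nf
  rw [Complex.I_sq]
  ring

/-- The derivative `∂_z G`. -/
noncomputable def dz (G : ℂ → ℂ) (z : ℂ) : ℂ :=
  (fderiv ℝ G z 1 - Complex.I * fderiv ℝ G z Complex.I) / 2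

/-- The derivative `∂_{z̄} G`. -/
noncomputable def dzbar (G : ℂ → ℂ) (z : ℂ) : ℂ :=
  (fderiv ℝ G z 1 + Complex.I * fderiv ℝ G z Complex.I) / 2

theorem hasFDerivAt_dz {G : ℂ → ℂ} {z : ℂ} (h : DifferentiableAt ℝ G z) :
    HasFDerivAt G (wirtinger (dz G z) (dzbar G z)) z := by
  have := h.hasFDerivAt
  rwa [wirtinger_of_linear (fderiv ℝ G z)] at this

theorem isC_of_contDiff : ∀ {j : ℕ} {G : ℂ → ℂ}, ContDiff ℝ ∞ G → IsC j G := by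
  intro j
  induction j with
  | zero =>
    intro G hG R
    have hc : Continuous (fderiv ℝ G) := hG.continuous_fderiv (by simp)
    obtain ⟨M, hM⟩ := (isCompact_closedBall (0 : ℂ) R).exists_bound_of_continuousOn hc.continuousOn
    refine ⟨M.toNNReal, (convex_closedBall (0 : ℂ) R).lipschitzOnWith_of_nnnorm_fderiv_le
      (fun z _ => hG.differentiable (by simp) z) fun z hz => ?_⟩
    rw [← NNReal.coe_le_coe, coe_nnnorm]
    exact (hM z hz).trans (Real.le_coe_toNNReal M)
  | succ j ih =>
    intro G hG
    have h1 : ContDiff ℝ ∞ (fderiv ℝ G) := hG.fderiv_right (by simp)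
    refine ⟨dz G, dzbar G, ih ?_, ih ?_, fun z => hasFDerivAt_dz (hG.differentiable (by simp) z)⟩
    · unfold dz; fun_prop
    · unfold dzbar; fun_prop

/-- `G` is smooth away from the origin and positively homogeneous of degree `q`. -/
structure IsHomogeneousSmooth (q : ℝ) (G : ℂ → ℂ) : Prop where
  contDiffAt : ∀ z ≠ 0, ContDiffAt ℝ ∞ G z
  map_smul : ∀ t : ℝ, 0 < t → ∀ z, G (t • z) = (t ^ q) • G z

theorem norm_le_of_homogeneous {E : Type*} [NormedAddCommGroup E] [NormedSpace ℝ E] {q : ℝ}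
    {G : ℂ → E} (hc : ContinuousOn G {0}ᶜ) (h : ∀ t : ℝ, 0 < t → ∀ z, G (t • z) = (t ^ q) • G z) :
    ∃ M : ℝ, 0 ≤ M ∧ ∀ z ≠ 0, ‖G z‖ ≤ M * ‖z‖ ^ q := by
  obtain ⟨M, hM⟩ := (isCompact_sphere (0 : ℂ) 1).exists_bound_of_continuousOn
    (hc.mono fun z hz => by
      rw [mem_compl_singleton_iff]; rintro rfl; simp at hz)
  have h1 := hM 1 (by simp)
  refine ⟨M, (norm_nonneg _).trans h1, fun z hz => ?_⟩
  have hz' : 0 < ‖z‖ := norm_pos_iff.2 hz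
  have h2 := hM (‖z‖⁻¹ • z) (by simp [hz'.ne'])
  have h3 := h ‖z‖ hz' (‖z‖⁻¹ • z)
  rw [smul_smul, mul_inv_cancel₀ hz'.ne', one_smul] at h3
  rw [h3, norm_smul, Real.norm_of_nonneg (by positivity), mul_comm]
  gcongr

theorem IsHomogeneousSmooth.continuousOn {q : ℝ} {G : ℂ → ℂ} (h : IsHomogeneousSmooth q G) :
    ContinuousOn G {0}ᶜ := fun z hz => (h.contDiffAt z hz).continuousAt.continuousWithinAt

theorem IsHomogeneousSmooth.map_zero {q : ℝ} {G : ℂ → ℂ} (h : IsHomogeneousSmooth q G)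
    (hq : 0 < q) : G 0 = 0 := by
  have h1 := h.map_smul 2 two_pos 0
  rw [smul_zero] at h1
  have h2 : (1 : ℝ) < 2 ^ q := Real.one_lt_rpow one_lt_two hq
  have h3 : ((2 : ℝ) ^ q - 1) • G 0 = 0 := by rw [sub_smul, ← h1, one_smul, sub_self]
  exact (smul_eq_zero.1 h3).resolve_left (by linarith)

theorem IsHomogeneousSmooth.fderiv_smul {q : ℝ} {G : ℂ → ℂ} (h : IsHomogeneousSmooth q G) {t : ℝ}
    (ht : 0 < t) (z : ℂ) : fderiv ℝ G (t • z) = (t ^ (q - 1)) • fderiv ℝ G z := by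
  have h1 := congrFun (congrArg (fderiv ℝ) (funext (h.map_smul t ht))) z
  have h2 : fderiv ℝ (fun z => G (t • z)) z = t • fderiv ℝ G (t • z) := fderiv_comp_smul t
  have h3 : fderiv ℝ (fun z => (t ^ q) • G z) z = (t ^ q) • fderiv ℝ G z :=
    congrFun (fderiv_const_smul_field (f := G) (𝕜 := ℝ) (t ^ q)) z
  rw [h2, h3] at h1
  rw [Real.rpow_sub ht, Real.rpow_one, div_eq_inv_mul, mul_smul, ← h1, smul_smul,
    inv_mul_cancel₀ ht.ne', one_smul]

theorem IsHomogeneousSmooth.fderiv_bound {q : ℝ} {G : ℂ → ℂ} (h : IsHomogeneousSmooth q G) :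
    ∃ M : ℝ, 0 ≤ M ∧ ∀ z ≠ 0, ‖fderiv ℝ G z‖ ≤ M * ‖z‖ ^ (q - 1) :=
  norm_le_of_homogeneous (fun z hz => ((h.contDiffAt z hz).fderiv_right (m := ∞)
    (by simp)).continuousAt.continuousWithinAt) fun _ ht z => h.fderiv_smul ht z

/-- Only the origin is critical. If `‖x - y‖ ≥ ‖x‖ / 2`, the sizes of `G x` and `G y` suffice.
Otherwise the ball of radius `‖x‖ / 2` about `x` avoids the origin, and the mean value inequality
applies there with the bound `‖z‖^{q-1}` for the derivative. -/
theorem IsHomogeneousSmooth.isC_zero {q : ℝ} {G : ℂ → ℂ} (h : IsHomogeneousSmooth q G)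
    (hq : 1 ≤ q) : IsC 0 G := by
  intro R
  obtain ⟨M, hM0, hM⟩ := norm_le_of_homogeneous h.continuousOn h.map_smul
  obtain ⟨M', hM0', hM'⟩ := h.fderiv_bound
  have G0 := h.map_zero (by linarith)
  set S : ℝ := (2 * max R 0) ^ (q - 1)
  have hS : 0 ≤ S := by positivity
  have hball : ∀ z : ℂ, ‖z‖ ≤ 2 * max R 0 → ‖z‖ ^ (q - 1) ≤ S := fun z hz => by
    have : 0 ≤ q - 1 := by linarith
    exact Real.rpow_le_rpow (norm_nonneg _) hz this
  have hG : ∀ z : ℂ, ‖z‖ ≤ R → ‖G z‖ ≤ M * S * ‖z‖ := by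
    intro z hz
    rcases eq_or_ne z 0 with rfl | h0
    · simp [G0]
    have hz' : 0 < ‖z‖ := norm_pos_iff.2 h0
    have e : ‖z‖ ^ q = ‖z‖ ^ (q - 1) * ‖z‖ := by
      rw [Real.rpow_sub_one hz'.ne']; field_simp
    refine (hM z h0).trans ?_
    rw [e, ← mul_assoc]
    gcongr
    refine hball z ?_
    have := le_max_left R 0
    have := le_max_right R 0
    linarith
  have key : ∀ x y : ℂ, ‖x‖ ≤ R → ‖y‖ ≤ ‖x‖ → ‖G x - G y‖ ≤ (4 * M * S + M' * S) * ‖x - y‖ := by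
    intro x y hx hy
    by_cases hxy : ‖x‖ / 2 ≤ ‖x - y‖
    · have h1 : ‖G x - G y‖ ≤ M * S * ‖x‖ + M * S * ‖y‖ :=
        (norm_sub_le _ _).trans (add_le_add (hG x hx) (hG y (hy.trans hx)))
      have h2 : M * S * ‖y‖ ≤ M * S * ‖x‖ := by gcongr
      have h3 : M * S * (‖x‖ / 2) ≤ M * S * ‖x - y‖ := by gcongr
      have h4 : 0 ≤ M' * S * ‖x - y‖ := by positivity
      nlinarith
    · rw [not_le] at hxy
      have hx0 : 0 < ‖x‖ := by
        have := norm_nonneg (x - y)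
        linarith
      have hz : ∀ z ∈ Metric.ball x (‖x‖ / 2), z ≠ 0 ∧ ‖z‖ ≤ 2 * max R 0 := by
        intro z hz
        have h1 : ‖z - x‖ < ‖x‖ / 2 := by simpa [dist_eq_norm] using hz
        have h2 : ‖x‖ ≤ ‖z‖ + ‖z - x‖ := by
          have := norm_sub_le z (z - x)
          rwa [sub_sub_cancel] at this
        have h3 : ‖z‖ ≤ ‖x‖ + ‖z - x‖ := by
          have := norm_add_le x (z - x)
          rwa [add_sub_cancel] at this
        have := le_max_left R 0
        exact ⟨norm_pos_iff.1 (by linarith), by linarith⟩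
      have h1 : ‖G x - G y‖ ≤ M' * S * ‖x - y‖ := by
        refine (convex_ball x (‖x‖ / 2)).norm_image_sub_le_of_norm_fderiv_le (𝕜 := ℝ)
          (fun z hz' => (h.contDiffAt z (hz z hz').1).differentiableAt (by simp))
          (fun z hz' => (hM' z (hz z hz').1).trans ?_) ?_ ?_
        · gcongr
          exact hball z (hz z hz').2
        · rw [Metric.mem_ball, dist_comm, dist_eq_norm]; exact hxy
        · exact Metric.mem_ball_self (by linarith)
      have h4 : 0 ≤ 4 * M * S * ‖x - y‖ := by positivity
      nlinarith
  refine ⟨(4 * M * S + M' * S).toNNReal, LipschitzOnWith.of_dist_le_mul fun x hx y hy => ?_⟩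
  rw [mem_closedBall_zero_iff] at hx hy
  rw [Real.coe_toNNReal _ (by positivity), dist_eq_norm, dist_eq_norm]
  rcases le_total ‖y‖ ‖x‖ with hle | hle
  · exact key x y hx hle
  · rw [norm_sub_rev, norm_sub_rev x]
    exact key y x hy hle

/-- At the origin, the bound of `G z` by a multiple of `‖z‖^q` with `q > 1` forces the derivative to
exist and vanish. -/
theorem IsHomogeneousSmooth.differentiableAt {q : ℝ} {G : ℂ → ℂ} (h : IsHomogeneousSmooth q G)
    (hq : 1 < q) (z : ℂ) : DifferentiableAt ℝ G z := by
  rcases eq_or_ne z 0 with rfl | hz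
  · obtain ⟨M, hM0, hM⟩ := norm_le_of_homogeneous h.continuousOn h.map_smul
    have G0 := h.map_zero (by linarith)
    have : HasFDerivAt G (0 : ℂ →L[ℝ] ℂ) 0 := by
      rw [hasFDerivAt_iff_isLittleO_nhds_zero]
      simp only [zero_add, G0, sub_zero, _root_.zero_apply]
      have h1 : (fun z : ℂ => G z) =O[𝓝 0] fun z : ℂ => ‖z‖ ^ q := by
        refine Asymptotics.IsBigO.of_bound M (Eventually.of_forall fun z => ?_)
        rw [Real.norm_of_nonneg (by positivity)]
        rcases eq_or_ne z 0 with rfl | hz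
        · rw [G0, norm_zero, Real.zero_rpow (by linarith), mul_zero]
        · exact hM z hz
      refine h1.trans_isLittleO ?_
      have h2 : Tendsto (fun z : ℂ => ‖z‖ ^ (q - 1)) (𝓝 0) (𝓝 0) := by
        have : Continuous fun z : ℂ => ‖z‖ ^ (q - 1) :=
          continuous_norm.rpow_const fun z => Or.inr (by linarith)
        have h3 := this.tendsto 0
        rwa [norm_zero, Real.zero_rpow (by linarith)] at h3
      rw [Asymptotics.isLittleO_iff]
      intro c hc
      filter_upwards [h2.eventually (gt_mem_nhds hc)] with z hz
      rw [Real.norm_of_nonneg (by positivity)]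
      rcases eq_or_ne z 0 with rfl | hz0
      · rw [norm_zero, Real.zero_rpow (by linarith), mul_zero]
      · have hz' : 0 < ‖z‖ := norm_pos_iff.2 hz0
        have e : ‖z‖ ^ q = ‖z‖ ^ (q - 1) * ‖z‖ := by
          rw [Real.rpow_sub_one hz'.ne']; field_simp
        rw [e]
        gcongr
    exact this.differentiableAt
  · exact (h.contDiffAt z hz).differentiableAt (by simp)

/-- Each Wirtinger derivative is again smooth off the origin and homogeneous, of degree `q - 1`. The
last one must have degree at least `1` to be locally Lipschitz, whence `j + 1 ≤ q`. -/
theorem IsHomogeneousSmooth.isC : ∀ {j : ℕ} {q : ℝ} {G : ℂ → ℂ}, (j : ℝ) + 1 ≤ q →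
    IsHomogeneousSmooth q G → IsC j G := by
  intro j
  induction j with
  | zero => intro q G hq h; exact h.isC_zero (by simpa using hq)
  | succ j ih =>
    intro q G hq h
    push_cast at hq
    have hj0 : (0 : ℝ) ≤ j := Nat.cast_nonneg j
    have cd : ∀ z ≠ 0, ContDiffAt ℝ ∞ (fderiv ℝ G) z := fun z hz =>
      (h.contDiffAt z hz).fderiv_right (by simp)
    refine ⟨dz G, dzbar G, ih (q := q - 1) (by linarith) ⟨fun z hz => ?_, fun t ht z => ?_⟩,
      ih (q := q - 1) (by linarith) ⟨fun z hz => ?_, fun t ht z => ?_⟩,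
      fun z => hasFDerivAt_dz (h.differentiableAt (by linarith) z)⟩
    · have := cd z hz
      unfold dz; fun_prop
    · rw [dz, h.fderiv_smul ht]
      simp only [dz, _root_.smul_apply, Complex.real_smul]
      ring
    · have := cd z hz
      unfold dzbar; fun_prop
    · rw [dzbar, h.fderiv_smul ht]
      simp only [dzbar, _root_.smul_apply, Complex.real_smul]
      ring

/-- The function `|z|^{ν-1} z`. -/
noncomputable def powFun (ν : ℝ) (z : ℂ) : ℂ := ((‖z‖ ^ (ν - 1) : ℝ) : ℂ) * z

theorem powFun_zero (ν : ℝ) : powFun ν 0 = 0 := by simp [powFun]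

theorem powerNonlinearity_eq {d : ℕ} (ν : ℝ) (f : L2 d) :
    powerNonlinearity ν f = compL2 (powFun ν) f := rfl

theorem isHomogeneousSmooth_powFun (ν : ℝ) : IsHomogeneousSmooth ν (powFun ν) := by
  refine ⟨fun z hz => ?_, fun t ht z => ?_⟩
  · have h1 : ContDiffAt ℝ ∞ (fun z : ℂ => ‖z‖ ^ (ν - 1)) z :=
      (contDiffAt_norm ℝ hz).rpow_const_of_ne (norm_ne_zero_iff.2 hz)
    have h2 : ContDiffAt ℝ ∞ (fun z : ℂ => ((‖z‖ ^ (ν - 1) : ℝ) : ℂ)) z :=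
      Complex.ofRealCLM.contDiff.contDiffAt.comp z h1
    exact h2.mul contDiffAt_id
  · rcases eq_or_ne z 0 with rfl | hz
    · simp [powFun]
    rw [powFun, norm_smul, Real.norm_of_nonneg ht.le, powFun, Complex.real_smul,
      Complex.real_smul, Real.mul_rpow ht.le (norm_nonneg _), Real.rpow_sub_one ht.ne']
    have : (t : ℂ) ≠ 0 := Complex.ofReal_ne_zero.2 ht.ne'
    push_cast
    field_simp

/-- For odd `ν` the function `|z|^{ν-1} z` is a polynomial in `z` and its conjugate. In the other
case it is homogeneous of degree `ν ≥ k + 1`, and an integer `k > d/2` is at least `d / 2 + 1` in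
natural-number division. -/
theorem isC_powFun {d : ℕ} {ν : ℝ}
    (hreg : (∃ m : ℕ, ν = 2 * (m : ℝ) + 1) ∨ ∃ k : ℕ, (d : ℝ) / 2 < k ∧ (k : ℝ) + 1 ≤ ν) :
    IsC (d / 2 + 1) (powFun ν) := by
  rcases hreg with ⟨m, rfl⟩ | ⟨k, hk, hν⟩
  · refine isC_of_contDiff ?_
    have e : powFun (2 * (m : ℝ) + 1) = fun z : ℂ => (((‖z‖ ^ 2) ^ m : ℝ) : ℂ) * z := by
      funext z
      rw [powFun, add_sub_cancel_right, ← pow_mul, ← Real.rpow_natCast]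
      push_cast
      rfl
    rw [e]
    have h1 : ContDiff ℝ ∞ fun z : ℂ => (‖z‖ ^ 2) ^ m := (contDiff_norm_sq ℝ).pow m
    exact (Complex.ofRealCLM.contDiff.comp h1).mul contDiff_id
  · refine (isHomogeneousSmooth_powFun ν).isC ?_
    have h1 : d < 2 * k := by
      have : (d : ℝ) < 2 * k := by linarith
      exact_mod_cast this
    have h2 : d / 2 + 1 ≤ k := by omega
    have h3 : ((d / 2 + 1 : ℕ) : ℝ) ≤ k := by exact_mod_cast h2
    linarith

theorem half_lt_index (d : ℕ) : (d : ℝ) / 2 < (d / 2 + 1 : ℕ) := by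
  have : d < 2 * (d / 2 + 1) := by omega
  have : (d : ℝ) < 2 * ((d / 2 + 1 : ℕ) : ℝ) := by exact_mod_cast this
  linarith

theorem index_le_half (d : ℕ) : ((d / 2 + 1 : ℕ) : ℝ) ≤ (d : ℝ) / 2 + 1 := by
  have : 2 * (d / 2 + 1) ≤ d + 2 := by omega
  have : 2 * ((d / 2 + 1 : ℕ) : ℝ) ≤ d + 2 := by exact_mod_cast this
  linarith

/-- The bound `ν ≥ 2` is what puts differences of the nonlinearity in `L¹`, for the argument at low
frequencies. -/
theorem two_le_of_regular {d : ℕ} (hd : 1 ≤ d) {ν : ℝ} (hν : 1 < ν)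
    (hreg : (∃ m : ℕ, ν = 2 * (m : ℝ) + 1) ∨ ∃ k : ℕ, (d : ℝ) / 2 < k ∧ (k : ℝ) + 1 ≤ ν) :
    2 ≤ ν := by
  rcases hreg with ⟨m, rfl⟩ | ⟨k, hk, h⟩
  · have h1 : (0 : ℝ) < m := by linarith
    have h2 : (1 : ℝ) ≤ m := by exact_mod_cast Nat.cast_pos.1 h1
    linarith
  · have h0 : (1 : ℝ) ≤ d := by exact_mod_cast hd
    have h1 : (0 : ℝ) < k := by linarith
    have h2 : (1 : ℝ) ≤ k := by exact_mod_cast Nat.cast_pos.1 h1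
    linarith

end

/-! ## The half-wave group and mild solutions -/

theorem norm_exp_sub_exp_le (a b : ℝ) :
    ‖Complex.exp (Complex.I * (a : ℂ)) - Complex.exp (Complex.I * (b : ℂ))‖ ≤ |a - b| := by
  have e : Complex.exp (Complex.I * (a : ℂ)) - Complex.exp (Complex.I * (b : ℂ)) =
      Complex.exp (Complex.I * (b : ℂ)) * (Complex.exp (Complex.I * ((a - b : ℝ) : ℂ)) - 1) := by
    rw [mul_sub, ← Complex.exp_add, mul_one]
    congr 2
    push_cast; ring
  rw [e, norm_mul, mul_comm Complex.I (b : ℂ), Complex.norm_exp_ofReal_mul_I, one_mul]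
  exact Real.norm_exp_I_mul_ofReal_sub_one_le

theorem sobolevNorm_halfWave_sub_le {d : ℕ} (s t t₀ : ℝ) (f : L2 d) :
    sobolevNorm s (halfWave t f - halfWave t₀ f) ≤
      ENNReal.ofReal |t - t₀| * sobolevNorm (s + 1) f := by
  refine ennreal_le_of_sq_le ?_
  rw [mul_pow, sobolevNorm_sq, sobolevNorm_sq,
    ← lintegral_const_mul' _ _ (ENNReal.pow_ne_top ENNReal.ofReal_ne_top)]
  refine lintegral_mono_ae ?_
  filter_upwards [fourier_sub_ae (halfWave t f) (halfWave t₀ f), fourier_halfWave t f,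
    fourier_halfWave t₀ f] with ξ h1 h2 h3
  rw [h1, h2, h3, ← sub_mul, enorm_mul, mul_pow, ← mul_assoc, ← mul_assoc (_ ^ 2)]
  refine mul_le_mul_left ?_ _
  have hw := weight_pos ξ
  rw [← ofReal_norm, ← ENNReal.ofReal_pow (norm_nonneg _), ← ENNReal.ofReal_pow (abs_nonneg _),
    ← ENNReal.ofReal_mul (Real.rpow_nonneg hw.le _), ← ENNReal.ofReal_mul (by positivity)]
  refine ENNReal.ofReal_le_ofReal ?_
  have h4 := norm_exp_sub_exp_le (t * (2 * Real.pi * ‖ξ‖)) (t₀ * (2 * Real.pi * ‖ξ‖))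
  rw [← sub_mul, abs_mul, abs_of_nonneg (by positivity : 0 ≤ 2 * Real.pi * ‖ξ‖)] at h4
  have h5 : (2 * Real.pi * ‖ξ‖) ^ 2 ≤ weight ξ := by unfold weight; linarith
  rw [Real.rpow_add hw, Real.rpow_one]
  calc weight ξ ^ s * _ ≤ weight ξ ^ s * (|t - t₀| * (2 * Real.pi * ‖ξ‖)) ^ 2 := by gcongr
    _ = weight ξ ^ s * (|t - t₀| ^ 2 * (2 * Real.pi * ‖ξ‖) ^ 2) := by rw [mul_pow]
    _ ≤ weight ξ ^ s * (|t - t₀| ^ 2 * weight ξ) := by gcongr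
    _ = _ := by ring

theorem halfWave_sub {d : ℕ} (t : ℝ) (f g : L2 d) :
    halfWave t (f - g) = halfWave t f - halfWave t g := map_sub (halfWaveL t) f g

theorem halfWave_smul {d : ℕ} (t : ℝ) (c : ℂ) (f : L2 d) :
    halfWave t (c • f) = c • halfWave t f := map_smul (halfWaveL t) c f

/-- Unitarity reduces strong continuity to Schwartz functions, for which
`sobolevNorm_halfWave_sub_le` is a Lipschitz bound in time. -/
theorem continuous_halfWave_left {d : ℕ} (f : L2 d) : Continuous fun t => halfWave t f := by
  rw [Metric.continuous_iff]
  intro t₀ ε hε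
  obtain ⟨φ, hφ⟩ := denseRange_schwartzL2.exists_dist_lt f (by positivity : 0 < ε / 4)
  have hN := sobolevNorm_schwartzL2_lt_top (d := d) 1 φ
  set M := (sobolevNorm 1 (schwartzL2 φ)).toReal
  refine ⟨ε / (4 * (M + 1)), by positivity, fun t ht => ?_⟩
  rw [Real.dist_eq] at ht
  rw [dist_eq_norm] at hφ ⊢
  have h1 : ‖halfWave t (schwartzL2 φ) - halfWave t₀ (schwartzL2 φ)‖ ≤ |t - t₀| * M := by
    have := sobolevNorm_halfWave_sub_le 0 t t₀ (schwartzL2 φ)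
    rw [sobolevNorm_zero_left, zero_add] at this
    have h2 := ENNReal.toReal_mono (ENNReal.mul_lt_top ENNReal.ofReal_lt_top hN).ne this
    rwa [toReal_enorm, ENNReal.toReal_mul, ENNReal.toReal_ofReal (abs_nonneg _)] at h2
  have h2 : |t - t₀| * M ≤ ε / 4 := by
    calc |t - t₀| * M ≤ ε / (4 * (M + 1)) * (M + 1) := by gcongr; linarith
      _ = ε / 4 := by
        have : 0 < M + 1 := by positivity
        field_simp
  have e : halfWave t f - halfWave t₀ f = halfWave t (f - schwartzL2 φ) +
      (halfWave t (schwartzL2 φ) - halfWave t₀ (schwartzL2 φ)) -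
        halfWave t₀ (f - schwartzL2 φ) := by
    rw [halfWave_sub, halfWave_sub]; abel
  rw [e]
  refine (norm_sub_le _ _).trans_lt ?_
  refine (add_le_add_left (norm_add_le _ _) _).trans_lt ?_
  rw [norm_halfWave, norm_halfWave]
  linarith

theorem continuous_halfWave {d : ℕ} : Continuous fun p : ℝ × L2 d => halfWave p.1 p.2 := by
  rw [continuous_iff_continuousAt]
  rintro ⟨t₀, f₀⟩
  have h1 := ((continuous_halfWave_left f₀).comp continuous_fst).tendsto ((t₀, f₀) : ℝ × L2 d)
  have h2 : Tendsto (fun p : ℝ × L2 d => ‖p.2 - f₀‖) (𝓝 (t₀, f₀)) (𝓝 0) := by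
    have : Continuous fun p : ℝ × L2 d => ‖p.2 - f₀‖ := by fun_prop
    simpa using this.tendsto (t₀, f₀)
  have h3 : Tendsto (fun p : ℝ × L2 d => halfWave p.1 (p.2 - f₀)) (𝓝 (t₀, f₀)) (𝓝 0) := by
    rw [tendsto_zero_iff_norm_tendsto_zero]
    simpa only [norm_halfWave] using h2
  have h4 := h3.add h1
  simp only [Function.comp_apply, zero_add] at h4
  refine h4.congr fun p => ?_
  rw [halfWave_sub, sub_add_cancel]

/-! ### Gronwall's inequality and Duhamel's formula -/

theorem gronwall_integral {e : ℝ → ℝ} {T a K : ℝ} (hK : 0 ≤ K) (he : ContinuousOn e (Icc 0 T))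
    (h : ∀ t ∈ Icc 0 T, e t ≤ a + K * ∫ τ in (0 : ℝ)..t, e τ) :
    ∀ t ∈ Icc 0 T, e t ≤ a * Real.exp (K * t) := by
  intro t ht
  have hT : 0 ≤ T := ht.1.trans ht.2
  -- Extending `e` by constants makes the primitive `E` differentiable on all of `ℝ`, which avoids
  -- one-sided derivatives at the end points.
  set e' : ℝ → ℝ := IccExtend hT (domRestrict (Icc 0 T) e) with he'
  have hc : Continuous e' := (continuousOn_iff_continuous_domRestrict.1 he).Icc_extend'
  have heq : ∀ x ∈ Icc 0 T, e' x = e x := fun x hx => IccExtend_of_mem hT _ hx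
  have hint : ∀ x ∈ Icc 0 T, ∫ τ in (0 : ℝ)..x, e' τ = ∫ τ in (0 : ℝ)..x, e τ := by
    intro x hx
    refine intervalIntegral.integral_congr fun τ hτ => ?_
    rw [uIcc_of_le hx.1] at hτ
    exact heq τ ⟨hτ.1, hτ.2.trans hx.2⟩
  set E : ℝ → ℝ := fun t => a + K * ∫ τ in (0 : ℝ)..t, e' τ
  have hd : ∀ x, HasDerivAt E (K * e' x) x := fun x =>
    ((hc.integral_hasStrictDerivAt 0 x).hasDerivAt.const_mul K).const_add a
  have hb : ∀ x ∈ Icc 0 T, e' x ≤ E x := fun x hx => by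
    rw [heq x hx]; simp only [E]; rw [hint x hx]; exact h x hx
  have := le_gronwallBound_of_liminf_deriv_right_le (f := E) (f' := fun x => K * e' x) (δ := a)
    (K := K) (ε := 0) (a := 0) (b := T) (fun x _ => (hd x).continuousAt.continuousWithinAt)
    (fun x _ r hr => (hd x).hasDerivWithinAt.liminf_right_slope_le hr) (by simp [E])
    (fun x hx => by
      rw [add_zero]
      exact mul_le_mul_of_nonneg_left (hb x ⟨hx.1, hx.2.le⟩) hK) t ht
  rw [sub_zero, gronwallBound_ε0] at this
  rw [← heq t ht]
  exact (hb t ht).trans this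

/-- The right-hand side of Duhamel's formula for the equation with the free evolution
`t ↦ halfWave (δ t)` and the nonlinearity `N`. -/
noncomputable def duhamel {d : ℕ} (δ : ℝ) (N : L2 d → L2 d) (u₀ : L2 d) (u : ℝ → L2 d) (t : ℝ) :
    L2 d :=
  halfWave (δ * t) u₀ + ∫ τ in (0 : ℝ)..t, halfWave (δ * (t - τ)) (N (u τ))

/-- Mild solutions on `[0,T]`. -/
def IsMild {d : ℕ} (δ T : ℝ) (N : L2 d → L2 d) (u₀ : L2 d) (u : ℝ → L2 d) : Prop :=
  ∀ t ∈ Icc 0 T, u t = duhamel δ N u₀ u t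

theorem continuousOn_duhamel_integrand {d : ℕ} {δ T : ℝ} {w : ℝ → L2 d}
    (hw : ContinuousOn w (Icc 0 T)) (t : ℝ) :
    ContinuousOn (fun τ => halfWave (δ * (t - τ)) (w τ)) (Icc 0 T) :=
  (continuous_halfWave (d := d)).comp_continuousOn (f := fun τ => (δ * (t - τ), w τ))
    (ContinuousOn.prodMk (Continuous.continuousOn (by fun_prop)) hw)

theorem intervalIntegrable_duhamel {d : ℕ} {δ T : ℝ} {w : ℝ → L2 d}
    (hw : ContinuousOn w (Icc 0 T)) {t : ℝ} (ht : t ∈ Icc 0 T) (r : ℝ) :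
    IntervalIntegrable (fun τ => halfWave (δ * (r - τ)) (w τ)) volume 0 t := by
  refine ContinuousOn.intervalIntegrable ?_
  rw [uIcc_of_le ht.1]
  exact (continuousOn_duhamel_integrand hw r).mono (Icc_subset_Icc_right ht.2)

theorem norm_duhamel_sub_le {d : ℕ} {δ T K : ℝ} {N : L2 d → L2 d} {u₀ : L2 d} {u v : ℝ → L2 d}
    (hu : ContinuousOn u (Icc 0 T)) (hv : ContinuousOn v (Icc 0 T))
    (hNu : ContinuousOn (fun t => N (u t)) (Icc 0 T))
    (hNv : ContinuousOn (fun t => N (v t)) (Icc 0 T))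
    (hN : ∀ t ∈ Icc 0 T, ‖N (u t) - N (v t)‖ ≤ K * ‖u t - v t‖) {t : ℝ} (ht : t ∈ Icc 0 T) :
    ‖duhamel δ N u₀ u t - duhamel δ N u₀ v t‖ ≤ K * ∫ τ in (0 : ℝ)..t, ‖u τ - v τ‖ := by
  rw [duhamel, duhamel, add_sub_add_left_eq_sub, ← intervalIntegral.integral_sub
    (intervalIntegrable_duhamel hNu ht t) (intervalIntegrable_duhamel hNv ht t),
    ← intervalIntegral.integral_const_mul]
  refine intervalIntegral.norm_integral_le_of_norm_le ht.1 ?_ ?_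
  · refine Eventually.of_forall fun τ hτ => ?_
    rw [← halfWave_sub, norm_halfWave]
    exact hN τ ⟨hτ.1.le, hτ.2.trans ht.2⟩
  · refine ContinuousOn.intervalIntegrable ?_
    rw [uIcc_of_le ht.1]
    exact ((hu.sub hv).norm.const_mul K |>.mono (Icc_subset_Icc_right ht.2))

/-- Gronwall for two approximate solutions. The Lipschitz bound is required only along the two
curves, so it serves both globally Lipschitz maps and solutions that are bounded in `H^s`. -/
theorem norm_sub_le_of_approx {d : ℕ} {δ T K η₁ η₂ : ℝ} {N : L2 d → L2 d} {u₀ : L2 d}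
    {u v : ℝ → L2 d} (hK : 0 ≤ K)
    (hu : ContinuousOn u (Icc 0 T)) (hv : ContinuousOn v (Icc 0 T))
    (hNu : ContinuousOn (fun t => N (u t)) (Icc 0 T))
    (hNv : ContinuousOn (fun t => N (v t)) (Icc 0 T))
    (hN : ∀ t ∈ Icc 0 T, ‖N (u t) - N (v t)‖ ≤ K * ‖u t - v t‖)
    (h₁ : ∀ t ∈ Icc 0 T, ‖u t - duhamel δ N u₀ u t‖ ≤ η₁)
    (h₂ : ∀ t ∈ Icc 0 T, ‖v t - duhamel δ N u₀ v t‖ ≤ η₂) :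
    ∀ t ∈ Icc 0 T, ‖u t - v t‖ ≤ (η₁ + η₂) * Real.exp (K * t) := by
  refine gronwall_integral hK (hu.sub hv).norm fun t ht => ?_
  have e : u t - v t = (u t - duhamel δ N u₀ u t) - (v t - duhamel δ N u₀ v t) +
      (duhamel δ N u₀ u t - duhamel δ N u₀ v t) := by abel
  rw [e]
  exact (norm_add_le _ _).trans (add_le_add ((norm_sub_le _ _).trans
    (add_le_add (h₁ t ht) (h₂ t ht))) (norm_duhamel_sub_le hu hv hNu hNv hN ht))

theorem halfWave_integral {d : ℕ} (r a b : ℝ) (f : ℝ → L2 d) (hf : IntervalIntegrable f volume a b) :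
    halfWave r (∫ τ in a..b, f τ) = ∫ τ in a..b, halfWave r (f τ) :=
  ((halfWaveL r).intervalIntegral_comp_comm hf).symm

/-- In the interaction picture `w(t) = e^{-iδtΛ} u(t)` the unbounded generator disappears, and the
equation is an ordinary differential equation in `L²` with a bounded, globally Lipschitz field.
Picard–Lindelöf then covers the whole interval. -/
theorem exists_isMild_of_bounded {d : ℕ} (δ : ℝ) {T : ℝ} (hT : 0 ≤ T) {N : L2 d → L2 d}
    {C K : ℝ≥0} (hC : ∀ f, ‖N f‖ ≤ C) (hK : LipschitzWith K N) (u₀ : L2 d) :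
    ∃ u : ℝ → L2 d, ContinuousOn u (Icc 0 T) ∧ IsMild δ T N u₀ u := by
  set f : ℝ → L2 d → L2 d := fun t w => halfWave (-(δ * t)) (N (halfWave (δ * t) w)) with hf
  have hpl : IsPicardLindelof f (⟨0, le_rfl, hT⟩ : Icc 0 T) u₀ (C * T.toNNReal) 0 C K := by
    refine ⟨fun t _ => LipschitzWith.lipschitzOnWith ?_, fun x _ => Continuous.continuousOn ?_,
      fun t _ x _ => ?_, ?_⟩
    · refine LipschitzWith.of_dist_le_mul fun x y => ?_
      rw [dist_eq_norm, dist_eq_norm, hf]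
      simp only
      rw [← halfWave_sub, norm_halfWave, ← norm_halfWave (δ * t) (x - y), halfWave_sub,
        ← dist_eq_norm, ← dist_eq_norm]
      exact hK.dist_le_mul _ _
    · have h1 : Continuous fun t => halfWave (δ * t) x :=
        (continuous_halfWave_left x).comp (by fun_prop)
      exact continuous_halfWave.comp
        ((by fun_prop : Continuous fun t : ℝ => -(δ * t)).prodMk (hK.continuous.comp h1))
    · rw [hf]; simp only [norm_halfWave]; exact hC _
    · simp [hT]
  obtain ⟨w, hw0, hw⟩ := hpl.exists_eq_forall_mem_Icc_hasDerivWithinAt₀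
  have hw0 : w 0 = u₀ := hw0
  have hwc : ContinuousOn w (Icc 0 T) := fun t ht => (hw t ht).continuousWithinAt
  have huc : ContinuousOn (fun t => halfWave (δ * t) (w t)) (Icc 0 T) :=
    (continuous_halfWave (d := d)).comp_continuousOn (f := fun t => (δ * t, w t))
      (ContinuousOn.prodMk (Continuous.continuousOn (by fun_prop)) hwc)
  have hfc : ContinuousOn (fun t => f t (w t)) (Icc 0 T) :=
    (continuous_halfWave (d := d)).comp_continuousOn
      (f := fun t => (-(δ * t), N (halfWave (δ * t) (w t))))
      (ContinuousOn.prodMk (Continuous.continuousOn (by fun_prop))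
        (hK.continuous.comp_continuousOn huc))
  refine ⟨fun t => halfWave (δ * t) (w t), huc, fun t ht => ?_⟩
  have hsub : Icc 0 t ⊆ Icc 0 T := Icc_subset_Icc_right ht.2
  have hii : IntervalIntegrable (fun τ => f τ (w τ)) volume 0 t := by
    refine ContinuousOn.intervalIntegrable ?_
    rw [uIcc_of_le ht.1]
    exact hfc.mono hsub
  have h1 := intervalIntegral.integral_eq_sub_of_hasDerivAt_of_le ht.1 (hwc.mono hsub)
    (fun x hx => (hw x (hsub (Ioo_subset_Icc_self hx))).hasDerivAt
      (Icc_mem_nhds hx.1 (hx.2.trans_le ht.2))) hii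
  have h2 : w t = u₀ + ∫ τ in (0 : ℝ)..t, f τ (w τ) := by rw [h1, hw0]; abel
  simp only [duhamel]
  conv_lhs => rw [h2]
  rw [← halfWaveL_apply, map_add, halfWaveL_apply, halfWaveL_apply, halfWave_integral _ _ _ _ hii]
  congr 1
  refine intervalIntegral.integral_congr fun τ _ => ?_
  simp only [hf]
  rw [← halfWave_add]
  congr 1
  ring

/-! ## Stability -/

/-- The radial retraction onto the closed ball of radius `ρ`. -/
noncomputable def ballRetraction {E : Type*} [NormedAddCommGroup E] [NormedSpace ℝ E] (ρ : ℝ)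
    (x : E) : E := (ρ / max ρ ‖x‖) • x

theorem ballRetraction_of_norm_le {E : Type*} [NormedAddCommGroup E] [NormedSpace ℝ E] {ρ : ℝ}
    (hρ : 0 < ρ) {x : E} (hx : ‖x‖ ≤ ρ) : ballRetraction ρ x = x := by
  rw [ballRetraction, max_eq_left hx, div_self hρ.ne', one_smul]

theorem norm_ballRetraction_le {E : Type*} [NormedAddCommGroup E] [NormedSpace ℝ E] {ρ : ℝ}
    (hρ : 0 < ρ) (x : E) : ‖ballRetraction ρ x‖ ≤ ρ := by
  have hm : 0 < max ρ ‖x‖ := lt_max_of_lt_left hρ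
  rw [ballRetraction, norm_smul, Real.norm_of_nonneg (by positivity), div_mul_eq_mul_div,
    div_le_iff₀ hm]
  gcongr
  exact le_max_right _ _

/-- The difference is `(ρ/a)(x - y)` plus a multiple of `y` whose coefficient is controlled because
`max ρ ‖·‖` is 1-Lipschitz; each term is at most `‖x - y‖`. -/
theorem norm_ballRetraction_sub_le {E : Type*} [NormedAddCommGroup E] [NormedSpace ℝ E] {ρ : ℝ}
    (hρ : 0 < ρ) (x y : E) : ‖ballRetraction ρ x - ballRetraction ρ y‖ ≤ 2 * ‖x - y‖ := by
  set a := max ρ ‖x‖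
  set b := max ρ ‖y‖
  have ha : 0 < a := lt_max_of_lt_left hρ
  have hb : 0 < b := lt_max_of_lt_left hρ
  have e : ballRetraction ρ x - ballRetraction ρ y =
      (ρ / a) • (x - y) + (ρ / a * ((b - a) / b)) • y := by
    have : ρ / a * ((b - a) / b) = ρ / a - ρ / b := by field_simp
    rw [this, smul_sub, sub_smul, ballRetraction, ballRetraction]
    abel
  have h1 : ρ / a ≤ 1 := (div_le_one ha).2 (le_max_left _ _)
  have h2 : |b - a| ≤ ‖x - y‖ := by
    refine (abs_max_sub_max_le_max _ _ _ _).trans ?_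
    rw [sub_self, abs_zero, max_eq_right (abs_nonneg _), norm_sub_rev]
    exact abs_norm_sub_norm_le _ _
  have h3 : ‖y‖ ≤ b := le_max_right _ _
  rw [e]
  refine (norm_add_le _ _).trans ?_
  rw [norm_smul, norm_smul, norm_mul, norm_div, norm_div, Real.norm_of_nonneg hρ.le,
    Real.norm_of_nonneg ha.le, Real.norm_of_nonneg hb.le, Real.norm_eq_abs]
  have h4 : ρ / a * ‖x - y‖ ≤ 1 * ‖x - y‖ := by gcongr
  have h5 : ρ / a * (|b - a| / b) * ‖y‖ ≤ 1 * (‖x - y‖ / b) * b := by gcongr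
  have h6 : 1 * (‖x - y‖ / b) * b = ‖x - y‖ := by field_simp
  linarith

/-- Lipschitz continuity on bounded sets. -/
def LipOnBalls {d : ℕ} (N : L2 d → L2 d) (K : ℝ → ℝ) : Prop :=
  ∀ R x y, ‖x‖ ≤ R → ‖y‖ ≤ R → ‖N x - N y‖ ≤ K R * ‖x - y‖

theorem LipOnBalls.continuousOn {d : ℕ} {N : L2 d → L2 d} {K : ℝ → ℝ} (hN : LipOnBalls N K)
    {T R : ℝ} {u : ℝ → L2 d} (hu : ContinuousOn u (Icc 0 T)) (hR : ∀ t ∈ Icc 0 T, ‖u t‖ ≤ R) :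
    ContinuousOn (fun t => N (u t)) (Icc 0 T) := by
  intro t ht
  have h1 := (tendsto_iff_norm_sub_tendsto_zero.1 (hu t ht)).const_mul (K R)
  rw [mul_zero] at h1
  refine tendsto_iff_norm_sub_tendsto_zero.2 (squeeze_zero' (Eventually.of_forall fun _ =>
    norm_nonneg _) ?_ h1)
  filter_upwards [self_mem_nhdsWithin] with r hr
  exact hN R _ _ (hR r hr) (hR t ht)

/-- Composition with the retraction makes a map that is Lipschitz on balls bounded and globally
Lipschitz without changing it on the ball of radius `ρ`, so the modified equation is solvable on all
of `[0,T]`. -/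
theorem exists_truncated {d : ℕ} {N : L2 d → L2 d} {K : ℝ → ℝ} (hN : LipOnBalls N K) (δ : ℝ)
    {T ρ : ℝ} (hT : 0 ≤ T) (hρ : 0 < ρ) (hK : 0 ≤ K ρ) (u₀ : L2 d) :
    ∃ M : L2 d → L2 d, (∀ x, ‖x‖ ≤ ρ → M x = N x) ∧ (∀ x y, ‖M x - M y‖ ≤ 2 * K ρ * ‖x - y‖) ∧
      ∃ u : ℝ → L2 d, ContinuousOn u (Icc 0 T) ∧ IsMild δ T M u₀ u := by
  have h1 : ∀ x y, ‖N (ballRetraction ρ x) - N (ballRetraction ρ y)‖ ≤ 2 * K ρ * ‖x - y‖ := by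
    intro x y
    refine (hN ρ _ _ (norm_ballRetraction_le hρ x) (norm_ballRetraction_le hρ y)).trans ?_
    have := mul_le_mul_of_nonneg_left (norm_ballRetraction_sub_le hρ x y) hK
    linarith
  refine ⟨fun x => N (ballRetraction ρ x),
    fun x hx => congrArg N (ballRetraction_of_norm_le hρ hx), h1, exists_isMild_of_bounded δ hT (C := (‖N 0‖ + K ρ * ρ).toNNReal)
    (K := (2 * K ρ).toNNReal) (fun f => ?_) (LipschitzWith.of_dist_le_mul fun x y => ?_) u₀⟩
  · have h2 := hN ρ (ballRetraction ρ f) 0 (norm_ballRetraction_le hρ f) (by simpa using hρ.le)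
    rw [sub_zero] at h2
    have h3 := norm_ballRetraction_le hρ f
    have h4 : ‖N (ballRetraction ρ f)‖ ≤ ‖N 0‖ + ‖N (ballRetraction ρ f) - N 0‖ := by
      have := norm_add_le (N 0) (N (ballRetraction ρ f) - N 0)
      rwa [add_sub_cancel] at this
    have h5 := mul_le_mul_of_nonneg_left h3 hK
    exact le_trans (by linarith) (Real.le_coe_toNNReal _)
  · rw [Real.coe_toNNReal _ (by positivity), dist_eq_norm, dist_eq_norm]
    exact h1 x y

/-- A curve `U` with small defect is shadowed by a true solution. Truncate at radius `R + 1`: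
Gronwall keeps the solution of the truncated equation within `1` of `U`, so the truncation is never
felt. Continuous dependence, the limit of small dispersion and short-time existence are all
instances. -/
theorem exists_mild_near {d : ℕ} {N : L2 d → L2 d} {K : ℝ → ℝ} (hN : LipOnBalls N K) {δ T R η : ℝ}
    (hT : 0 ≤ T) (hR : 0 ≤ R) (hK : 0 ≤ K (R + 1)) {u₀ : L2 d} {U : ℝ → L2 d}
    (hU : ContinuousOn U (Icc 0 T)) (hUR : ∀ t ∈ Icc 0 T, ‖U t‖ ≤ R) (hη0 : 0 ≤ η)
    (hη : ∀ t ∈ Icc 0 T, ‖U t - duhamel δ N u₀ U t‖ ≤ η)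
    (hsmall : η * Real.exp (2 * K (R + 1) * T) ≤ 1) :
    ∃ u : ℝ → L2 d, ContinuousOn u (Icc 0 T) ∧ IsMild δ T N u₀ u ∧
      ∀ t ∈ Icc 0 T, ‖u t - U t‖ ≤ η * Real.exp (2 * K (R + 1) * T) := by
  have hρ : 0 < R + 1 := by linarith
  obtain ⟨M, hM, hL, u, huc, hu⟩ := exists_truncated hN δ hT hρ hK u₀
  have hLc : Continuous M := by
    refine LipschitzWith.continuous (K := (2 * K (R + 1)).toNNReal)
      (LipschitzWith.of_dist_le_mul fun x y => ?_)
    rw [Real.coe_toNNReal _ (by positivity), dist_eq_norm, dist_eq_norm]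
    exact hL x y
  have congrD : ∀ {v : ℝ → L2 d}, (∀ t ∈ Icc 0 T, ‖v t‖ ≤ R + 1) → ∀ t ∈ Icc 0 T,
      duhamel δ M u₀ v t = duhamel δ N u₀ v t := by
    intro v hv t ht
    unfold duhamel
    congr 1
    refine intervalIntegral.integral_congr fun τ hτ => ?_
    rw [uIcc_of_le ht.1] at hτ
    rw [hM _ (hv τ ⟨hτ.1, hτ.2.trans ht.2⟩)]
  have h1 := norm_sub_le_of_approx (N := M) (δ := δ) (η₁ := 0) (η₂ := η) (u₀ := u₀)
    (by positivity : 0 ≤ 2 * K (R + 1)) huc hU (hLc.comp_continuousOn huc)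
    (hLc.comp_continuousOn hU) (fun t _ => hL _ _)
    (fun t ht => by rw [← hu t ht, sub_self, norm_zero])
    (fun t ht => by
      rw [congrD (fun t ht => (hUR t ht).trans (by linarith)) t ht]; exact hη t ht)
  have h2 : ∀ t ∈ Icc 0 T, ‖u t - U t‖ ≤ η * Real.exp (2 * K (R + 1) * T) := by
    intro t ht
    refine (h1 t ht).trans ?_
    rw [zero_add]
    gcongr
    exact ht.2
  have h3 : ∀ t ∈ Icc 0 T, ‖u t‖ ≤ R + 1 := by
    intro t ht
    have h4 := norm_add_le (U t) (u t - U t)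
    rw [add_sub_cancel] at h4
    have := hUR t ht
    have := h2 t ht
    linarith
  exact ⟨u, huc, fun t ht => (hu t ht).trans (congrD h3 t ht), h2⟩

/-! ## The Cauchy problem in Sobolev spaces -/

/-- The least integer above `d / 2`. -/
abbrev idx (d : ℕ) : ℕ := d / 2 + 1

/-- The right-hand side of the equation, including the constant `iμ`. -/
noncomputable def nl {d : ℕ} (μ ν : ℝ) (f : L2 d) : L2 d :=
  (Complex.I * (μ : ℂ)) • powerNonlinearity ν f

theorem norm_I_mul {μ : ℝ} (hμ : μ = 1 ∨ μ = -1) : ‖Complex.I * (μ : ℂ)‖ = 1 := by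
  rcases hμ with rfl | rfl <;> simp

theorem enorm_I_mul {μ : ℝ} (hμ : μ = 1 ∨ μ = -1) : ‖Complex.I * (μ : ℂ)‖ₑ = 1 := by
  rw [← ofReal_norm, norm_I_mul hμ, ENNReal.ofReal_one]

theorem ContinuousSobolevOn.exists_bessel {d : ℕ} {s T : ℝ} (hs : 0 ≤ s) {u : ℝ → L2 d}
    (h : ContinuousSobolevOn s T u) :
    ∃ x : ℝ → L2 d, ContinuousOn x (Icc 0 T) ∧ ∀ t ∈ Icc 0 T, u t = bessel s (x t) := by
  have h1 : ∀ t, ∃ x, t ∈ Icc 0 T → u t = bessel s x := fun t => by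
    by_cases ht : t ∈ Icc 0 T
    · obtain ⟨x, hx⟩ := exists_bessel_eq hs (h t ht).1
      exact ⟨x, fun _ => hx.symm⟩
    · exact ⟨0, fun h => absurd h ht⟩
  choose x hx using h1
  refine ⟨x, fun t ht => ?_, hx⟩
  rw [ContinuousWithinAt, tendsto_iff_edist_tendsto_0]
  refine (h t ht).2.congr' ?_
  filter_upwards [self_mem_nhdsWithin] with r hr
  rw [hx r hr, hx t ht, ← map_sub, sobolevNorm_bessel hs, edist_eq_enorm_sub]

theorem continuousSobolevOn_bessel {d : ℕ} {s T : ℝ} (hs : 0 ≤ s) {u x : ℝ → L2 d}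
    (hx : ContinuousOn x (Icc 0 T)) (h : ∀ t ∈ Icc 0 T, u t = bessel s (x t)) :
    ContinuousSobolevOn s T u := by
  intro t ht
  refine ⟨by rw [h t ht]; exact sobolevNorm_bessel_lt_top hs _, ?_⟩
  have h1 := tendsto_iff_edist_tendsto_0.1 (hx t ht)
  refine h1.congr' ?_
  filter_upwards [self_mem_nhdsWithin] with r hr
  rw [h r hr, h t ht, ← map_sub, sobolevNorm_bessel hs, edist_eq_enorm_sub]

theorem ContinuousSobolevOn.mono {d : ℕ} {s r T : ℝ} (hsr : s ≤ r) {u : ℝ → L2 d}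
    (h : ContinuousSobolevOn r T u) : ContinuousSobolevOn s T u := fun t ht =>
  ⟨(sobolevNorm_mono hsr _).trans_lt (h t ht).1,
    tendsto_of_tendsto_of_tendsto_of_le_of_le tendsto_const_nhds (h t ht).2
      (fun _ => zero_le) fun _ => sobolevNorm_mono hsr _⟩

theorem ContinuousSobolevOn.restrict {d : ℕ} {s T T' : ℝ} (hT : T' ≤ T) {u : ℝ → L2 d}
    (h : ContinuousSobolevOn s T u) : ContinuousSobolevOn s T' u := fun t ht =>
  ⟨(h t ⟨ht.1, ht.2.trans hT⟩).1,
    (h t ⟨ht.1, ht.2.trans hT⟩).2.mono_left (nhdsWithin_mono _ (Icc_subset_Icc_right hT))⟩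

theorem exists_norm_le_of_continuousOn {d : ℕ} {T : ℝ} {x : ℝ → L2 d}
    (hx : ContinuousOn x (Icc 0 T)) : ∃ R : ℝ, 0 ≤ R ∧ ∀ t ∈ Icc 0 T, ‖x t‖ ≤ R := by
  obtain ⟨R, hR⟩ := isCompact_Icc.exists_bound_of_continuousOn hx
  exact ⟨max R 0, le_max_right _ _, fun t ht => (hR t ht).trans (le_max_left _ _)⟩

theorem ContinuousSobolevOn.exists_bound {d : ℕ} {s T : ℝ} (hs : 0 ≤ s) {u : ℝ → L2 d}
    (h : ContinuousSobolevOn s T u) :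
    ∃ R : ℝ≥0∞, R < ∞ ∧ ∀ t ∈ Icc 0 T, sobolevNorm s (u t) ≤ R := by
  obtain ⟨x, hx, hu⟩ := h.exists_bessel hs
  obtain ⟨R, -, hR⟩ := exists_norm_le_of_continuousOn hx
  refine ⟨ENNReal.ofReal R, ENNReal.ofReal_lt_top, fun t ht => ?_⟩
  rw [hu t ht, sobolevNorm_bessel hs, ← ofReal_norm]
  exact ENNReal.ofReal_le_ofReal (hR t ht)

theorem ContinuousSobolevOn.continuousOn {d : ℕ} {s T : ℝ} (hs : 0 ≤ s) {u : ℝ → L2 d}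
    (h : ContinuousSobolevOn s T u) : ContinuousOn u (Icc 0 T) := by
  obtain ⟨x, hx, hu⟩ := h.exists_bessel hs
  exact ((bessel s).continuous.comp_continuousOn hx).congr hu

theorem continuousOn_comp_of_norm_sub_le {d : ℕ} {N : L2 d → L2 d} {T K : ℝ} {u : ℝ → L2 d}
    (hu : ContinuousOn u (Icc 0 T))
    (h : ∀ r ∈ Icc 0 T, ∀ t ∈ Icc 0 T, ‖N (u r) - N (u t)‖ ≤ K * ‖u r - u t‖) :
    ContinuousOn (fun t => N (u t)) (Icc 0 T) := by
  intro t ht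
  have h1 := (tendsto_iff_norm_sub_tendsto_zero.1 (hu t ht)).const_mul K
  rw [mul_zero] at h1
  refine tendsto_iff_norm_sub_tendsto_zero.2 (squeeze_zero' (Eventually.of_forall fun _ =>
    norm_nonneg _) ?_ h1)
  filter_upwards [self_mem_nhdsWithin] with r hr
  exact h r hr t ht

/-- The data of the Cauchy problem. -/
structure Params (d : ℕ) (μ ν : ℝ) : Prop where
  one_le : 1 ≤ d
  sign : μ = 1 ∨ μ = -1
  one_lt : 1 < ν
  isC : IsC (idx d) (powFun ν)

theorem isNLHWSolution_iff {d : ℕ} {μ ν T : ℝ} {u₀ : L2 d} {u : ℝ → L2 d} :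
    IsNLHWSolution μ ν T u₀ u ↔ (∃ s : ℝ, (d : ℝ) / 2 < s ∧ ContinuousSobolevOn s T u) ∧
      IsMild 1 T (nl μ ν) u₀ u := by
  refine and_congr Iff.rfl (forall₂_congr fun t ht => ?_)
  simp only [duhamel, nl, one_mul, halfWave_smul, intervalIntegral.integral_smul]

theorem Params.exists_lipschitz {d : ℕ} {μ ν : ℝ} (P : Params d μ ν) {s : ℝ}
    (hs : (d : ℝ) / 2 < s) {R : ℝ≥0∞} (hR : R < ∞) :
    ∃ K : ℝ≥0, ∀ u v : L2 d, sobolevNorm s u ≤ R → sobolevNorm s v ≤ R →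
      ‖nl μ ν u - nl μ ν v‖ ≤ K * ‖u - v‖ := by
  obtain ⟨K, hK⟩ := norm_compL2_sub_le hs P.isC.zero (powFun_zero ν) hR
  refine ⟨K, fun u v hu hv => ?_⟩
  rw [nl, nl, ← smul_sub, norm_smul, norm_I_mul P.sign, one_mul]
  exact hK u v hu hv

/-- The difference is estimated in `L²`, with a Lipschitz constant that comes from the common bound
in `H^{min s s'}`; so the two solutions may have different regularity. -/
theorem Params.unique {d : ℕ} {μ ν : ℝ} (P : Params d μ ν) {s s' T δ : ℝ}
    (hs : (d : ℝ) / 2 < s) (hs' : (d : ℝ) / 2 < s') {u₀ : L2 d} {u v : ℝ → L2 d}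
    (hu : ContinuousSobolevOn s T u) (hv : ContinuousSobolevOn s' T v)
    (hu' : IsMild δ T (nl μ ν) u₀ u) (hv' : IsMild δ T (nl μ ν) u₀ v) :
    ∀ t ∈ Icc 0 T, u t = v t := by
  have hm : (d : ℝ) / 2 < min s s' := lt_min hs hs'
  have hm0 : 0 ≤ min s s' := (by positivity : (0 : ℝ) ≤ (d : ℝ) / 2).trans hm.le
  have hu := hu.mono (min_le_left s s')
  have hv := hv.mono (min_le_right s s')
  obtain ⟨R₁, hR₁, b₁⟩ := hu.exists_bound hm0
  obtain ⟨R₂, hR₂, b₂⟩ := hv.exists_bound hm0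
  obtain ⟨K, hK⟩ := P.exists_lipschitz hm (max_lt hR₁ hR₂)
  have c₁ := fun t ht => (b₁ t ht).trans (le_max_left R₁ R₂)
  have c₂ := fun t ht => (b₂ t ht).trans (le_max_right R₁ R₂)
  have huc := hu.continuousOn hm0
  have hvc := hv.continuousOn hm0
  have h := norm_sub_le_of_approx (N := nl μ ν) (η₁ := 0) (η₂ := 0) K.2 huc hvc
    (continuousOn_comp_of_norm_sub_le huc fun r hr t ht => hK _ _ (c₁ r hr) (c₁ t ht))
    (continuousOn_comp_of_norm_sub_le hvc fun r hr t ht => hK _ _ (c₂ r hr) (c₂ t ht))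
    (fun t ht => hK _ _ (c₁ t ht) (c₂ t ht))
    (fun t ht => by rw [← hu' t ht, sub_self, norm_zero])
    (fun t ht => by rw [← hv' t ht, sub_self, norm_zero])
  intro t ht
  have h1 := h t ht
  rw [add_zero, zero_mul] at h1
  exact sub_eq_zero.1 (norm_le_zero_iff.1 h1)

/-- `M` is the nonlinearity, transported to `L²` by the Bessel potential. -/
structure IsLift {d : ℕ} (μ ν : ℝ) (M : L2 d → L2 d) (K : ℝ → ℝ) : Prop where
  bessel_eq : ∀ x, bessel (idx d : ℝ) (M x) = nl μ ν (bessel (idx d : ℝ) x)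
  nonneg : ∀ R, 0 ≤ K R
  lip : LipOnBalls M K

theorem idx_nonneg (d : ℕ) : (0 : ℝ) ≤ (idx d : ℝ) := Nat.cast_nonneg _

theorem Params.sobolevNorm_nl_sub_le {d : ℕ} {μ ν : ℝ} (P : Params d μ ν) {s : ℝ}
    (hs : (d : ℝ) / 2 < s) {R : ℝ≥0∞} (hR : R < ∞) : ∃ C : ℝ≥0∞, C < ∞ ∧
      ∀ u₁ u₂ : L2 d, sobolevNorm s u₁ ≤ R → sobolevNorm s u₂ ≤ R → sobolevNorm (idx d) u₁ < ∞ →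
        sobolevNorm (idx d) u₂ < ∞ → sobolevNorm (idx d) (nl μ ν u₁ - nl μ ν u₂) ≤
          C * (sobolevNorm s (u₁ - u₂) * sobolevNorm (idx d) u₁ +
            sobolevNorm (idx d) (u₁ - u₂)) := by
  have := index_le_half d
  obtain ⟨C, hC, h⟩ := sobolevNorm_compL2_sub_le hs (powFun_zero ν) (j := idx d) (by linarith)
    P.isC hR
  refine ⟨C, hC, fun u₁ u₂ h1 h2 h3 h4 => ?_⟩
  rw [nl, nl, ← smul_sub, sobolevNorm_smul, enorm_I_mul P.sign, one_mul]
  exact h u₁ u₂ h1 h2 h3 h4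

theorem nl_zero {d : ℕ} (μ ν : ℝ) : nl μ ν (0 : L2 d) = 0 := by
  rw [nl, powerNonlinearity_eq, compL2_zero (powFun_zero ν), smul_zero]

theorem Params.sobolevNorm_nl_le {d : ℕ} {μ ν : ℝ} (P : Params d μ ν) {s : ℝ}
    (hs : (d : ℝ) / 2 < s) {R : ℝ≥0∞} (hR : R < ∞) : ∃ C : ℝ≥0∞, C < ∞ ∧
      ∀ u : L2 d, sobolevNorm s u ≤ R → sobolevNorm (idx d) u < ∞ →
        sobolevNorm (idx d) (nl μ ν u) ≤ C * sobolevNorm (idx d) u := by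
  obtain ⟨C, hC, h⟩ := P.sobolevNorm_nl_sub_le hs hR
  refine ⟨C * (R + 1), ENNReal.mul_lt_top hC (ENNReal.add_lt_top.2 ⟨hR, ENNReal.one_lt_top⟩),
    fun u hu hu' => ?_⟩
  have h1 := h u 0 hu (by simp [sobolevNorm_zero]) hu' (by simp [sobolevNorm_zero])
  rw [nl_zero, sub_zero, sub_zero] at h1
  refine h1.trans ?_
  rw [mul_assoc, add_mul, one_mul]
  gcongr

/-- By the tame estimate with `s = idx d`, the nonlinearity maps `H^{idx d}` to itself and is
Lipschitz on its balls; conjugation by the Bessel potential gives `M`. As the free evolution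
commutes with the potential, the equation itself transports to `L²`. -/
theorem Params.exists_isLift {d : ℕ} {μ ν : ℝ} (P : Params d μ ν) :
    ∃ (M : L2 d → L2 d) (K : ℝ → ℝ), IsLift μ ν M K := by
  have hk := idx_nonneg d
  have h1 : ∀ x : L2 d, ∃ y, bessel (idx d : ℝ) y = nl μ ν (bessel (idx d : ℝ) x) := by
    intro x
    have hx := sobolevNorm_bessel_lt_top hk x
    obtain ⟨C, hC, h⟩ := P.sobolevNorm_nl_le (half_lt_index d) hx
    exact exists_bessel_eq hk ((h _ le_rfl hx).trans_lt (ENNReal.mul_lt_top hC hx))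
  choose M hM using h1
  have h2 : ∀ R : ℝ, ∃ K : ℝ, 0 ≤ K ∧ ∀ x y, ‖x‖ ≤ R → ‖y‖ ≤ R →
      ‖M x - M y‖ ≤ K * ‖x - y‖ := by
    intro R
    obtain ⟨C, hC, h⟩ := P.sobolevNorm_nl_sub_le (half_lt_index d)
      (ENNReal.ofReal_lt_top (r := R))
    refine ⟨(C * (ENNReal.ofReal R + 1)).toReal, ENNReal.toReal_nonneg, fun x y hx hy => ?_⟩
    have e : ∀ {z : L2 d}, ‖z‖ ≤ R → sobolevNorm (idx d) (bessel (idx d : ℝ) z) ≤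
        ENNReal.ofReal R := fun {z} hz => by
      rw [sobolevNorm_bessel hk, ← ofReal_norm]
      exact ENNReal.ofReal_le_ofReal hz
    have h3 := h _ _ (e hx) (e hy) (sobolevNorm_bessel_lt_top hk x)
      (sobolevNorm_bessel_lt_top hk y)
    rw [← hM, ← hM, ← map_sub, ← map_sub, sobolevNorm_bessel hk, sobolevNorm_bessel hk] at h3
    have h4 : ‖M x - M y‖ₑ ≤ C * (ENNReal.ofReal R + 1) * ‖x - y‖ₑ := by
      refine h3.trans ?_
      rw [mul_assoc, add_mul, one_mul, mul_comm (‖x - y‖ₑ)]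
      gcongr
      exact e hx
    have hfin : C * (ENNReal.ofReal R + 1) ≠ ∞ := (ENNReal.mul_lt_top hC
      (ENNReal.add_lt_top.2 ⟨ENNReal.ofReal_lt_top, ENNReal.one_lt_top⟩)).ne
    have h5 := ENNReal.toReal_mono (ENNReal.mul_ne_top hfin enorm_ne_top) h4
    rwa [ENNReal.toReal_mul, toReal_enorm, toReal_enorm] at h5
  choose K hK0 hK using h2
  exact ⟨M, K, hM, hK0, hK⟩

theorem IsLift.bessel_duhamel {d : ℕ} {μ ν : ℝ} {M : L2 d → L2 d} {K : ℝ → ℝ}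
    (hM : IsLift μ ν M K) {δ T : ℝ} {x₀ : L2 d} {x : ℝ → L2 d} (hx : ContinuousOn x (Icc 0 T))
    {t : ℝ} (ht : t ∈ Icc 0 T) :
    bessel (idx d : ℝ) (duhamel δ M x₀ x t) =
      duhamel δ (nl μ ν) (bessel (idx d : ℝ) x₀) (fun t => bessel (idx d : ℝ) (x t)) t := by
  obtain ⟨R, -, hR⟩ := exists_norm_le_of_continuousOn hx
  have hc := hM.lip.continuousOn hx hR
  rw [duhamel, duhamel, map_add, ← halfWave_bessel,
    ← (bessel (idx d : ℝ)).intervalIntegral_comp_comm (intervalIntegrable_duhamel hc ht t)]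
  congr 1
  refine intervalIntegral.integral_congr fun τ _ => ?_
  rw [← halfWave_bessel, hM.bessel_eq]

theorem IsLift.isMild {d : ℕ} {μ ν : ℝ} {M : L2 d → L2 d} {K : ℝ → ℝ}
    (hM : IsLift μ ν M K) {δ T : ℝ} {x₀ : L2 d} {x : ℝ → L2 d} (hx : ContinuousOn x (Icc 0 T))
    (h : IsMild δ T M x₀ x) :
    IsMild δ T (nl μ ν) (bessel (idx d : ℝ) x₀) (fun t => bessel (idx d : ℝ) (x t)) := by
  intro t ht
  rw [← hM.bessel_duhamel hx ht, ← h t ht]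

theorem IsMild.congr {d : ℕ} {N : L2 d → L2 d} {δ T : ℝ} {u₀ : L2 d} {u v : ℝ → L2 d}
    (h : IsMild δ T N u₀ u) (huv : ∀ t ∈ Icc 0 T, u t = v t) : IsMild δ T N u₀ v := by
  intro t ht
  rw [← huv t ht, h t ht, duhamel, duhamel]
  congr 1
  refine intervalIntegral.integral_congr fun τ hτ => ?_
  rw [uIcc_of_le ht.1] at hτ
  rw [huv τ ⟨hτ.1, hτ.2.trans ht.2⟩]

theorem IsMild.restrict {d : ℕ} {N : L2 d → L2 d} {δ T T' : ℝ} (hT : T' ≤ T) {u₀ : L2 d}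
    {u : ℝ → L2 d} (h : IsMild δ T N u₀ u) : IsMild δ T' N u₀ u :=
  fun t ht => h t ⟨ht.1, ht.2.trans hT⟩

theorem IsLift.isMild_of_bessel {d : ℕ} {μ ν : ℝ} {M : L2 d → L2 d} {K : ℝ → ℝ}
    (hM : IsLift μ ν M K) {δ T : ℝ} {x₀ : L2 d} {x u : ℝ → L2 d} (hx : ContinuousOn x (Icc 0 T))
    (h : IsMild δ T (nl μ ν) (bessel (idx d : ℝ) x₀) u)
    (hu : ∀ t ∈ Icc 0 T, u t = bessel (idx d : ℝ) (x t)) : IsMild δ T M x₀ x := by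
  intro t ht
  refine bessel_injective (idx_nonneg d) ?_
  have h1 := h.congr hu t ht
  rw [hM.bessel_duhamel hx ht, ← h1]

theorem IsMild.map_zero {d : ℕ} {N : L2 d → L2 d} {δ T : ℝ} (hT : 0 ≤ T) {u₀ : L2 d}
    {u : ℝ → L2 d} (h : IsMild δ T N u₀ u) : u 0 = u₀ := by
  rw [h 0 ⟨le_rfl, hT⟩, duhamel]
  simp [halfWave_zero]

theorem IsMild.norm_le {d : ℕ} {N : L2 d → L2 d} {δ T A : ℝ} (hA : 0 ≤ A) {u₀ : L2 d}
    {u : ℝ → L2 d} (hu : ContinuousOn u (Icc 0 T)) (h : IsMild δ T N u₀ u)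
    (hN : ∀ t ∈ Icc 0 T, ‖N (u t)‖ ≤ A * ‖u t‖) :
    ∀ t ∈ Icc 0 T, ‖u t‖ ≤ ‖u₀‖ * Real.exp (A * t) := by
  refine gronwall_integral hA hu.norm fun t ht => ?_
  rw [h t ht, duhamel]
  refine (norm_add_le _ _).trans ?_
  rw [norm_halfWave]
  gcongr
  rw [← intervalIntegral.integral_const_mul]
  refine intervalIntegral.norm_integral_le_of_norm_le ht.1 (Eventually.of_forall fun τ hτ => ?_) ?_
  · rw [norm_halfWave]; exact hN τ ⟨hτ.1.le, hτ.2.trans ht.2⟩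
  · refine ContinuousOn.intervalIntegrable ?_
    rw [uIcc_of_le ht.1]
    exact (hu.norm.const_mul A).mono (Icc_subset_Icc_right ht.2)

/-- A bootstrap. By the tame estimate the nonlinearity grows at most linearly in `H^{idx d}`, with a
constant `A` that depends only on the `H^s` bound of `u`. Solve the lifted equation truncated at
radius `ρ`: while its solution stays in the ball it equals `u` by uniqueness, so Gronwall with the
constant `A` keeps it strictly inside. -/
theorem Params.persistence {d : ℕ} {μ ν : ℝ} (P : Params d μ ν) {M : L2 d → L2 d} {K : ℝ → ℝ}
    (hM : IsLift μ ν M K) {s T δ : ℝ} (hT : 0 ≤ T) (hs : (d : ℝ) / 2 < s) {x₀ : L2 d}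
    {u : ℝ → L2 d} (hu : ContinuousSobolevOn s T u)
    (hu' : IsMild δ T (nl μ ν) (bessel (idx d : ℝ) x₀) u) :
    ∃ x : ℝ → L2 d, ContinuousOn x (Icc 0 T) ∧ IsMild δ T M x₀ x ∧
      ∀ t ∈ Icc 0 T, u t = bessel (idx d : ℝ) (x t) := by
  have hk := idx_nonneg d
  have hs0 : 0 ≤ s := (by positivity : (0 : ℝ) ≤ (d : ℝ) / 2).trans hs.le
  obtain ⟨R, hR, hRu⟩ := hu.exists_bound hs0
  obtain ⟨C, hC, hCn⟩ := P.sobolevNorm_nl_le hs hR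
  have hA0 : 0 ≤ C.toReal := ENNReal.toReal_nonneg
  set A := C.toReal
  have hA : ∀ x : L2 d, sobolevNorm s (bessel (idx d : ℝ) x) ≤ R → ‖M x‖ ≤ A * ‖x‖ := by
    intro x hx
    have h1 := hCn _ hx (sobolevNorm_bessel_lt_top hk x)
    rw [← hM.bessel_eq, sobolevNorm_bessel hk, sobolevNorm_bessel hk] at h1
    have h2 := ENNReal.toReal_mono (ENNReal.mul_ne_top hC.ne enorm_ne_top) h1
    rwa [ENNReal.toReal_mul, toReal_enorm, toReal_enorm] at h2
  -- Gronwall's bound plus one, so that the a priori estimate is strict.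
  set ρ := ‖x₀‖ * Real.exp (A * T) + 1 with hρd
  have hρ : 0 < ρ := by positivity
  obtain ⟨M', hM', -, x, hxc, hx⟩ := exists_truncated hM.lip δ hT hρ (hM.nonneg ρ) x₀
  have key : ∀ t₁ ∈ Icc 0 T, (∀ t ∈ Icc 0 t₁, ‖x t‖ ≤ ρ) → IsMild δ t₁ M x₀ x ∧
      ∀ t ∈ Icc 0 t₁, u t = bessel (idx d : ℝ) (x t) ∧ ‖x t‖ < ρ := by
    intro t₁ ht₁ hb
    have hxc' : ContinuousOn x (Icc 0 t₁) := hxc.mono (Icc_subset_Icc_right ht₁.2)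
    have hm : IsMild δ t₁ M x₀ x := by
      intro t ht
      rw [hx t ⟨ht.1, ht.2.trans ht₁.2⟩, duhamel, duhamel]
      congr 1
      refine intervalIntegral.integral_congr fun τ hτ => ?_
      rw [uIcc_of_le ht.1] at hτ
      rw [hM' _ (hb τ ⟨hτ.1, hτ.2.trans ht.2⟩)]
    have heq := P.unique hs (half_lt_index d) (hu.restrict ht₁.2)
      (continuousSobolevOn_bessel hk hxc' fun t _ => rfl) (hu'.restrict ht₁.2)
      (hM.isMild hxc' hm)
    refine ⟨hm, fun t ht => ⟨heq t ht, ?_⟩⟩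
    have hle := hm.norm_le hA0 hxc' (fun t ht => hA _ (by
      have h1 := heq t ht
      rw [← h1]; exact hRu t ⟨ht.1, ht.2.trans ht₁.2⟩)) t ht
    have h2 : ‖x₀‖ * Real.exp (A * t) ≤ ‖x₀‖ * Real.exp (A * T) := by
      gcongr
      exact ht.2.trans ht₁.2
    linarith
  have hlt : ∀ t ∈ Icc 0 T, ‖x t‖ < ρ := by
    by_contra hcon
    push Not at hcon
    obtain ⟨t₁, ht₁, hge⟩ := hcon
    have h0 : ‖x 0‖ < ρ := by
      refine ((key 0 ⟨le_rfl, hT⟩ fun t ht => ?_).2 0 ⟨le_rfl, le_rfl⟩).2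
      have : t = 0 := le_antisymm ht.2 ht.1
      rw [this, hx.map_zero hT]
      have h1 : 1 ≤ Real.exp (A * T) := Real.one_le_exp (by positivity)
      have h2 : ‖x₀‖ * 1 ≤ ‖x₀‖ * Real.exp (A * T) := by gcongr
      linarith
    have ivt : ∀ t ∈ Icc 0 T, ρ ≤ ‖x t‖ → ∃ r ∈ Icc 0 t, ‖x r‖ = ρ := by
      intro t ht hge
      have := intermediate_value_Icc ht.1 (hxc.norm.mono (Icc_subset_Icc_right ht.2))
      exact this ⟨h0.le, hge⟩
    -- Compactness yields the first time `t₀` at which the norm equals `ρ`. Up to then the norm is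
    -- at most `ρ`, so `key` applies and makes it smaller than `ρ` at `t₀`.
    have hcl : IsCompact (Icc 0 T ∩ (fun t => ‖x t‖) ⁻¹' {ρ}) :=
      isCompact_Icc.of_isClosed_subset (hxc.norm.preimage_isClosed_of_isClosed isClosed_Icc
        isClosed_singleton) inter_subset_left
    obtain ⟨r, hr, hr'⟩ := ivt t₁ ht₁ hge
    obtain ⟨t₀, ⟨ht₀, ht₀'⟩, hmin⟩ := hcl.exists_isLeast
      ⟨r, ⟨hr.1, hr.2.trans ht₁.2⟩, hr'⟩
    have hb : ∀ t ∈ Icc 0 t₀, ‖x t‖ ≤ ρ := by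
      intro t ht
      by_contra hcon
      rw [not_le] at hcon
      obtain ⟨r, hr, hr'⟩ := ivt t ⟨ht.1, ht.2.trans ht₀.2⟩ hcon.le
      have h1 : t₀ ≤ r := hmin ⟨⟨hr.1, hr.2.trans (ht.2.trans ht₀.2)⟩, hr'⟩
      have h2 : t = t₀ := le_antisymm ht.2 (h1.trans hr.2)
      rw [h2] at hcon
      exact hcon.ne' ht₀'
    exact ((key t₀ ht₀ hb).2 t₀ ⟨ht₀.1, le_rfl⟩).2.ne ht₀'
  obtain ⟨h1, h2⟩ := key T ⟨hT, le_rfl⟩ fun t ht => (hlt t ht).le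
  exact ⟨x, hxc, h1, fun t ht => (h2 t ht).1⟩

theorem IsLift.isNLHWSolution {d : ℕ} {μ ν : ℝ} {M : L2 d → L2 d} {K : ℝ → ℝ}
    (hM : IsLift μ ν M K) {T : ℝ} {x₀ : L2 d} {x : ℝ → L2 d} (hx : ContinuousOn x (Icc 0 T))
    (h : IsMild 1 T M x₀ x) :
    IsNLHWSolution μ ν T (bessel (idx d : ℝ) x₀) (fun t => bessel (idx d : ℝ) (x t)) :=
  isNLHWSolution_iff.2 ⟨⟨_, half_lt_index d, continuousSobolevOn_bessel (idx_nonneg d) hx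
    fun _ _ => rfl⟩, hM.isMild hx h⟩

theorem IsNLHWSolution.restrict {d : ℕ} {μ ν T T' : ℝ} (hT : T' ≤ T) {u₀ : L2 d}
    {u : ℝ → L2 d} (h : IsNLHWSolution μ ν T u₀ u) : IsNLHWSolution μ ν T' u₀ u := by
  rw [isNLHWSolution_iff] at h ⊢
  obtain ⟨⟨s, hs, h1⟩, h2⟩ := h
  exact ⟨⟨s, hs, h1.restrict hT⟩, h2.restrict hT⟩

theorem Params.solution_unique {d : ℕ} {μ ν : ℝ} (P : Params d μ ν) {T : ℝ} {u₀ : L2 d}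
    {u v : ℝ → L2 d} (hu : IsNLHWSolution μ ν T u₀ u) (hv : IsNLHWSolution μ ν T u₀ v) :
    ∀ t ∈ Icc 0 T, u t = v t := by
  rw [isNLHWSolution_iff] at hu hv
  obtain ⟨⟨s, hs, h1⟩, h2⟩ := hu
  obtain ⟨⟨s', hs', h1'⟩, h2'⟩ := hv
  exact P.unique hs hs' h1 h1' h2 h2'

/-- Continuous dependence on the data in `H^k` near a given solution. -/
theorem Params.exists_solution_near {d : ℕ} {μ ν : ℝ} (P : Params d μ ν) {T : ℝ} (hT : 0 ≤ T)
    {u₀ : L2 d} (hu₀ : sobolevNorm (idx d) u₀ < ∞) {u : ℝ → L2 d}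
    (hu : IsNLHWSolution μ ν T u₀ u) :
    (∀ t ∈ Icc 0 T, sobolevNorm (idx d) (u t) < ∞) ∧
    ∀ ε : ℝ≥0∞, 0 < ε → ∃ δ : ℝ≥0∞, 0 < δ ∧ ∀ v₀ : L2 d, sobolevNorm (idx d) (v₀ - u₀) < δ →
      ∃ v : ℝ → L2 d, IsNLHWSolution μ ν T v₀ v ∧
        ∀ t ∈ Icc 0 T, sobolevNorm (idx d) (v t - u t) ≤ ε := by
  have hk := idx_nonneg d
  obtain ⟨M, K, hM⟩ := P.exists_isLift
  obtain ⟨x₀, rfl⟩ := exists_bessel_eq hk hu₀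
  obtain ⟨⟨s, hs, h1⟩, h2⟩ := isNLHWSolution_iff.1 hu
  obtain ⟨x, hxc, hxm, hux⟩ := P.persistence hM hT hs h1 h2
  refine ⟨fun t ht => by rw [hux t ht]; exact sobolevNorm_bessel_lt_top hk _, fun ε hε => ?_⟩
  obtain ⟨R, hR0, hR⟩ := exists_norm_le_of_continuousOn hxc
  set E := Real.exp (2 * K (R + 1) * T)
  have hE : 0 < E := Real.exp_pos _
  obtain ⟨ε', hε', hle⟩ : ∃ ε' : ℝ, 0 < ε' ∧ ENNReal.ofReal ε' ≤ ε ∧ ε' ≤ 1 := by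
    rcases eq_or_ne ε ∞ with rfl | hne
    · exact ⟨1, one_pos, le_top, le_rfl⟩
    · refine ⟨min ε.toReal 1, lt_min (ENNReal.toReal_pos hε.ne' hne) one_pos, ?_, min_le_right _ _⟩
      exact (ENNReal.ofReal_le_ofReal (min_le_left _ _)).trans ENNReal.ofReal_toReal_le
  refine ⟨ENNReal.ofReal (ε' / E), ENNReal.ofReal_pos.2 (by positivity), fun v₀ hv₀ => ?_⟩
  have hvf : sobolevNorm (idx d) v₀ < ∞ := by
    have := sobolevNorm_add_le (idx d : ℝ) (v₀ - bessel (idx d : ℝ) x₀) (bessel (idx d : ℝ) x₀)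
    rw [sub_add_cancel] at this
    exact this.trans_lt (ENNReal.add_lt_top.2 ⟨hv₀.trans ENNReal.ofReal_lt_top, hu₀⟩)
  obtain ⟨y₀, rfl⟩ := exists_bessel_eq hk hvf
  rw [← map_sub, sobolevNorm_bessel hk, ← ofReal_norm] at hv₀
  have hy : ‖y₀ - x₀‖ ≤ ε' / E := ((ENNReal.ofReal_lt_ofReal_iff (by positivity)).1 hv₀).le
  have hη : ε' / E * E = ε' := by field_simp
  -- The given solution `x` is an approximate solution for the new data `y₀`, with defect `‖y₀ -
  -- x₀‖`.
  obtain ⟨y, hyc, hym, hyx⟩ := exists_mild_near (δ := 1) (u₀ := y₀) (η := ε' / E) hM.lip hT hR0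
    (hM.nonneg _) hxc hR (by positivity) (fun t ht => by
      conv_lhs => rw [hxm t ht]
      rw [duhamel, duhamel, add_sub_add_right_eq_sub, ← halfWave_sub, norm_halfWave, norm_sub_rev]
      exact hy) (by rw [hη]; exact hle.2)
  refine ⟨_, hM.isNLHWSolution hyc hym, fun t ht => ?_⟩
  rw [hux t ht, ← map_sub, sobolevNorm_bessel hk, ← ofReal_norm]
  refine (ENNReal.ofReal_le_ofReal (hyx t ht)).trans ?_
  rw [hη]
  exact hle.1

/-! ## Dilations -/

theorem map_smul_volume {d : ℕ} {c : ℝ} (hc : 0 < c) :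
    Measure.map (fun x : Space d => c • x) volume = ENNReal.ofReal ((c ^ d)⁻¹) • volume := by
  rw [Measure.map_addHaar_smul volume hc.ne', finrank_euclideanSpace_fin, abs_of_pos (by positivity)]

theorem ae_comp_smul {d : ℕ} {c : ℝ} (hc : 0 < c) {p : Space d → Prop} (h : ∀ᵐ x, p x) :
    ∀ᵐ x, p (c • x) := by
  have : Measure.QuasiMeasurePreserving (fun x : Space d => c • x) volume volume :=
    ⟨measurable_const_smul c, by rw [map_smul_volume hc]; exact Measure.smul_absolutelyContinuous⟩
  exact this.ae h

theorem lintegral_comp_smul {d : ℕ} {c : ℝ} (hc : 0 < c) (f : Space d → ℝ≥0∞) :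
    ∫⁻ x, f (c • x) = ENNReal.ofReal ((c ^ d)⁻¹) * ∫⁻ x, f x := by
  have := lintegral_map_equiv (μ := volume) f
    (Homeomorph.smulOfNeZero (α := Space d) c hc.ne').toMeasurableEquiv
  change ∫⁻ x, f x ∂(Measure.map (fun x : Space d => c • x) volume) = ∫⁻ x, f (c • x) at this
  rw [← this, map_smul_volume hc, lintegral_smul_measure, smul_eq_mul]

theorem memLp_comp_smul {d : ℕ} {c : ℝ} (hc : 0 < c) (f : L2 d) :
    MemLp (fun x => f (c • x)) 2 volume := by
  have h : MemLp f 2 (Measure.map (fun x : Space d => c • x) volume) := by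
    rw [map_smul_volume hc]; exact (Lp.memLp f).smul_measure ENNReal.ofReal_ne_top
  exact h.comp_of_map (measurable_const_smul c).aemeasurable

theorem enorm_sq_eq_lintegral {d : ℕ} (f : L2 d) : ‖f‖ₑ ^ 2 = ∫⁻ x, ‖f x‖ₑ ^ 2 := by
  rw [Lp.enorm_def, eLpNorm_two_eq, ← ENNReal.rpow_natCast, ← ENNReal.rpow_mul]
  norm_num

theorem enorm_toLp_comp_smul {d : ℕ} {c : ℝ} (hc : 0 < c) (f : L2 d) :
    ‖((memLp_comp_smul hc f).toLp : L2 d)‖ₑ ^ 2 = ENNReal.ofReal ((c ^ d)⁻¹) * ‖f‖ₑ ^ 2 := by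
  rw [enorm_sq_eq_lintegral, enorm_sq_eq_lintegral, ← lintegral_comp_smul hc]
  refine lintegral_congr_ae ?_
  filter_upwards [(memLp_comp_smul hc f).coeFn_toLp] with x h
  rw [h]

open Classical in
/-- The dilation `f ↦ f(c ·)` on `L²`, for `c > 0`. -/
noncomputable def dil {d : ℕ} (c : ℝ) : L2 d →L[ℂ] L2 d :=
  if hc : 0 < c then
    LinearMap.mkContinuous
      { toFun := fun f => (memLp_comp_smul hc f).toLp
        map_add' := fun f g => by
          refine Lp.ext ?_
          filter_upwards [(memLp_comp_smul hc (f + g)).coeFn_toLp,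
            (memLp_comp_smul hc f).coeFn_toLp, (memLp_comp_smul hc g).coeFn_toLp,
            Lp.coeFn_add ((memLp_comp_smul hc f).toLp) ((memLp_comp_smul hc g).toLp),
            ae_comp_smul hc (Lp.coeFn_add f g)] with x h1 h2 h3 h4 h5
          rw [h1, h4, Pi.add_apply, h2, h3, h5, Pi.add_apply]
        map_smul' := fun a f => by
          refine Lp.ext ?_
          filter_upwards [(memLp_comp_smul hc (a • f)).coeFn_toLp,
            (memLp_comp_smul hc f).coeFn_toLp, Lp.coeFn_smul a ((memLp_comp_smul hc f).toLp),
            ae_comp_smul hc (Lp.coeFn_smul a f)] with x h1 h2 h3 h4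
          rw [h1, RingHom.id_apply, h3, Pi.smul_apply, h2, h4, Pi.smul_apply] }
      (Real.sqrt ((c ^ d)⁻¹)) (fun f => by
        have h := congrArg ENNReal.toReal (enorm_toLp_comp_smul hc f)
        rw [ENNReal.toReal_mul, ENNReal.toReal_pow, ENNReal.toReal_pow, toReal_enorm,
          toReal_enorm, ENNReal.toReal_ofReal (by positivity)] at h
        refine le_of_sq_le_sq ?_ (by positivity)
        rw [mul_pow, Real.sq_sqrt (by positivity)]
        exact h.le)
  else 0

theorem coeFn_dil {d : ℕ} {c : ℝ} (hc : 0 < c) (f : L2 d) :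
    dil c f =ᵐ[volume] fun x => f (c • x) := by
  rw [dil, dif_pos hc]
  exact (memLp_comp_smul hc f).coeFn_toLp

theorem exists_schwartzL2_eq_dil {d : ℕ} {c : ℝ} (hc : 0 < c) (φ : 𝓢(Space d, ℂ)) :
    ∃ ψ : 𝓢(Space d, ℂ), (∀ x, ψ x = φ (c • x)) ∧ dil c (schwartzL2 φ) = schwartzL2 ψ := by
  refine ⟨SchwartzMap.compCLMOfContinuousLinearEquiv ℂ
    (ContinuousLinearEquiv.smulLeft (Units.mk0 c hc.ne')) φ, fun x => rfl, ?_⟩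
  refine Lp.ext ?_
  filter_upwards [coeFn_dil hc (schwartzL2 φ), ae_comp_smul hc (coeFn_schwartzL2 φ),
    coeFn_schwartzL2 (SchwartzMap.compCLMOfContinuousLinearEquiv ℂ
    (ContinuousLinearEquiv.smulLeft (Units.mk0 c hc.ne')) φ)] with x h1 h2 h3
  rw [h1, h2, h3]
  rfl

theorem fourier_dil {d : ℕ} {c : ℝ} (hc : 0 < c) (f : L2 d) :
    (𝓕 (dil c f) : L2 d) = (((c ^ d)⁻¹ : ℝ) : ℂ) • dil c⁻¹ (𝓕 f : L2 d) := by
  have hF : Continuous fun f : L2 d => (𝓕 f : L2 d) :=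
    (Lp.fourierTransformₗᵢ (Space d) ℂ).continuous
  have h1 : Continuous fun f : L2 d => (𝓕 (dil c f) : L2 d) := hF.comp (dil c).continuous
  have h2 : Continuous fun f : L2 d => (((c ^ d)⁻¹ : ℝ) : ℂ) • dil c⁻¹ (𝓕 f : L2 d) := by
    have h : Continuous fun f : L2 d => dil c⁻¹ (𝓕 f : L2 d) := (dil c⁻¹).continuous.comp hF
    exact h.const_smul (((c ^ d)⁻¹ : ℝ) : ℂ)
  refine congrFun (denseRange_schwartzL2.equalizer h1 h2 ?_) f
  funext φ
  simp only [Function.comp]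
  obtain ⟨ψ, hψ, e⟩ := exists_schwartzL2_eq_dil hc φ
  obtain ⟨χ, hχ, e'⟩ := exists_schwartzL2_eq_dil (inv_pos.2 hc) (𝓕 φ)
  rw [e, fourier_schwartzL2, fourier_schwartzL2, e']
  refine Lp.ext ?_
  filter_upwards [coeFn_schwartzL2 (𝓕 ψ), coeFn_schwartzL2 χ,
    Lp.coeFn_smul (((c ^ d)⁻¹ : ℝ) : ℂ) (schwartzL2 χ)] with ξ h1 h2 h3
  rw [h1, h3, Pi.smul_apply, h2, hχ, SchwartzMap.fourier_coe, SchwartzMap.fourier_coe,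
    Real.fourier_eq', Real.fourier_eq']
  have := Measure.integral_comp_smul (volume : Measure (Space d))
    (fun v => Complex.exp (((-2 * Real.pi * inner ℝ v (c⁻¹ • ξ) : ℝ) : ℂ) * Complex.I) • φ v) c
  rw [finrank_euclideanSpace_fin, abs_of_pos (by positivity)] at this
  rw [Complex.real_smul] at this
  rw [smul_eq_mul, ← this]
  refine integral_congr_ae (Eventually.of_forall fun v => ?_)
  simp only
  rw [hψ, real_inner_smul_left, real_inner_smul_right, mul_inv_cancel_left₀ hc.ne']

theorem fourier_dil_ae {d : ℕ} {c : ℝ} (hc : 0 < c) (f : L2 d) :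
    (𝓕 (dil c f) : L2 d) =ᵐ[volume] fun ξ => (((c ^ d)⁻¹ : ℝ) : ℂ) * (𝓕 f : L2 d) (c⁻¹ • ξ) := by
  rw [fourier_dil hc]
  filter_upwards [Lp.coeFn_smul (((c ^ d)⁻¹ : ℝ) : ℂ) (dil c⁻¹ (𝓕 f : L2 d)),
    coeFn_dil (inv_pos.2 hc) (𝓕 f : L2 d)] with ξ h1 h2
  rw [h1, Pi.smul_apply, h2, smul_eq_mul]

theorem dil_dil_inv {d : ℕ} {c : ℝ} (hc : 0 < c) (f : L2 d) : dil c (dil c⁻¹ f) = f := by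
  refine Lp.ext ?_
  filter_upwards [coeFn_dil hc (dil c⁻¹ f), ae_comp_smul hc (coeFn_dil (inv_pos.2 hc) f)]
    with x h1 h2
  rw [h1, h2, smul_smul, inv_mul_cancel₀ hc.ne', one_smul]

theorem halfWave_dil {d : ℕ} {c : ℝ} (hc : 0 < c) (t : ℝ) (f : L2 d) :
    halfWave t (dil c f) = dil c (halfWave (c * t) f) := by
  refine fourier_injective ?_
  filter_upwards [fourier_halfWave t (dil c f), fourier_dil_ae hc f,
    fourier_dil_ae hc (halfWave (c * t) f),
    ae_comp_smul (inv_pos.2 hc) (fourier_halfWave (c * t) f)] with ξ h1 h2 h3 h4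
  rw [h1, h2, h3, h4, norm_smul, Real.norm_of_nonneg (inv_pos.2 hc).le]
  have e : c * t * (2 * Real.pi * (c⁻¹ * ‖ξ‖)) = t * (2 * Real.pi * ‖ξ‖) := by field_simp
  rw [e]
  ring

theorem sobolevNorm_dil_sq {d : ℕ} {c : ℝ} (hc : 0 < c) (γ : ℝ) (f : L2 d) :
    sobolevNorm γ (dil c f) ^ 2 = ENNReal.ofReal ((c ^ d)⁻¹) *
      ∫⁻ η, ENNReal.ofReal ((1 + (c * (2 * Real.pi * ‖η‖)) ^ 2) ^ γ) * ‖(𝓕 f : L2 d) η‖ₑ ^ 2 := by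
  have h1 : sobolevNorm γ (dil c f) ^ 2 = ∫⁻ ξ, ENNReal.ofReal ((c ^ d)⁻¹) ^ 2 *
      (ENNReal.ofReal ((1 + (c * (2 * Real.pi * ‖c⁻¹ • ξ‖)) ^ 2) ^ γ) *
        ‖(𝓕 f : L2 d) (c⁻¹ • ξ)‖ₑ ^ 2) := by
    rw [sobolevNorm_sq]
    refine lintegral_congr_ae ?_
    filter_upwards [fourier_dil_ae hc f] with ξ h
    rw [h, enorm_mul, mul_pow, norm_smul, Real.norm_of_nonneg (inv_pos.2 hc).le,
      ← ofReal_norm (((c ^ d)⁻¹ : ℝ) : ℂ), Complex.norm_real, Real.norm_of_nonneg (by positivity)]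
    have e : c * (2 * Real.pi * (c⁻¹ * ‖ξ‖)) = 2 * Real.pi * ‖ξ‖ := by field_simp
    rw [e, weight]
    ring
  rw [h1, lintegral_const_mul' _ _ (ENNReal.pow_ne_top ENNReal.ofReal_ne_top),
    lintegral_comp_smul (inv_pos.2 hc) (fun η =>
      ENNReal.ofReal ((1 + (c * (2 * Real.pi * ‖η‖)) ^ 2) ^ γ) * ‖(𝓕 f : L2 d) η‖ₑ ^ 2),
    ← mul_assoc]
  congr 1
  rw [← ENNReal.ofReal_pow (by positivity), ← ENNReal.ofReal_mul (by positivity)]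
  congr 1
  rw [inv_pow c, inv_inv]
  field_simp

/-- The quantity `∫ (ℓ² + |2πη|²)^γ |𝓕 f(η)|² dη`. -/
noncomputable def scaledEnergy {d : ℕ} (γ ℓ : ℝ) (f : L2 d) : ℝ≥0∞ :=
  ∫⁻ η, ENNReal.ofReal ((ℓ ^ 2 + (2 * Real.pi * ‖η‖) ^ 2) ^ γ) * ‖(𝓕 f : L2 d) η‖ₑ ^ 2

/-- Pulling `ℓ^{-2γ}` out of the Sobolev weight separates the scaling factor `A ℓ^{d/2-γ}` from an
energy in which `ℓ` only regularises the homogeneous weight `|2πη|^{2γ}` near frequency zero. -/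
theorem sobolevNorm_scaled_sq {d : ℕ} {ℓ A : ℝ} (hℓ : 0 < ℓ) (hA : 0 < A) (γ : ℝ) (f : L2 d) :
    sobolevNorm γ ((A : ℂ) • dil ℓ⁻¹ f) ^ 2 =
      ENNReal.ofReal ((A * ℓ ^ ((d : ℝ) / 2 - γ)) ^ 2) * scaledEnergy γ ℓ f := by
  rw [sobolevNorm_smul, mul_pow, sobolevNorm_dil_sq (inv_pos.2 hℓ), ← ofReal_norm,
    Complex.norm_real, Real.norm_of_nonneg hA.le, ← ENNReal.ofReal_pow hA.le, ← mul_assoc,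
    ← ENNReal.ofReal_mul (by positivity), scaledEnergy]
  have e : ∀ η : Space d, (ℓ ^ 2 + (2 * Real.pi * ‖η‖) ^ 2) ^ γ =
      ℓ ^ (2 * γ) * (1 + (ℓ⁻¹ * (2 * Real.pi * ‖η‖)) ^ 2) ^ γ := by
    intro η
    rw [Real.rpow_mul hℓ.le, ← Real.mul_rpow (by positivity) (by positivity)]
    congr 1
    rw [Real.rpow_two]
    field_simp
  simp only [e]
  have e2 : ∀ η : Space d, ENNReal.ofReal (ℓ ^ (2 * γ) *
      (1 + (ℓ⁻¹ * (2 * Real.pi * ‖η‖)) ^ 2) ^ γ) * ‖(𝓕 f : L2 d) η‖ₑ ^ 2 =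
      ENNReal.ofReal (ℓ ^ (2 * γ)) * (ENNReal.ofReal ((1 + (ℓ⁻¹ * (2 * Real.pi * ‖η‖)) ^ 2) ^ γ) *
        ‖(𝓕 f : L2 d) η‖ₑ ^ 2) := fun η => by
    rw [ENNReal.ofReal_mul (by positivity), mul_assoc]
  simp only [e2]
  rw [lintegral_const_mul' _ _ ENNReal.ofReal_ne_top, ← mul_assoc,
    ← ENNReal.ofReal_mul (by positivity)]
  congr 2
  rw [inv_pow, inv_inv, mul_pow, ← Real.rpow_natCast (ℓ ^ ((d : ℝ) / 2 - γ)), ← Real.rpow_mul hℓ.le,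
    mul_assoc, ← Real.rpow_add hℓ, ← Real.rpow_natCast ℓ d]
  congr 2
  push_cast; ring

theorem rpow_le_of_ratio {x y b γ : ℝ} (hb : 1 ≤ b) (hx : 0 < x) (hy : 0 < y) (h1 : x ≤ b * y)
    (h2 : y ≤ b * x) : x ^ γ ≤ b ^ |γ| * y ^ γ := by
  have hb0 : 0 < b := by linarith
  rcases le_total 0 γ with h | h
  · rw [abs_of_nonneg h, ← Real.mul_rpow hb0.le hy.le]
    exact Real.rpow_le_rpow hx.le h1 h
  · rw [abs_of_nonpos h]
    have h3 : (b * x) ^ γ ≤ y ^ γ := Real.rpow_le_rpow_of_nonpos hy h2 h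
    rw [Real.mul_rpow hb0.le hx.le] at h3
    calc x ^ γ = b ^ (-γ) * (b ^ γ * x ^ γ) := by
          rw [← mul_assoc, ← Real.rpow_add hb0, neg_add_cancel, Real.rpow_zero, one_mul]
      _ ≤ b ^ (-γ) * y ^ γ := by gcongr

/-- The constant is far from sharp; what matters is that it is uniform over `c ∈ [b⁻¹, b]`. -/
theorem sobolevNorm_dil_le {d : ℕ} {b c : ℝ} (hb : 1 ≤ b) (hc : b⁻¹ ≤ c) (hc' : c ≤ b) (γ : ℝ)
    (f : L2 d) : sobolevNorm γ (dil c f) ≤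
      ENNReal.ofReal (b ^ d * (b ^ 2) ^ |γ|) * sobolevNorm γ f := by
  have hb0 : 0 < b := by linarith
  have hc0 : 0 < c := (inv_pos.2 hb0).trans_le hc
  refine ennreal_le_of_sq_le ?_
  have hcb : 1 ≤ c * b := by
    calc (1 : ℝ) = b⁻¹ * b := (inv_mul_cancel₀ hb0.ne').symm
      _ ≤ c * b := by gcongr
  have hp1 : 1 ≤ b ^ d := one_le_pow₀ hb
  have hp2 : 1 ≤ (b ^ 2) ^ |γ| := Real.one_le_rpow (one_le_pow₀ hb) (abs_nonneg _)
  rw [sobolevNorm_dil_sq hc0, mul_pow, sobolevNorm_sq,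
    ← lintegral_const_mul' _ _ ENNReal.ofReal_ne_top,
    ← lintegral_const_mul' _ _ (ENNReal.pow_ne_top ENNReal.ofReal_ne_top)]
  refine lintegral_mono fun η => ?_
  rw [← ENNReal.ofReal_pow (by positivity), ← mul_assoc (ENNReal.ofReal _),
    ← mul_assoc (ENNReal.ofReal _), ← ENNReal.ofReal_mul (by positivity),
    ← ENNReal.ofReal_mul (by positivity)]
  refine mul_le_mul_left (ENNReal.ofReal_le_ofReal ?_) _
  have h1 : (c ^ d)⁻¹ ≤ b ^ d := by
    rw [inv_le_iff_one_le_mul₀ (by positivity), ← mul_pow, mul_comm]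
    exact one_le_pow₀ hcb
  set m := (2 * Real.pi * ‖η‖) ^ 2
  have hm : 0 ≤ m := by positivity
  have hc2 : c ^ 2 ≤ b ^ 2 := by gcongr
  have hcb2 : 1 ≤ c ^ 2 * b ^ 2 := by rw [← mul_pow]; exact one_le_pow₀ hcb
  have hb2 : 1 ≤ b ^ 2 := one_le_pow₀ hb
  have h2 := rpow_le_of_ratio (γ := γ) hb2 (by positivity : 0 < 1 + (c * (2 * Real.pi * ‖η‖)) ^ 2)
    (weight_pos η) (by
      rw [mul_pow, weight]
      have := mul_le_mul_of_nonneg_right hc2 hm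
      nlinarith) (by
      rw [mul_pow, weight]
      have := mul_le_mul_of_nonneg_right hcb2 hm
      nlinarith)
  have hw : 0 < weight η ^ γ := Real.rpow_pos_of_pos (weight_pos η) γ
  calc (c ^ d)⁻¹ * (1 + (c * (2 * Real.pi * ‖η‖)) ^ 2) ^ γ
      ≤ b ^ d * ((b ^ 2) ^ |γ| * weight η ^ γ) := by gcongr
    _ = (b ^ d * (b ^ 2) ^ |γ|) * 1 * weight η ^ γ := by ring
    _ ≤ (b ^ d * (b ^ 2) ^ |γ|) * (b ^ d * (b ^ 2) ^ |γ|) * weight η ^ γ := by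
        gcongr
        nlinarith
    _ = _ := by ring

/-! ## Scaling and time reversal of solutions -/

theorem powFun_smul (ν : ℝ) {A : ℝ} (hA : 0 < A) (z : ℂ) :
    powFun ν ((A : ℂ) * z) = ((A ^ ν : ℝ) : ℂ) * powFun ν z := by
  have := (isHomogeneousSmooth_powFun ν).map_smul A hA z
  rwa [Complex.real_smul, Complex.real_smul] at this

theorem Params.coeFn_nl {d : ℕ} {μ ν : ℝ} (P : Params d μ ν) {s : ℝ} (hs : (d : ℝ) / 2 < s)
    {u : L2 d} (hu : sobolevNorm s u < ∞) :
    nl μ ν u =ᵐ[volume] fun x => Complex.I * μ * powFun ν (u x) := by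
  filter_upwards [Lp.coeFn_smul (Complex.I * (μ : ℂ)) (powerNonlinearity ν u),
    coeFn_compL2 hs P.isC.zero (powFun_zero ν) hu] with x h1 h2
  rw [nl, h1, Pi.smul_apply, powerNonlinearity_eq, h2, smul_eq_mul]

theorem sobolevNorm_smul_dil_lt_top {d : ℕ} {s c : ℝ} (hc : 0 < c) (A : ℂ) :
    ∃ C : ℝ≥0∞, C < ∞ ∧ ∀ f : L2 d, sobolevNorm s (A • dil c f) ≤ C * sobolevNorm s f := by
  set b := max 1 (max c c⁻¹)
  have hb : 1 ≤ b := le_max_left _ _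
  have hb0 : 0 < b := by linarith
  have h1 : c ≤ b := (le_max_left c c⁻¹).trans (le_max_right _ _)
  have h2 : b⁻¹ ≤ c := inv_le_of_inv_le₀ hc ((le_max_right c c⁻¹).trans (le_max_right _ _))
  refine ⟨‖A‖ₑ * ENNReal.ofReal (b ^ d * (b ^ 2) ^ |s|),
    ENNReal.mul_lt_top enorm_lt_top ENNReal.ofReal_lt_top, fun f => ?_⟩
  rw [sobolevNorm_smul, mul_assoc]
  gcongr
  exact sobolevNorm_dil_le hb h2 h1 s f

theorem Params.nl_smul_dil {d : ℕ} {μ ν : ℝ} (P : Params d μ ν) {s : ℝ} (hs : (d : ℝ) / 2 < s)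
    {u : L2 d} (hu : sobolevNorm s u < ∞) {A c : ℝ} (hA : 0 < A) (hc : 0 < c) :
    nl μ ν ((A : ℂ) • dil c u) = ((A ^ ν : ℝ) : ℂ) • dil c (nl μ ν u) := by
  obtain ⟨C, hC, hCs⟩ := sobolevNorm_smul_dil_lt_top (d := d) (s := s) hc (A : ℂ)
  refine Lp.ext ?_
  filter_upwards [P.coeFn_nl hs ((hCs u).trans_lt (ENNReal.mul_lt_top hC hu)),
    Lp.coeFn_smul (A : ℂ) (dil c u), coeFn_dil hc u, coeFn_dil hc (nl μ ν u),
    Lp.coeFn_smul ((A ^ ν : ℝ) : ℂ) (dil c (nl μ ν u)), ae_comp_smul hc (P.coeFn_nl hs hu)]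
    with x h1 h2 h3 h4 h5 h6
  rw [h1, h2, h5, Pi.smul_apply, Pi.smul_apply, h3, h4, h6, smul_eq_mul, smul_eq_mul,
    powFun_smul ν hA]
  ring

theorem Params.continuousOn_nl {d : ℕ} {μ ν : ℝ} (P : Params d μ ν) {s T : ℝ}
    (hs : (d : ℝ) / 2 < s) {u : ℝ → L2 d} (hu : ContinuousSobolevOn s T u) :
    ContinuousOn (fun t => nl μ ν (u t)) (Icc 0 T) := by
  have hs0 : 0 ≤ s := (by positivity : (0 : ℝ) ≤ (d : ℝ) / 2).trans hs.le
  obtain ⟨R, hR, b⟩ := hu.exists_bound hs0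
  obtain ⟨K, hK⟩ := P.exists_lipschitz hs hR
  exact continuousOn_comp_of_norm_sub_le (hu.continuousOn hs0) fun r hr t ht =>
    hK _ _ (b r hr) (b t ht)

theorem ContinuousSobolevOn.scale {d : ℕ} {s T c : ℝ} (hc : 0 < c) (A : ℂ) {l : ℝ} (hl : 0 < l)
    {u : ℝ → L2 d} (hu : ContinuousSobolevOn s T u) :
    ContinuousSobolevOn s (l * T) (fun t => A • dil c (u (t / l))) := by
  obtain ⟨C, hC, hCs⟩ := sobolevNorm_smul_dil_lt_top (d := d) (s := s) hc A
  have hmem : ∀ t ∈ Icc 0 (l * T), t / l ∈ Icc 0 T := fun t ht =>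
    ⟨div_nonneg ht.1 hl.le, by rw [div_le_iff₀ hl, mul_comm]; exact ht.2⟩
  intro t ht
  refine ⟨(hCs _).trans_lt (ENNReal.mul_lt_top hC (hu _ (hmem t ht)).1), ?_⟩
  have h1 : Tendsto (fun t' => t' / l) (𝓝[Icc 0 (l * T)] t) (𝓝[Icc 0 T] (t / l)) :=
    ((continuous_id.div_const l).continuousWithinAt).tendsto_nhdsWithin hmem
  have h2 := ENNReal.Tendsto.const_mul ((hu _ (hmem t ht)).2.comp h1) (Or.inr hC.ne)
  rw [mul_zero] at h2
  refine tendsto_of_tendsto_of_tendsto_of_le_of_le tendsto_const_nhds h2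
    (fun _ => zero_le) fun t' => ?_
  simp only [Function.comp]
  rw [← smul_sub, ← map_sub]
  exact hCs _

/-- The homogeneity of the nonlinearity requires `A^{ν-1} l = 1`, and that of `Λ` turns the
coefficient `δ` into `1` when `δ = l c`. For `δ = 1` this is the scaling symmetry of the equation;
for small `δ` it realises weakly dispersive behaviour on unit scale by true solutions. -/
theorem Params.scale {d : ℕ} {μ ν : ℝ} (P : Params d μ ν) {s T δ l c A : ℝ}
    (hs : (d : ℝ) / 2 < s) (hl : 0 < l) (hc : 0 < c) (hA : 0 < A) (hAl : A ^ (ν - 1) * l = 1)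
    (hδ : δ = l * c) {u₀ : L2 d} {u : ℝ → L2 d} (hu : ContinuousSobolevOn s T u)
    (hm : IsMild δ T (nl μ ν) u₀ u) :
    IsNLHWSolution μ ν (l * T) ((A : ℂ) • dil c u₀) (fun t => (A : ℂ) • dil c (u (t / l))) := by
  refine isNLHWSolution_iff.2 ⟨⟨s, hs, hu.scale hc _ hl⟩, fun t ht => ?_⟩
  have htl : t / l ∈ Icc 0 T :=
    ⟨div_nonneg ht.1 hl.le, by rw [div_le_iff₀ hl, mul_comm]; exact ht.2⟩
  have hAν : A ^ ν = A * l⁻¹ := by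
    have : A ^ (ν - 1) = l⁻¹ := by field_simp; exact hAl
    rw [← this, Real.rpow_sub_one hA.ne']; field_simp
  have hD : ∀ (r : ℝ) (f : L2 d), (A : ℂ) • dil c (halfWave (δ * r) f) =
      halfWave (l * r) ((A : ℂ) • dil c f) := by
    intro r f
    rw [halfWave_smul, halfWave_dil hc, hδ]
    congr 3
    ring
  set D : L2 d →L[ℂ] L2 d := (A : ℂ) • dil c with hDd
  have hD' : ∀ f, (A : ℂ) • dil c f = D f := fun f => rfl
  set g : ℝ → L2 d := fun τ => halfWave (1 * (t - l * τ)) (nl μ ν (D (u τ))) with hg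
  have hnl : ∀ τ ∈ Icc 0 T, D (nl μ ν (u τ)) = (l : ℂ) • nl μ ν (D (u τ)) := by
    intro τ hτ
    rw [← hD', ← hD', P.nl_smul_dil hs (hu τ hτ).1 hA hc, hAν, smul_smul]
    congr 1
    have : (l : ℂ) ≠ 0 := Complex.ofReal_ne_zero.2 hl.ne'
    push_cast
    field_simp
  have hI := intervalIntegrable_duhamel (δ := δ) (P.continuousOn_nl hs hu) htl (t / l)
  simp only [hD'] at hD ⊢
  rw [hm _ htl, duhamel, map_add, hD, mul_div_cancel₀ _ hl.ne', duhamel, one_mul,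
    ← D.intervalIntegral_comp_comm hI]
  congr 1
  have h1 := intervalIntegral.integral_comp_div (a := 0) (b := t) g hl.ne'
  rw [zero_div] at h1
  have h2 : ∫ σ in (0 : ℝ)..t, halfWave (1 * (t - σ)) (nl μ ν (D (u (σ / l)))) =
      ∫ σ in (0 : ℝ)..t, g (σ / l) := by
    simp only [hg, mul_div_cancel₀ _ hl.ne']
  rw [h2, h1, ← intervalIntegral.integral_smul]
  refine intervalIntegral.integral_congr fun τ hτ => ?_
  rw [uIcc_of_le htl.1] at hτ
  simp only [hg]
  rw [hD, hnl τ ⟨hτ.1, hτ.2.trans htl.2⟩, halfWave_smul, mul_sub, mul_div_cancel₀ _ hl.ne', one_mul,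
    Complex.coe_smul]
  rfl

theorem Params.conj_nl {d : ℕ} {μ ν : ℝ} (P : Params d μ ν) {s : ℝ} (hs : (d : ℝ) / 2 < s)
    {u : L2 d} (hu : sobolevNorm s u < ∞) : conjL2 (nl μ ν u) = - nl μ ν (conjL2 u) := by
  refine Lp.ext ?_
  filter_upwards [coeFn_conjL2 (nl μ ν u), Lp.coeFn_neg (nl μ ν (conjL2 u)), P.coeFn_nl hs hu,
    P.coeFn_nl hs (u := conjL2 u) (by rwa [sobolevNorm_conjL2]), coeFn_conjL2 u]
    with x h1 h2 h3 h4 h5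
  rw [h1, h2, Pi.neg_apply, h3, h4, h5, powFun, powFun, RCLike.norm_conj, map_mul, map_mul,
    Complex.conj_I, map_mul, Complex.conj_ofReal, Complex.conj_ofReal]
  ring

/-- Conjugation turns `e^{itΛ}` into `e^{-itΛ}` and changes the sign of the nonlinear term; the
reflection `t ↦ T - t` undoes both. The work lies in restarting Duhamel's formula from time `T`
(`e1`, `e2`). -/
theorem Params.reverse {d : ℕ} {μ ν : ℝ} (P : Params d μ ν) {T : ℝ} (hT : 0 ≤ T)
    {u₀ : L2 d} {u : ℝ → L2 d} (hu : IsNLHWSolution μ ν T u₀ u) :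
    IsNLHWSolution μ ν T (conjL2 (u T)) (fun t => conjL2 (u (T - t))) := by
  obtain ⟨⟨s, hs, h1⟩, h2⟩ := isNLHWSolution_iff.1 hu
  have hmem : ∀ t ∈ Icc 0 T, T - t ∈ Icc 0 T := fun t ht =>
    ⟨by linarith [ht.2], by linarith [ht.1]⟩
  refine isNLHWSolution_iff.2 ⟨⟨s, hs, fun t ht => ⟨?_, ?_⟩⟩, fun t ht => ?_⟩
  · rw [sobolevNorm_conjL2]; exact (h1 _ (hmem t ht)).1
  · have h3 : Tendsto (fun t' => T - t') (𝓝[Icc 0 T] t) (𝓝[Icc 0 T] (T - t)) :=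
      ((continuous_const.sub continuous_id).continuousWithinAt).tendsto_nhdsWithin hmem
    refine ((h1 _ (hmem t ht)).2.comp h3).congr fun t' => ?_
    simp only [Function.comp]
    rw [← map_sub, sobolevNorm_conjL2]
  · have hc := P.continuousOn_nl hs h1
    have hTm : T ∈ Icc 0 T := ⟨hT, le_rfl⟩
    have hr := hmem t ht
    set r := T - t
    have i1 := intervalIntegrable_duhamel (δ := 1) hc hTm r
    have i2 := intervalIntegrable_duhamel (δ := 1) hc hr r
    have i3 := intervalIntegrable_duhamel (δ := 1) hc hTm T
    have e1 : halfWave (-t) (u T) = halfWave r u₀ +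
        ∫ τ in (0 : ℝ)..T, halfWave (1 * (r - τ)) (nl μ ν (u τ)) := by
      rw [h2 T hTm, duhamel, ← halfWaveL_apply, map_add, halfWaveL_apply, halfWaveL_apply,
        halfWave_integral _ _ _ _ i3, ← halfWave_add]
      congr 1
      · congr 1; ring
      · refine intervalIntegral.integral_congr fun τ _ => ?_
        rw [← halfWave_add]
        congr 1
        simp only [r]; ring
    have e2 : u r = halfWave (-t) (u T) -
        ∫ τ in r..T, halfWave (1 * (r - τ)) (nl μ ν (u τ)) := by
      rw [e1, h2 r hr, duhamel, one_mul, ← intervalIntegral.integral_interval_sub_left i1 i2]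
      abel
    have i4 : IntervalIntegrable (fun τ => halfWave (1 * (r - τ)) (nl μ ν (u τ))) volume r T :=
      i2.symm.trans i1
    change conjL2 (u r) = _
    rw [duhamel, e2, map_sub, ← halfWave_conjL2, one_mul, sub_eq_add_neg,
      ← conjL2.intervalIntegral_comp_comm i4, ← intervalIntegral.integral_neg]
    congr 1
    have e3 := intervalIntegral.integral_comp_sub_left (a := 0) (b := t)
      (fun τ => -conjL2 (halfWave (1 * (r - τ)) (nl μ ν (u τ)))) T
    rw [sub_zero] at e3
    rw [← e3]
    refine intervalIntegral.integral_congr fun τ hτ => ?_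
    rw [uIcc_of_le ht.1] at hτ
    have hτT : τ ∈ Icc 0 T := ⟨hτ.1, hτ.2.trans ht.2⟩
    have e4 : 1 * (r - (T - τ)) = -(1 * (t - τ)) := by simp only [r]; ring
    rw [e4, ← halfWave_conjL2, P.conj_nl hs (h1 _ (hmem τ hτT)).1, ← halfWaveL_apply, map_neg,
      neg_neg, halfWaveL_apply]

/-! ## Profiles: the equation without dispersion -/

/-- The function `x ↦ exp (-q / (1 - |x|²))` on the unit ball, extended by zero. -/
noncomputable def bumpFun {d : ℕ} (q : ℝ) (x : Space d) : ℝ := expNegInvGlue ((1 - ‖x‖ ^ 2) / q)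

theorem bumpFun_nonneg {d : ℕ} (q : ℝ) (x : Space d) : 0 ≤ bumpFun q x := expNegInvGlue.nonneg _

theorem contDiff_bumpFun {d : ℕ} (q : ℝ) : ContDiff ℝ ((⊤ : ℕ∞) : WithTop ℕ∞) (bumpFun q : Space d → ℝ) :=
  expNegInvGlue.contDiff.comp ((contDiff_const.sub (contDiff_norm_sq ℝ)).div_const q)

/-- The reason for this choice of bump: its positive powers are again smooth bumps, so `|φ|^{ν-1}`
is smooth whatever the real exponent `ν > 1`. -/
theorem bumpFun_rpow {d : ℕ} {q : ℝ} (hq : 0 < q) (x : Space d) :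
    bumpFun 1 x ^ q = bumpFun q x := by
  rw [bumpFun, bumpFun, div_one]
  rcases le_or_gt (1 - ‖x‖ ^ 2) 0 with h | h
  · rw [expNegInvGlue.zero_of_nonpos h, expNegInvGlue.zero_of_nonpos
      (div_nonpos_of_nonpos_of_nonneg h hq.le), Real.zero_rpow hq.ne']
  · rw [expNegInvGlue, expNegInvGlue, if_neg h.not_ge, if_neg (div_pos h hq).not_ge,
      ← Real.exp_mul]
    congr 1
    field_simp

theorem hasCompactSupport_bumpFun {d : ℕ} {q : ℝ} (hq : 0 < q) :
    HasCompactSupport (fun x : Space d => ((bumpFun q x : ℝ) : ℂ)) := by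
  refine HasCompactSupport.intro (isCompact_closedBall (0 : Space d) 1) fun x hx => ?_
  rw [mem_closedBall_zero_iff, not_le] at hx
  rw [bumpFun, expNegInvGlue.zero_of_nonpos, Complex.ofReal_zero]
  refine div_nonpos_of_nonpos_of_nonneg ?_ hq.le
  nlinarith

/-- The function `bumpFun q` as a Schwartz function. -/
noncomputable def bump (d : ℕ) {q : ℝ} (hq : 0 < q) : 𝓢(Space d, ℂ) :=
  (hasCompactSupport_bumpFun hq).toSchwartzMap (Complex.ofRealCLM.contDiff.comp (contDiff_bumpFun q))

theorem bump_apply {d : ℕ} {q : ℝ} (hq : 0 < q) (x : Space d) : bump d hq x = bumpFun q x := rfl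

/-- The function `z ↦ e^{iμz}`. -/
noncomputable def expFun (μ : ℝ) (z : ℂ) : ℂ := Complex.exp (Complex.I * μ * z)

theorem isC_expFun (μ : ℝ) (j : ℕ) : IsC j (expFun μ) := by
  refine isC_of_contDiff ?_
  unfold expFun
  exact Complex.contDiff_exp.comp (contDiff_const.mul contDiff_id)

/-- The solution `e^{iμtw} φ` of the equation without dispersion, where `w = |φ|^{ν-1}`. -/
noncomputable def phaseSol {d : ℕ} (μ : ℝ) (w φ : L2 d) (t : ℝ) : L2 d :=
  pmul (fun x => expFun μ (((t : ℂ) • w) x)) φ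

/-- `w` is the potential `|φ|^{ν-1}`, and both functions are in `H^k`. -/
structure IsProfile {d : ℕ} (ν : ℝ) (w φ : L2 d) : Prop where
  finite : sobolevNorm (idx d) φ < ∞
  finite' : sobolevNorm (idx d) w < ∞
  eq_pow : ∀ᵐ x, w x = ((‖φ x‖ ^ (ν - 1) : ℝ) : ℂ)

theorem IsProfile.smul_lt_top {d : ℕ} {ν : ℝ} {w φ : L2 d} (h : IsProfile ν w φ) (t : ℝ) :
    sobolevNorm (idx d) ((t : ℂ) • w) < ∞ := by
  rw [sobolevNorm_smul]
  exact ENNReal.mul_lt_top enorm_lt_top h.finite'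

theorem IsProfile.coeFn_phaseSol {d : ℕ} {μ ν : ℝ} {w φ : L2 d} (h : IsProfile ν w φ) (t : ℝ) :
    phaseSol μ w φ t =ᵐ[volume] fun x => Complex.exp (Complex.I * μ * (t * w x)) * φ x := by
  filter_upwards [coeFn_pmul (memLp_comp_mul (half_lt_index d) (isC_expFun μ 0) (h.smul_lt_top t) φ),
    Lp.coeFn_smul (t : ℂ) w] with x h1 h2
  rw [phaseSol, h1, h2, expFun, Pi.smul_apply, smul_eq_mul]

theorem IsProfile.norm_phaseSol_apply {d : ℕ} {μ ν : ℝ} {w φ : L2 d} (h : IsProfile ν w φ)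
    (t : ℝ) : ∀ᵐ x, ‖phaseSol μ w φ t x‖ = ‖φ x‖ := by
  filter_upwards [h.coeFn_phaseSol (μ := μ) t, h.eq_pow] with x h1 h2
  rw [h1, h2, norm_mul]
  have e : Complex.I * μ * (t * ((‖φ x‖ ^ (ν - 1) : ℝ) : ℂ)) =
      ((μ * (t * ‖φ x‖ ^ (ν - 1)) : ℝ) : ℂ) * Complex.I := by push_cast; ring
  rw [e, Complex.norm_exp_ofReal_mul_I, one_mul]

theorem IsProfile.continuousSobolevOn {d : ℕ} {μ ν : ℝ} {w φ : L2 d} (h : IsProfile ν w φ)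
    (T : ℝ) : ContinuousSobolevOn (idx d) T (phaseSol μ w φ) := by
  have hs := half_lt_index d
  have hL : LipComp d (idx d) (idx d) (expFun μ) :=
    lipComp_of_isC hs le_rfl (isC_expFun μ (idx d))
  intro t ht
  obtain ⟨C, hC, b⟩ := hL.exists_bound hs (isC_expFun μ 0) (h.smul_lt_top t)
  refine ⟨(b _ _ le_rfl h.finite).trans_lt (ENNReal.mul_lt_top hC h.finite), ?_⟩
  set R := ENNReal.ofReal T * sobolevNorm (idx d) w
  have hR : R < ∞ := ENNReal.mul_lt_top ENNReal.ofReal_lt_top h.finite'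
  have hle : ∀ r ∈ Icc 0 T, sobolevNorm (idx d) ((r : ℂ) • w) ≤ R := by
    intro r hr
    rw [sobolevNorm_smul, ← ofReal_norm, Complex.norm_real, Real.norm_of_nonneg hr.1]
    simp only [R]
    gcongr
    exact hr.2
  obtain ⟨C', hC', b'⟩ := hL R hR
  have hlim : Tendsto (fun r : ℝ => C' * (ENNReal.ofReal |r - t| * sobolevNorm (idx d) w) *
      sobolevNorm (idx d) φ) (𝓝[Icc 0 T] t) (𝓝 0) := by
    have h1 : Tendsto (fun r : ℝ => ENNReal.ofReal |r - t|) (𝓝[Icc 0 T] t) (𝓝 0) := by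
      have : Continuous fun r : ℝ => ENNReal.ofReal |r - t| :=
        ENNReal.continuous_ofReal.comp (by fun_prop)
      have h2 := this.tendsto t
      rw [sub_self, abs_zero, ENNReal.ofReal_zero] at h2
      exact h2.mono_left nhdsWithin_le_nhds
    have h2 := ENNReal.Tendsto.mul_const (ENNReal.Tendsto.const_mul
      (ENNReal.Tendsto.mul_const h1 (Or.inr h.finite'.ne)) (Or.inr hC'.ne)) (Or.inr h.finite.ne)
    simpa using h2
  refine tendsto_of_tendsto_of_tendsto_of_le_of_le' tendsto_const_nhds hlim
    (Eventually.of_forall fun _ => zero_le) ?_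
  filter_upwards [self_mem_nhdsWithin] with r hr
  have h1 := b' _ _ φ (hle r hr) (hle t ht) h.finite
  rw [pmul_sub_left (memLp_comp_mul hs (isC_expFun μ 0) (h.smul_lt_top r) φ)
    (memLp_comp_mul hs (isC_expFun μ 0) (h.smul_lt_top t) φ), ← sub_smul, sobolevNorm_smul,
    ← ofReal_norm, ← Complex.ofReal_sub, Complex.norm_real, Real.norm_eq_abs] at h1
  exact h1

theorem IsProfile.coeFn_nl_phaseSol {d : ℕ} {μ ν : ℝ} (P : Params d μ ν) {w φ : L2 d}
    (h : IsProfile ν w φ) (t : ℝ) : nl μ ν (phaseSol μ w φ t) =ᵐ[volume]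
      fun x => Complex.I * μ * (w x * phaseSol μ w φ t x) := by
  have hf : sobolevNorm (idx d) (phaseSol μ w φ t) < ∞ := by
    obtain ⟨C, hC, b⟩ := (lipComp_of_isC (half_lt_index d) le_rfl
      (isC_expFun μ (idx d))).exists_bound (half_lt_index d) (isC_expFun μ 0) (h.smul_lt_top t)
    exact (b _ _ le_rfl h.finite).trans_lt (ENNReal.mul_lt_top hC h.finite)
  filter_upwards [P.coeFn_nl (half_lt_index d) hf, h.norm_phaseSol_apply (μ := μ) t, h.eq_pow]
    with x h1 h2 h3
  rw [h1, powFun, h2, h3]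

/-- The modulus of the solution does not change, so the potential stays `w` and the equation is
linear at each point. The quadratic remainder of the exponential is uniform in `x` because `w` is
bounded, which gives differentiability in `L²`. -/
theorem IsProfile.hasDerivAt {d : ℕ} {μ ν : ℝ} (P : Params d μ ν) {w φ : L2 d}
    (h : IsProfile ν w φ) (t : ℝ) :
    HasDerivAt (phaseSol μ w φ) (nl μ ν (phaseSol μ w φ t)) t := by
  set W := (embConst d (idx d) * sobolevNorm (idx d) w).toReal
  have hW0 : 0 ≤ W := ENNReal.toReal_nonneg
  have hW : ∀ᵐ x, ‖w x‖ ≤ W := ae_norm_le_of_sobolev (half_lt_index d) h.finite' le_rfl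
  have hμ : |μ| = 1 := by rcases P.sign with h | h <;> simp [h]
  have key : ∀ r : ℝ, |r| * W ≤ 1 → ‖phaseSol μ w φ (t + r) - phaseSol μ w φ t -
      r • nl μ ν (phaseSol μ w φ t)‖ ≤ (|r| * W) ^ 2 * ‖φ‖ := by
    intro r hr
    refine Lp.norm_le_mul_norm_of_ae_le_mul ?_
    filter_upwards [Lp.coeFn_sub (phaseSol μ w φ (t + r) - phaseSol μ w φ t)
        (r • nl μ ν (phaseSol μ w φ t)), Lp.coeFn_sub (phaseSol μ w φ (t + r)) (phaseSol μ w φ t),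
      Lp.coeFn_smul r (nl μ ν (phaseSol μ w φ t)), h.coeFn_nl_phaseSol P t,
      h.coeFn_phaseSol (μ := μ) t, h.coeFn_phaseSol (μ := μ) (t + r),
      h.norm_phaseSol_apply (μ := μ) t, hW] with x h1 h2 h3 h4 h5 h6 h7 h8
    have e : phaseSol μ w φ (t + r) x = Complex.exp (Complex.I * μ * (r * w x)) *
        phaseSol μ w φ t x := by
      rw [h6, h5, ← mul_assoc (Complex.exp _), ← Complex.exp_add]
      congr 2
      push_cast; ring
    rw [h1, Pi.sub_apply, h2, Pi.sub_apply, h3, Pi.smul_apply, h4, e]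
    have e2 : Complex.exp (Complex.I * μ * (r * w x)) * phaseSol μ w φ t x - phaseSol μ w φ t x -
        r • (Complex.I * μ * (w x * phaseSol μ w φ t x)) =
        (Complex.exp (Complex.I * μ * (r * w x)) - 1 - Complex.I * μ * (r * w x)) *
          phaseSol μ w φ t x := by
      rw [Complex.real_smul]; ring
    rw [e2, norm_mul, h7]
    have hn : ‖Complex.I * μ * (r * w x)‖ ≤ |r| * W := by
      rw [norm_mul, norm_mul, norm_mul, Complex.norm_I, Complex.norm_real, Complex.norm_real,
        Real.norm_eq_abs, Real.norm_eq_abs, hμ, one_mul, one_mul]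
      gcongr
    gcongr
    exact (Complex.norm_exp_sub_one_sub_id_le (hn.trans hr)).trans (by gcongr)
  rw [hasDerivAt_iff_isLittleO_nhds_zero]
  have hO : (fun r : ℝ => phaseSol μ w φ (t + r) - phaseSol μ w φ t -
      r • nl μ ν (phaseSol μ w φ t)) =O[𝓝 0] fun r : ℝ => r ^ 2 := by
    refine Asymptotics.IsBigO.of_bound (W ^ 2 * ‖φ‖) ?_
    have h0 : Tendsto (fun r : ℝ => |r| * W) (𝓝 0) (𝓝 0) := by
      have : Continuous fun r : ℝ => |r| * W := by fun_prop
      simpa using this.tendsto 0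
    filter_upwards [h0.eventually (gt_mem_nhds one_pos)] with r hr
    refine (key r hr.le).trans_eq ?_
    rw [norm_pow, Real.norm_eq_abs]
    ring
  exact hO.trans_isLittleO (Asymptotics.isLittleO_pow_id one_lt_two)

theorem IsProfile.isMild {d : ℕ} {μ ν : ℝ} (P : Params d μ ν) {w φ : L2 d}
    (h : IsProfile ν w φ) (T : ℝ) : IsMild 0 T (nl μ ν) φ (phaseSol μ w φ) := by
  intro t ht
  have hc := P.continuousOn_nl (half_lt_index d) (h.continuousSobolevOn (μ := μ) t)
  have h1 := intervalIntegral.integral_eq_sub_of_hasDerivAt (fun τ _ => h.hasDerivAt P τ)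
    (ContinuousOn.intervalIntegrable (a := 0) (b := t) (by rwa [uIcc_of_le ht.1]))
  have h0 : phaseSol μ w φ 0 = φ := by
    refine Lp.ext ?_
    filter_upwards [h.coeFn_phaseSol (μ := μ) 0] with x hx
    rw [hx]; simp
  rw [duhamel]
  simp only [zero_mul, halfWave_zero]
  rw [h1, h0, add_sub_cancel]

/-! ## Small dispersion -/

theorem eventually_norm_halfWave_sub_le {d : ℕ} {S : Set (L2 d)} (hS : IsCompact S) {η : ℝ}
    (hη : 0 < η) : ∀ᶠ r in 𝓝 (0 : ℝ), ∀ v ∈ S, ‖halfWave r v - v‖ ≤ η := by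
  refine hS.eventually_forall_of_forall_eventually fun v _ => ?_
  have hc : Continuous fun p : ℝ × L2 d => ‖halfWave p.1 p.2 - p.2‖ :=
    ((continuous_halfWave (d := d)).sub continuous_snd).norm
  have h1 := hc.tendsto (0, v)
  simp only [halfWave_zero, sub_self, norm_zero] at h1
  exact (h1.eventually (gt_mem_nhds hη)).mono fun _ h => h.le

/-- The dispersionless solution has small defect in the equation with small `δ`: the initial value
and the nonlinearity along the curve form a compact set, on which `halfWave` at times at most `δT`
is uniformly close to the identity. Then `exists_mild_near` applies. -/
theorem IsLift.exists_small_dispersion {d : ℕ} {μ ν : ℝ} {M : L2 d → L2 d} {K : ℝ → ℝ}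
    (hM : IsLift μ ν M K) {T : ℝ} (hT : 0 ≤ T) {x₀ : L2 d} {x : ℝ → L2 d}
    (hx : ContinuousOn x (Icc 0 T)) (hm : IsMild 0 T M x₀ x) {ε : ℝ} (hε : 0 < ε) :
    ∃ δ₀ : ℝ, 0 < δ₀ ∧ ∀ δ, 0 < δ → δ < δ₀ → ∃ y : ℝ → L2 d, ContinuousOn y (Icc 0 T) ∧
      IsMild δ T M x₀ y ∧ ∀ t ∈ Icc 0 T, ‖y t - x t‖ ≤ ε := by
  obtain ⟨R, hR0, hR⟩ := exists_norm_le_of_continuousOn hx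
  have hc := hM.lip.continuousOn hx hR
  set E := Real.exp (2 * K (R + 1) * T)
  have hE : 0 < E := Real.exp_pos _
  -- Normalised so that the defect `η (1 + T)` times the Gronwall factor `E` is `min ε 1`; the `1`
  -- meets the smallness condition of `exists_mild_near`.
  set η := min ε 1 / (E * (1 + T)) with hηd
  have hη : 0 < η := by positivity
  have hS : IsCompact (insert x₀ ((fun t => M (x t)) '' Icc 0 T)) :=
    (isCompact_Icc.image_of_continuousOn hc).insert x₀
  obtain ⟨r₀, hr₀, hr⟩ := Metric.eventually_nhds_iff.1 (eventually_norm_halfWave_sub_le hS hη)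
  have hE1 : η * (1 + T) * E = min ε 1 := by rw [hηd]; field_simp
  refine ⟨r₀ / (1 + T), by positivity, fun δ hδ hδ₀ => ?_⟩
  have hsm : ∀ r ∈ Icc 0 T, ∀ v ∈ insert x₀ ((fun t => M (x t)) '' Icc 0 T),
      ‖halfWave (δ * r) v - v‖ ≤ η := by
    intro r hr' v hv
    refine hr ?_ v hv
    rw [Real.dist_eq, sub_zero, abs_of_nonneg (mul_nonneg hδ.le hr'.1)]
    rw [lt_div_iff₀ (by positivity)] at hδ₀
    have : δ * r ≤ δ * (1 + T) := by
      gcongr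
      linarith [hr'.2]
    linarith
  have herr : ∀ t ∈ Icc 0 T, ‖x t - duhamel δ M x₀ x t‖ ≤ η * (1 + T) := by
    intro t ht
    rw [hm t ht, norm_sub_rev, duhamel, duhamel, add_sub_add_comm,
      ← intervalIntegral.integral_sub (intervalIntegrable_duhamel hc ht t)
        (intervalIntegrable_duhamel hc ht t)]
    simp only [zero_mul, halfWave_zero]
    rw [mul_add, mul_one]
    refine (norm_add_le _ _).trans (add_le_add (hsm t ht _ (mem_insert _ _)) ?_)
    have h1 := intervalIntegral.norm_integral_le_of_norm_le_const (a := 0) (b := t) (C := η)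
      (f := fun τ => halfWave (δ * (t - τ)) (M (x τ)) - M (x τ)) (fun τ hτ => by
        rw [uIoc_of_le ht.1] at hτ
        exact hsm _ ⟨by linarith [hτ.2], by linarith [hτ.1, ht.2]⟩ _
          (mem_insert_of_mem _ ⟨τ, ⟨hτ.1.le, hτ.2.trans ht.2⟩, rfl⟩))
    rw [sub_zero, abs_of_nonneg ht.1] at h1
    exact h1.trans (by gcongr; exact ht.2)
  obtain ⟨y, hyc, hym, hyx⟩ := exists_mild_near (δ := δ) hM.lip hT hR0 (hM.nonneg _) hx hR
    (by positivity) herr (by rw [hE1]; exact min_le_right _ _)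
  refine ⟨y, hyc, hym, fun t ht => (hyx t ht).trans ?_⟩
  rw [hE1]
  exact min_le_left _ _

/-- Here the constant curve `x₀` is the approximate solution. The time `T` is fixed before `δ`,
because the later scaling sends `δ` to `0`. -/
theorem IsLift.exists_short_time {d : ℕ} {μ ν : ℝ} {M : L2 d → L2 d} {K : ℝ → ℝ}
    (hM : IsLift μ ν M K) (x₀ : L2 d) {ε : ℝ} (hε : 0 < ε) :
    ∃ T : ℝ, 0 < T ∧ T ≤ 1 ∧ ∀ δ, 0 < δ → δ ≤ 1 → ∃ y : ℝ → L2 d, ContinuousOn y (Icc 0 T) ∧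
      IsMild δ T M x₀ y ∧ ∀ t ∈ Icc 0 T, ‖y t - x₀‖ ≤ ε := by
  set R := ‖x₀‖
  set E := Real.exp (2 * K (R + 1) * 1)
  have hE : 0 < E := Real.exp_pos _
  set η := min ε 1 / (2 * E) with hηd
  have hη : 0 < η := by positivity
  obtain ⟨r₀, hr₀, hr⟩ := Metric.eventually_nhds_iff.1
    (eventually_norm_halfWave_sub_le (isCompact_singleton (x := x₀)) hη)
  have hE1 : (η + η) * E = min ε 1 := by rw [hηd]; field_simp; ring
  set T := min 1 (min (r₀ / 2) (η / (‖M x₀‖ + 1)))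
  have hT : 0 < T := by positivity
  have hT1 : T ≤ 1 := min_le_left _ _
  have hT2 : T ≤ r₀ / 2 := (min_le_right _ _).trans (min_le_left _ _)
  have hT3 : T * ‖M x₀‖ ≤ η := by
    have h1 : T ≤ η / (‖M x₀‖ + 1) := (min_le_right _ _).trans (min_le_right _ _)
    rw [le_div_iff₀ (by positivity)] at h1
    linarith
  refine ⟨T, hT, hT1, fun δ hδ hδ1 => ?_⟩
  have hEx : Real.exp (2 * K (R + 1) * T) ≤ E := by
    have := hM.nonneg (R + 1)
    exact Real.exp_le_exp.2 (mul_le_mul_of_nonneg_left hT1 (by positivity))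
  have herr : ∀ t ∈ Icc 0 T, ‖x₀ - duhamel δ M x₀ (fun _ => x₀) t‖ ≤ η + η := by
    intro t ht
    rw [norm_sub_rev, duhamel, add_sub_right_comm]
    refine (norm_add_le _ _).trans (add_le_add (hr ?_ _ rfl) ?_)
    · rw [Real.dist_eq, sub_zero, abs_of_nonneg (mul_nonneg hδ.le ht.1)]
      have : δ * t ≤ 1 * T := by
        have := ht.1
        gcongr
        exact ht.2
      linarith
    · have h1 := intervalIntegral.norm_integral_le_of_norm_le_const (a := 0) (b := t)
        (C := ‖M x₀‖) (f := fun τ => halfWave (δ * (t - τ)) (M x₀)) (fun τ _ => by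
          rw [norm_halfWave])
      rw [sub_zero, abs_of_nonneg ht.1] at h1
      refine h1.trans (le_trans ?_ hT3)
      rw [mul_comm]
      gcongr
      exact ht.2
  have hsm : (η + η) * Real.exp (2 * K (R + 1) * T) ≤ min ε 1 := by
    rw [← hE1]; gcongr
  obtain ⟨y, hyc, hym, hyx⟩ := exists_mild_near (δ := δ) hM.lip hT.le (norm_nonneg x₀)
    (hM.nonneg _) (continuousOn_const (c := x₀)) (fun _ _ => le_rfl)
    (by positivity) herr (hsm.trans (min_le_right _ _))
  exact ⟨y, hyc, hym, fun t ht => (hyx t ht).trans (hsm.trans (min_le_left _ _))⟩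

theorem Params.exists_profile_solution {d : ℕ} {μ ν : ℝ} (P : Params d μ ν) {w φ : L2 d}
    (h : IsProfile ν w φ) {T : ℝ} (hT : 0 ≤ T) {ε : ℝ} (hε : 0 < ε) :
    ∃ δ₀ : ℝ, 0 < δ₀ ∧ ∀ δ, 0 < δ → δ < δ₀ → ∃ v : ℝ → L2 d,
      ContinuousSobolevOn (idx d) T v ∧ IsMild δ T (nl μ ν) φ v ∧
      ∀ t ∈ Icc 0 T, sobolevNorm (idx d) (v t - phaseSol μ w φ t) ≤ ENNReal.ofReal ε := by
  have hk := idx_nonneg d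
  obtain ⟨M, K, hM⟩ := P.exists_isLift
  obtain ⟨x₀, rfl⟩ := exists_bessel_eq hk h.finite
  obtain ⟨x, hx, hux⟩ := (h.continuousSobolevOn (μ := μ) T).exists_bessel hk
  obtain ⟨δ₀, hδ₀, H⟩ := hM.exists_small_dispersion hT hx
    (hM.isMild_of_bessel hx (h.isMild P T) hux) hε
  refine ⟨δ₀, hδ₀, fun δ hδ hδ' => ?_⟩
  obtain ⟨y, hy, hym, hyx⟩ := H δ hδ hδ'
  refine ⟨_, continuousSobolevOn_bessel hk hy fun _ _ => rfl, hM.isMild hy hym, fun t ht => ?_⟩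
  rw [hux t ht, ← map_sub, sobolevNorm_bessel hk, ← ofReal_norm]
  exact ENNReal.ofReal_le_ofReal (hyx t ht)

theorem Params.exists_short_time_solution {d : ℕ} {μ ν : ℝ} (P : Params d μ ν) {φ : L2 d}
    (h : sobolevNorm (idx d) φ < ∞) {ε : ℝ} (hε : 0 < ε) :
    ∃ T : ℝ, 0 < T ∧ T ≤ 1 ∧ ∀ δ, 0 < δ → δ ≤ 1 → ∃ v : ℝ → L2 d,
      ContinuousSobolevOn (idx d) T v ∧ IsMild δ T (nl μ ν) φ v ∧
      ∀ t ∈ Icc 0 T, sobolevNorm (idx d) (v t - φ) ≤ ENNReal.ofReal ε := by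
  have hk := idx_nonneg d
  obtain ⟨M, K, hM⟩ := P.exists_isLift
  obtain ⟨x₀, rfl⟩ := exists_bessel_eq hk h
  obtain ⟨T, hT, hT1, H⟩ := hM.exists_short_time x₀ hε
  refine ⟨T, hT, hT1, fun δ hδ hδ' => ?_⟩
  obtain ⟨y, hy, hym, hyx⟩ := H δ hδ hδ'
  refine ⟨_, continuousSobolevOn_bessel hk hy fun _ _ => rfl, hM.isMild hy hym, fun t ht => ?_⟩
  rw [← map_sub, sobolevNorm_bessel hk, ← ofReal_norm]
  exact ENNReal.ofReal_le_ofReal (hyx t ht)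

/-! ## Concentrating solutions -/

theorem schwartzL2_smul {d : ℕ} (c : ℂ) (f : 𝓢(Space d, ℂ)) :
    schwartzL2 (c • f) = c • schwartzL2 f := by
  refine Lp.ext ?_
  filter_upwards [coeFn_schwartzL2 (c • f), Lp.coeFn_smul c (schwartzL2 f), coeFn_schwartzL2 f]
    with x h1 h2 h3
  rw [h1, h2, Pi.smul_apply, h3]
  rfl

theorem schwartzL2_sub {d : ℕ} (f g : 𝓢(Space d, ℂ)) :
    schwartzL2 (f - g) = schwartzL2 f - schwartzL2 g := by
  refine Lp.ext ?_
  filter_upwards [coeFn_schwartzL2 (f - g), Lp.coeFn_sub (schwartzL2 f) (schwartzL2 g),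
    coeFn_schwartzL2 f, coeFn_schwartzL2 g] with x h1 h2 h3 h4
  rw [h1, h2, Pi.sub_apply, h3, h4]
  rfl

/-- With `l = δℓ` the two conditions reduce to `ℓ^{e-p} = B δ^p`, whose root tends to `0` with `δ`
when `p < e`. For `p = 1/(ν-1)` and `e = d/2 - γ`, the condition `p < e` says `γ < γ_c`. -/
theorem eventually_exists_scaling_params {p e B ε : ℝ} (hp : 0 < p) (hpe : p < e) (hB : 0 < B)
    (hε : 0 < ε) : ∀ᶠ δ in 𝓝[>] (0 : ℝ), ∃ l ℓ : ℝ, 0 < l ∧ l < ε ∧ 0 < ℓ ∧ ℓ < ε ∧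
      δ = l * ℓ⁻¹ ∧ l ^ (-p) * ℓ ^ e = B := by
  have hq : 0 < e - p := sub_pos.2 hpe
  have hlim : Tendsto (fun δ : ℝ => B ^ (1 / (e - p)) * δ ^ (p / (e - p))) (𝓝[>] 0) (𝓝 0) := by
    have h1 : ContinuousAt (fun δ : ℝ => B ^ (1 / (e - p)) * δ ^ (p / (e - p))) 0 :=
      continuousAt_const.mul (Real.continuousAt_rpow_const _ _ (Or.inr (by positivity)))
    have h2 := h1.tendsto
    rw [Real.zero_rpow (by positivity), mul_zero] at h2
    exact h2.mono_left nhdsWithin_le_nhds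
  filter_upwards [hlim.eventually (gt_mem_nhds hε), self_mem_nhdsWithin,
    nhdsWithin_le_nhds (gt_mem_nhds one_pos)] with δ h1 (hδ : 0 < δ) hδ1
  set ℓ := B ^ (1 / (e - p)) * δ ^ (p / (e - p))
  have hℓ : 0 < ℓ := by positivity
  refine ⟨δ * ℓ, ℓ, by positivity, by nlinarith, hℓ, h1, by field_simp, ?_⟩
  have h3 : ℓ ^ (e - p) = B * δ ^ p := by
    rw [Real.mul_rpow (by positivity) (by positivity), ← Real.rpow_mul hB.le,
      ← Real.rpow_mul hδ.le, one_div_mul_cancel hq.ne', div_mul_cancel₀ _ hq.ne', Real.rpow_one]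
  rw [Real.mul_rpow hδ.le hℓ.le, mul_assoc, ← Real.rpow_add hℓ, neg_add_eq_sub, h3,
    Real.rpow_neg hδ.le]
  have : 0 < δ ^ p := by positivity
  field_simp

/-- The map `D` concentrates at length `ℓ` with the amplitude dictated by `l`; the normalisation `B`
is free. The statement holds for all small `δ`, so that it can be combined with the smallness that
the δ-equation demands. -/
theorem Params.eventually_exists_scaling {d : ℕ} {μ ν : ℝ} (P : Params d μ ν) {γ B ε : ℝ}
    (hγ : γ < criticalExponent d ν) (hB : 0 < B) (hε : 0 < ε) :
    ∀ᶠ δ in 𝓝[>] (0 : ℝ), ∃ (l ℓ : ℝ) (D : L2 d →L[ℂ] L2 d), 0 < l ∧ l < ε ∧ 0 < ℓ ∧ ℓ < ε ∧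
      (∀ g, sobolevNorm γ (D g) ^ 2 = ENNReal.ofReal (B ^ 2) * scaledEnergy γ ℓ g) ∧
      ∀ (T : ℝ) (f : 𝓢(Space d, ℂ)) (v : ℝ → L2 d), ContinuousSobolevOn (idx d) T v →
        IsMild δ T (nl μ ν) (schwartzL2 f) v → ∃ (f' : 𝓢(Space d, ℂ)) (u : ℝ → L2 d),
          IsNLHWSolution μ ν (l * T) (schwartzL2 f') u ∧ schwartzL2 f' = D (schwartzL2 f) ∧
            u (l * T) = D (v T) := by
  have hν := P.one_lt
  have hp : 0 < 1 / (ν - 1) := one_div_pos.2 (sub_pos.2 hν)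
  rw [criticalExponent] at hγ
  filter_upwards [eventually_exists_scaling_params (e := (d : ℝ) / 2 - γ) hp (by linarith) hB hε]
    with δ ⟨l, ℓ, hl, hl', hℓ, hℓ', hδ, hA⟩
  set A := l ^ (-(1 / (ν - 1)))
  have hA0 : 0 < A := by positivity
  refine ⟨l, ℓ, (A : ℂ) • dil ℓ⁻¹, hl, hl', hℓ, hℓ', fun g => ?_, fun T f v hv hm => ?_⟩
  · rw [← hA]
    exact sobolevNorm_scaled_sq hℓ hA0 γ g
  · obtain ⟨ψ, -, hψ⟩ := exists_schwartzL2_eq_dil (inv_pos.2 hℓ) f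
    have hAl : A ^ (ν - 1) * l = 1 := by
      rw [← Real.rpow_mul hl.le, neg_mul, one_div_mul_cancel (sub_pos.2 hν).ne', Real.rpow_neg_one,
        inv_mul_cancel₀ hl.ne']
    have h1 := P.scale (half_lt_index d) hl (inv_pos.2 hℓ) hA0 hAl hδ hv hm
    refine ⟨(A : ℂ) • ψ, fun t => (A : ℂ) • dil ℓ⁻¹ (v (t / l)), ?_, ?_, ?_⟩
    · rwa [schwartzL2_smul, ← hψ]
    · rw [schwartzL2_smul, ← hψ]; rfl
    · simp only [mul_div_cancel_left₀ T hl.ne']; rfl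

theorem scaledEnergy_le {d : ℕ} {γ ℓ : ℝ} (hγ : 0 ≤ γ) (hℓ : 0 < ℓ) (hℓ1 : ℓ < 1) (f : L2 d) :
    scaledEnergy γ ℓ f ≤ sobolevNorm γ f ^ 2 := by
  rw [sobolevNorm_sq, scaledEnergy]
  refine lintegral_mono fun ξ => ?_
  gcongr
  rw [weight]
  gcongr
  nlinarith

theorem scaledEnergy_zero_le {d : ℕ} {γ ℓ : ℝ} (hγ : 0 ≤ γ) (hℓ : 0 ≤ ℓ) (f : L2 d) :
    scaledEnergy γ 0 f ≤ scaledEnergy γ ℓ f := by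
  refine lintegral_mono fun ξ => ?_
  gcongr

theorem scaledEnergy_zero_left {d : ℕ} (ℓ : ℝ) (f : L2 d) : scaledEnergy 0 ℓ f = ‖f‖ₑ ^ 2 := by
  rw [scaledEnergy, ← sobolevNorm_zero_left, sobolevNorm_sq]
  simp only [Real.rpow_zero]

/-- The potential of the profile `a • bump`. -/
theorem isProfile_bump {d : ℕ} {ν : ℝ} (hν : 1 < ν) {a : ℝ} (ha : 0 < a) :
    IsProfile ν (((a ^ (ν - 1) : ℝ) : ℂ) • schwartzL2 (bump d (sub_pos.2 hν)))
      ((a : ℂ) • schwartzL2 (bump d one_pos)) where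
  finite := by
    rw [← schwartzL2_smul]
    exact sobolevNorm_schwartzL2_lt_top _ _
  finite' := by
    rw [← schwartzL2_smul]
    exact sobolevNorm_schwartzL2_lt_top _ _
  eq_pow := by
    filter_upwards [Lp.coeFn_smul ((a ^ (ν - 1) : ℝ) : ℂ) (schwartzL2 (bump d (sub_pos.2 hν))),
      Lp.coeFn_smul (a : ℂ) (schwartzL2 (bump d one_pos)), coeFn_schwartzL2 (bump d one_pos),
      coeFn_schwartzL2 (bump d (sub_pos.2 hν))] with x h1 h2 h3 h4
    rw [h1, h2, Pi.smul_apply, Pi.smul_apply, h3, h4, bump_apply, bump_apply, smul_eq_mul,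
      smul_eq_mul, ← Complex.ofReal_mul, ← Complex.ofReal_mul, Complex.norm_real,
      Real.norm_of_nonneg (mul_nonneg ha.le (bumpFun_nonneg _ _)),
      Real.mul_rpow ha.le (bumpFun_nonneg _ _), bumpFun_rpow (sub_pos.2 hν)]

theorem coeFn_phaseSol_bump {d : ℕ} {μ ν : ℝ} (hν : 1 < ν) {a : ℝ} (ha : 0 < a) (t : ℝ) :
    phaseSol μ (((a ^ (ν - 1) : ℝ) : ℂ) • schwartzL2 (bump d (sub_pos.2 hν)))
      ((a : ℂ) • schwartzL2 (bump d one_pos)) t =ᵐ[volume] fun x =>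
        Complex.exp (((μ * t * a ^ (ν - 1) * bumpFun (ν - 1) x : ℝ) : ℂ) * Complex.I) *
          (a * bumpFun 1 x : ℝ) := by
  filter_upwards [(isProfile_bump hν ha).coeFn_phaseSol (μ := μ) t,
    Lp.coeFn_smul ((a ^ (ν - 1) : ℝ) : ℂ) (schwartzL2 (bump d (sub_pos.2 hν))),
    Lp.coeFn_smul (a : ℂ) (schwartzL2 (bump d one_pos)), coeFn_schwartzL2 (bump d one_pos),
    coeFn_schwartzL2 (bump d (sub_pos.2 hν))] with x h0 h1 h2 h3 h4
  rw [h0, h1, h2, Pi.smul_apply, Pi.smul_apply, h3, h4, bump_apply, bump_apply, smul_eq_mul,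
    smul_eq_mul]
  push_cast
  congr 2
  ring

/-! ## Growth of the homogeneous Sobolev norm of an oscillating profile -/

theorem enorm_sq_eq_lintegral_fourier {d : ℕ} (f : L2 d) :
    ‖f‖ₑ ^ 2 = ∫⁻ ξ, ‖(𝓕 f : L2 d) ξ‖ₑ ^ 2 := by
  rw [← sobolevNorm_zero_left, sobolevNorm_sq]
  simp only [Real.rpow_zero, ENNReal.ofReal_one, one_mul]

/-- The squared minimum is at most `4 (ay)^p` for every `0 < p ≤ 2`. With `p = 2 min γ 1` the power
of `y` is dominated by `1 + y^{2γ}`. -/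
theorem min_mul_sq_le {γ a y : ℝ} (hγ : 0 < γ) (ha : 0 ≤ a) (hy : 0 ≤ y) :
    min 2 (a * y) ^ 2 ≤ 4 * a ^ (2 * min γ 1) * (1 + (0 ^ 2 + y ^ 2) ^ γ) := by
  have hm : 0 < min γ 1 := lt_min hγ one_pos
  have h1 : min 2 (a * y) ^ 2 ≤ 4 * (a * y) ^ (2 * min γ 1) := by
    have hay : 0 ≤ a * y := mul_nonneg ha hy
    have hmin : 0 ≤ min 2 (a * y) := le_min two_pos.le hay
    rcases le_total 1 (a * y) with h | h
    · have h2 : min 2 (a * y) ^ 2 ≤ 2 ^ 2 := by gcongr; exact min_le_left _ _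
      have h3 : 1 ≤ (a * y) ^ (2 * min γ 1) := Real.one_le_rpow h (by positivity)
      linarith
    · have h2 : min 2 (a * y) ^ 2 ≤ (a * y) ^ 2 := by gcongr; exact min_le_right _ _
      have h3 : (a * y) ^ (2 : ℝ) ≤ (a * y) ^ (2 * min γ 1) := by
        refine Real.rpow_le_rpow_of_exponent_ge_of_imp hay h ?_ fun _ h' => absurd h' (by positivity)
        linarith [min_le_right γ 1]
      rw [Real.rpow_two] at h3
      nlinarith [sq_nonneg (a * y)]
  have h2 : y ^ (2 * min γ 1) ≤ 1 + (0 ^ 2 + y ^ 2) ^ γ := by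
    rw [zero_pow two_ne_zero, zero_add, ← Real.rpow_natCast_mul hy]
    have h0 : 0 ≤ y ^ (((2 : ℕ) : ℝ) * γ) := by positivity
    rcases le_total y 1 with h | h
    · have := Real.rpow_le_one hy h (z := 2 * min γ 1) (by positivity)
      linarith
    · have : y ^ (2 * min γ 1) ≤ y ^ (((2 : ℕ) : ℝ) * γ) := by
        refine Real.rpow_le_rpow_of_exponent_le h ?_
        push_cast
        linarith [min_le_left γ 1]
      linarith
  rw [Real.mul_rpow ha hy, ← mul_assoc] at h1
  exact h1.trans (by gcongr)

theorem fourier_comp_add_right {d : ℕ} (f : Space d → ℂ) (h ξ : Space d) :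
    𝓕 (fun x => f (x + h)) ξ =
      Complex.exp (Complex.I * ((2 * Real.pi * inner ℝ h ξ : ℝ) : ℂ)) * 𝓕 f ξ := by
  have := congr_fun (VectorFourier.fourierIntegral_comp_add_right Real.fourierChar
    (volume : Measure (Space d)) (innerₗ (Space d)) f h) ξ
  refine this.trans ?_
  rw [Circle.smul_def, Real.fourierChar_apply, smul_eq_mul, mul_comm Complex.I]
  rfl

/-- Finite energy of order `γ > 0` means Hölder continuity in `L²` under translations. Through this
criterion a fractional norm can be shown to be large without being computed. -/
theorem lintegral_translate_sub_le {d : ℕ} {f : Space d → ℂ} (h1 : Integrable f)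
    (h2 : MemLp f 2 volume) {γ : ℝ} (hγ : 0 < γ) (h : Space d) :
    ∫⁻ x, ‖f (x + h) - f x‖ₑ ^ 2 ≤ ENNReal.ofReal (4 * ‖h‖ ^ (2 * min γ 1)) *
      (‖(h2.toLp f : L2 d)‖ₑ ^ 2 + scaledEnergy γ 0 (h2.toLp f)) := by
  have h1' : Integrable (fun x => f (x + h)) := h1.comp_add_right h
  have h2' : MemLp (fun x => f (x + h)) 2 volume :=
    h2.comp_measurePreserving (measurePreserving_add_right volume h)
  have e : ∫⁻ x, ‖f (x + h) - f x‖ₑ ^ 2 = ‖(h2'.toLp _ - h2.toLp f : L2 d)‖ₑ ^ 2 := by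
    rw [enorm_sq_eq_lintegral]
    refine lintegral_congr_ae ?_
    filter_upwards [Lp.coeFn_sub (h2'.toLp _) (h2.toLp f), h2.coeFn_toLp, h2'.coeFn_toLp]
      with x e1 e2 e3
    rw [e1, Pi.sub_apply, e2, e3]
  have hm : AEMeasurable (fun ξ : Space d => ‖(𝓕 (h2.toLp f : L2 d) : L2 d) ξ‖ₑ ^ 2) volume :=
    (Lp.aestronglyMeasurable _).enorm.pow_const 2
  rw [e, enorm_sq_eq_lintegral_fourier, enorm_sq_eq_lintegral_fourier, scaledEnergy,
    ← lintegral_add_left' hm, ← lintegral_const_mul' _ _ ENNReal.ofReal_ne_top]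
  refine lintegral_mono_ae ?_
  filter_upwards [fourier_sub_ae (h2'.toLp _ : L2 d) (h2.toLp f), fourier_toLp_ae h1 h2,
    fourier_toLp_ae h1' h2'] with ξ e1 e2 e3
  rw [e1, e3, e2, fourier_comp_add_right, ← sub_one_mul, enorm_mul, mul_pow, ← one_add_mul,
    ← mul_assoc]
  gcongr
  set θ : ℝ := 2 * Real.pi * inner ℝ h ξ
  have hθ : |θ| ≤ ‖h‖ * (2 * Real.pi * ‖ξ‖) := by
    rw [abs_mul, abs_of_pos Real.two_pi_pos]
    nlinarith [abs_real_inner_le_norm h ξ, Real.two_pi_pos]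
  have hn : ‖Complex.exp (Complex.I * (θ : ℂ)) - 1‖ ≤ min 2 (‖h‖ * (2 * Real.pi * ‖ξ‖)) := by
    refine le_min ?_ (Real.norm_exp_I_mul_ofReal_sub_one_le.trans hθ)
    refine (norm_sub_le _ _).trans ?_
    rw [mul_comm, Complex.norm_exp_ofReal_mul_I, norm_one]
    norm_num
  rw [← ofReal_norm, ← ENNReal.ofReal_pow (norm_nonneg _), ← ENNReal.ofReal_one,
    ← ENNReal.ofReal_add zero_le_one (by positivity), ← ENNReal.ofReal_mul (by positivity)]
  refine ENNReal.ofReal_le_ofReal (le_trans ?_ (min_mul_sq_le hγ (norm_nonneg h) (by positivity)))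
  gcongr

theorem bumpFun_eq_zero {d : ℕ} {q : ℝ} (hq : 0 < q) {x : Space d} (hx : 1 ≤ ‖x‖) :
    bumpFun q x = 0 := by
  refine expNegInvGlue.zero_of_nonpos (div_nonpos_of_nonpos_of_nonneg ?_ hq.le)
  nlinarith

theorem bumpFun_pos {d : ℕ} {q : ℝ} (hq : 0 < q) {x : Space d} (hx : ‖x‖ < 1) :
    0 < bumpFun q x := by
  refine expNegInvGlue.pos_of_pos (div_pos ?_ hq)
  nlinarith [norm_nonneg x]

/-- Outside the open unit ball the bump attains its minimum, so its derivative vanishes there. If it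
vanished inside as well, the bump would be constant. -/
theorem exists_fderiv_bumpFun_ne_zero {d : ℕ} (hd : 1 ≤ d) {q : ℝ} (hq : 0 < q) :
    ∃ x : Space d, bumpFun 1 x ≠ 0 ∧ fderiv ℝ (bumpFun q) x ≠ 0 := by
  by_contra! H
  have h0 : ∀ x : Space d, fderiv ℝ (bumpFun q) x = 0 := by
    intro x
    rcases lt_or_ge ‖x‖ 1 with h | h
    · exact H x (bumpFun_pos one_pos h).ne'
    · refine IsLocalMin.fderiv_eq_zero (Eventually.of_forall fun y => ?_)
      rw [bumpFun_eq_zero hq h]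
      exact bumpFun_nonneg q y
  have h1 := is_const_of_fderiv_eq_zero ((contDiff_bumpFun q).differentiable (by simp)) h0 0
    (EuclideanSpace.single ⟨0, hd⟩ 1)
  rw [bumpFun_eq_zero (x := EuclideanSpace.single _ _) hq (by simp)] at h1
  exact (bumpFun_pos hq (by simp)).ne' h1

/-- The bump function with a phase proportional to another bump function. -/
noncomputable def oscBump {d : ℕ} (q θ : ℝ) (x : Space d) : ℂ :=
  Complex.exp (((θ * bumpFun q x : ℝ) : ℂ) * Complex.I) * (bumpFun 1 x : ℝ)

theorem continuous_bumpFun {d : ℕ} (q : ℝ) : Continuous (bumpFun q : Space d → ℝ) :=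
  (contDiff_bumpFun q).continuous

theorem continuous_oscBump {d : ℕ} (q θ : ℝ) : Continuous (oscBump q θ : Space d → ℂ) := by
  have := continuous_bumpFun (d := d) q
  have := continuous_bumpFun (d := d) 1
  unfold oscBump
  fun_prop

theorem norm_oscBump {d : ℕ} (q θ : ℝ) (x : Space d) : ‖oscBump q θ x‖ = bumpFun 1 x := by
  rw [oscBump, norm_mul, Complex.norm_exp_ofReal_mul_I, one_mul, Complex.norm_real,
    Real.norm_of_nonneg (bumpFun_nonneg _ _)]

theorem hasCompactSupport_oscBump {d : ℕ} (q θ : ℝ) :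
    HasCompactSupport (oscBump q θ : Space d → ℂ) :=
  (hasCompactSupport_bumpFun one_pos).mul_left

theorem memLp_oscBump {d : ℕ} (q θ : ℝ) : MemLp (oscBump q θ : Space d → ℂ) 2 volume :=
  (continuous_oscBump q θ).memLp_of_hasCompactSupport (hasCompactSupport_oscBump q θ)

theorem integrable_oscBump {d : ℕ} (q θ : ℝ) : Integrable (oscBump q θ : Space d → ℂ) :=
  (continuous_oscBump q θ).integrable_of_hasCompactSupport (hasCompactSupport_oscBump q θ)

theorem enorm_toLp_oscBump {d : ℕ} (q θ : ℝ) :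
    ‖((memLp_oscBump q θ).toLp _ : L2 d)‖ₑ = ‖schwartzL2 (bump d one_pos)‖ₑ := by
  rw [← ofReal_norm, ← ofReal_norm]
  congr 1
  refine le_antisymm (Lp.norm_le_norm_of_ae_le ?_) (Lp.norm_le_norm_of_ae_le ?_) <;>
  · filter_upwards [(memLp_oscBump (d := d) q θ).coeFn_toLp, coeFn_schwartzL2 (bump d one_pos)]
      with x h1 h2
    rw [h1, h2, norm_oscBump, bump_apply, Complex.norm_real,
      Real.norm_of_nonneg (bumpFun_nonneg _ _)]

theorem norm_exp_mul_sub_exp_mul (a b : ℝ) (x y : ℂ) :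
    ‖Complex.exp ((a : ℂ) * Complex.I) * x - Complex.exp ((b : ℂ) * Complex.I) * y‖ =
      ‖Complex.exp (((a - b : ℝ) : ℂ) * Complex.I) * x - y‖ := by
  have e : Complex.exp ((a : ℂ) * Complex.I) * x - Complex.exp ((b : ℂ) * Complex.I) * y =
      Complex.exp ((b : ℂ) * Complex.I) *
        (Complex.exp (((a - b : ℝ) : ℂ) * Complex.I) * x - y) := by
    rw [mul_sub, ← mul_assoc, ← Complex.exp_add]
    congr 3
    push_cast
    ring
  rw [e, norm_mul, Complex.norm_exp_ofReal_mul_I, one_mul]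

/-- A translation by `v/(n+1)` meets a phase of size `n + 1`: the phase difference is `μ` times a
difference quotient, which converges to a directional derivative, while the amplitude is unchanged
in the limit. -/
theorem tendsto_oscBump_translate {d : ℕ} (q μ : ℝ) (v x : Space d) :
    Tendsto (fun n : ℕ => ‖oscBump q (μ * (n + 1 : ℝ)) (x + (n + 1 : ℝ)⁻¹ • v) -
      oscBump q (μ * (n + 1 : ℝ)) x‖) atTop
      (𝓝 ‖(Complex.exp (((μ * fderiv ℝ (bumpFun q) x v : ℝ) : ℂ) * Complex.I) - 1) *
        (bumpFun 1 x : ℝ)‖) := by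
  have e : ∀ n : ℕ, ‖oscBump q (μ * (n + 1 : ℝ)) (x + (n + 1 : ℝ)⁻¹ • v) -
      oscBump q (μ * (n + 1 : ℝ)) x‖ =
      ‖Complex.exp (((μ * ((n + 1 : ℝ) * (bumpFun q (x + (n + 1 : ℝ)⁻¹ • v) - bumpFun q x)) : ℝ) :
        ℂ) * Complex.I) * (bumpFun 1 (x + (n + 1 : ℝ)⁻¹ • v) : ℝ) - (bumpFun 1 x : ℝ)‖ := by
    intro n
    rw [oscBump, oscBump, norm_exp_mul_sub_exp_mul, ← mul_sub, mul_assoc]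
  rw [sub_one_mul]
  refine Tendsto.congr (fun n => (e n).symm) ?_
  have hn : Tendsto (fun n : ℕ => (n + 1 : ℝ)⁻¹) atTop (𝓝 0) :=
    tendsto_inv_atTop_zero.comp (tendsto_atTop_add_const_right _ _ tendsto_natCast_atTop_atTop)
  have h1 : Tendsto (fun n : ℕ => (n + 1 : ℝ) * (bumpFun q (x + (n + 1 : ℝ)⁻¹ • v) - bumpFun q x))
      atTop (𝓝 (fderiv ℝ (bumpFun q) x v)) := by
    exact ((contDiff_bumpFun q).differentiable (by simp) x).hasFDerivAt.lim v
      (tendsto_norm_atTop_atTop.comp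
        (tendsto_atTop_add_const_right _ _ tendsto_natCast_atTop_atTop))
  have h2 : Tendsto (fun n : ℕ => bumpFun 1 (x + (n + 1 : ℝ)⁻¹ • v)) atTop (𝓝 (bumpFun 1 x)) := by
    have h3 : Tendsto (fun n : ℕ => x + (n + 1 : ℝ)⁻¹ • v) atTop (𝓝 (x + (0 : ℝ) • v)) :=
      tendsto_const_nhds.add (hn.smul_const v)
    rw [zero_smul, add_zero] at h3
    exact ((continuous_bumpFun 1).tendsto x).comp h3
  have hc : Continuous fun p : ℝ × ℝ => ‖Complex.exp (((μ * p.1 : ℝ) : ℂ) * Complex.I) * (p.2 : ℝ) -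
      (bumpFun 1 x : ℝ)‖ := by fun_prop
  have h4 := (hc.tendsto (fderiv ℝ (bumpFun q) x v, bumpFun 1 x)).comp (h1.prodMk_nhds h2)
  exact h4

/-- If the energies stayed bounded, translations by `v/(n+1)` would change the functions by `o(1)`
in `L²`. But the change converges pointwise to a continuous function that is not identically zero,
which contradicts Fatou's lemma. -/
theorem exists_energy_gt {d : ℕ} (hd : 1 ≤ d) {q μ γ : ℝ} (hq : 0 < q) (hμ : μ ≠ 0) (hγ : 0 < γ)
    {C : ℝ≥0∞} (hC : C < ∞) : ∃ n : ℕ,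
      C < scaledEnergy γ 0 ((memLp_oscBump q (μ * (n + 1 : ℝ))).toLp _ : L2 d) := by
  by_contra! H
  obtain ⟨x₀, hx₀, hfd⟩ := exists_fderiv_bumpFun_ne_zero hd hq
  obtain ⟨v₀, hv₀⟩ : ∃ v, fderiv ℝ (bumpFun q) x₀ v ≠ 0 := by
    by_contra! h
    exact hfd (ContinuousLinearMap.ext h)
  -- The length of `v` makes the limiting phase difference at `x₀` equal to `π`, where `e^{iπ} - 1 =
  -- -2`.
  set v := (Real.pi / (μ * fderiv ℝ (bumpFun q) x₀ v₀)) • v₀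
  have hv : μ * fderiv ℝ (bumpFun q) x₀ v = Real.pi := by
    simp only [v, map_smul, smul_eq_mul]
    field_simp
  set L : Space d → ℂ := fun x => (Complex.exp (((μ * fderiv ℝ (bumpFun q) x v : ℝ) : ℂ) *
    Complex.I) - 1) * (bumpFun 1 x : ℝ)
  have hLc : Continuous L := by
    have h1 : Continuous fun x : Space d => fderiv ℝ (bumpFun q) x v :=
      ((contDiff_bumpFun q).continuous_fderiv (by simp)).clm_apply continuous_const
    have := continuous_bumpFun (d := d) 1
    fun_prop
  have hL0 : L x₀ ≠ 0 := by
    refine mul_ne_zero ?_ (Complex.ofReal_ne_zero.2 hx₀)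
    rw [hv, Complex.exp_pi_mul_I]
    norm_num
  set c := ‖schwartzL2 (bump d one_pos)‖ₑ
  have hc : c ^ 2 + C < ∞ := ENNReal.add_lt_top.2 ⟨ENNReal.pow_lt_top enorm_lt_top, hC⟩
  set Φ : ℕ → Space d → ℝ≥0∞ := fun n x => ‖oscBump q (μ * (n + 1 : ℝ)) (x + (n + 1 : ℝ)⁻¹ • v) -
    oscBump q (μ * (n + 1 : ℝ)) x‖ₑ ^ 2
  have hm : ∀ n, AEMeasurable (Φ n) volume := by
    intro n
    have h1 := continuous_oscBump (d := d) q (μ * (n + 1 : ℝ))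
    have h2 : Continuous fun x : Space d => oscBump q (μ * (n + 1 : ℝ)) (x + (n + 1 : ℝ)⁻¹ • v) -
      oscBump q (μ * (n + 1 : ℝ)) x := by fun_prop
    exact (h2.enorm.measurable.pow_const 2).aemeasurable
  have hle : ∀ n, ∫⁻ x, Φ n x ≤
      ENNReal.ofReal (4 * ‖(n + 1 : ℝ)⁻¹ • v‖ ^ (2 * min γ 1)) * (c ^ 2 + C) := by
    intro n
    refine (lintegral_translate_sub_le (integrable_oscBump q _) (memLp_oscBump q _) hγ _).trans ?_
    rw [enorm_toLp_oscBump]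
    gcongr
    exact H n
  have hlim : Tendsto (fun n : ℕ => ENNReal.ofReal (4 * ‖(n + 1 : ℝ)⁻¹ • v‖ ^ (2 * min γ 1)) *
      (c ^ 2 + C)) atTop (𝓝 0) := by
    have hn : Tendsto (fun n : ℕ => (n + 1 : ℝ)⁻¹) atTop (𝓝 0) :=
      tendsto_inv_atTop_zero.comp (tendsto_atTop_add_const_right _ _ tendsto_natCast_atTop_atTop)
    have hmin : 0 < 2 * min γ 1 := mul_pos two_pos (lt_min hγ one_pos)
    have h1 := ((hn.smul_const v).norm.rpow_const (p := 2 * min γ 1) (Or.inr hmin.le)).const_mul 4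
    rw [zero_smul, norm_zero, Real.zero_rpow hmin.ne', mul_zero] at h1
    have h2 := ENNReal.Tendsto.mul_const (ENNReal.tendsto_ofReal h1)
      (Or.inr hc.ne : (ENNReal.ofReal 0 ≠ 0 ∨ c ^ 2 + C ≠ ∞))
    rwa [ENNReal.ofReal_zero, zero_mul] at h2
  have hΦ : Tendsto (fun n => ∫⁻ x, Φ n x) atTop (𝓝 0) :=
    tendsto_of_tendsto_of_tendsto_of_le_of_le tendsto_const_nhds hlim (fun _ => zero_le) hle
  have hpt : ∀ x, liminf (fun n => Φ n x) atTop = ‖L x‖ₑ ^ 2 := by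
    intro x
    refine Tendsto.liminf_eq ?_
    have h1 := ENNReal.tendsto_ofReal (tendsto_oscBump_translate q μ v x)
    simp only [ofReal_norm] at h1
    exact ENNReal.Tendsto.pow h1
  have hF := lintegral_liminf_le' (u := atTop) hm
  rw [hΦ.liminf_eq] at hF
  simp only [hpt] at hF
  have h0 := (lintegral_eq_zero_iff' ((hLc.enorm.measurable.pow_const 2).aemeasurable)).1
    (le_antisymm hF zero_le)
  have h1 : L =ᵐ[volume] fun _ => 0 := by
    filter_upwards [h0] with x hx
    simpa using hx
  exact hL0 (congr_fun ((hLc.ae_eq_iff_eq volume continuous_const).1 h1) x₀)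

/-! ## Norm inflation for positive exponents and decoherence -/

/-- The function `oscBump` as an element of `L²`. -/
noncomputable def oscL2 (d : ℕ) (q θ : ℝ) : L2 d := (memLp_oscBump q θ).toLp

theorem coeFn_oscL2 {d : ℕ} (q θ : ℝ) : oscL2 d q θ =ᵐ[volume] oscBump q θ :=
  (memLp_oscBump q θ).coeFn_toLp

theorem norm_oscL2 {d : ℕ} (q θ : ℝ) : ‖oscL2 d q θ‖ = ‖schwartzL2 (bump d one_pos)‖ := by
  have h := enorm_toLp_oscBump (d := d) q θ
  rw [← ofReal_norm, ← ofReal_norm, ENNReal.ofReal_eq_ofReal_iff (norm_nonneg _) (norm_nonneg _)]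
    at h
  exact h

theorem phaseSol_bump {d : ℕ} {μ ν : ℝ} (hν : 1 < ν) {a : ℝ} (ha : 0 < a) (t : ℝ) :
    phaseSol μ (((a ^ (ν - 1) : ℝ) : ℂ) • schwartzL2 (bump d (sub_pos.2 hν)))
      ((a : ℂ) • schwartzL2 (bump d one_pos)) t =
        (a : ℂ) • oscL2 d (ν - 1) (μ * t * a ^ (ν - 1)) := by
  refine Lp.ext ?_
  filter_upwards [coeFn_phaseSol_bump (μ := μ) (d := d) hν ha t,
    Lp.coeFn_smul (a : ℂ) (oscL2 d (ν - 1) (μ * t * a ^ (ν - 1))),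
    coeFn_oscL2 (d := d) (ν - 1) (μ * t * a ^ (ν - 1))] with x h1 h2 h3
  rw [h1, h2, Pi.smul_apply, h3, oscBump, smul_eq_mul]
  push_cast
  ring

theorem Params.eventually_exists_osc_solution {d : ℕ} {μ ν : ℝ} (P : Params d μ ν) {a T ε : ℝ}
    (ha : 0 < a) (hT : 0 ≤ T) (hε : 0 < ε) : ∀ᶠ δ in 𝓝[>] (0 : ℝ), ∃ v : ℝ → L2 d,
      ContinuousSobolevOn (idx d) T v ∧
      IsMild δ T (nl μ ν) (schwartzL2 ((a : ℂ) • bump d one_pos)) v ∧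
      sobolevNorm (idx d) (v T - (a : ℂ) • oscL2 d (ν - 1) (μ * T * a ^ (ν - 1))) ≤
        ENNReal.ofReal ε := by
  obtain ⟨δ₀, hδ₀, H⟩ := P.exists_profile_solution (isProfile_bump P.one_lt ha) hT hε
  filter_upwards [self_mem_nhdsWithin, nhdsWithin_le_nhds (gt_mem_nhds hδ₀)] with δ hδ hδ'
  obtain ⟨v, h1, h2, h3⟩ := H δ hδ hδ'
  refine ⟨v, h1, by rwa [schwartzL2_smul], ?_⟩
  rw [← phaseSol_bump P.one_lt ha]
  exact h3 T ⟨hT, le_rfl⟩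

theorem criticalExponent_lt_half (d : ℕ) {ν : ℝ} (hν : 1 < ν) :
    criticalExponent d ν < (d : ℝ) / 2 := by
  have : 0 < 1 / (ν - 1) := one_div_pos.2 (sub_pos.2 hν)
  rw [criticalExponent]
  linarith

theorem sobolevNorm_le_of_scaling {d : ℕ} {γ ℓ B : ℝ} {D : L2 d →L[ℂ] L2 d} (hγ : 0 ≤ γ)
    (hB : 0 < B) (hℓ : 0 < ℓ) (hℓ1 : ℓ < 1)
    (hD : ∀ g, sobolevNorm γ (D g) ^ 2 = ENNReal.ofReal (B ^ 2) * scaledEnergy γ ℓ g) (g : L2 d) :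
    sobolevNorm γ (D g) ≤ ENNReal.ofReal B * sobolevNorm γ g := by
  refine ennreal_le_of_sq_le ?_
  rw [hD, mul_pow, ENNReal.ofReal_pow hB.le]
  gcongr
  exact scaledEnergy_le hγ hℓ hℓ1 g

/-- At the time `T = n + 1` the dispersionless profile has as much energy as desired. For small `δ`
the dispersive solution is within `1` of it, and the rescaling compresses `T` to `lT < ε`. -/
theorem Params.normInflation_of_pos {d : ℕ} {μ ν γ : ℝ} (P : Params d μ ν) (hγ : 0 < γ)
    (hγc : γ < criticalExponent d ν) : NormInflation d μ ν γ := by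
  intro ε hε
  have hγk : γ ≤ idx d :=
    (hγc.trans ((criticalExponent_lt_half d P.one_lt).trans (half_lt_index d))).le
  set f : 𝓢(Space d, ℂ) := ((1 : ℝ) : ℂ) • bump d one_pos
  set N := (sobolevNorm γ (schwartzL2 f)).toReal
  have hN : sobolevNorm γ (schwartzL2 f) = ENNReal.ofReal N :=
    (ENNReal.ofReal_toReal (sobolevNorm_schwartzL2_lt_top γ f).ne).symm
  have hN0 : 0 ≤ N := ENNReal.toReal_nonneg
  -- The rescaled data have norm at most `B N < ε`.
  set B := ε / (N + 1)
  have hB : 0 < B := by positivity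
  have hμ : μ ≠ 0 := by rcases P.sign with h | h <;> simp [h]
  -- After multiplication by `B²` this energy exceeds `(ε⁻¹ + B + 1)²`; the summand `B` pays for the
  -- distance between solution and profile.
  obtain ⟨n, hn⟩ := exists_energy_gt P.one_le (q := ν - 1) (sub_pos.2 P.one_lt) hμ hγ
    (C := ENNReal.ofReal (((ε⁻¹ + B + 1) / B) ^ 2)) ENNReal.ofReal_lt_top
  set T : ℝ := n + 1
  have hT : 0 < T := by positivity
  obtain ⟨δ, ⟨v, hv, hm, hvT⟩, l, ℓ, D, hl, hl', hℓ, hℓ', hD, hsol⟩ :=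
    ((P.eventually_exists_osc_solution one_pos hT.le one_pos).and
      (P.eventually_exists_scaling hγc hB (ε := min 1 (ε / T)) (by positivity))).exists
  obtain ⟨f', u, hu, hf', huT⟩ := hsol T f v hv hm
  have hℓ1 : ℓ < 1 := hℓ'.trans_le (min_le_left _ _)
  rw [Real.one_rpow, mul_one] at hvT
  set Φ : L2 d := ((1 : ℝ) : ℂ) • oscL2 d (ν - 1) (μ * T) with hΦ
  refine ⟨f', l * T, u, by positivity, ?_, hu, ?_, ?_⟩
  · exact (lt_div_iff₀ hT).1 (hl'.trans_le (min_le_right _ _))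
  · rw [hf']
    refine (sobolevNorm_le_of_scaling hγ.le hB hℓ hℓ1 hD _).trans_lt ?_
    rw [hN, ← ENNReal.ofReal_mul hB.le, ENNReal.ofReal_lt_ofReal_iff hε]
    simp only [B]
    rw [div_mul_eq_mul_div, div_lt_iff₀ (by positivity)]
    nlinarith
  · rw [huT]
    by_contra! hle
    have h1 : ENNReal.ofReal (ε⁻¹ + B + 1) ≤ sobolevNorm γ (D Φ) := by
      refine ennreal_le_of_sq_le ?_
      rw [hD, ← ENNReal.ofReal_pow (by positivity)]
      have e : (ε⁻¹ + B + 1) ^ 2 = B ^ 2 * ((ε⁻¹ + B + 1) / B) ^ 2 := by field_simp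
      rw [e, ENNReal.ofReal_mul (by positivity)]
      gcongr
      refine hn.le.trans (le_trans ?_ (scaledEnergy_zero_le hγ.le hℓ.le Φ))
      rw [hΦ, Complex.ofReal_one, one_smul]
      rfl
    have h2 : sobolevNorm γ (D Φ) ≤ ENNReal.ofReal (ε⁻¹ + B) := by
      have e : D Φ = D (v T) - D (v T - Φ) := by rw [map_sub, sub_sub_cancel]
      rw [e, ENNReal.ofReal_add (by positivity) hB.le]
      refine (sobolevNorm_sub_le γ _ _).trans (add_le_add hle ?_)
      refine (sobolevNorm_le_of_scaling hγ.le hB hℓ hℓ1 hD _).trans ?_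
      refine (mul_le_mul_right ((sobolevNorm_mono hγk _).trans hvT) _).trans ?_
      rw [ENNReal.ofReal_one, mul_one]
    have h3 := h1.trans h2
    rw [ENNReal.ofReal_le_ofReal_iff (by positivity)] at h3
    linarith

/-- A common unimodular factor does not change the norm, so the separation depends on the phase
difference alone and not on the elapsed time. -/
theorem norm_oscL2_add_sub {d : ℕ} (q θ μ : ℝ) :
    ‖oscL2 d q (θ + μ) - oscL2 d q θ‖ = ‖oscL2 d q μ - oscL2 d q 0‖ := by
  have key : ∀ᵐ x, ‖(oscL2 d q (θ + μ) - oscL2 d q θ) x‖ = ‖(oscL2 d q μ - oscL2 d q 0) x‖ := by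
    filter_upwards [Lp.coeFn_sub (oscL2 d q (θ + μ)) (oscL2 d q θ),
      Lp.coeFn_sub (oscL2 d q μ) (oscL2 d q 0), coeFn_oscL2 (d := d) q (θ + μ),
      coeFn_oscL2 (d := d) q θ, coeFn_oscL2 (d := d) q μ, coeFn_oscL2 (d := d) q 0]
      with x h1 h2 h3 h4 h5 h6
    rw [h1, h2, Pi.sub_apply, Pi.sub_apply, h3, h4, h5, h6, oscBump, oscBump, oscBump, oscBump,
      norm_exp_mul_sub_exp_mul, norm_exp_mul_sub_exp_mul, ← sub_mul, ← sub_mul, add_sub_cancel_left,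
      sub_zero]
  exact le_antisymm (Lp.norm_le_norm_of_ae_le (key.mono fun _ h => h.le))
    (Lp.norm_le_norm_of_ae_le (key.mono fun _ h => h.ge))

theorem oscL2_ne {d : ℕ} {q μ : ℝ} (hq : 0 < q) (hμ : μ = 1 ∨ μ = -1) :
    oscL2 d q μ ≠ oscL2 d q 0 := by
  intro h
  have h1 : (oscBump q μ : Space d → ℂ) =ᵐ[volume] oscBump q 0 := by
    filter_upwards [coeFn_oscL2 (d := d) q μ, coeFn_oscL2 (d := d) q 0] with x h1 h2
    rw [← h1, ← h2, h]
  have h2 := congr_fun (((continuous_oscBump q μ).ae_eq_iff_eq volume (continuous_oscBump q 0)).1 h1)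
    (0 : Space d)
  -- The phase at the origin has absolute value in `(0, 1]`, below `π`, so its sine does not vanish.
  have hp : 0 < bumpFun q (0 : Space d) := bumpFun_pos hq (by simp)
  have hp1 : bumpFun q (0 : Space d) ≤ 1 := by
    rw [bumpFun, expNegInvGlue]
    split_ifs
    · exact zero_le_one
    · refine Real.exp_le_one_iff.2 ?_
      simp [hq.le]
  rw [oscBump, oscBump, zero_mul, Complex.ofReal_zero, zero_mul, Complex.exp_zero,
    mul_left_inj' (Complex.ofReal_ne_zero.2 (bumpFun_pos one_pos (by simp)).ne')] at h2
  have h3 := congrArg Complex.im h2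
  rw [Complex.exp_ofReal_mul_I_im, Complex.one_im] at h3
  have hs : 0 < Real.sin (bumpFun q (0 : Space d)) :=
    Real.sin_pos_of_pos_of_lt_pi hp (hp1.trans_lt (by linarith [Real.pi_gt_three]))
  rcases hμ with rfl | rfl
  · rw [one_mul] at h3
    exact hs.ne' h3
  · rw [neg_one_mul, Real.sin_neg, neg_eq_zero] at h3
    exact hs.ne' h3

theorem norm_of_scaling {d : ℕ} {ℓ B : ℝ} {D : L2 d →L[ℂ] L2 d} (hB : 0 < B)
    (hD : ∀ g, sobolevNorm 0 (D g) ^ 2 = ENNReal.ofReal (B ^ 2) * scaledEnergy 0 ℓ g) (g : L2 d) :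
    ‖D g‖ = B * ‖g‖ := by
  have h := hD g
  rw [sobolevNorm_zero_left, scaledEnergy_zero_left, ← ofReal_norm, ← ofReal_norm,
    ← ENNReal.ofReal_pow (norm_nonneg _), ← ENNReal.ofReal_pow (norm_nonneg _),
    ← ENNReal.ofReal_mul (by positivity), ENNReal.ofReal_eq_ofReal_iff (by positivity)
    (by positivity), ← mul_pow] at h
  exact (pow_left_inj₀ (norm_nonneg _) (by positivity) two_ne_zero).1 h

/-- Profiles of amplitudes `1` and `1 + κ` rotate at speeds in the ratio `1 : (1 + κ)^{ν-1}`.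
However small `κ` is, after the time `T` their phases differ by `μ bumpFun`, and the resulting `L²`
distance is nearly a constant `c` that does not depend on `κ`. The scaling with `γ = 0` multiplies
all `L²` norms by `B` and compresses `T` below `σ`. -/
theorem Params.decoherenceL2 {d : ℕ} {μ ν : ℝ} (P : Params d μ ν)
    (hc : 0 < criticalExponent d ν) : DecoherenceL2 d μ ν := by
  intro R hR
  have hν := sub_pos.2 P.one_lt
  set G := ‖schwartzL2 (bump d one_pos)‖
  have hG : 0 ≤ G := norm_nonneg _
  set c := ‖oscL2 d (ν - 1) μ - oscL2 d (ν - 1) 0‖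
  have hc0 : 0 < c := norm_pos_iff.2 (sub_ne_zero.2 (oscL2_ne hν P.sign))
  set B := R / (2 * G + 1)
  have hB : 0 < B := by positivity
  refine ⟨B * (c / 2), by positivity, fun σ hσ => ?_⟩
  -- The second entry makes the difference of amplitudes at most `c/4`, the third brings the
  -- rescaled data within `σ`.
  set κ := min 1 (min (c / (4 * (G + 1))) (σ / (B * (G + 1))))
  have hκ : 0 < κ := by positivity
  have hκ1 : κ ≤ 1 := min_le_left _ _
  have hκ2 : κ * G ≤ c / 4 := by
    have h1 : κ ≤ c / (4 * (G + 1)) := (min_le_right _ _).trans (min_le_left _ _)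
    rw [le_div_iff₀ (by positivity)] at h1
    linarith
  have hκ3 : B * (κ * G) < σ := by
    have h1 : κ ≤ σ / (B * (G + 1)) := (min_le_right _ _).trans (min_le_right _ _)
    rw [le_div_iff₀ (by positivity)] at h1
    nlinarith [mul_pos hκ hB]
  have ha : 0 < 1 + κ := by positivity
  have ha1 : 0 < (1 + κ) ^ (ν - 1) - 1 := sub_pos.2 (Real.one_lt_rpow (by linarith) hν)
  -- The time at which the two phases differ by exactly `μ` times the bump.
  set T := 1 / ((1 + κ) ^ (ν - 1) - 1) with hTd
  have hT : 0 < T := by positivity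
  obtain ⟨δ, ⟨⟨v, hv, hm, hvT⟩, v', hv', hm', hvT'⟩, l, ℓ, D, hl, hl', hℓ, hℓ', hD, hsol⟩ :=
    (((P.eventually_exists_osc_solution one_pos hT.le (ε := c / 8) (by positivity)).and
      (P.eventually_exists_osc_solution ha hT.le (ε := c / 8) (by positivity))).and
      (P.eventually_exists_scaling hc hB (ε := σ / T) (by positivity))).exists
  obtain ⟨f, u, hu, hf, huT⟩ := hsol T _ v hv hm
  obtain ⟨f', u', hu', hf', huT'⟩ := hsol T _ v' hv' hm'
  have hn := norm_of_scaling hB hD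
  have hBG : B * (2 * G) < R := by
    simp only [B]
    rw [div_mul_eq_mul_div, div_lt_iff₀ (by positivity)]
    nlinarith
  have toReal : ∀ {g : L2 d}, sobolevNorm (idx d) g ≤ ENNReal.ofReal (c / 8) → ‖g‖ ≤ c / 8 := by
    intro g hg
    have h1 := (enorm_le_sobolevNorm (idx_nonneg d) g).trans hg
    rwa [← ofReal_norm, ENNReal.ofReal_le_ofReal_iff (by positivity)] at h1
  refine ⟨f, f', l * T, u, u', by positivity, (lt_div_iff₀ hT).1 hl', hu, hu', ?_, ?_, ?_, ?_⟩
  · rw [hf, hn, schwartzL2_smul, norm_smul, Complex.norm_real, norm_one, one_mul]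
    nlinarith
  · rw [hf', hn, schwartzL2_smul, norm_smul, Complex.norm_real, Real.norm_of_nonneg ha.le]
    refine lt_of_le_of_lt ?_ hBG
    have : (1 + κ) * G ≤ 2 * G := by gcongr; linarith
    gcongr
  · rw [hf, hf', ← map_sub, hn, schwartzL2_smul, schwartzL2_smul, ← sub_smul, norm_smul,
      ← Complex.ofReal_sub, Complex.norm_real, sub_add_cancel_left, norm_neg,
      Real.norm_of_nonneg hκ.le]
    exact hκ3
  · rw [huT, huT', ← map_sub, hn]
    gcongr
    have h1 := toReal hvT
    have h2 := toReal hvT'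
    have e : μ * T * (1 + κ) ^ (ν - 1) = μ * T + μ := by
      have : T * ((1 + κ) ^ (ν - 1) - 1) = 1 := by rw [hTd]; field_simp
      linear_combination μ * this
    rw [Real.one_rpow, mul_one, Complex.ofReal_one, one_smul] at h1
    rw [e] at h2
    have h3 : ‖oscL2 d (ν - 1) (μ * T + μ) - oscL2 d (ν - 1) (μ * T)‖ = c :=
      norm_oscL2_add_sub _ _ _
    set X := oscL2 d (ν - 1) (μ * T)
    set Y := oscL2 d (ν - 1) (μ * T + μ) with hY
    have h4 : ‖(κ : ℂ) • Y‖ ≤ c / 4 := by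
      rw [norm_smul, Complex.norm_real, Real.norm_of_nonneg hκ.le, hY, norm_oscL2]
      exact hκ2
    -- The losses are `c/8` twice from dispersion and `c/4` from the amplitudes, which leaves `c/2`
    -- of the separation `c`.
    have h5 : Y - X = (v T - X) - (v' T - ((1 + κ : ℝ) : ℂ) • Y) - (κ : ℂ) • Y - (v T - v' T) := by
      push_cast
      module
    have h6 := norm_sub_le ((v T - X) - (v' T - ((1 + κ : ℝ) : ℂ) • Y) - (κ : ℂ) • Y) (v T - v' T)
    have h7 := norm_sub_le ((v T - X) - (v' T - ((1 + κ : ℝ) : ℂ) • Y)) ((κ : ℂ) • Y)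
    have h8 := norm_sub_le (v T - X) (v' T - ((1 + κ : ℝ) : ℂ) • Y)
    rw [← h5, h3] at h6
    linarith

/-! ## The nonlinearity in `L¹` -/

theorem abs_rpow_sub_rpow_le {p R x y : ℝ} (hp : 1 ≤ p) (hx : 0 ≤ x) (hy : 0 ≤ y) (hxR : x ≤ R)
    (hyR : y ≤ R) : |x ^ p - y ^ p| ≤ p * R ^ (p - 1) * |x - y| := by
  wlog h : y ≤ x generalizing x y
  · rw [abs_sub_comm, abs_sub_comm x]
    exact this hy hx hyR hxR (le_of_not_ge h)
  have hp0 : 0 < p := by linarith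
  rw [abs_of_nonneg (sub_nonneg.2 (Real.rpow_le_rpow hy h hp0.le)), abs_of_nonneg (sub_nonneg.2 h)]
  rcases hx.eq_or_lt with rfl | hx0
  · obtain rfl : y = 0 := le_antisymm h hy
    simp
  have hb := one_add_mul_self_le_rpow_one_add (s := (y - x) / x) (p := p)
    (by rw [le_div_iff₀ hx0]; linarith) hp
  have e : 1 + (y - x) / x = y / x := by field_simp; ring
  rw [e, Real.div_rpow hy hx, le_div_iff₀ (by positivity)] at hb
  have hxp : x ^ p = x ^ (p - 1) * x := by
    rw [← Real.rpow_add_one hx0.ne', sub_add_cancel]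
  have e2 : (1 + p * ((y - x) / x)) * x ^ p = x ^ p - p * x ^ (p - 1) * (x - y) := by
    rw [hxp]; field_simp; ring
  rw [e2] at hb
  have h1 : p * x ^ (p - 1) * (x - y) ≤ p * R ^ (p - 1) * (x - y) := by
    have := sub_nonneg.2 h
    gcongr
  linarith

/-- For `ν ≥ 2` the difference is dominated by a product of two factors of first order, so
Cauchy–Schwarz turns `L²` control into `L¹` control of the nonlinearity. This gives pointwise
control of its Fourier transform. -/
theorem norm_powFun_sub_le {ν R : ℝ} (hν : 2 ≤ ν) {a b : ℂ} (ha : ‖a‖ ≤ R) (hb : ‖b‖ ≤ R) :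
    ‖powFun ν a - powFun ν b‖ ≤ (ν - 1) * R ^ (ν - 2) * ((‖a‖ + ‖b‖) * ‖a - b‖) := by
  have e : powFun ν a - powFun ν b = ((‖a‖ ^ (ν - 1) : ℝ) : ℂ) * (a - b) +
      ((‖a‖ ^ (ν - 1) - ‖b‖ ^ (ν - 1) : ℝ) : ℂ) * b := by
    rw [powFun, powFun]; push_cast; ring
  have hR : 0 ≤ R := (norm_nonneg a).trans ha
  have h1 : ‖a‖ ^ (ν - 1) ≤ (ν - 1) * R ^ (ν - 2) * ‖a‖ := by
    have e1 : ‖a‖ ^ (ν - 1) = ‖a‖ ^ (ν - 2) * ‖a‖ := by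
      rw [← Real.rpow_add_one' (norm_nonneg a) (by linarith)]
      congr 1; ring
    rw [e1]
    gcongr
    have h2 : ‖a‖ ^ (ν - 2) ≤ R ^ (ν - 2) := by gcongr
    have h3 : 0 ≤ R ^ (ν - 2) := by positivity
    nlinarith
  have h2 := abs_rpow_sub_rpow_le (p := ν - 1) (by linarith) (norm_nonneg a) (norm_nonneg b) ha hb
  have h3 := abs_norm_sub_norm_le a b
  have e2 : ν - 1 - 1 = ν - 2 := by ring
  rw [e2] at h2
  have hν1 : 0 ≤ ν - 1 := by linarith
  rw [e]
  refine (norm_add_le _ _).trans ?_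
  rw [norm_mul, norm_mul, Complex.norm_real, Complex.norm_real,
    Real.norm_of_nonneg (by positivity), Real.norm_eq_abs]
  calc ‖a‖ ^ (ν - 1) * ‖a - b‖ + |‖a‖ ^ (ν - 1) - ‖b‖ ^ (ν - 1)| * ‖b‖
      ≤ ((ν - 1) * R ^ (ν - 2) * ‖a‖) * ‖a - b‖ + ((ν - 1) * R ^ (ν - 2) * ‖a - b‖) * ‖b‖ := by
        gcongr
        exact h2.trans (by gcongr)
    _ = _ := by ring

theorem lintegral_enorm_mul_le {d : ℕ} (f g : L2 d) : ∫⁻ x, ‖f x‖ₑ * ‖g x‖ₑ ≤ ‖f‖ₑ * ‖g‖ₑ := by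
  have h : ∀ f : L2 d, (∫⁻ x, ‖f x‖ₑ ^ 2) ^ (1 / 2 : ℝ) = ‖f‖ₑ := by
    intro f
    rw [← enorm_sq_eq_lintegral, ← ENNReal.rpow_natCast, ← ENNReal.rpow_mul]
    norm_num
  refine (lintegral_mul_le_two (Lp.aestronglyMeasurable f).enorm
    (Lp.aestronglyMeasurable g).enorm).trans_eq ?_
  rw [h, h]

theorem Params.exists_lintegral_nl_sub_le {d : ℕ} {μ ν : ℝ} (P : Params d μ ν) (hν : 2 ≤ ν)
    {R : ℝ≥0∞} (hR : R < ∞) : ∃ C : ℝ≥0∞, C < ∞ ∧ ∀ f h : L2 d, sobolevNorm (idx d) f ≤ R →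
      sobolevNorm (idx d) h ≤ R → ∫⁻ x, ‖(nl μ ν f - nl μ ν h) x‖ₑ ≤ C * ‖f - h‖ₑ := by
  set r := (embConst d (idx d) * R).toReal
  have hr : 0 ≤ r := ENNReal.toReal_nonneg
  have hs := half_lt_index d
  refine ⟨ENNReal.ofReal ((ν - 1) * r ^ (ν - 2)) * (R + R),
    ENNReal.mul_lt_top ENNReal.ofReal_lt_top (ENNReal.add_lt_top.2 ⟨hR, hR⟩), fun f h hf hh => ?_⟩
  have hμ := enorm_I_mul P.sign
  have h1 : ∫⁻ x, ‖(nl μ ν f - nl μ ν h) x‖ₑ ≤ ∫⁻ x, ENNReal.ofReal ((ν - 1) * r ^ (ν - 2)) *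
      (‖f x‖ₑ * ‖(f - h) x‖ₑ + ‖h x‖ₑ * ‖(f - h) x‖ₑ) := by
    refine lintegral_mono_ae ?_
    filter_upwards [Lp.coeFn_sub (nl μ ν f) (nl μ ν h), P.coeFn_nl hs (hf.trans_lt hR),
      P.coeFn_nl hs (hh.trans_lt hR), Lp.coeFn_sub f h, ae_norm_le_of_sobolev hs hR hf,
      ae_norm_le_of_sobolev hs hR hh] with x e1 e2 e3 e4 b1 b2
    rw [e1, Pi.sub_apply, e2, e3, e4, Pi.sub_apply, ← mul_sub, enorm_mul, hμ, one_mul, ← add_mul,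
      ← ofReal_norm, ← ofReal_norm (f x), ← ofReal_norm (h x), ← ofReal_norm (f x - h x),
      ← ENNReal.ofReal_add (norm_nonneg _) (norm_nonneg _), ← ENNReal.ofReal_mul (by positivity),
      ← ENNReal.ofReal_mul (mul_nonneg (by linarith) (by positivity))]
    exact ENNReal.ofReal_le_ofReal (norm_powFun_sub_le hν b1 b2)
  refine h1.trans ?_
  have hm : AEMeasurable (fun x => ‖f x‖ₑ * ‖(f - h) x‖ₑ) volume :=
    (Lp.aestronglyMeasurable f).enorm.mul (Lp.aestronglyMeasurable (f - h)).enorm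
  rw [lintegral_const_mul' _ _ ENNReal.ofReal_ne_top, lintegral_add_left' hm, mul_assoc]
  gcongr
  rw [add_mul]
  have hk := idx_nonneg d
  refine add_le_add ((lintegral_enorm_mul_le _ _).trans ?_) ((lintegral_enorm_mul_le _ _).trans ?_)
  · gcongr
    exact (enorm_le_sobolevNorm hk f).trans hf
  · gcongr
    exact (enorm_le_sobolevNorm hk h).trans hh

theorem Params.integrable_nl {d : ℕ} {μ ν : ℝ} (P : Params d μ ν) (hν : 2 ≤ ν) {f : L2 d}
    (hf : sobolevNorm (idx d) f < ∞) : Integrable (nl μ ν f) := by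
  obtain ⟨C, hC, b⟩ := P.exists_lintegral_nl_sub_le hν hf
  have h1 := b f 0 le_rfl (by rw [sobolevNorm_zero]; exact zero_le)
  rw [nl_zero, sub_zero, sub_zero] at h1
  exact ⟨Lp.aestronglyMeasurable _, h1.trans_lt (ENNReal.mul_lt_top hC enorm_lt_top)⟩

theorem Params.exists_lintegral_nl_sub_lt {d : ℕ} {μ ν : ℝ} (P : Params d μ ν) (hν : 2 ≤ ν)
    {f : L2 d} (hf : sobolevNorm (idx d) f < ∞) {ε : ℝ} (hε : 0 < ε) : ∃ κ : ℝ, 0 < κ ∧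
      ∀ h : L2 d, sobolevNorm (idx d) (h - f) ≤ ENNReal.ofReal κ → sobolevNorm (idx d) h < ∞ ∧
        ∫⁻ x, ‖(nl μ ν h - nl μ ν f) x‖ₑ ≤ ENNReal.ofReal ε := by
  have hR : sobolevNorm (idx d) f + 1 < ∞ := ENNReal.add_lt_top.2 ⟨hf, ENNReal.one_lt_top⟩
  obtain ⟨C, hC, b⟩ := P.exists_lintegral_nl_sub_le hν hR
  refine ⟨min 1 (ε / (C.toReal + 1)), lt_min one_pos (div_pos hε (by positivity)), fun h hh => ?_⟩
  have hh1 : sobolevNorm (idx d) h ≤ sobolevNorm (idx d) f + 1 := by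
    have h1 := sobolevNorm_add_le (idx d) f (h - f)
    rw [add_sub_cancel] at h1
    refine h1.trans (add_le_add le_rfl (hh.trans ?_))
    rw [← ENNReal.ofReal_one]
    exact ENNReal.ofReal_le_ofReal (min_le_left _ _)
  refine ⟨hh1.trans_lt hR, (b h f hh1 le_self_add).trans ?_⟩
  rw [← ENNReal.ofReal_toReal hC.ne]
  refine (mul_le_mul_right (((enorm_le_sobolevNorm (idx_nonneg d) _).trans hh).trans
    (ENNReal.ofReal_le_ofReal (min_le_right _ _))) _).trans ?_
  rw [← ENNReal.ofReal_mul ENNReal.toReal_nonneg]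
  refine ENNReal.ofReal_le_ofReal ?_
  rw [mul_div_assoc', div_le_iff₀ (by positivity)]
  nlinarith [ENNReal.toReal_nonneg (a := C)]

/-! ## Data without low frequencies -/

/-- A smooth cutoff function, equal to one on the ball of radius `r` about the origin and to zero
outside of the ball of radius `2r`. -/
noncomputable def cutoff {d : ℕ} {r : ℝ} (hr : 0 < r) : ContDiffBump (0 : Space d) :=
  ⟨r, 2 * r, hr, by linarith⟩

/-- The function `cutoff` as a Schwartz function. -/
noncomputable def schwartzCutoff (d : ℕ) {r : ℝ} (hr : 0 < r) : 𝓢(Space d, ℂ) :=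
  HasCompactSupport.toSchwartzMap (f := fun x => ((cutoff hr x : ℝ) : ℂ))
    ((cutoff hr).hasCompactSupport.comp_left Complex.ofReal_zero)
    (Complex.ofRealCLM.contDiff.comp (cutoff hr).contDiff)

theorem schwartzCutoff_apply {d : ℕ} {r : ℝ} (hr : 0 < r) (x : Space d) :
    schwartzCutoff d hr x = ((cutoff hr x : ℝ) : ℂ) := rfl

/-- The low-frequency part of a Schwartz function. -/
noncomputable def lowFreq {d : ℕ} {r : ℝ} (hr : 0 < r) (f : 𝓢(Space d, ℂ)) : 𝓢(Space d, ℂ) :=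
  𝓕⁻ (schwartzMul (schwartzCutoff d hr) (𝓕 f))

theorem fourier_lowFreq {d : ℕ} {r : ℝ} (hr : 0 < r) (f : 𝓢(Space d, ℂ)) (ξ : Space d) :
    (𝓕 (lowFreq hr f)) ξ = ((cutoff hr ξ : ℝ) : ℂ) * (𝓕 f) ξ := by
  rw [lowFreq, FourierTransform.fourier_fourierInv_eq, schwartzMul_apply, schwartzCutoff_apply]

/-- Absolute continuity of the integral: the cutoff lives on a ball whose measure is of order `r^d`.
-/
theorem exists_sobolevNorm_lowFreq_le {d : ℕ} (hd : 1 ≤ d) (s : ℝ) (f : 𝓢(Space d, ℂ)) {ε : ℝ≥0∞}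
    (hε : 0 < ε) : ∃ (r : ℝ) (hr : 0 < r), sobolevNorm s (schwartzL2 (lowFreq hr f)) ≤ ε := by
  have hfin := sobolevNorm_schwartzL2_lt_top s f
  have hfin2 : ∫⁻ ξ, ENNReal.ofReal (weight ξ ^ s) * ‖(𝓕 (schwartzL2 f) : L2 d) ξ‖ₑ ^ 2 ≠ ∞ := by
    rw [← sobolevNorm_sq]
    exact (ENNReal.pow_lt_top hfin).ne
  obtain ⟨κ, hκ, H⟩ := exists_pos_setLIntegral_lt_of_measure_lt hfin2
    (ε := ε ^ 2) (pow_ne_zero 2 hε.ne')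
  have hlim : Tendsto (fun r : ℝ => volume (Metric.ball (0 : Space d) (2 * r))) (𝓝[>] 0) (𝓝 0) := by
    have h1 : Tendsto (fun r : ℝ => ENNReal.ofReal ((2 * r) ^ d) *
        volume (Metric.ball (0 : Space d) 1)) (𝓝[>] 0) (𝓝 0) := by
      have h2 : Continuous fun r : ℝ => ENNReal.ofReal ((2 * r) ^ d) :=
        ENNReal.continuous_ofReal.comp (by fun_prop)
      have h3 := (h2.tendsto 0).mono_left (nhdsWithin_le_nhds (s := Ioi (0 : ℝ)))
      rw [mul_zero, zero_pow (by omega), ENNReal.ofReal_zero] at h3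
      have h4 := ENNReal.Tendsto.mul_const h3 (b := volume (Metric.ball (0 : Space d) 1))
        (Or.inr measure_ball_lt_top.ne)
      rwa [zero_mul] at h4
    refine h1.congr' ?_
    filter_upwards [self_mem_nhdsWithin] with r (hr : 0 < r)
    rw [Measure.addHaar_ball_of_pos volume (0 : Space d) (r := 2 * r) (by positivity), finrank_euclideanSpace_fin]
  obtain ⟨r, hr1, hr⟩ := ((hlim.eventually (gt_mem_nhds hκ)).and self_mem_nhdsWithin).exists
  refine ⟨r, hr, ennreal_le_of_sq_le (le_trans ?_ (H _ hr1).le)⟩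
  rw [sobolevNorm_sq, ← lintegral_indicator measurableSet_ball]
  refine lintegral_mono_ae ?_
  filter_upwards [coeFn_schwartzL2 (𝓕 (lowFreq hr f)), coeFn_schwartzL2 (𝓕 f)] with ξ h1 h2
  rw [fourier_schwartzL2, h1, fourier_lowFreq, fourier_schwartzL2]
  by_cases hξ : ξ ∈ Metric.ball (0 : Space d) (2 * r)
  · rw [indicator_of_mem hξ, h2, enorm_mul, ← ofReal_norm, Complex.norm_real,
      Real.norm_of_nonneg (cutoff hr).nonneg]
    gcongr
    refine mul_le_of_le_one_left zero_le ?_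
    rw [ENNReal.ofReal_le_one]
    exact (cutoff hr).le_one
  · have h3 : (cutoff hr ξ : ℝ) = 0 := by
      refine (cutoff hr).zero_of_le_dist ?_
      rwa [Metric.mem_ball, not_lt] at hξ
    rw [h3]
    simp

theorem Params.integral_nl_bump_ne_zero {d : ℕ} {μ ν : ℝ} (P : Params d μ ν) :
    ∫ x, nl μ ν (schwartzL2 (bump d one_pos)) x ≠ 0 := by
  have e : ∫ x, nl μ ν (schwartzL2 (bump d one_pos)) x =
      Complex.I * μ * ((∫ x : Space d, bumpFun 1 x ^ (ν - 1) * bumpFun 1 x : ℝ) : ℂ) := by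
    rw [← integral_complex_ofReal, ← integral_const_mul]
    refine integral_congr_ae ?_
    filter_upwards [P.coeFn_nl (half_lt_index d) (sobolevNorm_schwartzL2_lt_top _ (bump d one_pos)),
      coeFn_schwartzL2 (bump d one_pos)] with x h1 h2
    rw [h1, h2, bump_apply, powFun, Complex.norm_real, Real.norm_of_nonneg (bumpFun_nonneg _ _)]
    push_cast
    ring
  have hc : Continuous fun x : Space d => bumpFun 1 x ^ (ν - 1) * bumpFun 1 x := by
    have := continuous_bumpFun (d := d) 1
    exact (this.rpow_const fun _ => Or.inr (sub_pos.2 P.one_lt).le).mul this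
  have hs : HasCompactSupport fun x : Space d => bumpFun 1 x ^ (ν - 1) * bumpFun 1 x := by
    refine HasCompactSupport.intro (isCompact_closedBall (0 : Space d) 1) fun x hx => ?_
    rw [mem_closedBall_zero_iff, not_le] at hx
    rw [bumpFun_eq_zero one_pos hx.le, mul_zero]
  have hp : 0 < bumpFun 1 (0 : Space d) := bumpFun_pos one_pos (by simp)
  have hpos : 0 < ∫ x : Space d, bumpFun 1 x ^ (ν - 1) * bumpFun 1 x :=
    hc.integral_pos_of_hasCompactSupport_nonneg_nonzero hs
      (fun x => mul_nonneg (Real.rpow_nonneg (bumpFun_nonneg _ _) _) (bumpFun_nonneg _ _))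
      (x := 0) (by positivity)
  rw [e]
  have hμ : ‖Complex.I * (μ : ℂ)‖ = 1 := norm_I_mul P.sign
  exact mul_ne_zero (norm_ne_zero_iff.1 (by rw [hμ]; exact one_ne_zero))
    (Complex.ofReal_ne_zero.2 hpos.ne')

/-- Removing very low frequencies from the bump is a small change in `H^{idx d}`, hence a small
change of the nonlinearity in `L¹`, and cannot destroy its nonzero integral. Such data do not feel a
weight that is singular at frequency zero, while their nonlinearity does. -/
theorem Params.exists_data_without_low_frequencies {d : ℕ} {μ ν : ℝ} (P : Params d μ ν)
    (hν : 2 ≤ ν) : ∃ (f : 𝓢(Space d, ℂ)) (r : ℝ), 0 < r ∧ (∀ ξ, ‖ξ‖ < r → (𝓕 f) ξ = 0) ∧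
      ∫ x, nl μ ν (schwartzL2 f) x ≠ 0 := by
  set G := bump d one_pos
  have hG := sobolevNorm_schwartzL2_lt_top (idx d) G
  have hZ := P.integral_nl_bump_ne_zero
  set Z := ∫ x, nl μ ν (schwartzL2 G) x
  obtain ⟨κ, hκ, H⟩ := P.exists_lintegral_nl_sub_lt hν hG (half_pos (norm_pos_iff.2 hZ))
  obtain ⟨r, hr, hle⟩ := exists_sobolevNorm_lowFreq_le P.one_le (idx d) G
    (ENNReal.ofReal_pos.2 hκ)
  refine ⟨G - lowFreq hr G, r, hr, fun ξ hξ => ?_, fun h0 => ?_⟩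
  · have h1 := FourierTransform.fourier_add (G - lowFreq hr G) (lowFreq hr G)
    rw [sub_add_cancel] at h1
    have h2 := congrArg (fun g : 𝓢(Space d, ℂ) => g ξ) h1
    simp only [_root_.add_apply] at h2
    rw [fourier_lowFreq, (cutoff hr).one_of_mem_closedBall
      (by rw [mem_closedBall_zero_iff]; exact hξ.le), Complex.ofReal_one, one_mul] at h2
    simpa using h2
  · have h1 := H (schwartzL2 (G - lowFreq hr G)) (by
      rwa [schwartzL2_sub, sub_sub_cancel_left, sobolevNorm_neg])
    have h2 : ∫ x, (nl μ ν (schwartzL2 (G - lowFreq hr G)) - nl μ ν (schwartzL2 G)) x = -Z := by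
      rw [integral_congr_ae (Lp.coeFn_sub _ _)]
      simp only [Pi.sub_apply]
      rw [integral_sub (P.integrable_nl hν h1.1) (P.integrable_nl hν hG), h0, zero_sub]
    have h3 := enorm_integral_le_lintegral_enorm (μ := volume)
      (fun x => (nl μ ν (schwartzL2 (G - lowFreq hr G)) - nl μ ν (schwartzL2 G)) x)
    rw [h2, enorm_neg, ← ofReal_norm] at h3
    have h4 := h3.trans h1.2
    rw [ENNReal.ofReal_le_ofReal_iff (by positivity)] at h4
    linarith [norm_pos_iff.2 hZ]

/-! ## Low frequencies -/

/-- Functions whose Fourier transform is within `ε` of `Z` on the ball of radius `r`. -/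
def nearAtLowFreq (d : ℕ) (r : ℝ) (Z : ℂ) (ε : ℝ) : Set (L2 d) :=
  {g | ∀ᵐ ξ, ‖ξ‖ < r → ‖(𝓕 g : L2 d) ξ - Z‖ ≤ ε}

theorem real_smul_L2 {d : ℕ} (a : ℝ) (f : L2 d) : a • f = (a : ℂ) • f := by
  refine Lp.ext ?_
  filter_upwards [Lp.coeFn_smul a f, Lp.coeFn_smul (a : ℂ) f] with x h1 h2
  rw [h1, h2, Pi.smul_apply, Pi.smul_apply, Complex.coe_smul]

/-- Together with `isClosed_nearAtLowFreq` this puts time averages into the set, which replaces an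
interchange of the Fourier transform with the time integral. -/
theorem convex_nearAtLowFreq (d : ℕ) (r : ℝ) (Z : ℂ) (ε : ℝ) :
    Convex ℝ (nearAtLowFreq d r Z ε) := by
  intro g hg h hh a b ha hb hab
  rw [real_smul_L2, real_smul_L2]
  filter_upwards [hg, hh, fourier_add_ae ((a : ℂ) • g) ((b : ℂ) • h), fourier_smul_ae (a : ℂ) g,
    fourier_smul_ae (b : ℂ) h] with ξ h1 h2 h3 h4 h5 hξ
  have e : (𝓕 ((a : ℂ) • g + (b : ℂ) • h) : L2 d) ξ - Z =
      a • ((𝓕 g : L2 d) ξ - Z) + b • ((𝓕 h : L2 d) ξ - Z) := by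
    have hab' : (a : ℂ) + b = 1 := by exact_mod_cast hab
    rw [h3, h4, h5, Complex.real_smul, Complex.real_smul]
    linear_combination Z * hab'
  rw [e, ← mem_closedBall_zero_iff]
  exact convex_closedBall (0 : ℂ) ε (mem_closedBall_zero_iff.2 (h1 hξ))
    (mem_closedBall_zero_iff.2 (h2 hξ)) ha hb hab

theorem isClosed_nearAtLowFreq (d : ℕ) (r : ℝ) (Z : ℂ) (ε : ℝ) :
    IsClosed (nearAtLowFreq d r Z ε) := by
  refine IsSeqClosed.isClosed fun g g₀ hg hlim => ?_
  obtain ⟨ns, -, h⟩ := exists_subseq_ae (tendsto_fourier hlim)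
  filter_upwards [h, ae_all_iff.2 hg] with ξ h1 h2 hξ
  exact le_of_tendsto (h1.sub_const Z).norm (Eventually.of_forall fun i => h2 (ns i) hξ)

theorem exists_norm_fourier_sub_integral_le {d : ℕ} {f : L2 d} (hf : Integrable f) {ε : ℝ}
    (hε : 0 < ε) : ∃ r : ℝ, 0 < r ∧ f ∈ nearAtLowFreq d r (∫ x, f x) ε := by
  have hc : Continuous (𝓕 (f : Space d → ℂ)) :=
    VectorFourier.fourierIntegral_continuous Real.continuous_fourierChar
      (by exact continuous_inner) hf
  have h0 : 𝓕 (f : Space d → ℂ) 0 = ∫ x, f x := by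
    rw [Real.fourier_eq]
    simp
  obtain ⟨r, hr, H⟩ := Metric.continuous_iff.1 hc 0 ε hε
  refine ⟨r, hr, ?_⟩
  have h1 := fourier_toLp_ae hf (Lp.memLp f)
  rw [Lp.toLp_coeFn] at h1
  filter_upwards [h1] with ξ h2 hξ
  rw [h2, ← h0, ← dist_eq_norm]
  exact (H ξ (by rwa [dist_zero_right])).le

theorem norm_fourier_sub_le {d : ℕ} {f g : L2 d} {ε : ℝ} (hε : 0 ≤ ε)
    (h : ∫⁻ x, ‖(f - g) x‖ₑ ≤ ENNReal.ofReal ε) :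
    ∀ᵐ ξ, ‖(𝓕 f : L2 d) ξ - (𝓕 g : L2 d) ξ‖ ≤ ε := by
  have hi : Integrable (f - g : L2 d) :=
    ⟨Lp.aestronglyMeasurable _, h.trans_lt ENNReal.ofReal_lt_top⟩
  filter_upwards [norm_fourier_le_of_integrable hi, fourier_sub_ae f g] with ξ h1 h2
  rw [← h2]
  refine h1.trans ?_
  rw [integral_norm_eq_lintegral_enorm hi.1]
  exact ENNReal.toReal_le_of_le_ofReal hε h

theorem norm_mul_sub_le {z A Z : ℂ} (hz : ‖z - 1‖ ≤ 1 / 8) (hA : ‖A - Z‖ ≤ ‖Z‖ / 4) :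
    ‖z * A - Z‖ ≤ ‖Z‖ / 2 := by
  have e : z * A - Z = (z - 1) * (A - Z) + (z - 1) * Z + (A - Z) := by ring
  have h1 : ‖(z - 1) * (A - Z)‖ ≤ 1 / 8 * (‖Z‖ / 4) := by rw [norm_mul]; gcongr
  have h2 : ‖(z - 1) * Z‖ ≤ 1 / 8 * ‖Z‖ := by rw [norm_mul]; gcongr
  have h3 := norm_add_le ((z - 1) * (A - Z) + (z - 1) * Z) (A - Z)
  have h4 := norm_add_le ((z - 1) * (A - Z)) ((z - 1) * Z)
  rw [← e] at h3
  linarith [norm_nonneg Z]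

/-- The free part of Duhamel's formula has no low frequencies. Under the integral, the transform of
the nonlinearity is close to `Z` at low frequencies, because the solution stays near `f` for a short
time, and the phase factor is close to `1`. So the integral is `T` times an average near `Z`,
uniformly in `δ ≤ 1`. -/
theorem Params.exists_low_frequency_growth {d : ℕ} {μ ν : ℝ} (P : Params d μ ν) (hν : 2 ≤ ν)
    {f : 𝓢(Space d, ℂ)} {r₀ : ℝ} (hr₀ : 0 < r₀) (hf : ∀ ξ, ‖ξ‖ < r₀ → (𝓕 f) ξ = 0)
    (hZ : ∫ x, nl μ ν (schwartzL2 f) x ≠ 0) :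
    ∃ T r c : ℝ, 0 < T ∧ 0 < r ∧ 0 < c ∧ ∀ δ, 0 < δ → δ ≤ 1 → ∃ v : ℝ → L2 d,
      ContinuousSobolevOn (idx d) T v ∧ IsMild δ T (nl μ ν) (schwartzL2 f) v ∧
      ∀ᵐ ξ, ‖ξ‖ < r → c ≤ ‖(𝓕 (v T) : L2 d) ξ‖ := by
  have hfin := sobolevNorm_schwartzL2_lt_top (idx d) f
  set Z := ∫ x, nl μ ν (schwartzL2 f) x with hZd
  have hZ0 : 0 < ‖Z‖ := norm_pos_iff.2 hZ
  obtain ⟨κ, hκ, Hκ⟩ := P.exists_lintegral_nl_sub_lt hν hfin (ε := ‖Z‖ / 8) (by positivity)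
  obtain ⟨T, hT, hT1, HT⟩ := P.exists_short_time_solution hfin hκ
  obtain ⟨r₁, hr₁, H₁⟩ := exists_norm_fourier_sub_integral_le (P.integrable_nl hν hfin)
    (ε := ‖Z‖ / 8) (by positivity)
  -- The radius `1 / (16π)` keeps the phase `δ (T - τ) 2π‖ξ‖` at most `1/8`, as `norm_mul_sub_le`
  -- requires.
  refine ⟨T, min r₀ (min r₁ (1 / (16 * Real.pi))), T * (‖Z‖ / 2), hT,
    lt_min hr₀ (lt_min hr₁ (by positivity)), by positivity, fun δ hδ hδ1 => ?_⟩
  set r := min r₀ (min r₁ (1 / (16 * Real.pi)))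
  have hrπ : r ≤ 1 / (16 * Real.pi) := (min_le_right _ _).trans (min_le_right _ _)
  obtain ⟨v, hv, hm, hvf⟩ := HT δ hδ hδ1
  refine ⟨v, hv, hm, ?_⟩
  have hmem : ∀ τ ∈ Icc 0 T, halfWave (δ * (T - τ)) (nl μ ν (v τ)) ∈
      nearAtLowFreq d r Z (‖Z‖ / 2) := by
    intro τ hτ
    filter_upwards [fourier_halfWave (δ * (T - τ)) (nl μ ν (v τ)), H₁,
      norm_fourier_sub_le (by positivity) (Hκ _ (hvf τ hτ)).2] with ξ h1 h2 h3 hξ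
    rw [h1]
    refine norm_mul_sub_le ?_ ?_
    · refine Real.norm_exp_I_mul_ofReal_sub_one_le.trans ?_
      have h4 : 0 ≤ T - τ := sub_nonneg.2 hτ.2
      have h5 : δ * (T - τ) ≤ 1 := by nlinarith [hτ.1]
      have h6 : ‖ξ‖ ≤ 1 / (16 * Real.pi) := hξ.le.trans hrπ
      rw [le_div_iff₀ (by positivity)] at h6
      rw [Real.norm_of_nonneg (by positivity)]
      calc δ * (T - τ) * (2 * Real.pi * ‖ξ‖) ≤ 1 * (2 * Real.pi * ‖ξ‖) := by gcongr
        _ ≤ 1 / 8 := by linarith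
    · have h4 := h2 (hξ.trans_le ((min_le_right _ _).trans (min_le_left _ _)))
      have h5 := norm_add_le ((𝓕 (nl μ ν (v τ)) : L2 d) ξ - (𝓕 (nl μ ν (schwartzL2 f)) : L2 d) ξ)
        ((𝓕 (nl μ ν (schwartzL2 f)) : L2 d) ξ - Z)
      rw [sub_add_sub_cancel] at h5
      linarith
  have hint := intervalIntegrable_duhamel (δ := δ) (P.continuousOn_nl (half_lt_index d) hv)
    (t := T) ⟨hT.le, le_rfl⟩ T
  rw [intervalIntegrable_iff_integrableOn_Ioc_of_le hT.le] at hint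
  have hvol : volume (Ioc 0 T) = ENNReal.ofReal T := by rw [Real.volume_Ioc, sub_zero]
  have hav := (convex_nearAtLowFreq d r Z (‖Z‖ / 2)).set_average_mem
    (isClosed_nearAtLowFreq d r Z (‖Z‖ / 2)) (by rw [hvol]; simpa using hT)
    (by rw [hvol]; exact ENNReal.ofReal_ne_top)
    ((ae_restrict_iff' measurableSet_Ioc).2 (Eventually.of_forall fun τ hτ =>
      hmem τ ⟨hτ.1.le, hτ.2⟩)) hint
  set g := ⨍ τ in Ioc 0 T, halfWave (δ * (T - τ)) (nl μ ν (v τ))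
  have hvT : v T = halfWave (δ * T) (schwartzL2 f) + (T : ℂ) • g := by
    rw [hm T ⟨hT.le, le_rfl⟩, duhamel, intervalIntegral.integral_of_le hT.le]
    simp only [g]
    rw [setAverage_eq, measureReal_def, hvol, ENNReal.toReal_ofReal hT.le, ← real_smul_L2,
      smul_inv_smul₀ hT.ne']
  filter_upwards [hav, fourier_add_ae (halfWave (δ * T) (schwartzL2 f)) ((T : ℂ) • g),
    fourier_smul_ae (T : ℂ) g, fourier_halfWave (δ * T) (schwartzL2 f),
    coeFn_schwartzL2 (𝓕 f)] with ξ h1 h2 h3 h4 h5 hξ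
  rw [hvT, h2, h3, h4, fourier_schwartzL2, h5, hf ξ (hξ.trans_le (min_le_left _ _)), mul_zero,
    zero_add, norm_mul, Complex.norm_real, Real.norm_of_nonneg hT.le]
  gcongr
  have h6 := norm_sub_norm_le Z ((𝓕 g : L2 d) ξ)
  rw [norm_sub_rev] at h6
  linarith [h1 hξ]

/-! ### The Sobolev weight near frequency zero -/

/-- The Sobolev weight, rescaled to the length `ℓ`. -/
noncomputable def scaledWeight {d : ℕ} (γ ℓ : ℝ) (η : Space d) : ℝ≥0∞ :=
  ENNReal.ofReal ((ℓ ^ 2 + (2 * Real.pi * ‖η‖) ^ 2) ^ γ)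

theorem scaledWeight_anti {d : ℕ} {γ ℓ ℓ' : ℝ} (hγ : γ ≤ 0) (hℓ : 0 < ℓ) (h : ℓ ≤ ℓ')
    (η : Space d) : scaledWeight γ ℓ' η ≤ scaledWeight γ ℓ η := by
  refine ENNReal.ofReal_le_ofReal (Real.rpow_le_rpow_of_nonpos (by positivity) ?_ hγ)
  gcongr

theorem scaledWeight_zero_le_liminf {d : ℕ} {γ : ℝ} (hγ : γ < 0) (η : Space d) :
    scaledWeight γ 0 η ≤ liminf (fun n : ℕ => scaledWeight γ (n + 1 : ℝ)⁻¹ η) atTop := by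
  rcases eq_or_ne η 0 with rfl | hη
  -- At the origin the left side is `0`, by the convention `0 ^ γ = 0` for `γ ≠ 0`.
  · simp [scaledWeight, Real.zero_rpow hγ.ne]
  · refine (Tendsto.liminf_eq ?_).ge
    have hn : Tendsto (fun n : ℕ => (n + 1 : ℝ)⁻¹) atTop (𝓝 0) :=
      tendsto_inv_atTop_zero.comp (tendsto_atTop_add_const_right _ _ tendsto_natCast_atTop_atTop)
    have hpos : 0 < (2 * Real.pi * ‖η‖) ^ 2 := by
      have := norm_pos_iff.2 hη
      positivity
    exact ENNReal.tendsto_ofReal (((hn.pow 2).add_const _).rpow_const (Or.inl (by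
      rw [zero_pow two_ne_zero, zero_add]
      exact hpos.ne')))

theorem measurable_scaledWeight {d : ℕ} (γ ℓ : ℝ) :
    Measurable (scaledWeight γ ℓ : Space d → ℝ≥0∞) := by
  unfold scaledWeight
  fun_prop

/-- In polar coordinates the integrand is a multiple of `y^{d-1+2γ}` on `(0, r)`, which is
integrable only if `d + 2γ > 0`. The end point `γ = -d/2` diverges logarithmically. -/
theorem lintegral_scaledWeight_zero {d : ℕ} (hd : 1 ≤ d) {γ r : ℝ} (hγ : γ ≤ -(d : ℝ) / 2)
    (hr : 0 < r) : ∫⁻ η in Metric.ball (0 : Space d) r, scaledWeight γ 0 η = ∞ := by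
  by_contra hne
  have : Nontrivial (Space d) := by
    refine Module.nontrivial_of_finrank_pos (R := ℝ) ?_
    rw [finrank_euclideanSpace_fin]
    exact hd
  set w : ℝ → ℝ := fun y => ((0 : ℝ) ^ 2 + (2 * Real.pi * y) ^ 2) ^ γ
  have hi : IntegrableOn (fun η : Space d => w ‖η‖) (Metric.ball 0 r) := by
    have hm : Measurable fun η : Space d => w ‖η‖ := by
      simp only [w]
      fun_prop
    refine ⟨hm.aestronglyMeasurable, ?_⟩
    refine lt_of_le_of_lt (lintegral_mono fun η => ?_) (lt_top_iff_ne_top.2 hne)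
    rw [← ofReal_norm, Real.norm_of_nonneg (by positivity)]
    rfl
  rw [integrableOn_fun_norm_addHaar, finrank_euclideanSpace_fin] at hi
  have h1 : IntegrableOn (fun y : ℝ => y ^ ((d : ℝ) - 1 + 2 * γ)) (Ioo 0 r) := by
    have h0 : IntegrableOn (fun y : ℝ => ((2 * Real.pi) ^ (2 * γ))⁻¹ * (y ^ (d - 1) • w y))
      (Ioo 0 r) := hi.const_mul _
    refine h0.congr_fun (fun y hy => ?_) measurableSet_Ioo
    have hy0 : 0 < y := hy.1
    have h2 : w y = (2 * Real.pi) ^ (2 * γ) * y ^ (2 * γ) := by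
      simp only [w]
      rw [zero_pow two_ne_zero, zero_add, ← Real.rpow_natCast_mul (by positivity),
        Real.mul_rpow (by positivity) hy0.le]
      norm_num
    simp only [smul_eq_mul]
    rw [h2, Real.rpow_add hy0, ← Real.rpow_natCast, Nat.cast_sub hd, Nat.cast_one]
    have : (2 * Real.pi) ^ (2 * γ) ≠ 0 := by positivity
    field_simp
  rw [intervalIntegral.integrableOn_Ioo_rpow_iff hr] at h1
  linarith

/-- Were the integral below `C` for arbitrarily small `ℓ`, monotonicity in `ℓ` would bound it for
every `ℓ`, and Fatou's lemma would make the limiting integral finite. -/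
theorem exists_lintegral_scaledWeight_ge {d : ℕ} (hd : 1 ≤ d) {γ r : ℝ} (hγ : γ ≤ -(d : ℝ) / 2)
    (hr : 0 < r) {C : ℝ≥0∞} (hC : C < ∞) : ∃ ℓ₀ : ℝ, 0 < ℓ₀ ∧ ∀ ℓ, 0 < ℓ → ℓ < ℓ₀ →
      C ≤ ∫⁻ η in Metric.ball (0 : Space d) r, scaledWeight γ ℓ η := by
  have hd' : (1 : ℝ) ≤ d := by exact_mod_cast hd
  have hγ0 : γ < 0 := by linarith
  by_contra! H
  have hle : ∀ ℓ, 0 < ℓ → ∫⁻ η in Metric.ball (0 : Space d) r, scaledWeight γ ℓ η ≤ C := by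
    intro ℓ hℓ
    obtain ⟨ℓ', h1, h2, h3⟩ := H ℓ hℓ
    exact (lintegral_mono fun η => scaledWeight_anti hγ0.le h1 h2.le η).trans h3.le
  have h1 : ∫⁻ η in Metric.ball (0 : Space d) r, scaledWeight γ 0 η ≤ C := by
    refine (lintegral_mono fun η => scaledWeight_zero_le_liminf hγ0 η).trans
      ((lintegral_liminf_le fun n => measurable_scaledWeight γ _).trans ?_)
    refine liminf_le_of_le (by isBoundedDefault) fun b hb => ?_
    obtain ⟨n, hn⟩ := hb.exists
    exact hn.trans (hle _ (by positivity))
  rw [lintegral_scaledWeight_zero hd hγ hr] at h1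
  exact hC.not_ge h1

theorem scaledEnergy_ge {d : ℕ} {γ ℓ r c : ℝ} (hc : 0 ≤ c) {g : L2 d}
    (hg : ∀ᵐ ξ, ‖ξ‖ < r → c ≤ ‖(𝓕 g : L2 d) ξ‖) :
    ENNReal.ofReal (c ^ 2) * ∫⁻ η in Metric.ball (0 : Space d) r, scaledWeight γ ℓ η ≤
      scaledEnergy γ ℓ g := by
  rw [← lintegral_const_mul' _ _ ENNReal.ofReal_ne_top,
    ← lintegral_indicator measurableSet_ball, scaledEnergy]
  refine lintegral_mono_ae ?_
  filter_upwards [hg] with ξ h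
  by_cases hξ : ξ ∈ Metric.ball (0 : Space d) r
  · rw [indicator_of_mem hξ, mul_comm, scaledWeight, ENNReal.ofReal_pow hc, ← ofReal_norm]
    gcongr
    exact h (mem_ball_zero_iff.1 hξ)
  · rw [indicator_of_notMem hξ]
    exact zero_le

theorem scaledEnergy_le_of_low_frequencies {d : ℕ} {γ ℓ r : ℝ} (hγ : γ ≤ 0) (hr : 0 < r)
    {f : 𝓢(Space d, ℂ)} (hf : ∀ ξ, ‖ξ‖ < r → (𝓕 f) ξ = 0) :
    scaledEnergy γ ℓ (schwartzL2 f) ≤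
      ENNReal.ofReal (((2 * Real.pi * r) ^ 2) ^ γ) * ‖schwartzL2 f‖ₑ ^ 2 := by
  rw [enorm_sq_eq_lintegral_fourier, ← lintegral_const_mul' _ _ ENNReal.ofReal_ne_top, scaledEnergy]
  refine lintegral_mono_ae ?_
  filter_upwards [coeFn_schwartzL2 (𝓕 f)] with ξ h
  rcases lt_or_ge ‖ξ‖ r with hξ | hξ
  · rw [fourier_schwartzL2, h, hf ξ hξ]
    simp
  · gcongr ?_ * _
    refine ENNReal.ofReal_le_ofReal (Real.rpow_le_rpow_of_nonpos (by positivity) ?_ hγ)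
    have : (2 * Real.pi * r) ^ 2 ≤ (2 * Real.pi * ‖ξ‖) ^ 2 := by gcongr
    linarith [sq_nonneg ℓ]

/-- The frequencies of the data stay away from zero, so their energy is bounded independently of
`ℓ`. At time `T` the energy is at least `c²` times the integral of `scaledWeight`, which is
unbounded as `ℓ → 0`. Unlike for positive `γ`, profile and time are fixed, and the growth comes from
`ℓ` alone. -/
theorem Params.normInflation_of_le {d : ℕ} {μ ν γ : ℝ} (P : Params d μ ν) (hν : 2 ≤ ν)
    (hγ : γ ≤ -(d : ℝ) / 2) (hγc : γ < criticalExponent d ν) : NormInflation d μ ν γ := by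
  intro ε hε
  have hd' : (1 : ℝ) ≤ d := by exact_mod_cast P.one_le
  have hγ0 : γ ≤ 0 := by linarith
  obtain ⟨f, r₀, hr₀, hf, hZ⟩ := P.exists_data_without_low_frequencies hν
  obtain ⟨T, r, c, hT, hr, hc, H⟩ := P.exists_low_frequency_growth hν hr₀ hf hZ
  set N := Real.sqrt (((2 * Real.pi * r₀) ^ 2) ^ γ) * ‖schwartzL2 f‖
  have hN0 : 0 ≤ N := by positivity
  set B := ε / (N + 1)
  have hB : 0 < B := by positivity
  obtain ⟨ℓ₀, hℓ₀, Hℓ⟩ := exists_lintegral_scaledWeight_ge P.one_le hγ hr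
    (C := ENNReal.ofReal (((ε⁻¹ + 1) / (B * c)) ^ 2)) ENNReal.ofReal_lt_top
  obtain ⟨δ, ⟨l, ℓ, D, hl, hl', hℓ, hℓ', hD, hsol⟩, hδ, hδ1⟩ :=
    ((P.eventually_exists_scaling hγc hB (ε := min ℓ₀ (ε / T)) (by positivity)).and
      (eventually_mem_nhdsWithin.and (nhdsWithin_le_nhds (gt_mem_nhds one_pos)))).exists
  obtain ⟨v, hv, hm, hvT⟩ := H δ hδ hδ1.le
  obtain ⟨f', u, hu, hf', huT⟩ := hsol T f v hv hm
  refine ⟨f', l * T, u, by positivity, (lt_div_iff₀ hT).1 (hl'.trans_le (min_le_right _ _)), hu,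
    ?_, ?_⟩
  · rw [hf']
    refine lt_of_le_of_lt (b := ENNReal.ofReal (B * N)) (ennreal_le_of_sq_le ?_) ?_
    · rw [hD, ← ENNReal.ofReal_pow (by positivity), mul_pow, mul_pow, Real.sq_sqrt (by positivity),
        ENNReal.ofReal_mul (by positivity), ENNReal.ofReal_mul (by positivity),
        ENNReal.ofReal_pow (norm_nonneg _), ofReal_norm]
      gcongr
      exact scaledEnergy_le_of_low_frequencies hγ0 hr₀ hf
    · rw [ENNReal.ofReal_lt_ofReal_iff hε]
      simp only [B]
      rw [div_mul_eq_mul_div, div_lt_iff₀ (by positivity)]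
      nlinarith
  · rw [huT]
    refine lt_of_lt_of_le (b := ENNReal.ofReal (ε⁻¹ + 1)) ?_ (ennreal_le_of_sq_le ?_)
    · rw [ENNReal.ofReal_lt_ofReal_iff (by positivity)]
      linarith
    · rw [hD, ← ENNReal.ofReal_pow (by positivity)]
      have e : (ε⁻¹ + 1) ^ 2 = B ^ 2 * (c ^ 2 * ((ε⁻¹ + 1) / (B * c)) ^ 2) := by field_simp
      rw [e, ENNReal.ofReal_mul (by positivity), ENNReal.ofReal_mul (by positivity)]
      gcongr
      refine le_trans ?_ (scaledEnergy_ge hc.le hvT)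
      gcongr
      exact Hℓ ℓ hℓ (hℓ'.trans_le (min_le_left _ _))

/-! ## Failure of continuity at a fixed time -/

/-- `Params.scale` with `δ = 1`, restricted to factors between `1` and `2` so that the operator
bounds are uniform. It carries statements about the time `t` to all times in `[t, 2t]`. -/
theorem Params.exists_rescaling {d : ℕ} {μ ν : ℝ} (P : Params d μ ν) {γ b : ℝ} (hb1 : 1 ≤ b)
    (hb2 : b ≤ 2) : ∃ D E : L2 d →L[ℂ] L2 d,
      (∀ f : 𝓢(Space d, ℂ), ∃ f' : 𝓢(Space d, ℂ), schwartzL2 f' = E (schwartzL2 f)) ∧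
      (∀ g, D (E g) = g) ∧
      (∀ g, sobolevNorm γ (D g) ≤
        ENNReal.ofReal (2 ^ (1 / (ν - 1)) * (2 ^ d * (2 ^ 2) ^ |γ|)) * sobolevNorm γ g) ∧
      (∀ g, sobolevNorm γ (E g) ≤
        ENNReal.ofReal (2 ^ (1 / (ν - 1)) * (2 ^ d * (2 ^ 2) ^ |γ|)) * sobolevNorm γ g) ∧
      ∀ (T : ℝ) (u₀ : L2 d) (u : ℝ → L2 d), IsNLHWSolution μ ν T u₀ u → ∃ u' : ℝ → L2 d,
        IsNLHWSolution μ ν (b * T) (D u₀) u' ∧ u' (b * T) = D (u T) := by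
  have hb : 0 < b := by linarith
  have hp : 0 < 1 / (ν - 1) := one_div_pos.2 (sub_pos.2 P.one_lt)
  set A := b ^ (-(1 / (ν - 1)))
  have hA : 0 < A := by positivity
  have hA1 : A ≤ 2 ^ (1 / (ν - 1)) := by
    refine (Real.rpow_le_one_of_one_le_of_nonpos hb1 (by linarith)).trans ?_
    exact Real.one_le_rpow one_le_two hp.le
  have hA2 : A⁻¹ ≤ 2 ^ (1 / (ν - 1)) := by
    simp only [A]
    rw [Real.rpow_neg hb.le, inv_inv]
    gcongr
  have hAl : A ^ (ν - 1) * b = 1 := by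
    rw [← Real.rpow_mul hb.le, neg_mul, one_div_mul_cancel (sub_pos.2 P.one_lt).ne',
      Real.rpow_neg_one, inv_mul_cancel₀ hb.ne']
  have hbi : b⁻¹ ≤ 1 := inv_le_one_of_one_le₀ hb1
  have hbound : ∀ {a c : ℝ}, 0 < a → a ≤ 2 ^ (1 / (ν - 1)) → (2 : ℝ)⁻¹ ≤ c → c ≤ 2 → ∀ g : L2 d,
      sobolevNorm γ ((a : ℂ) • dil c g) ≤
        ENNReal.ofReal (2 ^ (1 / (ν - 1)) * (2 ^ d * (2 ^ 2) ^ |γ|)) * sobolevNorm γ g := by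
    intro a c ha ha2 hc1 hc2 g
    rw [sobolevNorm_smul, ← ofReal_norm, Complex.norm_real, Real.norm_of_nonneg ha.le,
      ENNReal.ofReal_mul (by positivity), mul_assoc]
    gcongr
    exact sobolevNorm_dil_le one_le_two hc1 hc2 γ g
  refine ⟨(A : ℂ) • dil b⁻¹, ((A⁻¹ : ℝ) : ℂ) • dil b, fun f => ?_, fun g => ?_,
    hbound hA hA1 (by gcongr) (by linarith), hbound (by positivity) hA2 ?_ hb2,
    fun T u₀ u hu => ?_⟩
  · obtain ⟨ψ, -, hψ⟩ := exists_schwartzL2_eq_dil hb f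
    exact ⟨((A⁻¹ : ℝ) : ℂ) • ψ, by rw [schwartzL2_smul, ← hψ]; rfl⟩
  · have h1 := dil_dil_inv (inv_pos.2 hb) g
    rw [inv_inv] at h1
    rw [_root_.smul_apply, _root_.smul_apply, map_smul, h1, smul_smul, ← Complex.ofReal_mul,
      mul_inv_cancel₀ hA.ne', Complex.ofReal_one, one_smul]
  · linarith [inv_lt_one_of_one_lt₀ (one_lt_two (α := ℝ))]
  · obtain ⟨⟨s, hs, hc⟩, hm⟩ := isNLHWSolution_iff.1 hu
    refine ⟨_, P.scale hs hb (inv_pos.2 hb) hA hAl (mul_inv_cancel₀ hb.ne').symm hc hm, ?_⟩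
    simp only [mul_div_cancel_left₀ T hb.ne']
    rfl

/-- The reversed solution starts from the conjugate of `U T`, which need not be a Schwartz function;
continuous dependence in `H^{idx d}` allows a Schwartz approximation. -/
theorem Params.exists_schwartz_reversed {d : ℕ} {μ ν : ℝ} (P : Params d μ ν) {T : ℝ} (hT : 0 ≤ T)
    {f : 𝓢(Space d, ℂ)} {U : ℝ → L2 d} (hU : IsNLHWSolution μ ν T (schwartzL2 f) U) {ε : ℝ}
    (hε : 0 < ε) : ∃ (h : 𝓢(Space d, ℂ)) (v : ℝ → L2 d),
      sobolevNorm (idx d) (schwartzL2 h - conjL2 (U T)) ≤ ENNReal.ofReal ε ∧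
      IsNLHWSolution μ ν T (schwartzL2 h) v ∧
      ∀ t ∈ Icc 0 T, sobolevNorm (idx d) (v t - conjL2 (U (T - t))) ≤ ENNReal.ofReal ε := by
  have h1 := (P.exists_solution_near hT (sobolevNorm_schwartzL2_lt_top _ f) hU).1 T ⟨hT, le_rfl⟩
  rw [← sobolevNorm_conjL2] at h1
  obtain ⟨δ, hδ, H⟩ := (P.exists_solution_near hT h1 (P.reverse hT hU)).2 (ENNReal.ofReal ε)
    (ENNReal.ofReal_pos.2 hε)
  obtain ⟨h, hh⟩ := exists_schwartz_sobolevNorm_sub_lt (idx_nonneg d) h1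
    (lt_min hδ (ENNReal.ofReal_pos.2 hε))
  obtain ⟨v, hv, hvU⟩ := H _ (hh.trans_le (min_le_left _ _))
  exact ⟨h, v, (hh.trans_le (min_le_right _ _)).le, hv, hvU⟩

/-- Solutions from Schwartz data, run backwards from a later time. -/
theorem Params.reversed_eq {d : ℕ} {μ ν : ℝ} (P : Params d μ ν) {t r : ℝ} (ht : 0 ≤ t)
    (hr : 0 ≤ r) {u₀ : L2 d} {u U : ℝ → L2 d} (hu : IsNLHWSolution μ ν r u₀ u)
    (hU : IsNLHWSolution μ ν (t + r) u₀ U) : conjL2 (U (t + r - t)) = conjL2 (u r) := by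
  rw [add_sub_cancel_left, P.solution_unique (hU.restrict (le_add_of_nonneg_left ht)) hu r
    ⟨hr, le_rfl⟩]

theorem Params.exists_continuity_uniform {d : ℕ} {μ ν γ t : ℝ} (P : Params d μ ν)
    (h : SolutionMapContinuousAtZero d μ ν γ t) {ε : ℝ} (hε : 0 < ε) : ∃ δ : ℝ, 0 < δ ∧
      ∀ b, 1 ≤ b → b ≤ 2 → ∀ f : 𝓢(Space d, ℂ), sobolevNorm γ (schwartzL2 f) < ENNReal.ofReal δ →
        ∃ u : ℝ → L2 d, IsNLHWSolution μ ν (b * t) (schwartzL2 f) u ∧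
          sobolevNorm γ (u (b * t)) < ENNReal.ofReal ε := by
  set C : ℝ := 2 ^ (1 / (ν - 1)) * (2 ^ d * (2 ^ 2) ^ |γ|)
  have hC : 0 < C := by positivity
  have hmul : ∀ {a : ℝ}, 0 < a → ENNReal.ofReal C * ENNReal.ofReal (a / C) = ENNReal.ofReal a := by
    intro a ha
    rw [← ENNReal.ofReal_mul hC.le, mul_div_cancel₀ _ hC.ne']
  have hlt : ∀ {a : ℝ} {x y : ℝ≥0∞}, 0 < a → y < ENNReal.ofReal (a / C) →
      x ≤ ENNReal.ofReal C * y → x < ENNReal.ofReal a := by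
    intro a x y ha hy hx
    rw [← hmul ha]
    exact hx.trans_lt ((ENNReal.mul_lt_mul_iff_right (ENNReal.ofReal_pos.2 hC).ne'
      ENNReal.ofReal_ne_top).2 hy)
  obtain ⟨δ, hδ, H⟩ := h (ε / C) (by positivity)
  refine ⟨δ / C, by positivity, fun b hb1 hb2 f hf => ?_⟩
  obtain ⟨D, E, hE, hDE, hDn, hEn, hsol⟩ := P.exists_rescaling (γ := γ) hb1 hb2
  obtain ⟨f', hf'⟩ := hE f
  obtain ⟨u, hu, hun⟩ := H f' (by rw [hf']; exact hlt hδ hf (hEn _))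
  obtain ⟨u', hu', hu't⟩ := hsol t _ u hu
  rw [hf', hDE] at hu'
  exact ⟨u', hu', by rw [hu't]; exact hlt hε hun (hDn _)⟩

/-- Let `f` inflate at a time `r ≤ t`. Continuity, carried to the time `t + r ∈ [t, 2t]`, gives a
solution `U` that is small in `H^γ` at `t + r`. Run backwards over time `t`, it becomes the
conjugate of `u r`, which is large, although continuity at time `t` makes it small. -/
theorem Params.not_continuous_of_normInflation {d : ℕ} {μ ν γ : ℝ} (P : Params d μ ν)
    (hγ : γ ≤ idx d) (h : NormInflation d μ ν γ) {t : ℝ} (ht : 0 < t) :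
    ¬ SolutionMapContinuousAtZero d μ ν γ t := by
  intro hcont
  obtain ⟨δ₁, hδ₁, H₁⟩ := hcont 1 one_pos
  obtain ⟨δ₂, hδ₂, H₂⟩ := P.exists_continuity_uniform hcont (half_pos hδ₁)
  -- The entry `1/2` makes the norm at time `r` exceed `2`, the entry `t` ensures `(t + r)/t ≤ 2`,
  -- and `δ₂` provides the continuity at time `t + r`.
  obtain ⟨f, r, u, hr, hrε, hu, hf, hbig⟩ := h (min (1 / 2) (min t δ₂)) (by positivity)
  have hrt : r ≤ t := hrε.le.trans ((min_le_right _ _).trans (min_le_left _ _))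
  obtain ⟨U, hU, hUn⟩ := H₂ ((t + r) / t) (by rw [le_div_iff₀ ht]; linarith)
    (by rw [div_le_iff₀ ht]; linarith) f
    (hf.trans_le (ENNReal.ofReal_le_ofReal ((min_le_right _ _).trans (min_le_right _ _))))
  rw [div_mul_cancel₀ _ ht.ne'] at hU hUn
  obtain ⟨g, v, hg, hv, hvU⟩ := P.exists_schwartz_reversed (by positivity) hU
    (lt_min (half_pos hδ₁) one_pos)
  have hgn : sobolevNorm γ (schwartzL2 g) < ENNReal.ofReal δ₁ := by
    have h1 := sobolevNorm_add_le γ (schwartzL2 g - conjL2 (U (t + r))) (conjL2 (U (t + r)))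
    rw [sub_add_cancel, sobolevNorm_conjL2] at h1
    have h2 : sobolevNorm γ (schwartzL2 g - conjL2 (U (t + r))) ≤ ENNReal.ofReal (δ₁ / 2) :=
      (sobolevNorm_mono hγ _).trans (hg.trans (ENNReal.ofReal_le_ofReal (min_le_left _ _)))
    have h3 := ENNReal.add_lt_add_of_le_of_lt (h2.trans_lt ENNReal.ofReal_lt_top).ne h2 hUn
    rw [← ENNReal.ofReal_add (by positivity) (by positivity), add_halves] at h3
    exact h1.trans_lt h3
  obtain ⟨w, hw, hwn⟩ := H₁ g hgn
  have hwv := P.solution_unique hw (hv.restrict (le_add_of_nonneg_right hr.le)) t ⟨ht.le, le_rfl⟩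
  have hvt := hvU t ⟨ht.le, le_add_of_nonneg_right hr.le⟩
  rw [P.reversed_eq ht.le hr.le hu hU, ← hwv] at hvt
  have h4 : sobolevNorm γ (u r) ≤ ENNReal.ofReal 2 := by
    rw [← sobolevNorm_conjL2]
    have h5 := sobolevNorm_sub_le γ (w t) (w t - conjL2 (u r))
    rw [sub_sub_cancel] at h5
    refine h5.trans ((add_le_add hwn.le ((sobolevNorm_mono hγ _).trans (hvt.trans
      (ENNReal.ofReal_le_ofReal (min_le_right _ _))))).trans_eq ?_)
    rw [← ENNReal.ofReal_add zero_le_one zero_le_one]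
    norm_num
  refine (hbig.trans_le h4).not_ge (ENNReal.ofReal_le_ofReal ?_)
  rw [le_inv_comm₀ two_pos (by positivity)]
  exact (min_le_left _ _).trans_eq (by norm_num)

theorem Params.exists_uniform_continuity_uniform {d : ℕ} {μ ν t : ℝ} (P : Params d μ ν)
    (h : SolutionMapUniformlyContinuousL2 d μ ν t) {ε : ℝ} (hε : 0 < ε) : ∃ δ : ℝ, 0 < δ ∧
      ∀ b, 1 ≤ b → b ≤ 2 → ∀ f g : 𝓢(Space d, ℂ), ‖schwartzL2 f - schwartzL2 g‖ < δ →
        ∃ u v : ℝ → L2 d, IsNLHWSolution μ ν (b * t) (schwartzL2 f) u ∧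
          IsNLHWSolution μ ν (b * t) (schwartzL2 g) v ∧ ‖u (b * t) - v (b * t)‖ < ε := by
  set C : ℝ := 2 ^ (1 / (ν - 1)) * (2 ^ d * (2 ^ 2) ^ |(0 : ℝ)|)
  have hC : 0 < C := by positivity
  have hnorm : ∀ {D : L2 d →L[ℂ] L2 d}, (∀ g, sobolevNorm 0 (D g) ≤
      ENNReal.ofReal C * sobolevNorm 0 g) → ∀ g, ‖D g‖ ≤ C * ‖g‖ := by
    intro D hD g
    have h1 := hD g
    rwa [sobolevNorm_zero_left, sobolevNorm_zero_left, ← ofReal_norm, ← ofReal_norm,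
      ← ENNReal.ofReal_mul hC.le, ENNReal.ofReal_le_ofReal_iff (by positivity)] at h1
  obtain ⟨δ, hδ, H⟩ := h (ε / C) (by positivity)
  refine ⟨δ / C, by positivity, fun b hb1 hb2 f g hfg => ?_⟩
  obtain ⟨D, E, hE, hDE, hDn, hEn, hsol⟩ := P.exists_rescaling (γ := 0) hb1 hb2
  obtain ⟨f', hf'⟩ := hE f
  obtain ⟨g', hg'⟩ := hE g
  obtain ⟨u, v, hu, hv, huv⟩ := H f' g' (by
    rw [hf', hg', ← map_sub]
    rw [lt_div_iff₀ hC] at hfg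
    linarith [hnorm hEn (schwartzL2 f - schwartzL2 g)])
  obtain ⟨u', hu', hut⟩ := hsol t _ u hu
  obtain ⟨v', hv', hvt⟩ := hsol t _ v hv
  rw [hf', hDE] at hu'
  rw [hg', hDE] at hv'
  refine ⟨u', v', hu', hv', ?_⟩
  rw [hut, hvt, ← map_sub]
  rw [lt_div_iff₀ hC] at huv
  linarith [hnorm hDn (u t - v t)]

/-- The same reversal for pairs. Uniform continuity at time `t + r` brings the two solutions
together there; reversed over time `t` they would stay close, but they arrive at conjugates of `u r`
and `v r`, which are `η` apart. -/
theorem Params.not_uniformly_continuous {d : ℕ} {μ ν : ℝ} (P : Params d μ ν)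
    (h : DecoherenceL2 d μ ν) {t : ℝ} (ht : 0 < t) :
    ¬ SolutionMapUniformlyContinuousL2 d μ ν t := by
  intro hcont
  obtain ⟨η, hη, H⟩ := h 1 one_pos
  obtain ⟨δ₁, hδ₁, H₁⟩ := hcont (η / 2) (by positivity)
  obtain ⟨δ₂, hδ₂, H₂⟩ := P.exists_uniform_continuity_uniform hcont (half_pos hδ₁)
  obtain ⟨f, g, r, u, v, hr, hrσ, hu, hv, -, -, hfg, hbig⟩ := H (min t δ₂) (by positivity)
  have hrt : r ≤ t := hrσ.le.trans (min_le_left _ _)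
  obtain ⟨U, V, hU, hV, hUV⟩ := H₂ ((t + r) / t) (by rw [le_div_iff₀ ht]; linarith)
    (by rw [div_le_iff₀ ht]; linarith) f g (hfg.trans_le (min_le_right _ _))
  rw [div_mul_cancel₀ _ ht.ne'] at hU hV hUV
  -- Two approximation errors of this size plus `δ₁ / 2` stay below `δ₁` for the data; likewise with
  -- `η` at time `t`.
  have hmin : 0 < min (δ₁ / 8) (η / 8) := by positivity
  obtain ⟨F, u', hF, hu', hu'U⟩ := P.exists_schwartz_reversed (by positivity) hU hmin
  obtain ⟨G, v', hG, hv', hv'V⟩ := P.exists_schwartz_reversed (by positivity) hV hmin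
  have toReal : ∀ {x : L2 d}, sobolevNorm (idx d) x ≤ ENNReal.ofReal (min (δ₁ / 8) (η / 8)) →
      ‖x‖ ≤ δ₁ / 8 ∧ ‖x‖ ≤ η / 8 := by
    intro x hx
    have h1 := (enorm_le_sobolevNorm (idx_nonneg d) x).trans hx
    rwa [← ofReal_norm, ENNReal.ofReal_le_ofReal_iff hmin.le, le_min_iff] at h1
  obtain ⟨w, z, hw, hz, hwz⟩ := H₁ F G (by
    have h1 := norm_add_le (schwartzL2 F - conjL2 (U (t + r)) + conjL2 (U (t + r) - V (t + r)))
      (-(schwartzL2 G - conjL2 (V (t + r))))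
    have h2 := norm_add_le (schwartzL2 F - conjL2 (U (t + r))) (conjL2 (U (t + r) - V (t + r)))
    have e : schwartzL2 F - conjL2 (U (t + r)) + conjL2 (U (t + r) - V (t + r)) +
        -(schwartzL2 G - conjL2 (V (t + r))) = schwartzL2 F - schwartzL2 G := by
      rw [map_sub]; abel
    rw [e, norm_neg] at h1
    rw [norm_conjL2] at h2
    linarith [(toReal hF).1, (toReal hG).1])
  have hle : t ≤ t + r := le_add_of_nonneg_right hr.le
  have hut := (toReal (hu'U t ⟨ht.le, hle⟩)).2
  have hvt := (toReal (hv'V t ⟨ht.le, hle⟩)).2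
  rw [P.reversed_eq ht.le hr.le hu hU, ← P.solution_unique hw (hu'.restrict hle) t
    ⟨ht.le, le_rfl⟩] at hut
  rw [P.reversed_eq ht.le hr.le hv hV, ← P.solution_unique hz (hv'.restrict hle) t
    ⟨ht.le, le_rfl⟩] at hvt
  have h1 := norm_add_le (-(w t - conjL2 (u r)) + (w t - z t)) (z t - conjL2 (v r))
  have h2 := norm_add_le (-(w t - conjL2 (u r))) (w t - z t)
  have e : -(w t - conjL2 (u r)) + (w t - z t) + (z t - conjL2 (v r)) = conjL2 (u r - v r) := by
    rw [map_sub]; abel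
  rw [e, norm_conjL2] at h1
  rw [norm_neg] at h2
  linarith

/-! ### Conclusion -/

theorem theorem3 (d : ℕ) (hd : 1 ≤ d) (μ : ℝ) (hμ : μ = 1 ∨ μ = -1) (ν : ℝ) (hν : 1 < ν)
    (hreg : (∃ m : ℕ, ν = 2 * (m : ℝ) + 1) ∨ ∃ k : ℕ, (d : ℝ) / 2 < k ∧ (k : ℝ) + 1 ≤ ν) :
    (∀ γ : ℝ,
      (0 < criticalExponent d ν ∧ γ ∈ Iic (-(d : ℝ) / 2) ∪ Ioo 0 (criticalExponent d ν)) ∨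
      (criticalExponent d ν ≤ 0 ∧ γ ∈ Iic (-(d : ℝ) / 2) ∩ Iio (criticalExponent d ν)) →
        (∀ t : ℝ, 0 < t → ¬ SolutionMapContinuousAtZero d μ ν γ t) ∧ NormInflation d μ ν γ) ∧
    (0 < criticalExponent d ν →
        (∀ t : ℝ, 0 < t → ¬ SolutionMapUniformlyContinuousL2 d μ ν t) ∧ DecoherenceL2 d μ ν) := by
  have P : Params d μ ν := ⟨hd, hμ, hν, isC_powFun hreg⟩
  have h2 : 2 ≤ ν := two_le_of_regular hd hν hreg
  have hd' : (1 : ℝ) ≤ d := by exact_mod_cast hd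
  refine ⟨fun γ hγ => ?_, fun hc => ?_⟩
  · have hγc : γ < criticalExponent d ν := by
      rcases hγ with ⟨hc, h | h⟩ | ⟨-, -, h⟩
      · rw [mem_Iic] at h
        linarith
      · exact h.2
      · exact h
    have hinf : NormInflation d μ ν γ := by
      rcases hγ with ⟨hc, h | h⟩ | ⟨-, h, -⟩
      · exact P.normInflation_of_le h2 h hγc
      · exact P.normInflation_of_pos h.1 h.2
      · exact P.normInflation_of_le h2 h hγc
    -- Approximations in `H^{idx d}` control errors in `H^γ` for such `γ`; here `γ < γ_c < d/2`.
    have hγk : γ ≤ idx d :=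
      (hγc.trans ((criticalExponent_lt_half d hν).trans (half_lt_index d))).le
    exact ⟨fun t ht => P.not_continuous_of_normInflation hγk hinf ht, hinf⟩
  · have hdec := P.decoherenceL2 hc
    exact ⟨fun t ht => P.not_uniformly_continuous hdec ht, hdec⟩
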